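/- **Setting.** Let $\mathcal H,\mathcal K$ be complex Hilbert spaces (inner products linear in the second variable) and $\mathbb V$ a complex vector space that is a unital right $\mathcal L(\mathcal H)$-module. Let $G$ be a measurable group acting on a measurable space $(\Omega,\Sigma)$ by a jointly measurable map $(g,\omega)\mapsto g\omega$, and let $\nu$ be a $\sigma$-finite measure on $\Sigma$ that is quasi-invariant: $\nu(X)=0$ implies $\nu(gX)=0$ for $g\in G$. Let $\nu_g(X)=\nu(gX)$ and $\rho_g=d\nu_g/d\nu$. Let $U:G\to \mathrm{GL}_{\mathcal L(\mathcal H)}(\mathbb V)$ be a representation by $\mathcal L(\mathcal H)$-linear bijections, let $m:G\times G\to\mathbb T$ be a 2-cocycle ($m(e,g)=m(g,e)=1$, $m(g,hk)m(h,k)=m(gh,k)m(g,h)$), and let $u_g$, $g\in G$, be unitaries on $\mathcal K$ with $u_e=I$, $u_{gh}=m(g,h)u_gu_h$. Let $\beta_g(b)=u_gbu_g^*$ on $\mathcal L(\mathcal K)$, $(\gamma_gf)(\omega)=f(g^{-1}\omega)$ on $L^\infty(\nu)$, and let $\delta_g=\beta_g\otimes\gamma_g$ on the von Neumann algebra tensor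 product $\mathcal L(\mathcal K)\otimes L^\infty(\nu)$. Let $S_{\mathcal L(\mathcal H)}(\mathbb V)$ be the space of maps $s:\mathbb V\times\mathbb V\to\mathcal L(\mathcal H)$, antilinear in the first and linear in the second variable, with $s(va,wb)=a^*s(v,w)b$ for $a,b\in\mathcal L(\mathcal H)$. Fix $s_1\in S_{\mathcal L(\mathcal H)}(\mathbb V)$. Let $\mathbf{NCP}^U_\delta(s_1)$ be the convex set of linear maps $S:\mathcal L(\mathcal K)\otimes L^\infty(\nu)\to S_{\mathcal L(\mathcal H)}(\mathbb V)$, $x\mapsto S_x$, that are completely positive ($\sum_{j,k}S_{x_j^*x_k}(v_j,v_k)\ge0$ for all finite families $x_j$, $v_j$), normal (each $x\mapsto S_x(v,v)$ preserves suprema of bounded increasing nets of selfadjoint elements), covariant ($S_{\delta_g(x)}(v,w)=S_x(U(g^{-1})v,U(g^{-1})w)$), and satisfy $S_1=s_1$. A Hilbert space $\mathcal K'$ is a minimal ancillary space of a map $T:\mathcal L(\mathcal K)\to S_{\mathcal L(\mathcal H)}(\mathbb V)$ if there is an $\mathcal L(\mathcal H)$-linear $J:\mathbb V\to\mathcal L(\mathcal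 H;\mathcal K\otimes\mathcal K')$ with $T_b(v,w)=(Jv)^*(b\otimes I_{\mathcal K'})(Jw)$ such that the operators $(b\otimes I_{\mathcal K'})(Jv)$, $b\in\mathcal L(\mathcal K)$, $v\in\mathbb V$, span a $\sigma$-strongly dense subspace of $\mathcal L(\mathcal H;\mathcal K\otimes\mathcal K')$. For $n\in\{0,1,2,\dots,\infty\}$ let $\mathcal H_n$ be the Hilbert space of square-summable sequences supported on the first $n$ indices; so $\mathcal H_n$ has dimension $n$, and operators between such spaces are composed after being extended by $0$ to $\ell^2$. For measurable $n:\Omega\to\{0,1,\dots,\infty\}$ let $\mathcal H_\oplus=\int^\oplus_\Omega\mathcal H_{n(\omega)}\,d\nu(\omega)$, with multiplication operators $\hat f$, $f\in L^\infty(\nu)$. **Proposition.** Let $S\in\mathbf{NCP}^U_\delta(s_1)$ be such that its first marginal $S^1_b=S_{b\otimes1}$ has a separable minimal ancillary space. Then there are a measurable $n:\Omega\to\{0,1,\dots,\infty\}$, an $\mathcal L(\mathcal H)$-linear map $Y:\mathbb V\to\mathcal L(\mathcal H;\mathcal K\otimes\mathcal H_\oplus)$, unitaries $y_g$ on $\mathcal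 H_\oplus$ and unitaries $y(g,\omega)$ on $\mathcal H_{n(\omega)}$ ($g\in G$, $\omega\in\Omega$) such that the following hold. 1. For every $g\in G$, $n(g\omega)=n(\omega)$ for $\nu$-a.a. $\omega$. If $G$ carries a non-zero $\sigma$-finite measure whose null sets are invariant under right translations (for instance, if $G$ is countable with the discrete $\sigma$-algebra, or locally compact second countable with its Borel $\sigma$-algebra), then $n(g\omega)=n(\omega)$ for all $g\in G$ and all $\omega\in\Omega$. 2. $S_{b\otimes f}(v,w)=(Yv)^*(b\otimes\hat f)(Yw)$ for all $b\in\mathcal L(\mathcal K)$, $f\in L^\infty(\nu)$, $v,w\in\mathbb V$, and the linear span of the operators $(b\otimes\hat f)(Yv)$ is $\sigma$-strongly dense in $\mathcal L(\mathcal H;\mathcal K\otimes\mathcal H_\oplus)$. 3. For every $g\in G$ the field $\omega\mapsto y(g,\omega)$ is weakly $\nu$-measurable, and for all $\psi\in\mathcal H_\oplus$ $$(y_g\psi)(\omega)=\sqrt{\rho_{g^{-1}}(\omega)}\;y(g,\omega)\psi(g^{-1}\omega)\qquad\text{for }\nu\text{-a.a. }\omega .$$ 4. $YU(g)=(u_g\otimes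 y_g)Y$ for all $g\in G$. 5. For all $g,h\in G$ and $\nu$-a.a. $\omega$, $y(gh,\omega)=\overline{m(g,h)}\,y(g,\omega)y(h,g^{-1}\omega)$; and $g\mapsto u_g\otimes y_g$ is a unitary representation of $G$ on $\mathcal K\otimes\mathcal H_\oplus$. 6. $S$ is an extreme point of $\mathbf{NCP}^U_\delta(s_1)$ if and only if every decomposable operator $D=\int^\oplus_\Omega D(\omega)\,d\nu(\omega)$ on $\mathcal H_\oplus$ that satisfies $(Yv)^*(I_{\mathcal K}\otimes D)(Yv)=0$ for all $v\in\mathbb V$ and, for every $g\in G$, $$D(\omega)\,y(g,\omega)=y(g,\omega)\,D(g^{-1}\omega)\qquad\text{for }\nu\text{-a.a. }\omega$$ is zero. -/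

import Mathlib

open MeasureTheory Filter
open scoped ENNReal TensorProduct Pointwise InnerProductSpace

set_option linter.unusedSectionVars false

noncomputable section

namespace CovInstr

/-! ### Hilbert space tensor products -/

/-- The Hilbert space tensor product `E ⊗ F` (completed algebraic tensor product). -/
def HilbertTensor (E F : Type*) [NormedAddCommGroup E] [InnerProductSpace ℂ E]
    [NormedAddCommGroup F] [InnerProductSpace ℂ F] : Type _ :=
  UniformSpace.Completion (E ⊗[ℂ] F)

section Tensor

variable {E E' E'' F F' F'' : Type*}
  [NormedAddCommGroup E] [InnerProductSpace ℂ E] [NormedAddCommGroup E'] [InnerProductSpace ℂ E']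
  [NormedAddCommGroup E''] [InnerProductSpace ℂ E'']
  [NormedAddCommGroup F] [InnerProductSpace ℂ F] [NormedAddCommGroup F'] [InnerProductSpace ℂ F']
  [NormedAddCommGroup F''] [InnerProductSpace ℂ F'']

instance : NormedAddCommGroup (HilbertTensor E F) :=
  inferInstanceAs (NormedAddCommGroup (UniformSpace.Completion (E ⊗[ℂ] F)))

instance : InnerProductSpace ℂ (HilbertTensor E F) :=
  inferInstanceAs (InnerProductSpace ℂ (UniformSpace.Completion (E ⊗[ℂ] F)))

instance : CompleteSpace (HilbertTensor E F) :=
  inferInstanceAs (CompleteSpace (UniformSpace.Completion (E ⊗[ℂ] F)))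

/-- The canonical isometric embedding of the algebraic tensor product. -/
def toHilbert : (E ⊗[ℂ] F) →ₗᵢ[ℂ] HilbertTensor E F :=
  (UniformSpace.Completion.toComplₗᵢ : (E ⊗[ℂ] F) →ₗᵢ[ℂ] UniformSpace.Completion (E ⊗[ℂ] F))

theorem denseRange_toHilbert : DenseRange (toHilbert : (E ⊗[ℂ] F) → HilbertTensor E F) :=
  UniformSpace.Completion.denseRange_coe

/-- The bounded operator `a ⊗ b` between Hilbert space tensor products. -/
def opTensor (a : E →L[ℂ] E') (b : F →L[ℂ] F') :
    HilbertTensor E F →L[ℂ] HilbertTensor E' F' :=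
  ((TensorProduct.mapL a b).completion :
    UniformSpace.Completion (E ⊗[ℂ] F) →L[ℂ] UniformSpace.Completion (E' ⊗[ℂ] F'))

theorem opTensor_toHilbert (a : E →L[ℂ] E') (b : F →L[ℂ] F') (z : E ⊗[ℂ] F) :
    opTensor a b (toHilbert z) = toHilbert (TensorProduct.mapL a b z) :=
  ContinuousLinearMap.completion_apply_coe _ _

theorem hilbertTensor_ext {X : Type*} [NormedAddCommGroup X] [InnerProductSpace ℂ X]
    {A B : HilbertTensor E F →L[ℂ] X} (h : ∀ z, A (toHilbert z) = B (toHilbert z)) : A = B :=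
  ContinuousLinearMap.ext fun x =>
    congrFun (denseRange_toHilbert.equalizer A.continuous B.continuous (funext h)) x

theorem opTensor_comp (a' : E' →L[ℂ] E'') (a : E →L[ℂ] E') (b' : F' →L[ℂ] F'')
    (b : F →L[ℂ] F') :
    opTensor a' b' ∘L opTensor a b = opTensor (a' ∘L a) (b' ∘L b) := by
  refine hilbertTensor_ext fun z => ?_
  simp only [ContinuousLinearMap.comp_apply, opTensor_toHilbert, TensorProduct.mapL_comp]

theorem opTensor_mul (a a' : E →L[ℂ] E) (b b' : F →L[ℂ] F) :
    opTensor a b * opTensor a' b' = opTensor (a * a') (b * b') :=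
  opTensor_comp a a' b b'

theorem opTensor_one : opTensor (1 : E →L[ℂ] E) (1 : F →L[ℂ] F) = 1 := by
  refine hilbertTensor_ext fun z => ?_
  rw [opTensor_toHilbert]
  change toHilbert (TensorProduct.mapL (.id ℂ E) (.id ℂ F) z) = toHilbert z
  rw [TensorProduct.mapL_id_id]
  rfl

theorem opTensor_star [CompleteSpace E] [CompleteSpace F] (a : E →L[ℂ] E) (b : F →L[ℂ] F) :
    star (opTensor a b) = opTensor (star a) (star b) := by
  rw [ContinuousLinearMap.star_eq_adjoint, eq_comm, ContinuousLinearMap.eq_adjoint_iff]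
  intro x y
  refine denseRange_toHilbert.induction_on₂ (p := fun x y =>
    inner ℂ (opTensor (star a) (star b) x) y = inner ℂ x (opTensor a b y))
    (isClosed_eq (by fun_prop) (by fun_prop)) (fun z w => ?_) x y
  simp only [opTensor_toHilbert, LinearIsometry.inner_map_map]
  induction z with
  | zero => simp
  | add z₁ z₂ h₁ h₂ => simp only [map_add, inner_add_left, h₁, h₂]
  | tmul e f =>
    induction w with
    | zero => simp
    | add w₁ w₂ h₁ h₂ => simp only [map_add, inner_add_right, h₁, h₂]
    | tmul e' f' =>
      simp [ContinuousLinearMap.star_eq_adjoint, ContinuousLinearMap.adjoint_inner_left]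

end Tensor

/-! ### Multiplication operators and the translation actions on `L^∞` and `L²` -/

section Translations

variable {Ω : Type*} [MeasurableSpace Ω]

/-- The operator `f̂` of multiplication by `f ∈ L^∞(ν)` on `L²(ν; E)`. -/
def mulOp (E : Type*) [NormedAddCommGroup E] [InnerProductSpace ℂ E] (ν : Measure Ω)
    (f : Lp ℂ ∞ ν) : Lp E 2 ν →L[ℂ] Lp E 2 ν :=
  (ContinuousLinearMap.lsmul ℂ ℂ : ℂ →L[ℂ] E →L[ℂ] E).holderL ν ∞ 2 2 f

theorem mulOp_coeFn {E : Type*} [NormedAddCommGroup E] [InnerProductSpace ℂ E] {ν : Measure Ω}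
    (f : Lp ℂ ∞ ν) (ψ : Lp E 2 ν) :
    ∀ᵐ ω ∂ν, mulOp E ν f ψ ω = f ω • ψ ω := by
  filter_upwards [ContinuousLinearMap.coeFn_holder (r := 2)
    (ContinuousLinearMap.lsmul ℂ ℂ : ℂ →L[ℂ] E →L[ℂ] E) f ψ] with ω h
  exact h

/-- The constant function `1` in `L^∞(ν)`. -/
def linftyOne (ν : Measure Ω) : Lp ℂ ∞ ν := (memLp_top_const (1 : ℂ)).toLp _

variable {G : Type*} [Group G] [MulAction G Ω]

/-- Quasi-invariance: translates of null sets are null. -/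
class QuasiInvariant (G : Type*) [Group G] {Ω : Type*} [MeasurableSpace Ω] [MulAction G Ω]
    (ν : Measure Ω) : Prop where
  smul_null : ∀ (g : G) (X : Set Ω), MeasurableSet X → ν X = 0 → ν (g • X) = 0

/-- The translated measure `ν_g(X) = ν(gX)`. -/
def transMeasure (ν : Measure Ω) (g : G) : Measure Ω := ν.map fun ω => g⁻¹ • ω

/-- The Radon-Nikodym derivative `ρ_g = dν_g/dν`. -/
def rho (ν : Measure Ω) (g : G) : Ω → ℝ≥0∞ := (transMeasure ν g).rnDeriv ν

variable [MeasurableConstSMul G Ω]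

theorem transMeasure_apply (ν : Measure Ω) (g : G) {X : Set Ω} (hX : MeasurableSet X) :
    transMeasure ν g X = ν (g • X) := by
  rw [transMeasure, Measure.map_apply (measurable_const_smul g⁻¹) hX, Set.preimage_smul, inv_inv]

theorem quasiMeasurePreserving_smul (ν : Measure Ω) [QuasiInvariant G ν] (g : G) :
    Measure.QuasiMeasurePreserving (fun ω : Ω => g • ω) ν ν := by
  refine ⟨measurable_const_smul g, Measure.AbsolutelyContinuous.mk fun X hX h => ?_⟩
  rw [Measure.map_apply (measurable_const_smul g) hX, Set.preimage_smul]
  exact QuasiInvariant.smul_null g⁻¹ X hX h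

instance (ν : Measure Ω) [SigmaFinite ν] (g : G) : SigmaFinite (transMeasure ν g) :=
  (MeasurableEquiv.smul (g⁻¹ : G) : Ω ≃ᵐ Ω).sigmaFinite_map

theorem transMeasure_ac (ν : Measure Ω) [QuasiInvariant G ν] (g : G) : transMeasure ν g ≪ ν :=
  (quasiMeasurePreserving_smul ν g⁻¹).absolutelyContinuous

theorem ac_transMeasure (ν : Measure Ω) [QuasiInvariant G ν] (g : G) : ν ≪ transMeasure ν g := by
  refine Measure.AbsolutelyContinuous.mk fun X hX h => ?_
  rw [transMeasure_apply ν g hX] at h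
  have := QuasiInvariant.smul_null (ν := ν) g⁻¹ (g • X) (hX.const_smul g) h
  rwa [inv_smul_smul] at this

/-- The action `(γ_g f)(ω) = f(g⁻¹ω)` on `L^∞(ν)`. -/
def gammaAct (ν : Measure Ω) [QuasiInvariant G ν] (g : G) (f : Lp ℂ ∞ ν) : Lp ℂ ∞ ν :=
  MemLp.toLp (fun ω => f (g⁻¹ • ω)) (memLp_top_of_bound
    ((Lp.aestronglyMeasurable f).comp_quasiMeasurePreserving (quasiMeasurePreserving_smul ν g⁻¹))
    (eLpNormEssSup f ν).toReal (by
      have h : ∀ᵐ ω ∂ν, ‖f ω‖ ≤ (eLpNormEssSup f ν).toReal := by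
        have hfin : eLpNormEssSup f ν ≠ ∞ := by
          rw [← eLpNorm_exponent_top]; exact Lp.eLpNorm_ne_top f
        filter_upwards [enorm_ae_le_eLpNormEssSup f ν] with ω hω
        rw [← toReal_enorm]
        exact ENNReal.toReal_mono hfin hω
      exact (quasiMeasurePreserving_smul ν g⁻¹).ae h))

theorem gammaAct_coeFn (ν : Measure Ω) [QuasiInvariant G ν] (g : G) (f : Lp ℂ ∞ ν) :
    ∀ᵐ ω ∂ν, gammaAct ν g f ω = f (g⁻¹ • ω) :=
  MemLp.coeFn_toLp _

section Koopman

variable {E : Type*} [NormedAddCommGroup E] [InnerProductSpace ℂ E]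
variable (ν : Measure Ω) [SigmaFinite ν] [QuasiInvariant G ν]

/-- The function `ω ↦ √ρ_{g⁻¹}(ω) ψ(g⁻¹ω)`. -/
def koopmanFun (g : G) (ψ : Ω → E) (ω : Ω) : E :=
  (Real.sqrt (rho ν g⁻¹ ω).toReal : ℂ) • ψ (g⁻¹ • ω)

theorem rho_ne_top (g : G) : ∀ᵐ ω ∂ν, rho ν g ω ≠ ∞ := by
  filter_upwards [Measure.rnDeriv_lt_top (transMeasure ν g) ν] with ω h using h.ne

theorem rho_ne_zero (g : G) : ∀ᵐ ω ∂ν, rho ν g ω ≠ 0 := by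
  filter_upwards [Measure.rnDeriv_pos' (ac_transMeasure ν g)] with ω h using h.ne'

theorem koopmanFun_aesm (g : G) {ψ : Ω → E} (hψ : AEStronglyMeasurable ψ ν) :
    AEStronglyMeasurable (koopmanFun ν g ψ) ν := by
  refine AEStronglyMeasurable.smul ?_
    (hψ.comp_quasiMeasurePreserving (quasiMeasurePreserving_smul ν g⁻¹))
  have : Measurable (rho ν g⁻¹) := Measure.measurable_rnDeriv _ _
  exact (by fun_prop : Measurable fun ω => (Real.sqrt (rho ν g⁻¹ ω).toReal : ℂ)).aestronglyMeasurable

theorem lintegral_rho (g : G) {F : Ω → ℝ≥0∞} (hF : AEMeasurable F ν) :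
    ∫⁻ ω, rho ν g⁻¹ ω * F (g⁻¹ • ω) ∂ν = ∫⁻ ω, F ω ∂ν := by
  have hq := quasiMeasurePreserving_smul ν (g⁻¹ : G)
  rw [rho, lintegral_rnDeriv_mul (transMeasure_ac ν g⁻¹) (f := fun ω => F (g⁻¹ • ω))
    (hF.comp_quasiMeasurePreserving hq)]
  have : transMeasure ν g⁻¹ = ν.map (MeasurableEquiv.smul g : Ω ≃ᵐ Ω) := by
    simp [transMeasure]
  rw [this, lintegral_map_equiv]
  simp

theorem eLpNorm_koopmanFun (g : G) {ψ : Ω → E} (hψ : AEStronglyMeasurable ψ ν) :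
    eLpNorm (koopmanFun ν g ψ) 2 ν = eLpNorm ψ 2 ν := by
  rw [eLpNorm_eq_lintegral_rpow_enorm_toReal two_ne_zero ENNReal.ofNat_ne_top,
    eLpNorm_eq_lintegral_rpow_enorm_toReal two_ne_zero ENNReal.ofNat_ne_top]
  congr 1
  rw [← lintegral_rho ν g (F := fun ω => ‖ψ ω‖ₑ ^ (2 : ℝ≥0∞).toReal) (by fun_prop)]
  refine lintegral_congr_ae ?_
  filter_upwards [rho_ne_top ν g⁻¹] with ω h
  rw [koopmanFun, enorm_smul, ENNReal.mul_rpow_of_nonneg _ _ (by norm_num)]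
  congr 1
  have he : ‖((Real.sqrt (rho ν g⁻¹ ω).toReal : ℝ) : ℂ)‖ₑ
      = ENNReal.ofReal (Real.sqrt (rho ν g⁻¹ ω).toReal) := by
    rw [← ofReal_norm, Complex.norm_real, Real.norm_of_nonneg (Real.sqrt_nonneg _)]
  rw [he,
    ENNReal.ofReal_rpow_of_nonneg (Real.sqrt_nonneg _) (by norm_num)]
  simp only [ENNReal.toReal_ofNat, Real.rpow_ofNat]
  rw [Real.sq_sqrt ENNReal.toReal_nonneg, ENNReal.ofReal_toReal h]

theorem koopmanFun_memLp (g : G) (ψ : Lp E 2 ν) : MemLp (koopmanFun ν g ψ) 2 ν :=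
  ⟨koopmanFun_aesm ν g (Lp.aestronglyMeasurable ψ), by
    rw [eLpNorm_koopmanFun ν g (Lp.aestronglyMeasurable ψ)]; exact Lp.eLpNorm_lt_top ψ⟩

/-- The isometry `(λ_g ψ)(ω) = √ρ_{g⁻¹}(ω) ψ(g⁻¹ω)` of `L²(ν; E)`. -/
def koopmanIsometry (g : G) : Lp E 2 ν →ₗᵢ[ℂ] Lp E 2 ν where
  toFun ψ := (koopmanFun_memLp ν g ψ).toLp (koopmanFun ν g ψ)
  map_add' ψ φ := by
    rw [← MemLp.toLp_add, MemLp.toLp_eq_toLp_iff]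
    filter_upwards [(quasiMeasurePreserving_smul ν g⁻¹).ae (Lp.coeFn_add ψ φ)] with ω h
    simp only [koopmanFun, Pi.add_apply]
    rw [h, Pi.add_apply, smul_add]
  map_smul' c ψ := by
    rw [RingHom.id_apply, ← MemLp.toLp_const_smul, MemLp.toLp_eq_toLp_iff]
    filter_upwards [(quasiMeasurePreserving_smul ν g⁻¹).ae (Lp.coeFn_smul c ψ)] with ω h
    simp only [koopmanFun, Pi.smul_apply]
    rw [h, Pi.smul_apply, smul_comm]
  norm_map' ψ := by
    change ‖(koopmanFun_memLp ν g ψ).toLp (koopmanFun ν g ψ)‖ = ‖ψ‖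
    rw [Lp.norm_toLp, eLpNorm_koopmanFun ν g (Lp.aestronglyMeasurable ψ), Lp.norm_def]

theorem koopmanIsometry_coeFn (g : G) (ψ : Lp E 2 ν) :
    koopmanIsometry ν g ψ =ᵐ[ν] koopmanFun ν g ψ :=
  MemLp.coeFn_toLp (koopmanFun_memLp ν g ψ)

theorem koopmanIsometry_surjective (g : G) :
    Function.Surjective (koopmanIsometry (E := E) ν g) := by
  intro φ
  set r : Ω → ℝ := fun ω => Real.sqrt (rho ν g⁻¹ ω).toReal with hr
  have hrm : Measurable r := by
    have : Measurable (rho ν g⁻¹) := Measure.measurable_rnDeriv _ _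
    fun_prop
  have hq := quasiMeasurePreserving_smul ν g
  have hr0 : ∀ᵐ ω ∂ν, r ω ≠ 0 := by
    filter_upwards [rho_ne_top ν g⁻¹, rho_ne_zero ν g⁻¹] with ω h1 h2
    exact (Real.sqrt_pos.2 (ENNReal.toReal_pos h2 h1)).ne'
  let ψ : Ω → E := fun ω => ((r (g • ω))⁻¹ : ℂ) • φ (g • ω)
  have hψm : AEStronglyMeasurable ψ ν := by
    refine AEStronglyMeasurable.smul ?_
      ((Lp.aestronglyMeasurable φ).comp_quasiMeasurePreserving hq)
    have : Measurable fun ω : Ω => r (g • ω) := hrm.comp (measurable_const_smul g)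
    exact (by fun_prop : Measurable fun ω : Ω => ((r (g • ω))⁻¹ : ℂ)).aestronglyMeasurable
  have hK : koopmanFun ν g ψ =ᵐ[ν] φ := by
    filter_upwards [hr0] with ω h
    have h' : (r ω : ℂ) ≠ 0 := by exact_mod_cast h
    simp only [koopmanFun, ψ, smul_inv_smul]
    change (r ω : ℂ) • (r ω : ℂ)⁻¹ • φ ω = φ ω
    rw [smul_smul, mul_inv_cancel₀ h', one_smul]
  have hψ : MemLp ψ 2 ν := ⟨hψm, by
    rw [← eLpNorm_koopmanFun ν g hψm, eLpNorm_congr_ae hK]; exact Lp.eLpNorm_lt_top φ⟩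
  refine ⟨hψ.toLp ψ, Lp.ext ?_⟩
  filter_upwards [koopmanIsometry_coeFn ν g (hψ.toLp ψ), hK,
    (quasiMeasurePreserving_smul ν g⁻¹).ae hψ.coeFn_toLp] with ω h1 h2 h3
  rw [h1, ← h2, koopmanFun, h3, koopmanFun]

variable (E) [CompleteSpace E]

/-- The unitary `λ_g` of `L²(ν; E)`, `(λ_g ψ)(ω) = √ρ_{g⁻¹}(ω) ψ(g⁻¹ω)`. -/
def koopman (g : G) : unitary (Lp E 2 ν →L[ℂ] Lp E 2 ν) :=
  Unitary.linearIsometryEquiv.symm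
    (LinearIsometryEquiv.ofSurjective (koopmanIsometry ν g) (koopmanIsometry_surjective ν g))

theorem koopman_coeFn (g : G) (ψ : Lp E 2 ν) :
    ∀ᵐ ω ∂ν, (koopman E ν g : Lp E 2 ν →L[ℂ] Lp E 2 ν) ψ ω
      = (Real.sqrt (rho ν g⁻¹ ω).toReal : ℂ) • ψ (g⁻¹ • ω) :=
  koopmanIsometry_coeFn ν g ψ

theorem koopman_mul_mulOp (g : G) (f : Lp ℂ ∞ ν) :
    (koopman E ν g : Lp E 2 ν →L[ℂ] Lp E 2 ν) * mulOp E ν f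
      = mulOp E ν (gammaAct ν g f) * (koopman E ν g : Lp E 2 ν →L[ℂ] Lp E 2 ν) := by
  ext1 ψ
  refine Lp.ext ?_
  filter_upwards [koopman_coeFn E ν g (mulOp E ν f ψ),
    mulOp_coeFn (gammaAct ν g f) ((koopman E ν g : Lp E 2 ν →L[ℂ] Lp E 2 ν) ψ),
    koopman_coeFn E ν g ψ, gammaAct_coeFn ν g f,
    (quasiMeasurePreserving_smul ν g⁻¹).ae (mulOp_coeFn f ψ)] with ω h1 h2 h3 h4 h5
  simp only [mul_apply_eq_comp]
  rw [h1, h2, h3, h4, h5, smul_comm]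

end Koopman

end Translations

/-! ### The von Neumann algebra `L(K) ⊗ L^∞(ν)` and the action `δ = β ⊗ γ` -/

section Algebra

variable (K : Type*) [NormedAddCommGroup K] [InnerProductSpace ℂ K] [CompleteSpace K]
variable {Ω : Type*} [MeasurableSpace Ω] (ν : Measure Ω)

/-- The operators `b ⊗ f̂` on `K ⊗ L²(ν)`. -/
def elemTensors : Set (HilbertTensor K (Lp ℂ 2 ν) →L[ℂ] HilbertTensor K (Lp ℂ 2 ν)) :=
  {x | ∃ (b : K →L[ℂ] K) (f : Lp ℂ ∞ ν), x = opTensor b (mulOp ℂ ν f)}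

/-- The commutant of the operators `b ⊗ f̂`. -/
def elemTensorsCommutant : VonNeumannAlgebra (HilbertTensor K (Lp ℂ 2 ν)) where
  toStarSubalgebra := StarSubalgebra.centralizer ℂ (elemTensors K ν)
  centralizer_centralizer' :=
    Set.centralizer_centralizer_centralizer (elemTensors K ν ∪ star (elemTensors K ν))

/-- The von Neumann algebra tensor product `L(K) ⊗ L^∞(ν)`: the von Neumann algebra on
`K ⊗ L²(ν)` generated by the operators `b ⊗ f̂` (their double commutant). -/
def instrVN : VonNeumannAlgebra (HilbertTensor K (Lp ℂ 2 ν)) :=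
  (elemTensorsCommutant K ν).commutant

/-- The algebra `L(K) ⊗ L^∞(ν)` as a type. -/
abbrev InstrAlg : Type _ := ↥(instrVN K ν).toStarSubalgebra

variable {K ν}

theorem mem_instrVN_iff (x : HilbertTensor K (Lp ℂ 2 ν) →L[ℂ] HilbertTensor K (Lp ℂ 2 ν)) :
    x ∈ (instrVN K ν).toStarSubalgebra ↔
      ∀ c, (∀ s ∈ elemTensors K ν, s * c = c * s ∧ star s * c = c * star s) → c * x = x * c := by
  change x ∈ (elemTensorsCommutant K ν).commutant ↔ _
  rw [VonNeumannAlgebra.mem_commutant_iff]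
  refine forall_congr' fun c => imp_congr ?_ Iff.rfl
  exact StarSubalgebra.mem_centralizer_iff ℂ

/-- The element `b ⊗ f` of `L(K) ⊗ L^∞(ν)`. -/
def elem (b : K →L[ℂ] K) (f : Lp ℂ ∞ ν) : InstrAlg K ν :=
  ⟨opTensor b (mulOp ℂ ν f), (mem_instrVN_iff _).2 fun _ hc => (hc _ ⟨b, f, rfl⟩).1.symm⟩

variable {G : Type*} [Group G] [MulAction G Ω] [MeasurableConstSMul G Ω]

/-- The unitary `u_g ⊗ λ_g` on `K ⊗ L²(ν)`. -/
def implUnitary (ν : Measure Ω) [SigmaFinite ν] [QuasiInvariant G ν]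
    (u : G → unitary (K →L[ℂ] K)) (g : G) :
    HilbertTensor K (Lp ℂ 2 ν) →L[ℂ] HilbertTensor K (Lp ℂ 2 ν) :=
  opTensor (u g : K →L[ℂ] K) (koopman ℂ ν g : Lp ℂ 2 ν →L[ℂ] Lp ℂ 2 ν)

theorem implUnitary_star_mul [SigmaFinite ν] [QuasiInvariant G ν] (u : G → unitary (K →L[ℂ] K))
    (g : G) : star (implUnitary ν u g) * implUnitary ν u g = 1 := by
  rw [implUnitary, opTensor_star, opTensor_mul, Unitary.star_mul_self_of_mem (u g).2,
    Unitary.star_mul_self_of_mem (koopman ℂ ν g).2, opTensor_one]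

theorem implUnitary_mul_star [SigmaFinite ν] [QuasiInvariant G ν] (u : G → unitary (K →L[ℂ] K))
    (g : G) : implUnitary ν u g * star (implUnitary ν u g) = 1 := by
  rw [implUnitary, opTensor_star, opTensor_mul, Unitary.mul_star_self_of_mem (u g).2,
    Unitary.mul_star_self_of_mem (koopman ℂ ν g).2, opTensor_one]

theorem implUnitary_conj_elem [SigmaFinite ν] [QuasiInvariant G ν] (u : G → unitary (K →L[ℂ] K))
    (g : G) (b : K →L[ℂ] K) (f : Lp ℂ ∞ ν) :
    implUnitary ν u g * opTensor b (mulOp ℂ ν f) * star (implUnitary ν u g)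
      = opTensor ((u g : K →L[ℂ] K) * b * star (u g : K →L[ℂ] K))
          (mulOp ℂ ν (gammaAct ν g f)) := by
  rw [implUnitary, opTensor_star, opTensor_mul, opTensor_mul, koopman_mul_mulOp,
    mul_assoc (mulOp _ _ _), Unitary.mul_star_self_of_mem (koopman ℂ ν g).2, mul_one]

theorem conj_commute {A : Type*} [Ring A] [StarRing A] {W s c : A} (h1 : star W * W = 1)
    (h : (W * s * star W) * c = c * (W * s * star W)) :
    s * (star W * c * W) = (star W * c * W) * s := by
  calc s * (star W * c * W) = (star W * W) * s * (star W * c * W) := by rw [h1, one_mul]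
    _ = star W * ((W * s * star W) * c) * W := by simp only [mul_assoc]
    _ = star W * (c * (W * s * star W)) * W := by rw [h]
    _ = (star W * c * W) * s * (star W * W) := by simp only [mul_assoc]
    _ = _ := by rw [h1, mul_one]

theorem commute_conj {A : Type*} [Ring A] [StarRing A] {W x c : A} (h2 : W * star W = 1)
    (h : (star W * c * W) * x = x * (star W * c * W)) :
    c * (W * x * star W) = (W * x * star W) * c := by
  calc c * (W * x * star W) = (W * star W) * c * (W * x * star W) := by rw [h2, one_mul]
    _ = W * ((star W * c * W) * x) * star W := by simp only [mul_assoc]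
    _ = W * (x * (star W * c * W)) * star W := by rw [h]
    _ = (W * x * star W) * c * (W * star W) := by simp only [mul_assoc]
    _ = _ := by rw [h2, mul_one]

theorem conj_mem_bicommutant {A : Type*} [Ring A] [StarRing A] {T : Set A} {W x : A}
    (h1 : star W * W = 1) (h2 : W * star W = 1) (hT : ∀ s ∈ T, W * s * star W ∈ T)
    (hx : ∀ c, (∀ s ∈ T, s * c = c * s ∧ star s * c = c * star s) → c * x = x * c) :
    ∀ c, (∀ s ∈ T, s * c = c * s ∧ star s * c = c * star s) →
      c * (W * x * star W) = (W * x * star W) * c := by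
  intro c hc
  refine commute_conj h2 (hx _ fun s hs => ?_)
  have h := hc _ (hT s hs)
  refine ⟨conj_commute h1 h.1, conj_commute h1 ?_⟩
  have e : star (W * s * star W) = W * star s * star W := by
    rw [star_mul, star_mul, star_star, mul_assoc]
  exact e ▸ h.2

theorem implUnitary_conj_elemTensors [SigmaFinite ν] [QuasiInvariant G ν]
    (u : G → unitary (K →L[ℂ] K)) (g : G)
    (s : HilbertTensor K (Lp ℂ 2 ν) →L[ℂ] HilbertTensor K (Lp ℂ 2 ν))
    (hs : s ∈ elemTensors K ν) :
    implUnitary ν u g * s * star (implUnitary ν u g) ∈ elemTensors K ν := by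
  obtain ⟨b, f, rfl⟩ := hs
  exact ⟨_, _, implUnitary_conj_elem u g b f⟩

theorem implUnitary_conj_mem [SigmaFinite ν] [QuasiInvariant G ν] (u : G → unitary (K →L[ℂ] K))
    (g : G) (x : InstrAlg K ν) :
    implUnitary ν u g * x.1 * star (implUnitary ν u g) ∈ (instrVN K ν).toStarSubalgebra := by
  have hx := (mem_instrVN_iff x.1).1 x.2
  have h1 := implUnitary_star_mul (ν := ν) u g
  have h2 := implUnitary_mul_star (ν := ν) u g
  rw [mem_instrVN_iff]
  exact conj_mem_bicommutant (T := elemTensors K ν) h1 h2 (implUnitary_conj_elemTensors u g) hx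

/-- The action `δ_g = β_g ⊗ γ_g` on `L(K) ⊗ L^∞(ν)`, where `β_g(b) = u_g b u_g^*`: it is
implemented by the unitary `u_g ⊗ λ_g`. -/
def deltaAct (ν : Measure Ω) [SigmaFinite ν] [QuasiInvariant G ν]
    (u : G → unitary (K →L[ℂ] K)) (g : G) (x : InstrAlg K ν) : InstrAlg K ν :=
  ⟨implUnitary ν u g * x.1 * star (implUnitary ν u g), implUnitary_conj_mem u g x⟩

theorem deltaAct_elem (ν : Measure Ω) [SigmaFinite ν] [QuasiInvariant G ν]
    (u : G → unitary (K →L[ℂ] K)) (g : G) (b : K →L[ℂ] K) (f : Lp ℂ ∞ ν) :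
    deltaAct ν u g (elem b f)
      = elem ((u g : K →L[ℂ] K) * b * star (u g : K →L[ℂ] K)) (gammaAct ν g f) :=
  Subtype.ext (implUnitary_conj_elem u g b f)

end Algebra

/-! ### Sesquilinear forms, completely positive maps -/

section Forms

variable (H : Type*) [NormedAddCommGroup H] [InnerProductSpace ℂ H] [CompleteSpace H]
variable (V : Type*) [AddCommGroup V] [Module ℂ V] [Module (H →L[ℂ] H)ᵐᵒᵖ V]

/-- The space `S_{L(H)}(V)` of `L(H)`-sesquilinear forms on the right `L(H)`-module `V`. -/
def SesqForm : Submodule ℂ (V → V → (H →L[ℂ] H)) where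
  carrier := {s |
    (∀ u v w (c : ℂ), s u (v + c • w) = s u v + c • s u w) ∧
    (∀ u v w (c : ℂ), s (v + c • w) u = s v u + (starRingEnd ℂ c) • s w u) ∧
    (∀ u v (a : H →L[ℂ] H), s u (MulOpposite.op a • v) = s u v * a) ∧
    (∀ u v (a : H →L[ℂ] H), s (MulOpposite.op a • u) v = star a * s u v)}
  add_mem' := by
    rintro s t ⟨h1, h2, h3, h4⟩ ⟨k1, k2, k3, k4⟩
    refine ⟨fun u v w c => ?_, fun u v w c => ?_, fun u v a => ?_, fun u v a => ?_⟩
    · simp only [Pi.add_apply, h1, k1, smul_add]; abel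
    · simp only [Pi.add_apply, h2, k2, smul_add]; abel
    · simp only [Pi.add_apply, h3, k3, add_mul]
    · simp only [Pi.add_apply, h4, k4, mul_add]
  zero_mem' := by
    refine ⟨fun u v w c => ?_, fun u v w c => ?_, fun u v a => ?_, fun u v a => ?_⟩ <;> simp
  smul_mem' := by
    rintro d s ⟨h1, h2, h3, h4⟩
    refine ⟨fun u v w c => ?_, fun u v w c => ?_, fun u v a => ?_, fun u v a => ?_⟩
    · simp only [Pi.smul_apply, h1, smul_add, smul_comm c d]
    · simp only [Pi.smul_apply, h2, smul_add, smul_comm _ d]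
    · simp only [Pi.smul_apply, h3, smul_mul_assoc]
    · simp only [Pi.smul_apply, h4, mul_smul_comm]

variable {H V}
variable {K : Type*} [NormedAddCommGroup K] [InnerProductSpace ℂ K] [CompleteSpace K]
variable {Ω : Type*} [MeasurableSpace Ω] {ν : Measure Ω}

/-- Multiplication of linear maps `L(K) ⊗ L^∞(ν) → S_{L(H)}(V)` by real scalars:
`r • S = (r : ℂ) • S`. -/
instance : SMul ℝ (InstrAlg K ν →ₗ[ℂ] SesqForm H V) :=
  ⟨fun r S => (r : ℂ) • S⟩

/-- Complete positivity of a linear map `S : L(K) ⊗ L^∞(ν) → S_{L(H)}(V)`. -/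
def IsCP (S : InstrAlg K ν →ₗ[ℂ] SesqForm H V) : Prop :=
  ∀ (n : ℕ) (x : Fin n → InstrAlg K ν) (v : Fin n → V),
    0 ≤ ∑ j, ∑ k, (S (star (x j) * x k)).1 (v j) (v k)

/-- Normality of a map `L(K) ⊗ L^∞(ν) → L(H)`: it preserves suprema of bounded increasing nets
of selfadjoint elements. -/
def IsNormalMap (f : InstrAlg K ν → (H →L[ℂ] H)) : Prop :=
  ∀ D : Set (InstrAlg K ν), D.Nonempty → DirectedOn (· ≤ ·) D → (∀ x ∈ D, IsSelfAdjoint x) →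
    ∀ s, IsLUB D s → IsLUB (f '' D) (f s)

/-- A `𝕋`-valued 2-cocycle. -/
structure IsTwoCocycle {G : Type*} [Group G] (m : G → G → Circle) : Prop where
  one_left : ∀ g, m 1 g = 1
  one_right : ∀ g, m g 1 = 1
  cocycle : ∀ g h k, m g (h * k) * m h k = m (g * h) k * m g h

/-- `u_e = I` and `u_{gh} = m(g,h) u_g u_h`. -/
structure IsMultiplierRep {G : Type*} [Group G] (m : G → G → Circle)
    (u : G → unitary (K →L[ℂ] K)) : Prop where
  one : u 1 = 1
  mul : ∀ g h, (u (g * h) : K →L[ℂ] K) = (m g h : ℂ) • ((u g : K →L[ℂ] K) * (u h : K →L[ℂ] K))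

/-- The set `NCP_δ^U(s₁)` of normal `(δ, U)`-covariant completely positive maps
`S : L(K) ⊗ L^∞(ν) → S_{L(H)}(V)` with `S_1 = s₁`, where `δ_g = β_g ⊗ γ_g` and
`β_g(b) = u_g b u_g^*`. -/
def NCP {G : Type*} [Group G] [MulAction G Ω] [MeasurableConstSMul G Ω] (ν : Measure Ω)
    [SigmaFinite ν] [QuasiInvariant G ν] (U : G →* (V ≃ₗ[(H →L[ℂ] H)ᵐᵒᵖ] V))
    (u : G → unitary (K →L[ℂ] K)) (s₁ : SesqForm H V) :
    Set (InstrAlg K ν →ₗ[ℂ] SesqForm H V) :=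
  {S | IsCP S ∧ (∀ v : V, IsNormalMap fun x => (S x).1 v v) ∧
    (∀ (g : G) (x : InstrAlg K ν) (v w : V),
      (S (deltaAct ν u g x)).1 v w = (S x).1 (U g⁻¹ v) (U g⁻¹ w)) ∧
    S 1 = s₁}

/-- The first marginal `S¹_b = S_{b ⊗ 1}`. -/
def firstMarginal (S : InstrAlg K ν →ₗ[ℂ] SesqForm H V) (b : K →L[ℂ] K) : SesqForm H V :=
  S (elem b (linftyOne ν))

/-- `L(H)`-linearity of a map `V → L(H; H')`. -/
def IsRightLinear {H' : Type*} [NormedAddCommGroup H'] [InnerProductSpace ℂ H']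
    (J : V →ₗ[ℂ] (H →L[ℂ] H')) : Prop :=
  ∀ (v : V) (a : H →L[ℂ] H), J (MulOpposite.op a • v) = J v ∘L a

/-- `σ`-strong density of a subspace of `L(H; H')`. The `σ`-strong topology is given by the
seminorms `m ↦ (∑_j ‖m ξ_j‖²)^{1/2}` for sequences `ξ` in `H` with `∑_j ‖ξ_j‖² < ∞`; this family
of seminorms is directed (interlace two sequences). -/
def SigmaStronglyDense {H' : Type*} [NormedAddCommGroup H'] [InnerProductSpace ℂ H']
    (A : Submodule ℂ (H →L[ℂ] H')) : Prop :=
  ∀ (m : H →L[ℂ] H') (ξ : ℕ → H), (Summable fun j => ‖ξ j‖ ^ 2) → ∀ ε > (0 : ℝ),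
    ∃ x ∈ A, ∑' j, ‖(m - x) (ξ j)‖ ^ 2 < ε

/-- `K'` is a minimal ancillary space of `T : L(K) → S_{L(H)}(V)`: there is an `L(H)`-linear
`J : V → L(H; K ⊗ K')` with `T_b(v,w) = (Jv)^*(b ⊗ I)(Jw)` such that the operators
`(b ⊗ I)(Jv)` span a `σ`-strongly dense subspace of `L(H; K ⊗ K')`. -/
def IsMinimalAncillary (T : (K →L[ℂ] K) → SesqForm H V) (K' : Type*) [NormedAddCommGroup K']
    [InnerProductSpace ℂ K'] [CompleteSpace K'] : Prop :=
  ∃ J : V →ₗ[ℂ] (H →L[ℂ] HilbertTensor K K'), IsRightLinear J ∧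
    (∀ (b : K →L[ℂ] K) (v w : V), (T b).1 v w
      = ContinuousLinearMap.adjoint (J v) ∘L opTensor b (1 : K' →L[ℂ] K') ∘L J w) ∧
    SigmaStronglyDense (Submodule.span ℂ
      {x | ∃ (b : K →L[ℂ] K) (v : V), x = opTensor b (1 : K' →L[ℂ] K') ∘L J v})

end Forms

/-! ### Direct integrals -/

/-- The space `ℓ²(ℕ)`. -/
abbrev Ell2 : Type := lp (fun _ : ℕ => ℂ) 2

/-- The `n`-dimensional Hilbert space `H_n`, `n ∈ {0, 1, …, ∞}`, realised as the space of
square-summable sequences supported on `{k | k < n}`. -/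
def Fiber (n : ℕ∞) : Submodule ℂ Ell2 where
  carrier := {x | ∀ k : ℕ, n ≤ (k : ℕ∞) → x k = 0}
  add_mem' {x y} hx hy k hk := by
    rw [lp.coeFn_add, Pi.add_apply, hx k hk, hy k hk, add_zero]
  zero_mem' k _ := by rw [lp.coeFn_zero, Pi.zero_apply]
  smul_mem' c x hx k hk := by rw [lp.coeFn_smul, Pi.smul_apply, hx k hk, smul_zero]

theorem isClosed_fiber (n : ℕ∞) : IsClosed (Fiber n : Set Ell2) := by
  have : (Fiber n : Set Ell2) = ⋂ k : ℕ, ⋂ _ : n ≤ (k : ℕ∞), {x : Ell2 | x k = 0} := by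
    ext x; simp [Fiber]
  rw [this]
  refine isClosed_iInter fun k => isClosed_iInter fun _ => ?_
  have hc : Continuous fun x : Ell2 => x k :=
    (continuous_apply k).comp (lp.uniformContinuous_coe (E := fun _ : ℕ => ℂ) (p := 2)).continuous
  exact isClosed_eq hc continuous_const

instance (n : ℕ∞) : CompleteSpace (Fiber n) := (isClosed_fiber n).completeSpace_coe

/-- An operator `H_a → H_b` regarded as an operator on `ℓ²(ℕ)` vanishing on the orthogonal
complement of `H_a`. -/
def extOp {a b : ℕ∞} (T : Fiber a →L[ℂ] Fiber b) : Ell2 →L[ℂ] Ell2 :=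
  (Fiber b).subtypeL ∘L T ∘L (Fiber a).orthogonalProjectionOnto

section DirectIntegral

variable {Ω : Type*} [MeasurableSpace Ω] (ν : Measure Ω) (n : Ω → ℕ∞)

/-- The direct integral Hilbert space `H_⊕ = ∫^⊕ H_{n(ω)} dν(ω)`: square-integrable functions
`ψ : Ω → ℓ²(ℕ)` with `ψ(ω) ∈ H_{n(ω)}` for a.a. `ω`. -/
def DirectIntegral : Submodule ℂ (Lp Ell2 2 ν) where
  carrier := {ψ | ∀ᵐ ω ∂ν, ψ ω ∈ Fiber (n ω)}
  add_mem' {ψ φ} hψ hφ := by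
    filter_upwards [hψ, hφ, Lp.coeFn_add ψ φ] with ω h1 h2 h3
    rw [h3]; exact (Fiber (n ω)).add_mem h1 h2
  zero_mem' := by
    filter_upwards [Lp.coeFn_zero Ell2 2 ν] with ω h
    rw [h]; exact (Fiber (n ω)).zero_mem
  smul_mem' c ψ hψ := by
    filter_upwards [hψ, Lp.coeFn_smul c ψ] with ω h1 h2
    rw [h2]; exact (Fiber (n ω)).smul_mem c h1

theorem isClosed_directIntegral : IsClosed (DirectIntegral ν n : Set (Lp Ell2 2 ν)) := by
  refine IsSeqClosed.isClosed fun x ψ hx hψ => ?_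
  obtain ⟨ns, -, hns⟩ := (tendstoInMeasure_of_tendsto_Lp hψ).exists_seq_tendsto_ae
  have hx' : ∀ᵐ ω ∂ν, ∀ k, x k ω ∈ Fiber (n ω) := ae_all_iff.2 hx
  change ∀ᵐ ω ∂ν, ψ ω ∈ Fiber (n ω)
  filter_upwards [hns, hx'] with ω h1 h2
  exact (isClosed_fiber (n ω)).mem_of_tendsto h1 (Eventually.of_forall fun k => h2 _)

instance : CompleteSpace (DirectIntegral ν n) := (isClosed_directIntegral ν n).completeSpace_coe

variable {ν n}

/-- The multiplication (diagonal) operator `f̂` on `H_⊕`. -/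
def diagOp (f : Lp ℂ ∞ ν) : DirectIntegral ν n →L[ℂ] DirectIntegral ν n :=
  ((mulOp Ell2 ν f) ∘L (DirectIntegral ν n).subtypeL).codRestrict (DirectIntegral ν n) fun ψ => by
    change ∀ᵐ ω ∂ν, mulOp Ell2 ν f ψ ω ∈ Fiber (n ω)
    filter_upwards [mulOp_coeFn f (ψ : Lp Ell2 2 ν), ψ.2] with ω h1 h2
    rw [h1]; exact (Fiber (n ω)).smul_mem _ h2

variable (ν)

/-- Weak `ν`-measurability of a field of operators `T(ω) : H_{n(ω)} → H_{n(ω)}`: the functions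
`ω ↦ ⟨φ(ω), T(ω) ψ(ω)⟩`, `φ, ψ ∈ H_⊕`, are measurable for the `ν`-completed `σ`-algebra. -/
def IsWeaklyMeasurable (T : ∀ ω, Fiber (n ω) →L[ℂ] Fiber (n ω)) : Prop :=
  ∀ φ ψ : DirectIntegral ν n,
    AEMeasurable (fun ω => inner ℂ ((φ : Lp Ell2 2 ν) ω) (extOp (T ω) ((ψ : Lp Ell2 2 ν) ω))) ν

variable {ν}

/-- `D = ∫^⊕ D(ω) dν(ω)` is the decomposable operator on `H_⊕` given by the weakly measurable,
essentially bounded field `ω ↦ D(ω)`. -/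
def IsDecomposedBy (D : DirectIntegral ν n →L[ℂ] DirectIntegral ν n)
    (Df : ∀ ω, Fiber (n ω) →L[ℂ] Fiber (n ω)) : Prop :=
  IsWeaklyMeasurable ν Df ∧ (∃ C : ℝ, ∀ᵐ ω ∂ν, ‖Df ω‖ ≤ C) ∧
    ∀ ψ : DirectIntegral ν n, ∀ᵐ ω ∂ν,
      (D ψ : Lp Ell2 2 ν) ω = extOp (Df ω) ((ψ : Lp Ell2 2 ν) ω)

end DirectIntegral

end CovInstr

end

noncomputable section

set_option linter.unusedSectionVars false

namespace CovInstr

open scoped ComplexOrder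

/-! Everything is tested on one unit vector ξ of H. The forms are L(H)-sesquilinear, so the rank-one
module elements |η⟩⟨ξ| recover S_x(v,w) from the scalars ⟨ξ, S_x(v,w)ξ⟩ (`SesqForm.ext_unit`).
Complete positivity then becomes positivity of scalar kernels, and σ-strong density becomes totality
of a family of vectors.

Dilation. In K ⊗ K' the vectors (b ⊗ 1)(Jv)ξ are total, and their Gram matrix is read off from the
first marginal. Complete positivity bounds the kernel ⟨ξ, S_{(b⊗1)^* x (b'⊗1)}(v,w)ξ⟩, which
therefore defines operators π(x) (`exists_marginal_compression`). Since 1 ⊗ f commutes with b ⊗ 1,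
so does π(1 ⊗ f); hence π(1 ⊗ f) = 1 ⊗ P(f) with a normal positive operator measure P on K'.
Separability of K' allows a countable matrix of densities of P against ν, positive semidefinite
almost everywhere. A measurable Cholesky factorisation writes it as a Gram matrix in ℓ², and n(ω) is
the number of non-zero pivots. This is a minimal Naimark dilation Z of P
(`IsNormalPOM.exists_isDilation`), and Y = (1 ⊗ Z)J.

Symmetry. Covariance preserves the Gram matrix of the total family (b ⊗ f)(Yv)ξ, so each g acts by a
unitary W_g. It intertwines b ⊗ 1 with β_g(b) ⊗ 1, so W_g = u_g ⊗ y_g (`exists_unitary_tensor`).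
Both y_g and the Koopman unitary λ_g implement γ_g, so y_g λ_g^* commutes with L^∞(ν) and is
decomposable. Its fibres are unitaries from H_{n(g⁻¹ω)} onto H_{n(ω)}, which forces n to be almost
invariant and gives the field y(g,ω) (`exists_field_of_covariant`). A Fubini argument replaces n by
a strictly invariant version (`exists_invariant_ae_eq`).

Extremality. As in Arveson's Radon-Nikodym theorem, a component S' of a convex decomposition of S
corresponds to an operator X that commutes with b ⊗ f and W_g; S'_1 = S_1 says that X - 1 is
annihilated by the form. Conversely, a selfadjoint X that is annihilated by the form and commutes
with b ⊗ f and W_g produces members of the convex set from 1 ± tX, with midpoint S. Commuting with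
L(K) ⊗ 1 means X = 1 ⊗ D, and commuting with L^∞(ν) means that D is decomposable. Both directions
rest on `SesqForm.ext_of_normal`: normal completely positive maps are determined by elementary
tensors. -/

/-! ### Kernels and total families -/

section Kernels

variable {ι κ ι' κ' : Type*}

/-- The sesquilinear form on finitely supported families defined by a kernel. -/
def kerForm (k : ι → κ → ℂ) (c : ι →₀ ℂ) (d : κ →₀ ℂ) : ℂ :=
  c.sum fun i x => d.sum fun j y => starRingEnd ℂ x * y * k i j

theorem kerForm_add_left (k : ι → κ → ℂ) (c c' : ι →₀ ℂ) (d : κ →₀ ℂ) :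
    kerForm k (c + c') d = kerForm k c d + kerForm k c' d := by
  classical
  refine Finsupp.sum_add_index' (by simp) fun i x y => ?_
  rw [← Finsupp.sum_add]
  simp only [map_add, add_mul]

theorem kerForm_add_right (k : ι → κ → ℂ) (c : ι →₀ ℂ) (d d' : κ →₀ ℂ) :
    kerForm k c (d + d') = kerForm k c d + kerForm k c d' := by
  classical
  unfold kerForm
  rw [← Finsupp.sum_add]
  refine Finsupp.sum_congr fun i _ => Finsupp.sum_add_index' (by simp) fun j x y => ?_
  ring

theorem kerForm_smul_left (k : ι → κ → ℂ) (z : ℂ) (c : ι →₀ ℂ) (d : κ →₀ ℂ) :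
    kerForm k (z • c) d = starRingEnd ℂ z * kerForm k c d := by
  unfold kerForm
  rw [Finsupp.sum_smul_index' (by simp), Finsupp.mul_sum]
  refine Finsupp.sum_congr fun i _ => ?_
  rw [Finsupp.mul_sum]
  refine Finsupp.sum_congr fun j _ => ?_
  simp only [smul_eq_mul, map_mul]; ring

theorem kerForm_smul_right (k : ι → κ → ℂ) (z : ℂ) (c : ι →₀ ℂ) (d : κ →₀ ℂ) :
    kerForm k c (z • d) = z * kerForm k c d := by
  unfold kerForm
  rw [Finsupp.mul_sum]
  refine Finsupp.sum_congr fun i _ => ?_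
  rw [Finsupp.sum_smul_index' (by simp), Finsupp.mul_sum]
  refine Finsupp.sum_congr fun j _ => ?_
  simp only [smul_eq_mul]; ring

theorem kerForm_single (k : ι → κ → ℂ) (i : ι) (j : κ) :
    kerForm k (Finsupp.single i 1) (Finsupp.single j 1) = k i j := by
  simp [kerForm]

theorem kerForm_mapDomain (k : ι' → κ' → ℂ) (f : ι → ι') (g : κ → κ') (c : ι →₀ ℂ) (d : κ →₀ ℂ) :
    kerForm k (c.mapDomain f) (d.mapDomain g) = kerForm (fun i j => k (f i) (g j)) c d := by
  unfold kerForm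
  rw [Finsupp.sum_mapDomain_index (by simp)]
  · refine Finsupp.sum_congr fun i _ => ?_
    rw [Finsupp.sum_mapDomain_index (by simp)]
    intro j x y; ring
  · intro i x y
    rw [← Finsupp.sum_add]
    simp only [map_add, add_mul]

theorem kerForm_add (k k' : ι → κ → ℂ) (c : ι →₀ ℂ) (d : κ →₀ ℂ) :
    kerForm (fun i j => k i j + k' i j) c d = kerForm k c d + kerForm k' c d := by
  unfold kerForm
  rw [← Finsupp.sum_add]
  refine Finsupp.sum_congr fun i _ => ?_
  rw [← Finsupp.sum_add]
  refine Finsupp.sum_congr fun j _ => ?_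
  ring

theorem kerForm_const_mul (z : ℂ) (k : ι → κ → ℂ) (c : ι →₀ ℂ) (d : κ →₀ ℂ) :
    kerForm (fun i j => z * k i j) c d = z * kerForm k c d := by
  unfold kerForm
  rw [Finsupp.mul_sum]
  refine Finsupp.sum_congr fun i _ => ?_
  rw [Finsupp.mul_sum]
  refine Finsupp.sum_congr fun j _ => ?_
  ring

theorem kerForm_inner {E : Type*} [NormedAddCommGroup E] [InnerProductSpace ℂ E]
    (a : ι → E) (b : κ → E) (c : ι →₀ ℂ) (d : κ →₀ ℂ) :
    kerForm (fun i j => inner ℂ (a i) (b j)) c d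
      = inner ℂ (Finsupp.linearCombination ℂ a c) (Finsupp.linearCombination ℂ b d) := by
  simp only [kerForm, Finsupp.linearCombination_apply, Finsupp.sum, sum_inner]
  refine Finset.sum_congr rfl fun i _ => ?_
  simp only [inner_sum, inner_smul_left, inner_smul_right]
  refine Finset.sum_congr rfl fun j _ => ?_
  ring

/-- Positive semidefinite kernels. -/
def PosKernel (k : ι → ι → ℂ) : Prop := ∀ c : ι →₀ ℂ, 0 ≤ kerForm k c c

/-- Polarisation: the form is real on the diagonal, and its values at c + d and c + i d give the
imaginary and the real part of the identity. -/
theorem PosKernel.conj_symm {k : ι → ι → ℂ} (hk : PosKernel k) (c d : ι →₀ ℂ) :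
    starRingEnd ℂ (kerForm k d c) = kerForm k c d := by
  have h0 : ∀ c, (kerForm k c c).im = 0 := fun c => ((Complex.le_def.1 (hk c)).2).symm
  have h1 := h0 (c + d)
  have h2 := h0 (c + Complex.I • d)
  have e : kerForm k (c + Complex.I • d) (c + Complex.I • d)
      = kerForm k c c + Complex.I * (kerForm k c d - kerForm k d c) + kerForm k d d := by
    simp only [kerForm_add_left, kerForm_add_right, kerForm_smul_left, kerForm_smul_right,
      Complex.conj_I]
    linear_combination (-kerForm k d d) * Complex.I_mul_I
  rw [e] at h2
  simp only [kerForm_add_left, kerForm_add_right, Complex.add_im, Complex.mul_im, Complex.I_re,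
    Complex.I_im, Complex.sub_re, h0 c, h0 d] at h1 h2
  refine Complex.ext ?_ ?_
  · rw [Complex.conj_re]; linarith
  · rw [Complex.conj_im]; linarith

theorem PosKernel.cauchy_schwarz {k : ι → ι → ℂ} (hk : PosKernel k) (c d : ι →₀ ℂ) :
    ‖kerForm k c d‖ ^ 2 ≤ (kerForm k c c).re * (kerForm k d d).re := by
  let core : PreInnerProductSpace.Core ℂ (ι →₀ ℂ) :=
    { inner := kerForm k
      conj_inner_symm := fun c d => hk.conj_symm c d
      re_inner_nonneg := fun c => (Complex.le_def.1 (hk c)).1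
      add_left := kerForm_add_left k
      smul_left := fun c d z => kerForm_smul_left k z c d }
  have h := InnerProductSpace.Core.inner_mul_inner_self_le (𝕜 := ℂ) (F := ι →₀ ℂ) (c := core) c d
  change ‖kerForm k c d‖ * ‖kerForm k d c‖ ≤ (kerForm k c c).re * (kerForm k d d).re at h
  rw [← hk.conj_symm d c, RCLike.norm_conj, ← sq] at h
  exact h

variable {E F : Type*} [NormedAddCommGroup E] [InnerProductSpace ℂ E] [CompleteSpace E]
  [NormedAddCommGroup F] [InnerProductSpace ℂ F] [CompleteSpace F]

/-- A family of vectors is total if only the zero vector is orthogonal to it. -/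
def Total (a : ι → E) : Prop := ∀ x, (∀ i, inner ℂ (a i) x = 0) → x = 0

theorem Total.denseRange {a : ι → E} (ha : Total a) :
    DenseRange (Finsupp.linearCombination ℂ a) := by
  have h : (Submodule.span ℂ (Set.range a)).topologicalClosure = ⊤ := by
    rw [Submodule.topologicalClosure_eq_top_iff, Submodule.eq_bot_iff]
    intro x hx
    exact ha x fun i => (Submodule.mem_orthogonal _ _).1 hx _ (Submodule.subset_span ⟨i, rfl⟩)
  rw [← Finsupp.range_linearCombination, ← Submodule.dense_iff_topologicalClosure_eq_top] at h
  rwa [DenseRange, ← LinearMap.coe_range]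

theorem total_of_dense {a : ι → E}
    (h : Dense (Submodule.span ℂ (Set.range a) : Set E)) : Total a := by
  rw [Submodule.dense_iff_topologicalClosure_eq_top, Submodule.topologicalClosure_eq_top_iff] at h
  intro x hx
  rw [← Submodule.mem_bot ℂ, ← h, Submodule.mem_orthogonal]
  intro y hy
  induction hy using Submodule.span_induction with
  | mem y hy => obtain ⟨i, rfl⟩ := hy; exact hx i
  | zero => simp
  | add y z _ _ h1 h2 => rw [inner_add_left, h1, h2, add_zero]
  | smul c y _ h1 => rw [inner_smul_left, h1, mul_zero]

theorem Total.ext {X : Type*} [NormedAddCommGroup X] [NormedSpace ℂ X] {a : ι → E} (ha : Total a)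
    {S T : E →L[ℂ] X} (h : ∀ i, S (a i) = T (a i)) : S = T := by
  refine ContinuousLinearMap.ext fun x => ?_
  refine congrFun (ha.denseRange.equalizer S.continuous T.continuous (funext fun c => ?_)) x
  simp only [Function.comp_apply, Finsupp.linearCombination_apply, Finsupp.sum, map_sum, map_smul,
    h]

theorem Total.ext_inner {ι' : Type*} {a : ι → E} {b : ι' → F} (ha : Total a) (hb : Total b)
    {S T : E →L[ℂ] F} (h : ∀ i j, inner ℂ (b i) (S (a j)) = inner ℂ (b i) (T (a j))) : S = T :=
  ha.ext fun j => sub_eq_zero.1 (hb _ fun i => by rw [inner_sub_right, h, sub_self])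

/-- Equal Gram matrices give equal norms of finite linear combinations, so a i ↦ b i extends from a
dense subspace. Nothing is asked of the span of b, so the isometry need not be onto. -/
theorem exists_isometry {a : ι → E} {b : ι → F} (ha : Total a)
    (h : ∀ i j, inner ℂ (b i) (b j) = inner ℂ (a i) (a j)) :
    ∃ T : E →ₗᵢ[ℂ] F, ∀ i, T (a i) = b i := by
  have hn : ∀ c, ‖Finsupp.linearCombination ℂ b c‖ = ‖Finsupp.linearCombination ℂ a c‖ := by
    intro c
    rw [@norm_eq_sqrt_re_inner ℂ, @norm_eq_sqrt_re_inner ℂ, ← kerForm_inner, ← kerForm_inner]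
    simp only [h]
  let T := (Finsupp.linearCombination ℂ b).extendOfNorm (Finsupp.linearCombination ℂ a)
  have hT : ∀ c, T (Finsupp.linearCombination ℂ a c) = Finsupp.linearCombination ℂ b c := fun c =>
    LinearMap.extendOfNorm_eq ha.denseRange ⟨1, fun c => by rw [hn, one_mul]⟩ c
  refine ⟨⟨T.toLinearMap, fun x => ?_⟩, fun i => ?_⟩
  · refine congrFun (ha.denseRange.equalizer (g := fun x => ‖T x‖) (h := fun x => ‖x‖)
      (by fun_prop) (by fun_prop) (funext fun c => ?_)) x
    simp only [Function.comp_apply, hT, hn]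
  · have := hT (Finsupp.single i 1)
    simpa using this

/-- The bound lets the kernel descend to the dense span of a in each variable. The second variable
is extended first and represented by a Riesz vector; the dependence of that vector on the first
variable is then extended as well. -/
theorem exists_op {a : ι → E} (ha : Total a) (k : ι → ι → ℂ) {C : ℝ} (hC : 0 ≤ C)
    (h : ∀ c d, ‖kerForm k c d‖
      ≤ C * ‖Finsupp.linearCombination ℂ a c‖ * ‖Finsupp.linearCombination ℂ a d‖) :
    ∃ T : E →L[ℂ] E, ‖T‖ ≤ C ∧ ∀ i j, inner ℂ (a i) (T (a j)) = k i j := by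
  set A := Finsupp.linearCombination ℂ a with hA
  have hd : DenseRange A := ha.denseRange
  let φ : (ι →₀ ℂ) → ((ι →₀ ℂ) →ₗ[ℂ] ℂ) := fun d =>
    { toFun := kerForm k d
      map_add' := kerForm_add_right k d
      map_smul' := fun z c => kerForm_smul_right k z d c }
  have hφ : ∀ d c, ‖φ d c‖ ≤ C * ‖A d‖ * ‖A c‖ := fun d c => h d c
  let t : (ι →₀ ℂ) → E := fun d => (InnerProductSpace.toDual ℂ E).symm ((φ d).extendOfNorm A)
  have ht : ∀ d c, inner ℂ (t d) (A c) = kerForm k d c := fun d c => by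
    rw [InnerProductSpace.toDual_symm_apply]
    exact LinearMap.extendOfNorm_eq hd ⟨_, hφ d⟩ c
  have huniq : ∀ x y : E, (∀ c, inner ℂ x (A c) = inner ℂ y (A c)) → x = y := fun x y hxy =>
    ext_inner_right ℂ fun z => congrFun (hd.equalizer (g := fun z => inner ℂ x z)
      (h := fun z => inner ℂ y z) (by fun_prop) (by fun_prop) (funext hxy)) z
  let tl : (ι →₀ ℂ) →ₗ[ℂ] E :=
    { toFun := t
      map_add' := fun d d' => huniq _ _ fun c => by
        rw [inner_add_left, ht, ht, ht, kerForm_add_left]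
      map_smul' := fun z d => huniq _ _ fun c => by
        rw [RingHom.id_apply, inner_smul_left, ht, ht, kerForm_smul_left] }
  have hb : ∀ d, ‖tl d‖ ≤ C * ‖A d‖ := fun d => by
    change ‖(InnerProductSpace.toDual ℂ E).symm ((φ d).extendOfNorm A)‖ ≤ _
    rw [LinearIsometryEquiv.norm_map]
    exact LinearMap.opNorm_extendOfNorm_le hd (by positivity) (hφ d)
  -- The Riesz vectors stand on the left of the inner product, so the operator sought is the
  -- adjoint.
  refine ⟨ContinuousLinearMap.adjoint (tl.extendOfNorm A), ?_, fun i j => ?_⟩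
  · rw [LinearIsometryEquiv.norm_map]
    exact LinearMap.opNorm_extendOfNorm_le hd hC hb
  · rw [ContinuousLinearMap.adjoint_inner_right]
    have e : ∀ i, A (Finsupp.single i 1) = a i := fun i => by simp [hA]
    rw [← e i, LinearMap.extendOfNorm_eq hd ⟨C, hb⟩, ← e j]
    exact (ht _ _).trans (kerForm_single k i j)

end Kernels

/-! ### Monotone nets of operators -/

section Monotone

variable {E : Type*} [NormedAddCommGroup E] [InnerProductSpace ℂ E] [CompleteSpace E]

theorem op_le_iff {x y : E →L[ℂ] E} : x ≤ y ↔ ∀ η, 0 ≤ inner ℂ η ((y - x) η) := by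
  rw [ContinuousLinearMap.le_def]
  refine ⟨fun h η => h.inner_nonneg_right η, fun h => ?_⟩
  rw [ContinuousLinearMap.isPositive_iff_complex]
  intro η
  have h2 : 0 ≤ inner ℂ ((y - x) η) η := by
    rw [← inner_conj_symm, starRingEnd_apply]
    exact star_nonneg_iff.2 (h η)
  have h3 := Complex.le_def.1 h2
  exact ⟨Complex.ext (by simp) (by rw [← h3.2]; simp), h3.1⟩

theorem op_nonneg_iff {x : E →L[ℂ] E} : 0 ≤ x ↔ ∀ η, 0 ≤ inner ℂ η (x η) := by
  rw [op_le_iff]; simp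

theorem op_eq_of_inner_self {x y : E →L[ℂ] E} (h : ∀ η, inner ℂ η (x η) = inner ℂ η (y η)) :
    x = y := by
  have : (x : E →ₗ[ℂ] E) = y := by
    refine (ext_inner_map (x : E →ₗ[ℂ] E) (y : E →ₗ[ℂ] E)).1 fun η => ?_
    rw [← inner_conj_symm, ← inner_conj_symm (y.toLinearMap η)]
    exact congrArg _ (h η)
  exact ContinuousLinearMap.coe_injective this

end Monotone

/-! ### Weak limits of bounded increasing nets, and square roots -/

section Monotone

open scoped Topology

variable {E : Type*} [NormedAddCommGroup E] [InnerProductSpace ℂ E] [CompleteSpace E]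

theorem op_le_re {x y : E →L[ℂ] E} (h : x ≤ y) (η : E) :
    (inner ℂ η (x η)).re ≤ (inner ℂ η (y η)).re := by
  have := (Complex.le_def.1 (op_le_iff.1 h η)).1
  simpa [inner_sub_right] using this

/-- A bounded increasing net of selfadjoint operators converges weakly to its supremum. -/
theorem exists_weak_limit {D : Set (E →L[ℂ] E)} (hne : D.Nonempty) (hdir : DirectedOn (· ≤ ·) D)
    (hsa : ∀ x ∈ D, IsSelfAdjoint x) {s : E →L[ℂ] E} (hs : ∀ x ∈ D, x ≤ s) :
    ∃ T : E →L[ℂ] E, (∀ x ∈ D, x ≤ T) ∧ (∀ B, (∀ x ∈ D, x ≤ B) → T ≤ B) ∧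
      (∀ η, ∀ ε > (0 : ℝ), ∃ x ∈ D, (inner ℂ η ((T - x) η)).re < ε) ∧
      (∀ c, (∀ x ∈ D, c * x = x * c) → c * T = T * c) := by
  have : Nonempty D := hne.to_subtype
  have : IsDirectedOrder D := ⟨fun a b => by
    obtain ⟨z, hz, h1, h2⟩ := hdir a a.2 b b.2
    exact ⟨⟨z, hz⟩, h1, h2⟩⟩
  obtain ⟨x₀, hx₀⟩ := id hne
  have hreal : ∀ (x : D) η, inner ℂ (x.1 η) η = ((inner ℂ η (x.1 η)).re : ℂ) := fun x η => by
    have h : inner ℂ (x.1 η) η = inner ℂ η (x.1 η) := (hsa x x.2).isSymmetric η η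
    rw [h]
    refine (Complex.conj_eq_iff_re.1 ?_).symm
    rw [inner_conj_symm, h]
  -- The diagonal values form a bounded monotone net of real numbers; the other matrix entries
  -- follow by polarisation.
  have hq : ∀ η, ∃ l : ℂ, Tendsto (fun x : D => inner ℂ (x.1 η) η) atTop (𝓝 l) := fun η => by
    have hm : Monotone fun x : D => (inner ℂ η (x.1 η)).re := fun x y hxy => op_le_re hxy η
    have hb : BddAbove (Set.range fun x : D => (inner ℂ η (x.1 η)).re) :=
      ⟨(inner ℂ η (s η)).re, by rintro _ ⟨x, rfl⟩; exact op_le_re (hs x x.2) η⟩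
    simp only [hreal]
    exact ⟨_, (Complex.continuous_ofReal.tendsto _).comp (tendsto_atTop_ciSup hm hb)⟩
  choose q hq using hq
  have hlim : ∀ ξ η, ∃ l : ℂ, Tendsto (fun x : D => inner ℂ ξ (x.1 η)) atTop (𝓝 l) := fun ξ η => by
    have hpol : ∀ x : D, inner ℂ ξ (x.1 η)
        = (inner ℂ (x.1 (η + ξ)) (η + ξ) - inner ℂ (x.1 (η - ξ)) (η - ξ)
          + Complex.I * inner ℂ (x.1 (η + Complex.I • ξ)) (η + Complex.I • ξ)
          - Complex.I * inner ℂ (x.1 (η - Complex.I • ξ)) (η - Complex.I • ξ)) / 4 := fun x => by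
      have h : inner ℂ (x.1 ξ) η = inner ℂ ξ (x.1 η) := (hsa x x.2).isSymmetric ξ η
      rw [← h]
      exact inner_map_polarization (x.1 : E →ₗ[ℂ] E) η ξ
    simp only [hpol]
    exact ⟨_, ((((hq _).sub (hq _)).add ((hq _).const_mul _)).sub ((hq _).const_mul _)).div_const _⟩
  choose k hk using hlim
  -- The net need not be bounded below, but beyond x₀ one has 0 ≤ x - x₀ ≤ s - x₀, which bounds the
  -- norms and hence the limit kernel.
  have hbd : ∀ᶠ x : D in atTop, ‖x.1‖ ≤ ‖x₀‖ + ‖s - x₀‖ := by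
    filter_upwards [eventually_ge_atTop (⟨x₀, hx₀⟩ : D)] with x hx
    have h1 : 0 ≤ x.1 - x₀ := sub_nonneg.2 hx
    have h2 : ‖x.1 - x₀‖ ≤ ‖s - x₀‖ :=
      CStarAlgebra.norm_le_norm_of_nonneg_of_le h1 (sub_le_sub_right (hs x x.2) _)
    calc ‖x.1‖ = ‖x₀ + (x.1 - x₀)‖ := by rw [add_sub_cancel]
      _ ≤ _ := (norm_add_le _ _).trans (add_le_add_right h2 _)
  have htot : Total (id : E → E) := fun x hx => inner_self_eq_zero.1 (hx x)
  obtain ⟨T, -, hT⟩ := exists_op htot k (C := ‖x₀‖ + ‖s - x₀‖) (by positivity) fun c d => by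
    have ht : Tendsto (fun x : D => kerForm (fun i j => inner ℂ i (x.1 j)) c d) atTop
        (𝓝 (kerForm k c d)) :=
      tendsto_finsetSum _ fun i _ => tendsto_finsetSum _ fun j _ => (hk _ _).const_mul _
    refine le_of_tendsto ht.norm (hbd.mono fun x hx => ?_)
    have e : kerForm (fun i j => inner ℂ i (x.1 j)) c d
        = inner ℂ (Finsupp.linearCombination ℂ id c) (x.1 (Finsupp.linearCombination ℂ id d)) := by
      refine (kerForm_inner id (fun j => x.1 j) c d).trans (congrArg _ ?_)
      simp [Finsupp.linearCombination_apply, Finsupp.sum, map_sum]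
    rw [e]
    refine (norm_inner_le_norm _ _).trans ?_
    calc _ ≤ ‖Finsupp.linearCombination ℂ (id : E → E) c‖ *
          (‖x.1‖ * ‖Finsupp.linearCombination ℂ (id : E → E) d‖) := by
            gcongr; exact x.1.le_opNorm _
      _ ≤ ‖Finsupp.linearCombination ℂ (id : E → E) c‖ *
          ((‖x₀‖ + ‖s - x₀‖) * ‖Finsupp.linearCombination ℂ (id : E → E) d‖) := by gcongr
      _ = _ := by ring
  have hlimT : ∀ ξ η, Tendsto (fun x : D => inner ℂ ξ (x.1 η)) atTop (𝓝 (inner ℂ ξ (T η))) :=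
    fun ξ η => by have := hT ξ η; simp only [id] at this; rw [this]; exact hk ξ η
  refine ⟨T, fun x hx => op_le_iff.2 fun η => ?_, fun B hB => op_le_iff.2 fun η => ?_,
    fun η ε hε => ?_, fun c hc => ?_⟩
  · simp only [sub_apply, inner_sub_right]
    refine ge_of_tendsto ((hlimT η η).sub_const _) ?_
    filter_upwards [eventually_ge_atTop (⟨x, hx⟩ : D)] with y hy
    have := op_le_iff.1 (show x ≤ y.1 from hy) η
    simpa [inner_sub_right] using this
  · simp only [sub_apply, inner_sub_right]
    refine ge_of_tendsto ((hlimT η η).const_sub _) (Eventually.of_forall fun y => ?_)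
    have := op_le_iff.1 (hB y y.2) η
    simpa [inner_sub_right] using this
  · have h := ((Complex.continuous_re.tendsto _).comp ((hlimT η η).const_sub (inner ℂ η (T η))))
    simp only [sub_self, Complex.zero_re] at h
    obtain ⟨x, hx⟩ := (h.eventually (gt_mem_nhds hε)).exists
    exact ⟨x, x.2, by simpa [inner_sub_right] using hx⟩
  · refine ContinuousLinearMap.ext fun η => ext_inner_left ℂ fun ξ => ?_
    have h1 := hlimT (ContinuousLinearMap.adjoint c ξ) η
    have h2 := hlimT ξ (c η)
    simp only [ContinuousLinearMap.adjoint_inner_left] at h1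
    refine tendsto_nhds_unique h1 (h2.congr fun x => ?_)
    have := congrArg (fun f : E →L[ℂ] E => inner ℂ ξ (f η)) (hc x x.2)
    exact this.symm

theorem exists_approx_of_isLUB {D : Set (E →L[ℂ] E)} (hne : D.Nonempty)
    (hdir : DirectedOn (· ≤ ·) D) (hsa : ∀ x ∈ D, IsSelfAdjoint x) {s : E →L[ℂ] E}
    (hs : IsLUB D s) (η : E) {ε : ℝ} (hε : 0 < ε) :
    ∃ x ∈ D, (inner ℂ η ((s - x) η)).re < ε := by
  obtain ⟨T, h1, h2, h3, -⟩ := exists_weak_limit hne hdir hsa (fun x hx => hs.1 hx)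
  have : s = T := le_antisymm (hs.2 h1) (h2 _ hs.1)
  exact this ▸ h3 η ε hε

/-- The last clause keeps the root in any von Neumann algebra containing x and makes it commute with
every symmetry that commutes with x. -/
theorem exists_sqrt_op {x : E →L[ℂ] E} (hx : 0 ≤ x) :
    ∃ r : E →L[ℂ] E, star r = r ∧ r * r = x ∧ ∀ c, c * x = x * c → c * r = r * c := by
  refine ⟨CFC.sqrt x, (CFC.sqrt_nonneg x).isSelfAdjoint, CFC.sqrt_mul_sqrt_self x hx,
    fun c hc => ?_⟩
  have : Commute x c := hc.symm
  exact (this.cfcₙ_nnreal NNReal.sqrt).symm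

end Monotone

/-! ### Legs of Hilbert space tensor products -/

section Legs

variable {E E' F F' : Type*}
  [NormedAddCommGroup E] [InnerProductSpace ℂ E] [NormedAddCommGroup E'] [InnerProductSpace ℂ E']
  [NormedAddCommGroup F] [InnerProductSpace ℂ F] [NormedAddCommGroup F'] [InnerProductSpace ℂ F']

/-- The operator `f ↦ e ⊗ f`. -/
def leg (e : E) : F →L[ℂ] HilbertTensor E F :=
  toHilbert.toContinuousLinearMap ∘L TensorProduct.mkL ℂ E F e

theorem leg_apply (e : E) (f : F) : leg e f = toHilbert (e ⊗ₜ[ℂ] f) := rfl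

theorem inner_leg (e e' : E) (f f' : F) :
    inner ℂ (leg e f) (leg e' f') = inner ℂ e e' * inner ℂ f f' := by
  rw [leg_apply, leg_apply, LinearIsometry.inner_map_map, TensorProduct.inner_tmul]

theorem opTensor_leg (a : E →L[ℂ] E') (b : F →L[ℂ] F') (e : E) (f : F) :
    opTensor a b (leg e f) = leg (a e) (b f) := by
  rw [leg_apply, opTensor_toHilbert, leg_apply]; rfl

theorem total_leg : Total fun p : E × F => (leg p.1 p.2 : HilbertTensor E F) := by
  intro x hx
  have h : ∀ z, inner ℂ (toHilbert z) x = 0 := fun z => by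
    induction z with
    | zero => simp
    | add z w h1 h2 => rw [map_add, inner_add_left, h1, h2, add_zero]
    | tmul e f => exact hx (e, f)
  refine (inner_self_eq_zero (𝕜 := ℂ)).1 ?_
  exact congrFun (denseRange_toHilbert.equalizer (g := fun y => inner ℂ y x) (h := fun _ => (0 : ℂ))
    (by fun_prop) (by fun_prop) (funext h)) x

theorem hilbertTensor_ext_leg {X : Type*} [NormedAddCommGroup X] [InnerProductSpace ℂ X]
    {A B : HilbertTensor E F →L[ℂ] X} (h : ∀ e f, A (leg e f) = B (leg e f)) : A = B :=
  total_leg.ext fun p => h p.1 p.2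

theorem opTensor_add_left (a a' : E →L[ℂ] E') (b : F →L[ℂ] F') :
    opTensor (a + a') b = opTensor a b + opTensor a' b :=
  hilbertTensor_ext_leg fun e f => by
    simp only [opTensor_leg, add_apply]
    simp only [leg_apply, TensorProduct.add_tmul, map_add]

theorem opTensor_add_right (a : E →L[ℂ] E') (b b' : F →L[ℂ] F') :
    opTensor a (b + b') = opTensor a b + opTensor a b' :=
  hilbertTensor_ext_leg fun e f => by
    simp only [opTensor_leg, add_apply, map_add]

theorem opTensor_smul_left (c : ℂ) (a : E →L[ℂ] E') (b : F →L[ℂ] F') :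
    opTensor (c • a) b = c • opTensor a b :=
  hilbertTensor_ext_leg fun e f => by
    simp only [opTensor_leg, smul_apply]
    simp only [leg_apply, ← TensorProduct.smul_tmul', map_smul]

theorem opTensor_smul_right (c : ℂ) (a : E →L[ℂ] E') (b : F →L[ℂ] F') :
    opTensor a (c • b) = c • opTensor a b :=
  hilbertTensor_ext_leg fun e f => by
    simp only [opTensor_leg, smul_apply, map_smul]

theorem opTensor_one_injective [Nontrivial E] :
    Function.Injective fun b : F →L[ℂ] F' => opTensor (1 : E →L[ℂ] E) b := by
  intro b b' h
  obtain ⟨e, he⟩ := exists_ne (0 : E)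
  refine ContinuousLinearMap.ext fun f => ext_inner_left ℂ fun f' => ?_
  have := congrArg (fun T : HilbertTensor E F →L[ℂ] HilbertTensor E F' =>
    inner ℂ (leg e f') (T (leg e f))) h
  simp only [opTensor_leg, one_apply_eq_self, inner_leg] at this
  exact mul_left_cancel₀ (inner_self_ne_zero.2 he) this

variable [CompleteSpace E] [CompleteSpace F]

theorem adjoint_leg (e e' : E) (f : F) :
    ContinuousLinearMap.adjoint (leg e) (leg e' f) = inner ℂ e e' • f :=
  ext_inner_left ℂ fun f' => by
    rw [ContinuousLinearMap.adjoint_inner_right, inner_leg, inner_smul_right]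

theorem leg_comp_adjoint_leg (e e' : E) (T : F →L[ℂ] F) :
    leg e ∘L T ∘L ContinuousLinearMap.adjoint (leg e')
      = opTensor (InnerProductSpace.rankOne ℂ e e') T :=
  hilbertTensor_ext_leg fun x f => by
    simp only [ContinuousLinearMap.comp_apply, adjoint_leg, opTensor_leg, map_smul,
      InnerProductSpace.rankOne_apply]
    simp only [leg_apply, ← TensorProduct.smul_tmul', map_smul]

/-- The commutant of L(E) ⊗ 1 is 1 ⊗ L(F). The rank-one operator |x⟩⟨e| moves e ⊗ f to x ⊗ f, so T
is determined by its compression to e ⊗ F. -/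
theorem eq_opTensor_one_of_commute {T : HilbertTensor E F →L[ℂ] HilbertTensor E F}
    (h : ∀ b : E →L[ℂ] E, T * opTensor b 1 = opTensor b 1 * T) {e : E} (he : ‖e‖ = 1) :
    T = opTensor 1 (ContinuousLinearMap.adjoint (leg e) ∘L T ∘L leg e) :=
  hilbertTensor_ext_leg fun x f => by
    have hx : leg x f = opTensor (InnerProductSpace.rankOne ℂ x e) (1 : F →L[ℂ] F) (leg e f) := by
      simp [opTensor_leg, InnerProductSpace.rankOne_apply, inner_self_eq_norm_sq_to_K, he]
    have h1 := congrArg (fun S : HilbertTensor E F →L[ℂ] HilbertTensor E F => S (leg e f))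
      (h (InnerProductSpace.rankOne ℂ x e))
    simp only [mul_apply_eq_comp] at h1
    conv_lhs => rw [hx]
    rw [h1, ← leg_comp_adjoint_leg, opTensor_leg]
    rfl

theorem opTensor_adjoint_right {F' : Type*} [NormedAddCommGroup F'] [InnerProductSpace ℂ F']
    [CompleteSpace F'] (Z : F →L[ℂ] F') :
    ContinuousLinearMap.adjoint (opTensor (1 : E →L[ℂ] E) Z)
      = opTensor 1 (ContinuousLinearMap.adjoint Z) := by
  rw [eq_comm, ContinuousLinearMap.eq_adjoint_iff]
  have : ∀ y, ContinuousLinearMap.adjoint (opTensor (1 : E →L[ℂ] E) Z) y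
      = opTensor 1 (ContinuousLinearMap.adjoint Z) y := fun y => by
    refine congrArg (fun T : HilbertTensor E F' →L[ℂ] HilbertTensor E F => T y) ?_
    refine Total.ext_inner total_leg total_leg fun p q => ?_
    simp only [ContinuousLinearMap.adjoint_inner_right, opTensor_leg, inner_leg,
      one_apply_eq_self]
  intro x y
  rw [← this, ContinuousLinearMap.adjoint_inner_left]

end Legs

/-! ### `σ`-strong density and totality -/

section SigmaStrong

variable {H H' : Type*} [NormedAddCommGroup H] [InnerProductSpace ℂ H] [CompleteSpace H]
  [NormedAddCommGroup H'] [InnerProductSpace ℂ H'] [CompleteSpace H']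

/-- If y is orthogonal to all the vectors, then ‖y - aξ‖² = ‖y‖² + ‖aξ‖² for every a in the span.
Testing density at the rank-one operator |y⟩⟨ξ| and the sequence (ξ, 0, 0, …) with ε = ‖y‖² gives a
contradiction. -/
theorem SigmaStronglyDense.total {ι : Type*} {x : ι → (H →L[ℂ] H')}
    (h : SigmaStronglyDense (Submodule.span ℂ (Set.range x))) [Nontrivial H] :
    Total fun p : ι × H => x p.1 p.2 := by
  obtain ⟨ξ, hξ⟩ := exists_norm_eq H (zero_le_one (α := ℝ))
  intro y hy
  have hz : ∀ a ∈ Submodule.span ℂ (Set.range x), ∀ η, inner ℂ (a η) y = 0 := by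
    intro a ha η
    induction ha using Submodule.span_induction with
    | mem a ha => obtain ⟨i, rfl⟩ := ha; exact hy (i, η)
    | zero => simp
    | add a b _ _ h1 h2 => rw [add_apply, inner_add_left, h1, h2, add_zero]
    | smul c a _ h1 => rw [smul_apply, inner_smul_left, h1, mul_zero]
  by_contra hne
  have hpos : 0 < ‖y‖ ^ 2 := by positivity
  let ζ : ℕ → H := fun j => if j = 0 then ξ else 0
  obtain ⟨a, ha, hlt⟩ := h (InnerProductSpace.rankOne ℂ y ξ) ζ
    (summable_of_ne_finset_zero (s := {0}) fun j hj => by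
      have : j ≠ 0 := by simpa using hj
      simp [ζ, this]) _ hpos
  rw [tsum_eq_single 0 (fun j hj => by simp [ζ, hj])] at hlt
  have e : (InnerProductSpace.rankOne ℂ y ξ - a) (ζ 0) = y - a ξ := by
    simp [ζ, InnerProductSpace.rankOne_apply, inner_self_eq_norm_sq_to_K, hξ]
  rw [e, @norm_sub_sq ℂ, ← inner_conj_symm, hz a ha] at hlt
  simp only [map_zero, mul_zero, sub_zero] at hlt
  nlinarith [sq_nonneg ‖a ξ‖]

/-- Stability under right multiplication puts |z⟩⟨e| into the span for every e and a dense set of z.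
Finitely many of these approximate the finite-rank operator m P_F in norm. -/
theorem exists_mem_span_norm_sub_comp_starProjection_le {ι : Type*} {x : ι → (H →L[ℂ] H')}
    (hr : ∀ i (b : H →L[ℂ] H), ∃ j, x i ∘L b = x j) (h : Total fun p : ι × H => x p.1 p.2)
    (m : H →L[ℂ] H') (F : Submodule ℂ H) [FiniteDimensional ℂ F] {η : ℝ} (hη : 0 < η) :
    ∃ a ∈ Submodule.span ℂ (Set.range x), ‖a - m ∘L F.starProjection‖ ≤ η := by
  let b := stdOrthonormalBasis ℂ F
  have hN : ∀ (y : H') (e : H) (δ : ℝ), 0 < δ → ∃ z : H', ‖z - y‖ < δ ∧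
      InnerProductSpace.rankOne ℂ z e ∈ Submodule.span ℂ (Set.range x) := by
    intro y e δ hδ
    obtain ⟨c, hc⟩ := h.denseRange.exists_dist_lt y hδ
    refine ⟨_, by rwa [dist_comm, dist_eq_norm] at hc, ?_⟩
    simp only [Finsupp.linearCombination_apply, Finsupp.sum, map_sum, map_smul,
      sum_apply, smul_apply]
    refine Submodule.sum_mem _ fun p _ => Submodule.smul_mem _ _ ?_
    obtain ⟨j, hj⟩ := hr p.1 (InnerProductSpace.rankOne ℂ p.2 e)
    refine Submodule.subset_span ⟨j, ?_⟩
    rw [← hj]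
    ext1 y
    simp [InnerProductSpace.rankOne_apply]
  -- The summand 1 keeps d positive when F is zero.
  set d : ℝ := Module.finrank ℂ F + 1 with hd
  have hd0 : 0 < d := by positivity
  choose z hz hzM using fun i => hN (m (b i : H)) (b i : H) (η / d) (by positivity)
  refine ⟨∑ i, InnerProductSpace.rankOne ℂ (z i) (b i : H),
    Submodule.sum_mem _ fun i _ => hzM i, ?_⟩
  have e : ∑ i, InnerProductSpace.rankOne ℂ (z i) (b i : H) - m ∘L F.starProjection
      = ∑ i, InnerProductSpace.rankOne ℂ (z i - m (b i : H)) (b i : H) := by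
    ext1 y
    have hp : F.starProjection y = ∑ i, inner ℂ (b i : H) y • (b i : H) := by
      rw [b.starProjection_eq_sum_rankOne]
      simp [InnerProductSpace.rankOne_apply]
    simp only [sub_apply, sum_apply, ContinuousLinearMap.comp_apply, hp,
      InnerProductSpace.rankOne_apply, map_sum, map_smul, smul_sub, Finset.sum_sub_distrib]
  rw [e]
  calc _ ≤ ∑ i : Fin (Module.finrank ℂ F), η / d := by
        refine norm_sum_le_of_le _ fun i _ => ?_
        rw [InnerProductSpace.norm_rankOne]
        have : ‖(b i : H)‖ = 1 := b.orthonormal.1 i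
        rw [this, mul_one]
        exact (hz i).le
    _ = (Module.finrank ℂ F : ℝ) * (η / d) := by simp
    _ ≤ d * (η / d) := by gcongr; linarith
    _ = η := by field_simp

/-- On the span F of the first N vectors of the sequence, a is norm-close to m; the tail is small
because m - a is bounded independently of N. -/
theorem sigmaStronglyDense_of_total {ι : Type*} {x : ι → (H →L[ℂ] H')}
    (hr : ∀ i (b : H →L[ℂ] H), ∃ j, x i ∘L b = x j)
    (h : Total fun p : ι × H => x p.1 p.2) :
    SigmaStronglyDense (Submodule.span ℂ (Set.range x)) := by
  intro m ξ hξ ε hε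
  set S := ∑' j, ‖ξ j‖ ^ 2 with hS
  have hS0 : 0 ≤ S := tsum_nonneg fun j => by positivity
  -- This bounds ‖m - a‖: the part m - m P_F contributes at most 2‖m‖, and a - m P_F at most η ≤ 1.
  -- Head and tail of the sum are each allotted ε/2.
  set C : ℝ := 2 * ‖m‖ + 1 with hC
  have hC0 : 0 < C := by positivity
  obtain ⟨N, hN⟩ := ((tendsto_sum_nat_add fun j => ‖ξ j‖ ^ 2).eventually
    (gt_mem_nhds (show 0 < ε / (2 * C ^ 2) by positivity))).exists
  let F : Submodule ℂ H := Submodule.span ℂ (ξ '' ↑(Finset.range N))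
  have : FiniteDimensional ℂ F :=
    FiniteDimensional.span_of_finite ℂ ((Finset.finite_toSet _).image ξ)
  obtain ⟨η, hη0, hη1, hηS⟩ : ∃ η : ℝ, 0 < η ∧ η ≤ 1 ∧ η ^ 2 * S < ε / 2 := by
    refine ⟨min 1 (ε / (4 * (S + 1))), by positivity, min_le_left _ _, ?_⟩
    set η := min 1 (ε / (4 * (S + 1)))
    have h1 : η ≤ 1 := min_le_left _ _
    have h2 : η ≤ ε / (4 * (S + 1)) := min_le_right _ _
    have h0 : 0 < η := by positivity
    have h3 : η ^ 2 ≤ η := by nlinarith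
    calc η ^ 2 * S ≤ η * (S + 1) := mul_le_mul h3 (by linarith) hS0 h0.le
      _ ≤ ε / (4 * (S + 1)) * (S + 1) := by gcongr
      _ = ε / 4 := by field_simp
      _ < ε / 2 := by linarith
  obtain ⟨a, ha, hle⟩ := exists_mem_span_norm_sub_comp_starProjection_le hr h m F hη0
  refine ⟨a, ha, ?_⟩
  have h1 : ∀ y ∈ F, ‖(m - a) y‖ ≤ η * ‖y‖ := fun y hy => by
    have e : (m - a) y = -((a - m ∘L F.starProjection) y) := by
      simp [Submodule.starProjection_eq_self_iff.2 hy]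
    rw [e, norm_neg]
    exact (ContinuousLinearMap.le_opNorm _ _).trans (by gcongr)
  have h2 : ∀ y, ‖(m - a) y‖ ≤ C * ‖y‖ := fun y => by
    have e : (m - a) y = m y - m (F.starProjection y) - (a - m ∘L F.starProjection) y := by
      simp
    have hp : ‖F.starProjection y‖ ≤ ‖y‖ := by
      refine (ContinuousLinearMap.le_opNorm _ _).trans ?_
      exact (mul_le_mul_of_nonneg_right F.starProjection_norm_le (norm_nonneg _)).trans
        (one_mul _).le
    rw [e]
    calc _ ≤ ‖m y‖ + ‖m (F.starProjection y)‖ + ‖(a - m ∘L F.starProjection) y‖ :=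
          (norm_sub_le _ _).trans (add_le_add_left (norm_sub_le _ _) _)
      _ ≤ ‖m‖ * ‖y‖ + ‖m‖ * ‖y‖ + 1 * ‖y‖ := by
          refine add_le_add (add_le_add (m.le_opNorm _) ((m.le_opNorm _).trans (by gcongr))) ?_
          exact (ContinuousLinearMap.le_opNorm _ _).trans (by gcongr; exact hle.trans hη1)
      _ = C * ‖y‖ := by rw [hC]; ring
  have hsum : Summable fun j => ‖(m - a) (ξ j)‖ ^ 2 := by
    refine Summable.of_nonneg_of_le (fun j => by positivity) (fun j => ?_) (hξ.mul_left (C ^ 2))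
    rw [← mul_pow]
    exact pow_le_pow_left₀ (norm_nonneg _) (h2 _) 2
  rw [← hsum.sum_add_tsum_nat_add N]
  have hA : ∑ j ∈ Finset.range N, ‖(m - a) (ξ j)‖ ^ 2 ≤ η ^ 2 * S := by
    calc _ ≤ ∑ j ∈ Finset.range N, η ^ 2 * ‖ξ j‖ ^ 2 := by
          refine Finset.sum_le_sum fun j hj => ?_
          rw [← mul_pow]
          exact pow_le_pow_left₀ (norm_nonneg _)
            (h1 _ (Submodule.subset_span ⟨j, Finset.mem_coe.2 hj, rfl⟩)) 2
      _ = η ^ 2 * ∑ j ∈ Finset.range N, ‖ξ j‖ ^ 2 := by rw [Finset.mul_sum]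
      _ ≤ _ := by
          gcongr
          exact hξ.sum_le_tsum _ fun j _ => by positivity
  have hB : ∑' j, ‖(m - a) (ξ (j + N))‖ ^ 2 ≤ C ^ 2 * (ε / (2 * C ^ 2)) := by
    have hs1 := (summable_nat_add_iff N).2 hsum
    have hs2 := (summable_nat_add_iff N).2 hξ
    calc _ ≤ ∑' j, C ^ 2 * ‖ξ (j + N)‖ ^ 2 := by
          refine hs1.tsum_le_tsum (fun j => ?_) (hs2.mul_left _)
          rw [← mul_pow]
          exact pow_le_pow_left₀ (norm_nonneg _) (h2 _) 2
      _ = C ^ 2 * ∑' j, ‖ξ (j + N)‖ ^ 2 := tsum_mul_left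
      _ ≤ _ := by gcongr
  have hC2 : C ^ 2 * (ε / (2 * C ^ 2)) = ε / 2 := by field_simp
  linarith

end SigmaStrong

/-! ### The algebra `L^∞(ν)` and its multiplication operators -/

section Linfty

variable {Ω : Type*} [MeasurableSpace Ω] {ν : Measure Ω}

theorem linfty_ae_le_norm (f : Lp ℂ ∞ ν) : ∀ᵐ ω ∂ν, ‖f ω‖ ≤ ‖f‖ := by
  filter_upwards [enorm_ae_le_eLpNormEssSup f ν] with ω hω
  rw [Lp.norm_def, eLpNorm_exponent_top, ← toReal_enorm]
  refine ENNReal.toReal_mono ?_ hω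
  rw [← eLpNorm_exponent_top]; exact Lp.eLpNorm_ne_top f

theorem linfty_norm_le {f : Lp ℂ ∞ ν} {C : ℝ} (hC : 0 ≤ C) (h : ∀ᵐ ω ∂ν, ‖f ω‖ ≤ C) :
    ‖f‖ ≤ C := by
  rw [Lp.norm_def, eLpNorm_exponent_top]
  refine ENNReal.toReal_le_of_le_ofReal hC (eLpNormEssSup_le_of_ae_bound h)

/-- The product in `L^∞(ν)`. -/
def linftyMul (f g : Lp ℂ ∞ ν) : Lp ℂ ∞ ν :=
  (ContinuousLinearMap.mul ℂ ℂ).holder ∞ f g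

theorem linftyMul_coeFn (f g : Lp ℂ ∞ ν) : ∀ᵐ ω ∂ν, linftyMul f g ω = f ω * g ω := by
  filter_upwards [ContinuousLinearMap.coeFn_holder (r := ∞) (ContinuousLinearMap.mul ℂ ℂ) f g]
    with ω h
  exact h

theorem linftyStar_coeFn (f : Lp ℂ ∞ ν) : ∀ᵐ ω ∂ν, (star f : Lp ℂ ∞ ν) ω = starRingEnd ℂ (f ω) :=
  Lp.coeFn_star f

theorem linftyOne_coeFn : ∀ᵐ ω ∂ν, linftyOne ν ω = 1 := MemLp.coeFn_toLp _

theorem linftyMul_comm (f g : Lp ℂ ∞ ν) : linftyMul f g = linftyMul g f := by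
  refine Lp.ext ?_
  filter_upwards [linftyMul_coeFn f g, linftyMul_coeFn g f] with ω h1 h2
  rw [h1, h2, mul_comm]

theorem linftyMul_one (f : Lp ℂ ∞ ν) : linftyMul f (linftyOne ν) = f := by
  refine Lp.ext ?_
  filter_upwards [linftyMul_coeFn f (linftyOne ν), linftyOne_coeFn] with ω h1 h2
  rw [h1, h2, mul_one]

theorem linftyOne_mul (f : Lp ℂ ∞ ν) : linftyMul (linftyOne ν) f = f := by
  rw [linftyMul_comm, linftyMul_one]

theorem linftyStar_one : star (linftyOne ν) = linftyOne ν := by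
  refine Lp.ext ?_
  filter_upwards [linftyStar_coeFn (linftyOne ν), linftyOne_coeFn] with ω h1 h2
  rw [h1, h2, map_one]

/-- The class of an almost everywhere bounded function. -/
def linftyMk (f : Ω → ℂ) (hf : AEStronglyMeasurable f ν) (C : ℝ) (hC : ∀ᵐ ω ∂ν, ‖f ω‖ ≤ C) :
    Lp ℂ ∞ ν := (memLp_top_of_bound hf C hC).toLp f

theorem linftyMk_coeFn {f : Ω → ℂ} (hf : AEStronglyMeasurable f ν) {C : ℝ}
    (hC : ∀ᵐ ω ∂ν, ‖f ω‖ ≤ C) : linftyMk f hf C hC =ᵐ[ν] f := MemLp.coeFn_toLp _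

/-- The indicator function of a measurable set as an element of `L^∞(ν)`. -/
def linftyInd (ν : Measure Ω) {X : Set Ω} (hX : MeasurableSet X) : Lp ℂ ∞ ν :=
  linftyMk (X.indicator fun _ => 1) (aestronglyMeasurable_const.indicator hX) 1
    (Eventually.of_forall fun ω => by by_cases h : ω ∈ X <;> simp [h])

theorem linftyInd_coeFn {X : Set Ω} (hX : MeasurableSet X) :
    linftyInd ν hX =ᵐ[ν] X.indicator fun _ => 1 := linftyMk_coeFn _ _

/-! ### Multiplication operators on L²(ν; E) as a *-representation of L^∞(ν) -/

section MulOp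

variable {E : Type*} [NormedAddCommGroup E] [InnerProductSpace ℂ E]

theorem mulOp_mul (f g : Lp ℂ ∞ ν) : mulOp E ν f * mulOp E ν g = mulOp E ν (linftyMul f g) := by
  ext1 ψ
  refine Lp.ext ?_
  filter_upwards [mulOp_coeFn f (mulOp E ν g ψ), mulOp_coeFn g ψ, mulOp_coeFn (linftyMul f g) ψ,
    linftyMul_coeFn f g] with ω h1 h2 h3 h4
  rw [mul_apply_eq_comp, h1, h2, h3, h4, mul_smul]

theorem mulOp_add (f g : Lp ℂ ∞ ν) : mulOp E ν (f + g) = mulOp E ν f + mulOp E ν g :=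
  map_add _ f g

theorem mulOp_smul (c : ℂ) (f : Lp ℂ ∞ ν) : mulOp E ν (c • f) = c • mulOp E ν f :=
  map_smul _ c f

theorem mulOp_one : mulOp E ν (linftyOne ν) = 1 := by
  ext1 ψ
  refine Lp.ext ?_
  filter_upwards [mulOp_coeFn (linftyOne ν) ψ, linftyOne_coeFn] with ω h1 h2
  rw [h1, h2, one_smul, one_apply_eq_self]

theorem inner_mulOp_left (f : Lp ℂ ∞ ν) (ψ φ : Lp E 2 ν) :
    inner ℂ (mulOp E ν f ψ) φ = inner ℂ ψ (mulOp E ν (star f) φ) := by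
  rw [L2.inner_def, L2.inner_def]
  refine integral_congr_ae ?_
  filter_upwards [mulOp_coeFn f ψ, mulOp_coeFn (star f) φ, linftyStar_coeFn f] with ω h1 h2 h3
  rw [h1, h2, h3, inner_smul_left, inner_smul_right]

theorem mulOp_star [CompleteSpace E] (f : Lp ℂ ∞ ν) : star (mulOp E ν f) = mulOp E ν (star f) := by
  rw [ContinuousLinearMap.star_eq_adjoint, eq_comm, ContinuousLinearMap.eq_adjoint_iff]
  intro ψ φ
  rw [inner_mulOp_left, star_star]

end MulOp

/-! ### The same representation on the direct integral -/

section DiagOp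

variable {n : Ω → ℕ∞}

theorem coe_diagOp (f : Lp ℂ ∞ ν) (ψ : DirectIntegral ν n) :
    (diagOp f ψ : Lp Ell2 2 ν) = mulOp Ell2 ν f ψ := rfl

theorem diagOp_mul (f g : Lp ℂ ∞ ν) :
    (diagOp f * diagOp g : DirectIntegral ν n →L[ℂ] DirectIntegral ν n)
      = diagOp (linftyMul f g) := by
  ext1 ψ
  refine Subtype.ext ?_
  rw [coe_diagOp, ← mulOp_mul]
  rfl

theorem diagOp_one :
    (diagOp (linftyOne ν) : DirectIntegral ν n →L[ℂ] DirectIntegral ν n) = 1 := by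
  ext1 ψ
  refine Subtype.ext ?_
  rw [coe_diagOp, mulOp_one]
  rfl

theorem diagOp_star (f : Lp ℂ ∞ ν) :
    star (diagOp f : DirectIntegral ν n →L[ℂ] DirectIntegral ν n) = diagOp (star f) := by
  rw [ContinuousLinearMap.star_eq_adjoint, eq_comm, ContinuousLinearMap.eq_adjoint_iff]
  intro ψ φ
  have := inner_mulOp_left (star f) (ψ : Lp Ell2 2 ν) φ
  rw [star_star] at this
  exact this

end DiagOp

end Linfty

/-! ### The algebra `L(K) ⊗ L^∞(ν)` -/

section Algebra

variable {K : Type*} [NormedAddCommGroup K] [InnerProductSpace ℂ K] [CompleteSpace K]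
variable {Ω : Type*} [MeasurableSpace Ω] {ν : Measure Ω}

theorem elem_mul (b b' : K →L[ℂ] K) (f f' : Lp ℂ ∞ ν) :
    elem b f * elem b' f' = elem (b * b') (linftyMul f f') :=
  Subtype.ext ((opTensor_mul _ _ _ _).trans (by rw [mulOp_mul]; rfl))

theorem star_elem (b : K →L[ℂ] K) (f : Lp ℂ ∞ ν) :
    star (elem b f) = elem (star b) (star f) :=
  Subtype.ext ((opTensor_star _ _).trans (by rw [mulOp_star]; rfl))

theorem elem_one : elem (1 : K →L[ℂ] K) (linftyOne ν) = 1 :=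
  Subtype.ext (by change opTensor _ _ = _; rw [mulOp_one, opTensor_one]; rfl)

theorem elem_add_left (b b' : K →L[ℂ] K) (f : Lp ℂ ∞ ν) :
    elem (b + b') f = elem b f + elem b' f := Subtype.ext (opTensor_add_left _ _ _)

theorem elem_add_right (b : K →L[ℂ] K) (f f' : Lp ℂ ∞ ν) :
    elem b (f + f') = elem b f + elem b f' :=
  Subtype.ext (by change opTensor _ _ = _; rw [mulOp_add, opTensor_add_right]; rfl)

theorem elem_smul_right (c : ℂ) (b : K →L[ℂ] K) (f : Lp ℂ ∞ ν) :
    elem b (c • f) = c • elem b f :=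
  Subtype.ext (by change opTensor _ _ = _; rw [mulOp_smul, opTensor_smul_right]; rfl)

theorem instrAlg_le_iff {x y : InstrAlg K ν} : x ≤ y ↔ x.1 ≤ y.1 := Iff.rfl

theorem exists_sqrt {x : InstrAlg K ν} (hx : 0 ≤ x) :
    ∃ r : InstrAlg K ν, star r = r ∧ r * r = x := by
  obtain ⟨r, h1, h2, h3⟩ := exists_sqrt_op (x := x.1) hx
  refine ⟨⟨r, (mem_instrVN_iff r).2 fun c hc => h3 c ((mem_instrVN_iff x.1).1 x.2 c hc)⟩,
    Subtype.ext h1, Subtype.ext h2⟩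

theorem star_mul_self_nonneg' (x : InstrAlg K ν) : 0 ≤ star x * x :=
  show (0 : _ →L[ℂ] _) ≤ star x.1 * x.1 from star_mul_self_nonneg _

/-- Writing ‖x‖² - x^*x as r^*r inside the algebra lets complete positivity alone bound the
operators built from x. -/
theorem exists_sub_eq_star_mul_self (x : InstrAlg K ν) :
    ∃ r : InstrAlg K ν, ((‖x.1‖ ^ 2 : ℝ) : ℂ) • 1 - star x * x = star r * r := by
  have h : (0 : InstrAlg K ν) ≤ ((‖x.1‖ ^ 2 : ℝ) : ℂ) • 1 - star x * x := by
    rw [instrAlg_le_iff, op_le_iff]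
    intro η
    have e : inner ℂ η (((((‖x.1‖ ^ 2 : ℝ) : ℂ) • 1 - star x * x : InstrAlg K ν).1
        - (0 : InstrAlg K ν).1) η) = ((‖x.1‖ ^ 2 * ‖η‖ ^ 2 - ‖x.1 η‖ ^ 2 : ℝ) : ℂ) := by
      change inner ℂ η ((((‖x.1‖ ^ 2 : ℝ) : ℂ) • 
        (1 : HilbertTensor K (Lp ℂ 2 ν) →L[ℂ] HilbertTensor K (Lp ℂ 2 ν))
        - star x.1 * x.1 - 0) η) = _
      simp only [sub_zero, sub_apply, smul_apply, one_apply_eq_self, mul_apply_eq_comp,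
        inner_sub_right, inner_smul_right, ContinuousLinearMap.star_eq_adjoint,
        ContinuousLinearMap.adjoint_inner_right, inner_self_eq_norm_sq_to_K]
      push_cast
      rfl
    rw [e, Complex.zero_le_real, sub_nonneg, ← mul_pow]
    exact pow_le_pow_left₀ (norm_nonneg _) (x.1.le_opNorm η) 2
  obtain ⟨r, h1, h2⟩ := exists_sqrt h
  exact ⟨r, by rw [h1, h2]⟩

/-- Suprema of increasing nets in `L(K) ⊗ L^∞(ν)` are weak limits. -/
theorem exists_approx_of_isLUB_instrAlg {D : Set (InstrAlg K ν)} (hne : D.Nonempty)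
    (hdir : DirectedOn (· ≤ ·) D) (hsa : ∀ x ∈ D, IsSelfAdjoint x) {s : InstrAlg K ν}
    (hs : IsLUB D s) (η : HilbertTensor K (Lp ℂ 2 ν)) {ε : ℝ} (hε : 0 < ε) :
    ∃ x ∈ D, (inner ℂ η ((s - x).1 η)).re < ε := by
  have hdir' : DirectedOn (· ≤ ·) (Subtype.val '' D) := by
    rintro _ ⟨x, hx, rfl⟩ _ ⟨y, hy, rfl⟩
    obtain ⟨z, hz, h1, h2⟩ := hdir x hx y hy
    exact ⟨z.1, ⟨z, hz, rfl⟩, h1, h2⟩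
  obtain ⟨T, h1, h2, h3, h4⟩ := exists_weak_limit (hne.image _) hdir'
    (by rintro _ ⟨x, hx, rfl⟩; exact congrArg Subtype.val (hsa x hx)) (s := s.1)
    (by rintro _ ⟨x, hx, rfl⟩; exact hs.1 hx)
  -- Weak limits keep commutation relations, so the limit lies in the algebra and equals the
  -- supremum taken inside the algebra.
  let t : InstrAlg K ν := ⟨T, (mem_instrVN_iff T).2 fun c hc => h4 c (by
    rintro _ ⟨x, _, rfl⟩
    exact (mem_instrVN_iff x.1).1 x.2 c hc)⟩
  have hst : s = t := le_antisymm (hs.2 fun x hx => h1 x.1 ⟨x, hx, rfl⟩)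
    (h2 s.1 (by rintro _ ⟨x, hx, rfl⟩; exact hs.1 hx))
  obtain ⟨_, ⟨x, hx, rfl⟩, hlt⟩ := h3 η ε hε
  exact ⟨x, hx, by rw [hst]; exact hlt⟩

theorem isLUB_of_approx {D : Set (InstrAlg K ν)} {s : InstrAlg K ν} (hub : ∀ x ∈ D, x ≤ s)
    (h : ∀ η, ∀ ε > (0 : ℝ), ∃ x ∈ D, (inner ℂ η ((s - x).1 η)).re < ε) : IsLUB D s := by
  refine ⟨hub, fun B hB => ?_⟩
  rw [instrAlg_le_iff, op_le_iff]
  intro η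
  have key : ∀ x ∈ D, inner ℂ η ((B.1 - s.1) η)
      = inner ℂ η ((B.1 - x.1) η) - inner ℂ η ((s.1 - x.1) η) := fun x _ => by
    rw [← inner_sub_right, ← sub_apply, sub_sub_sub_cancel_right]
  have p1 : ∀ x ∈ D, 0 ≤ inner ℂ η ((B.1 - x.1) η) := fun x hx => op_le_iff.1 (hB hx) η
  have p2 : ∀ x ∈ D, 0 ≤ inner ℂ η ((s.1 - x.1) η) := fun x hx => op_le_iff.1 (hub x hx) η
  rw [Complex.le_def]
  constructor
  · refine le_of_forall_pos_le_add fun ε hε => ?_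
    obtain ⟨x, hx, hlt⟩ := h η ε hε
    have hlt' : (inner ℂ η ((s.1 - x.1) η)).re < ε := hlt
    have := (Complex.le_def.1 (p1 x hx)).1
    rw [key x hx, Complex.sub_re]
    simp only [Complex.zero_re] at *
    linarith
  · obtain ⟨x, hx, -⟩ := h η 1 one_pos
    rw [key x hx, Complex.sub_im, ← (Complex.le_def.1 (p1 x hx)).2,
      ← (Complex.le_def.1 (p2 x hx)).2]
    simp

/-- Suprema are weak limits, and the vector state at η of y^*xy is the vector state at yη of x. -/
theorem IsLUB.conj {D : Set (InstrAlg K ν)} (hne : D.Nonempty)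
    (hdir : DirectedOn (· ≤ ·) D) (hsa : ∀ x ∈ D, IsSelfAdjoint x) {s : InstrAlg K ν}
    (hs : IsLUB D s) (y : InstrAlg K ν) :
    IsLUB ((fun x => star y * x * y) '' D) (star y * s * y) := by
  have e : ∀ x z : InstrAlg K ν, ∀ η, inner ℂ η ((star y * x * y - star y * z * y).1 η)
      = inner ℂ (y.1 η) ((x.1 - z.1) (y.1 η)) := fun x z η => by
    change inner ℂ η ((star y.1 * x.1 * y.1 - star y.1 * z.1 * y.1) η) = _
    rw [← sub_mul, ← mul_sub, mul_apply_eq_comp, mul_apply_eq_comp,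
      ContinuousLinearMap.star_eq_adjoint, ContinuousLinearMap.adjoint_inner_right]
  refine isLUB_of_approx ?_ fun η ε hε => ?_
  · rintro _ ⟨x, hx, rfl⟩
    rw [instrAlg_le_iff, op_le_iff]
    intro η
    have := op_le_iff.1 (hs.1 hx) (y.1 η)
    rw [← e] at this
    exact this
  · obtain ⟨x, hx, h⟩ := exists_approx_of_isLUB_instrAlg hne hdir hsa hs (y.1 η) hε
    refine ⟨_, ⟨x, hx, rfl⟩, ?_⟩
    rw [e]
    exact h

/-! ### Normal positive functionals -/

/-- Partially ordered star algebras whose positive elements have selfadjoint square roots. -/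
class SqrtStarAlgebra (A : Type*) [Ring A] [StarRing A] [Algebra ℂ A] [PartialOrder A] : Prop where
  exists_sqrt : ∀ x : A, 0 ≤ x → ∃ r, star r = r ∧ r * r = x
  sub_nonneg_iff : ∀ x y : A, 0 ≤ y - x ↔ x ≤ y

instance : SqrtStarAlgebra (InstrAlg K ν) where
  exists_sqrt _ hx := CovInstr.exists_sqrt hx
  sub_nonneg_iff x y := (sub_nonneg (a := y.1) (b := x.1))

/-- Normal positive linear functionals. -/
structure IsNormalPos {A : Type*} [Ring A] [StarRing A] [Algebra ℂ A] [PartialOrder A]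
    (φ : A →ₗ[ℂ] ℂ) : Prop where
  pos : ∀ x, 0 ≤ φ (star x * x)
  normal : ∀ D : Set A, D.Nonempty → DirectedOn (· ≤ ·) D →
    (∀ x ∈ D, IsSelfAdjoint x) → ∀ s, IsLUB D s → ∀ ε > (0 : ℝ), ∃ x ∈ D, (φ (s - x)).re < ε

/-! ### Positive functionals on algebras with square roots -/

section Functionals

variable {A : Type*} [Ring A] [StarRing A] [Algebra ℂ A] [PartialOrder A] [SqrtStarAlgebra A]

theorem functional_nonneg {φ : A →ₗ[ℂ] ℂ} (h : ∀ x, 0 ≤ φ (star x * x))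
    {x : A} (hx : 0 ≤ x) : 0 ≤ φ x := by
  obtain ⟨r, h1, h2⟩ := SqrtStarAlgebra.exists_sqrt x hx
  have := h r
  rwa [h1, h2] at this

theorem functional_mono {φ : A →ₗ[ℂ] ℂ} (h : ∀ x, 0 ≤ φ (star x * x))
    {x y : A} (hxy : x ≤ y) : φ x ≤ φ y := by
  have := functional_nonneg h ((SqrtStarAlgebra.sub_nonneg_iff x y).2 hxy)
  rwa [map_sub, sub_nonneg] at this

theorem functional_cauchy_schwarz [StarModule ℂ A] {φ : A →ₗ[ℂ] ℂ} (h : ∀ x, 0 ≤ φ (star x * x))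
    (x y : A) : ‖φ (star x * y)‖ ^ 2 ≤ (φ (star x * x)).re * (φ (star y * y)).re := by
  have hk : PosKernel fun x y : A => φ (star x * y) := fun c => by
    have := h (Finsupp.linearCombination ℂ id c)
    convert this using 1
    simp only [kerForm, Finsupp.linearCombination_apply, Finsupp.sum, star_sum, star_smul,
      Finset.sum_mul, Finset.mul_sum, map_sum, smul_mul_assoc, mul_smul_comm, map_smul,
      smul_eq_mul, id, mul_assoc]
    rw [Finset.sum_comm]
    refine Finset.sum_congr rfl fun i _ => Finset.sum_congr rfl fun j _ => ?_
    exact mul_left_comm _ _ _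
  have := hk.cauchy_schwarz (Finsupp.single x 1) (Finsupp.single y 1)
  simpa only [kerForm_single] using this

theorem IsNormalPos.add {φ ψ : A →ₗ[ℂ] ℂ} (hφ : IsNormalPos φ) (hψ : IsNormalPos ψ) :
    IsNormalPos (φ + ψ) := by
  refine ⟨fun x => add_nonneg (hφ.pos x) (hψ.pos x), fun D hne hdir hsa s hs ε hε => ?_⟩
  obtain ⟨x, hx, h1⟩ := hφ.normal D hne hdir hsa s hs (ε / 2) (half_pos hε)
  obtain ⟨y, hy, h2⟩ := hψ.normal D hne hdir hsa s hs (ε / 2) (half_pos hε)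
  obtain ⟨z, hz, hxz, hyz⟩ := hdir x hx y hy
  refine ⟨z, hz, ?_⟩
  have h3 := (Complex.le_def.1 (functional_mono hφ.pos hxz)).1
  have h4 := (Complex.le_def.1 (functional_mono hψ.pos hyz)).1
  simp only [LinearMap.add_apply, map_sub, Complex.add_re, Complex.sub_re] at *
  linarith

end Functionals

/-- The functional `x ↦ φ(y^* x y)`. -/
def conjFunctional (φ : InstrAlg K ν →ₗ[ℂ] ℂ) (y : InstrAlg K ν) : InstrAlg K ν →ₗ[ℂ] ℂ :=
  φ ∘ₗ LinearMap.mulRight ℂ y ∘ₗ LinearMap.mulLeft ℂ (star y)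

theorem IsNormalPos.conj {φ : InstrAlg K ν →ₗ[ℂ] ℂ} (hφ : IsNormalPos φ) (y : InstrAlg K ν) :
    IsNormalPos (conjFunctional φ y) := by
  refine ⟨fun x => ?_, fun D hne hdir hsa s hs ε hε => ?_⟩
  · have := hφ.pos (x * y)
    rwa [star_mul, mul_assoc, ← mul_assoc (star x), ← mul_assoc] at this
  · have hmono : ∀ x z : InstrAlg K ν, x ≤ z → star y * x * y ≤ star y * z * y := fun x z h =>
      show star y.1 * x.1 * y.1 ≤ star y.1 * z.1 * y.1 from 
        star_left_conjugate_le_conjugate (show x.1 ≤ z.1 from h) y.1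
    obtain ⟨_, ⟨x, hx, rfl⟩, h⟩ := hφ.normal _ (hne.image fun x => star y * x * y)
      (by
        rintro _ ⟨x, hx, rfl⟩ _ ⟨z, hz, rfl⟩
        obtain ⟨w, hw, h1, h2⟩ := hdir x hx z hz
        exact ⟨_, ⟨w, hw, rfl⟩, hmono _ _ h1, hmono _ _ h2⟩)
      (by
        rintro _ ⟨x, hx, rfl⟩
        exact (hsa x hx).conjugate' y) _ (IsLUB.conj hne hdir hsa hs y) ε hε
    refine ⟨x, hx, ?_⟩
    rwa [← sub_mul, ← mul_sub] at h

end Algebra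

/-! ### Decomposable operators on `L²(ν; E)` -/

section Decomposable

variable {Ω : Type*} [MeasurableSpace Ω] {ν : Measure Ω}
variable {E : Type*} [NormedAddCommGroup E] [InnerProductSpace ℂ E]

theorem norm_sq_eq_integral (φ : Lp E 2 ν) : ‖φ‖ ^ 2 = ∫ ω, ‖φ ω‖ ^ 2 ∂ν := by
  have h := L2.inner_def (𝕜 := ℂ) φ φ
  simp only [inner_self_eq_norm_sq_to_K] at h
  have h2 : ((‖φ‖ ^ 2 : ℝ) : ℂ) = ∫ ω, ((‖φ ω‖ ^ 2 : ℝ) : ℂ) ∂ν := by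
    push_cast; exact h
  rw [integral_complex_ofReal] at h2
  exact Complex.ofReal_injective h2

theorem integrable_norm_sq (φ : Lp E 2 ν) : Integrable (fun ω => ‖φ ω‖ ^ 2) ν :=
  (memLp_two_iff_integrable_sq_norm (Lp.aestronglyMeasurable φ)).1 (Lp.memLp φ)

theorem mulOp_ind_coeFn {X : Set Ω} (hX : MeasurableSet X) (φ : Lp E 2 ν) :
    ∀ᵐ ω ∂ν, mulOp E ν (linftyInd ν hX) φ ω = X.indicator φ ω := by
  filter_upwards [mulOp_coeFn (linftyInd ν hX) φ, linftyInd_coeFn (ν := ν) hX] with ω h1 h2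
  rw [h1, h2]
  by_cases h : ω ∈ X <;> simp [h]

theorem setIntegral_norm_sq {X : Set Ω} (hX : MeasurableSet X) (φ : Lp E 2 ν) :
    ∫ ω in X, ‖φ ω‖ ^ 2 ∂ν = ‖mulOp E ν (linftyInd ν hX) φ‖ ^ 2 := by
  rw [norm_sq_eq_integral, ← integral_indicator hX]
  refine integral_congr_ae ?_
  filter_upwards [mulOp_ind_coeFn hX φ] with ω h
  rw [h]
  by_cases h : ω ∈ X <;> simp [h]

/-- Two square-integrable functions with orthogonal `L^∞`-translates are pointwise orthogonal. -/
theorem ae_inner_eq_zero {φ ψ : Lp E 2 ν}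
    (h : ∀ f : Lp ℂ ∞ ν, inner ℂ (mulOp E ν f φ) ψ = 0) :
    ∀ᵐ ω ∂ν, inner ℂ (φ ω) (ψ ω) = 0 := by
  refine Integrable.ae_eq_zero_of_forall_setIntegral_eq_zero
    (L2.integrable_inner (𝕜 := ℂ) φ ψ) fun X hX _ => ?_
  rw [← integral_indicator hX, ← h (linftyInd ν hX), L2.inner_def]
  refine integral_congr_ae ?_
  filter_upwards [mulOp_ind_coeFn hX φ] with ω h
  rw [h]
  by_cases h : ω ∈ X <;> simp [h]

/-- A bounded operator on `L²(ν; E)` is decomposable if it commutes with `L^∞(ν)`. -/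
def CommutesLinfty (T : Lp E 2 ν →L[ℂ] Lp E 2 ν) : Prop :=
  ∀ f : Lp ℂ ∞ ν, T * mulOp E ν f = mulOp E ν f * T

theorem CommutesLinfty.apply {T : Lp E 2 ν →L[ℂ] Lp E 2 ν} (h : CommutesLinfty T) (f : Lp ℂ ∞ ν)
    (φ : Lp E 2 ν) : T (mulOp E ν f φ) = mulOp E ν f (T φ) :=
  congrArg (fun S : Lp E 2 ν →L[ℂ] Lp E 2 ν => S φ) (h f)

/-- Localisation by indicators: T commutes with χ_X, so the L² bound applied to χ_X φ compares the
integrals of both sides over every measurable X. -/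
theorem CommutesLinfty.norm_le {T : Lp E 2 ν →L[ℂ] Lp E 2 ν} (h : CommutesLinfty T)
    (φ : Lp E 2 ν) : ∀ᵐ ω ∂ν, ‖T φ ω‖ ≤ ‖T‖ * ‖φ ω‖ := by
  have : (fun ω => ‖T φ ω‖ ^ 2) ≤ᵐ[ν] fun ω => ‖T‖ ^ 2 * ‖φ ω‖ ^ 2 := by
    refine ae_le_of_forall_setIntegral_le (integrable_norm_sq _)
      ((integrable_norm_sq _).const_mul _) fun X hX _ => ?_
    rw [integral_const_mul, setIntegral_norm_sq hX, setIntegral_norm_sq hX, ← h.apply, ← mul_pow]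
    exact pow_le_pow_left₀ (norm_nonneg _) (T.le_opNorm _) 2
  filter_upwards [this] with ω hω
  rw [← mul_pow] at hω
  exact le_of_sq_le_sq hω (by positivity)

/-- The field `F` decomposes the operator `T`. -/
def IsField (T : Lp E 2 ν →L[ℂ] Lp E 2 ν) (F : Ω → E →L[ℂ] E) : Prop :=
  ∀ ψ : Lp E 2 ν, ∀ᵐ ω ∂ν, T ψ ω = F ω (ψ ω)

theorem IsField.mul {T T' : Lp E 2 ν →L[ℂ] Lp E 2 ν} {F F' : Ω → E →L[ℂ] E} (h : IsField T F)
    (h' : IsField T' F') : IsField (T * T') fun ω => F ω ∘L F' ω := fun ψ => by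
  filter_upwards [h (T' ψ), h' ψ] with ω h1 h2
  rw [mul_apply_eq_comp, h1, h2]
  rfl

theorem IsField.smul {T : Lp E 2 ν →L[ℂ] Lp E 2 ν} {F : Ω → E →L[ℂ] E} (h : IsField T F) (c : ℂ) :
    IsField (c • T) fun ω => c • F ω := fun ψ => by
  filter_upwards [h ψ, Lp.coeFn_smul c (T ψ)] with ω h1 h2
  rw [smul_apply, h2, Pi.smul_apply, h1, smul_apply]

theorem lp_coeFn_sum {ι : Type*} (s : Finset ι) (f : ι → Lp E 2 ν) :
    ∀ᵐ ω ∂ν, (∑ i ∈ s, f i : Lp E 2 ν) ω = ∑ i ∈ s, f i ω := by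
  classical
  induction s using Finset.induction_on with
  | empty =>
    simp only [Finset.sum_empty]
    exact Lp.coeFn_zero E 2 ν
  | insert i s hi ih =>
    rw [Finset.sum_insert hi]
    filter_upwards [ih, Lp.coeFn_add (f i) (∑ j ∈ s, f j)] with ω h1 h2
    rw [h2, Pi.add_apply, h1, Finset.sum_insert hi]

/-- A strictly positive square-integrable weight replaces the constant function 1, which is not in
L² when ν is infinite. -/
theorem exists_weight (ν : Measure Ω) [SigmaFinite ν] :
    ∃ w : Ω → ℝ, Measurable w ∧ (∀ ω, 0 < w ω) ∧ MemLp w 2 ν := by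
  obtain ⟨g, h1, h2, h3⟩ := exists_pos_lintegral_lt_of_sigmaFinite ν (ε := 1) one_ne_zero
  refine ⟨fun ω => Real.sqrt (g ω), by fun_prop, fun ω => Real.sqrt_pos.2 (h1 ω), ?_⟩
  rw [memLp_two_iff_integrable_sq (by fun_prop)]
  have : (fun ω => Real.sqrt (g ω) ^ 2) = fun ω => ((g ω : ℝ≥0∞)).toReal := by
    ext ω
    rw [Real.sq_sqrt (NNReal.coe_nonneg (g ω)), ENNReal.coe_toReal]
  rw [this]
  exact integrable_toReal_of_lintegral_ne_top (by fun_prop) (h3.trans_le le_top).ne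

theorem weight_memLp {w : Ω → ℝ} (hw : MemLp w 2 ν) (x : E) :
    MemLp (fun ω => (w ω : ℂ) • x) 2 ν := by
  have h : MemLp (fun ω => ‖x‖ * w ω) 2 ν := hw.const_mul _
  refine MemLp.of_le h ?_ (Eventually.of_forall fun ω => ?_)
  · exact (Complex.continuous_ofReal.comp_aestronglyMeasurable hw.1).smul_const x
  · rw [norm_smul, norm_mul, norm_norm, mul_comm, Complex.norm_real]

/-- The vector `x` times a square-integrable weight. -/
def constVec {w : Ω → ℝ} (hw : MemLp w 2 ν) (x : E) : Lp E 2 ν := (weight_memLp hw x).toLp _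

theorem constVec_coeFn {w : Ω → ℝ} (hw : MemLp w 2 ν) (x : E) :
    ∀ᵐ ω ∂ν, constVec hw x ω = (w ω : ℂ) • x := MemLp.coeFn_toLp _

theorem constVec_sum {w : Ω → ℝ} (hw : MemLp w 2 ν) {ι : Type*} (s : Finset ι) (c : ι → ℂ)
    (x : ι → E) : constVec hw (∑ i ∈ s, c i • x i) = ∑ i ∈ s, c i • constVec hw (x i) := by
  let L : E →ₗ[ℂ] Lp E 2 ν :=
    { toFun := constVec hw
      map_add' := fun x y => Lp.ext <| by
        filter_upwards [constVec_coeFn hw (x + y), constVec_coeFn hw x, constVec_coeFn hw y,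
          Lp.coeFn_add (constVec hw x) (constVec hw y)] with ω h1 h2 h3 h4
        rw [h1, h4, Pi.add_apply, h2, h3, smul_add]
      map_smul' := fun c x => Lp.ext <| by
        filter_upwards [constVec_coeFn hw (c • x), constVec_coeFn hw x,
          Lp.coeFn_smul c (constVec hw x)] with ω h1 h2 h3
        rw [RingHom.id_apply, h1, h3, Pi.smul_apply, h2, smul_comm] }
  change L _ = ∑ i ∈ s, c i • L (x i)
  simp only [map_sum, map_smul]

variable [CompleteSpace E] [TopologicalSpace.SeparableSpace E]

open TopologicalSpace

theorem total_constVec {w : Ω → ℝ} (hw : MemLp w 2 ν) (hw0 : ∀ ω, 0 < w ω) :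
    Total fun p : Lp ℂ ∞ ν × ℕ => mulOp E ν p.1 (constVec hw (denseSeq E p.2)) := by
  intro ψ hψ
  have h : ∀ᵐ ω ∂ν, ∀ k, inner ℂ (denseSeq E k) (ψ ω) = 0 := ae_all_iff.2 fun k => by
    have hk : ∀ f : Lp ℂ ∞ ν, inner ℂ (mulOp E ν f (constVec hw (denseSeq E k))) ψ = 0 :=
      fun f => hψ (f, k)
    filter_upwards [ae_inner_eq_zero hk, constVec_coeFn hw (denseSeq E k)]
      with ω h1 h2
    rw [h2, inner_smul_left] at h1
    refine (mul_eq_zero.1 h1).resolve_left ?_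
    simpa using (hw0 ω).ne'
  refine Lp.ext ?_
  filter_upwards [h, Lp.coeFn_zero E 2 ν] with ω h1 h2
  rw [h2]
  refine (inner_self_eq_zero (𝕜 := ℂ)).1 ?_
  exact congrFun ((denseRange_denseSeq E).equalizer (g := fun y => inner ℂ y (ψ ω))
    (h := fun _ => (0 : ℂ)) (by fun_prop) (by fun_prop) (funext h1)) (ψ ω)

/-- Fields are compared on the vectors w(ω)x with x in a countable dense set, so only countably many
null sets occur. -/
theorem IsField.ae_eq [SigmaFinite ν] {T : Lp E 2 ν →L[ℂ] Lp E 2 ν} {F F' : Ω → E →L[ℂ] E}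
    (h : IsField T F) (h' : IsField T F') : F =ᵐ[ν] F' := by
  obtain ⟨w, -, hw0, hw⟩ := exists_weight ν
  have h1 : ∀ᵐ ω ∂ν, ∀ k, F ω (denseSeq E k) = F' ω (denseSeq E k) := ae_all_iff.2 fun k => by
    filter_upwards [h (constVec hw (denseSeq E k)), h' (constVec hw (denseSeq E k)),
      constVec_coeFn hw (denseSeq E k)] with ω h1 h2 h3
    rw [h1, h3, map_smul, map_smul] at h2
    exact smul_right_injective E (r := (w ω : ℂ)) (by simpa using (hw0 ω).ne') h2
  filter_upwards [h1] with ω h1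
  exact ContinuousLinearMap.ext fun x => congrFun
    ((denseRange_denseSeq E).equalizer (F ω).continuous (F' ω).continuous (funext h1)) x

/-- A continuous family of inequalities that holds almost everywhere for each parameter holds
almost everywhere for all parameters. -/
theorem ae_forall_of_continuous {X : Type*} [TopologicalSpace X] [SeparableSpace X] [Nonempty X]
    {p : Ω → X → Prop} (hp : ∀ ω, IsClosed {x | p ω x}) (h : ∀ x, ∀ᵐ ω ∂ν, p ω x) :
    ∀ᵐ ω ∂ν, ∀ x, p ω x := by
  filter_upwards [ae_all_iff.2 fun k => h (denseSeq X k)] with ω hω x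
  exact (denseRange_denseSeq X).induction_on (p := p ω) x (hp ω) hω

theorem linearCombination_eq_sum_range (x y : ℕ → E) (c : ℕ →₀ ℂ) :
    ∃ N, Finsupp.linearCombination ℂ x c = ∑ k ∈ Finset.range N, c k • x k ∧
      Finsupp.linearCombination ℂ y c = ∑ k ∈ Finset.range N, c k • y k := by
  refine ⟨c.support.sup id + 1, ?_, ?_⟩ <;>
  · rw [Finsupp.linearCombination_apply]
    refine Finsupp.sum_of_support_subset _ (fun k hk => ?_) _ (by simp)
    exact Finset.mem_range.2 (Nat.lt_succ_of_le (Finset.le_sup (f := id) hk))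

/-- Operators commuting with `L^∞(ν)` are decomposable. -/
theorem CommutesLinfty.exists_field [SigmaFinite ν] {T : Lp E 2 ν →L[ℂ] Lp E 2 ν}
    (hT : CommutesLinfty T) : ∃ F : Ω → E →L[ℂ] E, (∀ ω, ‖F ω‖ ≤ ‖T‖) ∧ IsField T F := by
  classical
  obtain ⟨w, hwm, hw0, hw⟩ := exists_weight ν
  have hw0' : ∀ ω, (w ω : ℂ) ≠ 0 := fun ω => by simpa using (hw0 ω).ne'
  set x := denseSeq E with hx
  -- The candidate for F(ω) x_k: the value of T on the weighted constant vector, with the weight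
  -- divided out.
  let τ : ℕ → Ω → E := fun k ω => (w ω : ℂ)⁻¹ • T (constVec hw (x k)) ω
  -- For fixed coefficients this is the pointwise norm bound for T; it is closed in the
  -- coefficients, which range over a separable space, so one null set serves all of them.
  have hbound : ∀ᵐ ω ∂ν, ∀ N, ∀ c : ℕ → ℂ,
      ‖∑ k ∈ Finset.range N, c k • τ k ω‖ ≤ ‖T‖ * ‖∑ k ∈ Finset.range N, c k • x k‖ := by
    refine ae_all_iff.2 fun N => ae_forall_of_continuous (fun ω => isClosed_le (by fun_prop)
      (by fun_prop)) fun c => ?_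
    have e : T (constVec hw (∑ k ∈ Finset.range N, c k • x k))
        = ∑ k ∈ Finset.range N, c k • T (constVec hw (x k)) := by
      rw [constVec_sum, map_sum]; simp only [map_smul]
    filter_upwards [hT.norm_le (constVec hw (∑ k ∈ Finset.range N, c k • x k)),
      constVec_coeFn hw (∑ k ∈ Finset.range N, c k • x k),
      lp_coeFn_sum (Finset.range N) fun k => c k • T (constVec hw (x k)),
      ae_all_iff.2 fun k => Lp.coeFn_smul (c k) (T (constVec hw (x k)))] with ω h1 h2 h3 h4
    rw [e, h2, h3, norm_smul] at h1
    have e2 : ∑ k ∈ Finset.range N, c k • τ k ω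
        = (w ω : ℂ)⁻¹ • ∑ k ∈ Finset.range N, (c k • T (constVec hw (x k)) : Lp E 2 ν) ω := by
      rw [Finset.smul_sum]
      refine Finset.sum_congr rfl fun k _ => ?_
      rw [h4, Pi.smul_apply, smul_comm]
    rw [e2, norm_smul, norm_inv, inv_mul_le_iff₀ (norm_pos_iff.2 (hw0' ω))]
    linarith
  have hdense : DenseRange (Finsupp.linearCombination ℂ x) :=
    (denseRange_denseSeq E).mono (by
      rintro _ ⟨k, rfl⟩
      exact ⟨Finsupp.single k 1, by simp [hx]⟩)
  let Good : Ω → Prop := fun ω => ∀ N, ∀ c : ℕ → ℂ,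
      ‖∑ k ∈ Finset.range N, c k • τ k ω‖ ≤ ‖T‖ * ‖∑ k ∈ Finset.range N, c k • x k‖
  -- The value 0 on the exceptional null set keeps the norm bound valid at every point.
  let F : Ω → E →L[ℂ] E := fun ω => if Good ω then
    (Finsupp.linearCombination ℂ fun k => τ k ω).extendOfNorm (Finsupp.linearCombination ℂ x) else 0
  have hlc : ∀ ω, Good ω → ∀ c, ‖Finsupp.linearCombination ℂ (fun k => τ k ω) c‖
      ≤ ‖T‖ * ‖Finsupp.linearCombination ℂ x c‖ := fun ω hω c => by
    obtain ⟨N, h1, h2⟩ := linearCombination_eq_sum_range x (fun k => τ k ω) c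
    rw [h1, h2]
    exact hω N c
  have hFx : ∀ ω, Good ω → ∀ k, F ω (x k) = τ k ω := fun ω hω k => by
    have := LinearMap.extendOfNorm_eq hdense ⟨_, hlc ω hω⟩ (Finsupp.single k 1)
    simp only [F, if_pos hω]
    simpa using this
  refine ⟨F, fun ω => ?_, fun ψ => ?_⟩
  · by_cases hω : Good ω
    · simp only [F, if_pos hω]
      exact LinearMap.opNorm_extendOfNorm_le hdense (norm_nonneg _) (hlc ω hω)
    · simp only [F, if_neg hω, norm_zero, norm_nonneg]
  -- The vectors on which F computes T form a closed subspace, since norm limits have almost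
  -- everywhere convergent subsequences; it contains the total family of multiples of weighted
  -- constants.
  · let M : Submodule ℂ (Lp E 2 ν) :=
      { carrier := {ψ | ∀ᵐ ω ∂ν, T ψ ω = F ω (ψ ω)}
        add_mem' := fun {ψ φ} h1 h2 => by
          filter_upwards [h1, h2, Lp.coeFn_add ψ φ, Lp.coeFn_add (T ψ) (T φ)] with ω h1 h2 h3 h4
          rw [map_add, h4, h3, Pi.add_apply, Pi.add_apply, h1, h2, map_add]
        zero_mem' := by
          filter_upwards [Lp.coeFn_zero E 2 ν] with ω h
          rw [map_zero, h, Pi.zero_apply, map_zero]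
        smul_mem' := fun c ψ h1 => by
          filter_upwards [h1, Lp.coeFn_smul c ψ, Lp.coeFn_smul c (T ψ)] with ω h1 h3 h4
          rw [map_smul, h4, h3, Pi.smul_apply, Pi.smul_apply, h1, map_smul] }
    have hcl : IsClosed (M : Set (Lp E 2 ν)) := by
      refine IsSeqClosed.isClosed fun y φ hy hφ => ?_
      have hTφ : Tendsto (fun k => T (y k)) atTop (nhds (T φ)) := (T.continuous.tendsto _).comp hφ
      obtain ⟨ns, hns, h1⟩ := (tendstoInMeasure_of_tendsto_Lp hφ).exists_seq_tendsto_ae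
      obtain ⟨ms, hms, h2⟩ := (tendstoInMeasure_of_tendsto_Lp
        (hTφ.comp hns.tendsto_atTop)).exists_seq_tendsto_ae
      have hy' : ∀ᵐ ω ∂ν, ∀ k, T (y k) ω = F ω (y k ω) := ae_all_iff.2 hy
      change ∀ᵐ ω ∂ν, T φ ω = F ω (φ ω)
      filter_upwards [h1, h2, hy'] with ω h1 h2 h3
      refine tendsto_nhds_unique h2 ?_
      have := ((F ω).continuous.tendsto _).comp (h1.comp hms.tendsto_atTop)
      refine this.congr fun k => ?_
      exact (h3 _).symm
    have hgood : ∀ᵐ ω ∂ν, Good ω := hbound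
    have hmem : ∀ p : Lp ℂ ∞ ν × ℕ, mulOp E ν p.1 (constVec hw (x p.2)) ∈ M := fun p => by
      change ∀ᵐ ω ∂ν, _
      filter_upwards [hgood, mulOp_coeFn p.1 (constVec hw (x p.2)), constVec_coeFn hw (x p.2),
        mulOp_coeFn p.1 (T (constVec hw (x p.2)))] with ω h1 h2 h3 h4
      rw [hT.apply, h4, h2, h3, map_smul, map_smul, hFx ω h1]
      simp only [τ]
      rw [smul_inv_smul₀ (hw0' ω)]
    have htop : M = ⊤ := by
      rw [← hcl.submodule_topologicalClosure_eq, Submodule.topologicalClosure_eq_top_iff,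
        Submodule.eq_bot_iff]
      intro φ hφ
      exact total_constVec hw hw0 φ fun p => (Submodule.mem_orthogonal _ _).1 hφ _ (hmem p)
    have : ψ ∈ M := htop ▸ Submodule.mem_top
    exact this

/-- `L^∞(ν)` is maximal abelian on `L²(ν)`. -/
theorem exists_eq_mulOp_of_commutesLinfty [SigmaFinite ν] {T : Lp ℂ 2 ν →L[ℂ] Lp ℂ 2 ν}
    (hT : CommutesLinfty T) : ∃ f, T = mulOp ℂ ν f := by
  obtain ⟨F, hF, h⟩ := hT.exists_field
  obtain ⟨w, hwm, hw0, hw⟩ := exists_weight ν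
  have hm : AEStronglyMeasurable (fun ω => F ω 1) ν := by
    have h1 : AEStronglyMeasurable (fun ω => (w ω : ℂ)⁻¹ • T (constVec hw (1 : ℂ)) ω) ν :=
      AEStronglyMeasurable.smul (by fun_prop : Measurable fun ω => (w ω : ℂ)⁻¹).aestronglyMeasurable
        (Lp.aestronglyMeasurable _)
    refine h1.congr ?_
    filter_upwards [h (constVec hw (1 : ℂ)), constVec_coeFn hw (1 : ℂ)] with ω h1 h2
    rw [h1, h2, map_smul, inv_smul_smul₀]
    simpa using (hw0 ω).ne'
  refine ⟨linftyMk (fun ω => F ω 1) hm ‖T‖ (Eventually.of_forall fun ω => ?_), ?_⟩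
  · exact ((F ω).le_opNorm 1).trans (by simpa using hF ω)
  · ext1 ψ
    refine Lp.ext ?_
    filter_upwards [h ψ, mulOp_coeFn (linftyMk (fun ω => F ω 1) hm ‖T‖ _) ψ, linftyMk_coeFn hm
      (Eventually.of_forall fun ω => ((F ω).le_opNorm 1).trans (by simpa using hF ω))]
      with ω h1 h2 h3
    rw [h1, h2, h3, smul_eq_mul, mul_comm, ← smul_eq_mul, ← map_smul, smul_eq_mul, mul_one]

end Decomposable

/-! ### Normal functionals are determined by elementary tensors -/

section Projections

variable {A : Type*} [Ring A] [StarRing A] [Algebra ℂ A] [PartialOrder A] [SqrtStarAlgebra A]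
  [StarModule ℂ A]

/-- Cauchy-Schwarz gives |φ((1-p)y)|² ≤ φ(1-p) φ(y^*y), and similarly on the other side with yy^*.
The constant δ absorbs φ(y^*y) and φ(yy^*) together. -/
theorem IsNormalPos.exists_proj {φ : A →ₗ[ℂ] ℂ} (hφ : IsNormalPos φ) {ε : ℝ} (hε : 0 < ε) (y : A) :
    ∃ δ > 0, ∀ p : A, star p = p → p * p = p → (φ (1 - p)).re < δ →
        ‖φ ((1 - p) * y)‖ < ε ∧ ‖φ (y * (1 - p))‖ < ε := by
  set A := (φ (star y * y)).re with hA
  set B := (φ (star (star y) * star y)).re with hB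
  have hA0 : 0 ≤ A := (Complex.le_def.1 (hφ.pos y)).1
  have hB0 : 0 ≤ B := (Complex.le_def.1 (hφ.pos (star y))).1
  refine ⟨ε ^ 2 / (A + B + 1), by positivity, fun p hps hpi hF => ?_⟩
  have hs : star (1 - p) = 1 - p := by rw [star_sub, star_one, hps]
  have hi : (1 - p) * (1 - p) = 1 - p := by rw [mul_sub, sub_mul, sub_mul, hpi]; simp
  have h0 : 0 ≤ (φ (1 - p)).re := by
    have := (Complex.le_def.1 (hφ.pos (1 - p))).1
    rwa [hs, hi] at this
  have h1 := functional_cauchy_schwarz hφ.pos (1 - p) y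
  have h2 := functional_cauchy_schwarz hφ.pos (star y) (1 - p)
  rw [hs, hi] at h1
  rw [hs, hi, star_star] at h2
  rw [lt_div_iff₀ (by positivity)] at hF
  constructor
  · refine lt_of_pow_lt_pow_left₀ 2 hε.le (h1.trans_lt (lt_of_le_of_lt ?_ hF))
    exact mul_le_mul_of_nonneg_left (by linarith) h0
  · refine lt_of_pow_lt_pow_left₀ 2 hε.le (h2.trans_lt (lt_of_le_of_lt ?_ hF))
    rw [mul_comm]
    refine mul_le_mul_of_nonneg_left ?_ h0
    rw [star_star] at hB
    linarith

/-- A single projection works for both functionals because normality is applied to φ + ψ, which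
dominates each of them on 1 - p. -/
theorem IsNormalPos.exists_proj₂ {φ ψ : A →ₗ[ℂ] ℂ} (hφ : IsNormalPos φ)
    (hψ : IsNormalPos ψ) {P : Set A} (hne : P.Nonempty)
    (hdir : DirectedOn (· ≤ ·) P) (hP : ∀ p ∈ P, star p = p ∧ p * p = p) (hlub : IsLUB P 1)
    (y : A) {ε : ℝ} (hε : 0 < ε) : ∃ p ∈ P,
      ‖φ ((1 - p) * y)‖ < ε ∧ ‖φ (y * (1 - p))‖ < ε ∧
      ‖ψ ((1 - p) * y)‖ < ε ∧ ‖ψ (y * (1 - p))‖ < ε := by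
  obtain ⟨δ, hδ, h1⟩ := hφ.exists_proj hε y
  obtain ⟨δ', hδ', h2⟩ := hψ.exists_proj hε y
  obtain ⟨p, hp, hF⟩ := (hφ.add hψ).normal _ hne hdir (fun p hp => (hP p hp).1) 1 hlub (min δ δ')
    (lt_min hδ hδ')
  obtain ⟨hps, hpi⟩ := hP p hp
  have hs : star (1 - p) = 1 - p := by rw [star_sub, star_one, hps]
  have hi : (1 - p) * (1 - p) = 1 - p := by rw [mul_sub, sub_mul, sub_mul, hpi]; simp
  have p1 := (Complex.le_def.1 (hφ.pos (1 - p))).1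
  have p2 := (Complex.le_def.1 (hψ.pos (1 - p))).1
  rw [hs, hi, Complex.zero_re] at p1 p2
  rw [LinearMap.add_apply, Complex.add_re] at hF
  have m1 := min_le_left δ δ'
  have m2 := min_le_right δ δ'
  obtain ⟨a1, a2⟩ := h1 p hps hpi (by linarith)
  obtain ⟨b1, b2⟩ := h2 p hps hpi (by linarith)
  exact ⟨p, hp, a1, a2, b1, b2⟩

/-- Decompose x = pxq + (1-p)x + px(1-q): the functionals agree on the corner, and p, then q
depending on p, make each of the four remaining values smaller than ε/4. -/
theorem IsNormalPos.ext_of_proj {φ ψ : A →ₗ[ℂ] ℂ} (hφ : IsNormalPos φ) (hψ : IsNormalPos ψ)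
    {P : Set A} (hne : P.Nonempty)
    (hdir : DirectedOn (· ≤ ·) P) (hP : ∀ p ∈ P, star p = p ∧ p * p = p) (hlub : IsLUB P 1)
    (h : ∀ p ∈ P, ∀ q ∈ P, ∀ x, φ (p * x * q) = ψ (p * x * q)) : φ = ψ := by
  ext x
  refine eq_of_forall_dist_le fun ε hε => ?_
  obtain ⟨p, hp, f1, -, f2, -⟩ := hφ.exists_proj₂ hψ hne hdir hP hlub x (ε := ε / 4)
    (by positivity)
  obtain ⟨q, hq, -, g1, -, g2⟩ := hφ.exists_proj₂ hψ hne hdir hP hlub (p * x) (ε := ε / 4)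
    (by positivity)
  have e : x = p * x * q + (1 - p) * x + p * x * (1 - q) := by noncomm_ring
  rw [dist_eq_norm]
  have e2 : φ x - ψ x = φ ((1 - p) * x) + φ (p * x * (1 - q))
      - ψ ((1 - p) * x) - ψ (p * x * (1 - q)) := by
    conv_lhs => rw [e]
    simp only [map_add, h p hp q hq]
    ring
  rw [e2]
  refine (norm_sub_le _ _).trans ?_
  have := norm_sub_le (φ ((1 - p) * x) + φ (p * x * (1 - q))) (ψ ((1 - p) * x))
  have := norm_add_le (φ ((1 - p) * x)) (φ (p * x * (1 - q)))
  linarith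

end Projections

section Uniqueness

variable {K : Type*} [NormedAddCommGroup K] [InnerProductSpace ℂ K] [CompleteSpace K]
variable {Ω : Type*} [MeasurableSpace Ω] {ν : Measure Ω}

theorem commute_one_tensor (x : InstrAlg K ν) (f : Lp ℂ ∞ ν) :
    opTensor 1 (mulOp ℂ ν f) * x.1 = x.1 * opTensor 1 (mulOp ℂ ν f) := by
  refine (mem_instrVN_iff x.1).1 x.2 _ ?_
  rintro _ ⟨b, g, rfl⟩
  rw [opTensor_star, mulOp_star]
  simp only [opTensor_mul, mulOp_mul, one_mul, mul_one]
  rw [linftyMul_comm f, linftyMul_comm f]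
  exact ⟨rfl, rfl⟩

/-- The matrix entries of x in the first tensor factor commute with L^∞(ν), because x commutes with
1 ⊗ f. As L^∞(ν) is maximal abelian, they are multiplication operators. -/
theorem commutesLinfty_slice (x : InstrAlg K ν) (e e' : K) :
    CommutesLinfty (ContinuousLinearMap.adjoint (leg e) ∘L x.1 ∘L leg e' : Lp ℂ 2 ν →L[ℂ] _) := by
  intro f
  have h1 : leg e' ∘L mulOp ℂ ν f = opTensor 1 (mulOp ℂ ν f) ∘L leg e' := by
    ext1 g
    simp only [ContinuousLinearMap.comp_apply, opTensor_leg, one_apply_eq_self]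
  have h2 : ContinuousLinearMap.adjoint (leg e) ∘L opTensor 1 (mulOp ℂ ν f)
      = mulOp ℂ ν f ∘L ContinuousLinearMap.adjoint (leg e) :=
    hilbertTensor_ext_leg fun k g => by
      simp only [ContinuousLinearMap.comp_apply, opTensor_leg, one_apply_eq_self, adjoint_leg,
        map_smul]
  have h3 := commute_one_tensor x f
  calc (ContinuousLinearMap.adjoint (leg e) ∘L x.1 ∘L leg e') * mulOp ℂ ν f
      = ContinuousLinearMap.adjoint (leg e) ∘L x.1 ∘L (leg e' ∘L mulOp ℂ ν f) := rfl
    _ = ContinuousLinearMap.adjoint (leg e) ∘L (x.1 * opTensor 1 (mulOp ℂ ν f)) ∘L leg e' := by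
        rw [h1]; rfl
    _ = (ContinuousLinearMap.adjoint (leg e) ∘L opTensor 1 (mulOp ℂ ν f)) ∘L x.1 ∘L leg e' := by
        rw [← h3]; rfl
    _ = _ := by rw [h2]; rfl

/-- The projection `p ⊗ 1` for the orthogonal projection `p` on a finite-dimensional subspace. -/
def finProj (ν : Measure Ω) (F : Submodule ℂ K) [FiniteDimensional ℂ F] : InstrAlg K ν :=
  elem F.starProjection (linftyOne ν)

theorem finProj_star (F : Submodule ℂ K) [FiniteDimensional ℂ F] :
    star (finProj ν F) = finProj ν F := by
  rw [finProj, star_elem, linftyStar_one, (isSelfAdjoint_starProjection F).star_eq]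

theorem finProj_mul (F : Submodule ℂ K) [FiniteDimensional ℂ F] :
    finProj ν F * finProj ν F = finProj ν F := by
  rw [finProj, elem_mul, linftyMul_one, F.isIdempotentElem_starProjection.eq]

theorem coe_finProj (F : Submodule ℂ K) [FiniteDimensional ℂ F] :
    (finProj ν F).1 = ∑ i, leg (stdOrthonormalBasis ℂ F i : K) ∘L
      ContinuousLinearMap.adjoint (leg (stdOrthonormalBasis ℂ F i : K)) := by
  have h : ∀ e : K, (leg e ∘L ContinuousLinearMap.adjoint (leg e) :
      HilbertTensor K (Lp ℂ 2 ν) →L[ℂ] _) = opTensor (InnerProductSpace.rankOne ℂ e e) 1 :=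
    fun e => leg_comp_adjoint_leg e e 1
  simp only [h]
  change opTensor _ (mulOp ℂ ν (linftyOne ν)) = _
  rw [mulOp_one, (stdOrthonormalBasis ℂ F).starProjection_eq_sum_rankOne]
  refine hilbertTensor_ext_leg fun e f => ?_
  simp only [opTensor_leg, sum_apply]
  simp only [leg_apply, TensorProduct.sum_tmul, map_sum]

/-- A finite corner of x is a finite matrix whose entries are multiplication operators, hence a
finite sum of elementary tensors. Normal functionals can thus be compared on elementary tensors
only. -/
theorem exists_finProj_mul_mul [SigmaFinite ν] (x : InstrAlg K ν) (F F' : Submodule ℂ K)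
    [FiniteDimensional ℂ F] [FiniteDimensional ℂ F'] :
    ∃ (b : Fin (Module.finrank ℂ F) → Fin (Module.finrank ℂ F') → (K →L[ℂ] K))
      (f : Fin (Module.finrank ℂ F) → Fin (Module.finrank ℂ F') → Lp ℂ ∞ ν),
      finProj ν F * x * finProj ν F' = ∑ i, ∑ j, elem (b i j) (f i j) := by
  choose f hf using fun i j => exists_eq_mulOp_of_commutesLinfty (commutesLinfty_slice x
    (stdOrthonormalBasis ℂ F i : K) (stdOrthonormalBasis ℂ F' j : K))
  refine ⟨fun i j => InnerProductSpace.rankOne ℂ (stdOrthonormalBasis ℂ F i : K)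
    (stdOrthonormalBasis ℂ F' j : K), f, Subtype.ext ?_⟩
  have e : (∑ i, ∑ j, elem (InnerProductSpace.rankOne ℂ (stdOrthonormalBasis ℂ F i : K)
      (stdOrthonormalBasis ℂ F' j : K)) (f i j) : InstrAlg K ν).1
      = ∑ i, ∑ j, opTensor (InnerProductSpace.rankOne ℂ (stdOrthonormalBasis ℂ F i : K)
      (stdOrthonormalBasis ℂ F' j : K)) (mulOp ℂ ν (f i j)) := by
    simp only [AddSubmonoidClass.coe_finsetSum]
    rfl
  rw [e]
  change (finProj ν F).1 * x.1 * (finProj ν F').1 = _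
  rw [coe_finProj, coe_finProj, Finset.sum_mul, Finset.sum_mul]
  refine Finset.sum_congr rfl fun i _ => ?_
  rw [Finset.mul_sum]
  refine Finset.sum_congr rfl fun j _ => ?_
  rw [← hf, ← leg_comp_adjoint_leg]
  rfl

theorem elem_mono_left {b b' : K →L[ℂ] K} (h : b ≤ b') :
    (elem b (linftyOne ν) : InstrAlg K ν) ≤ elem b' (linftyOne ν) := by
  obtain ⟨r, h1, h2, -⟩ := exists_sqrt_op (sub_nonneg.2 h)
  have e : (elem b' (linftyOne ν) : InstrAlg K ν)
      = elem b (linftyOne ν) + star (elem r (linftyOne ν)) * elem r (linftyOne ν) := by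
    rw [star_elem, elem_mul, linftyStar_one, linftyMul_one, h1, h2, ← elem_add_left,
      add_sub_cancel]
  rw [e]
  have := star_mul_self_nonneg' (elem r (linftyOne ν) : InstrAlg K ν)
  exact le_add_of_nonneg_right this

theorem finProj_mono {F F' : Submodule ℂ K} [FiniteDimensional ℂ F] [FiniteDimensional ℂ F']
    (h : F ≤ F') : finProj ν F ≤ finProj ν F' :=
  elem_mono_left (Submodule.starProjection_le_starProjection_iff.2 h)

/-- The set of projections `p ⊗ 1` of finite rank in the first factor. -/
def finProjSet (K : Type*) [NormedAddCommGroup K] [InnerProductSpace ℂ K] [CompleteSpace K]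
    (ν : Measure Ω) : Set (InstrAlg K ν) :=
  {p | ∃ (F : Submodule ℂ K) (_ : FiniteDimensional ℂ F), p = finProj ν F}

theorem finProjSet_nonempty : (finProjSet K ν).Nonempty := ⟨_, ⊥, inferInstance, rfl⟩

theorem finProjSet_directed : DirectedOn (· ≤ ·) (finProjSet K ν) := by
  rintro _ ⟨F, _, rfl⟩ _ ⟨F', _, rfl⟩
  exact ⟨_, ⟨F ⊔ F', inferInstance, rfl⟩, finProj_mono le_sup_left, finProj_mono le_sup_right⟩

theorem exists_finProj_apply (z : K ⊗[ℂ] Lp ℂ 2 ν) :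
    ∃ (F : Submodule ℂ K) (_ : FiniteDimensional ℂ F),
      ∀ (F' : Submodule ℂ K) [FiniteDimensional ℂ F'], F ≤ F' →
        (finProj ν F').1 (toHilbert z) = toHilbert z := by
  induction z with
  | zero => exact ⟨⊥, inferInstance, fun F' _ _ => by simp⟩
  | add z w h1 h2 =>
    obtain ⟨F, _, hF⟩ := h1
    obtain ⟨G, _, hG⟩ := h2
    refine ⟨F ⊔ G, inferInstance, fun F' _ h => ?_⟩
    rw [map_add, map_add, hF F' (le_sup_left.trans h), hG F' (le_sup_right.trans h)]
  | tmul e f =>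
    refine ⟨ℂ ∙ e, inferInstance, fun F' _ h => ?_⟩
    have he : e ∈ F' := h (Submodule.mem_span_singleton_self e)
    change opTensor _ (mulOp ℂ ν (linftyOne ν)) (leg e f) = leg e f
    rw [mulOp_one, opTensor_leg, Submodule.starProjection_eq_self_iff.2 he, one_apply_eq_self]

/-- An algebraic tensor z near η is fixed by some finite-rank P ⊗ 1, so the state of 1 - P ⊗ 1 at η
equals the one at η - z and is at most ‖η - z‖². -/
theorem isLUB_finProjSet : IsLUB (finProjSet K ν) 1 := by
  have hle : ∀ (F : Submodule ℂ K) [FiniteDimensional ℂ F], finProj ν F ≤ 1 := fun F _ => by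
    rw [← elem_one]
    refine elem_mono_left ?_
    have h := Submodule.starProjection_le_starProjection_iff.2 (le_top : F ≤ ⊤)
    rwa [Submodule.starProjection_top] at h
  refine isLUB_of_approx (by rintro _ ⟨F, _, rfl⟩; exact hle F) fun η ε hε => ?_
  obtain ⟨z, hz⟩ := denseRange_toHilbert.exists_dist_lt η (Real.sqrt_pos.2 hε)
  obtain ⟨F, _, hF⟩ := exists_finProj_apply (ν := ν) z
  refine ⟨_, ⟨F, inferInstance, rfl⟩, ?_⟩
  set P := (finProj ν F).1 with hP
  have hPz : (1 - P) (toHilbert z) = 0 := by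
    rw [sub_apply, hF F le_rfl, one_apply_eq_self, sub_self]
  have hPs : star (1 - P) = 1 - P := by
    rw [star_sub, star_one]
    exact congrArg (fun x : InstrAlg K ν => 1 - x.1) (finProj_star F)
  have h0 : 0 ≤ P := by
    have := star_mul_self_nonneg' (finProj ν F)
    rw [finProj_star, finProj_mul] at this
    exact this
  have e : inner ℂ η ((1 - P) η) = inner ℂ (η - toHilbert z) ((1 - P) (η - toHilbert z)) := by
    rw [map_sub, hPz, sub_zero, inner_sub_left]
    have : inner ℂ (toHilbert z) ((1 - P) η) = 0 := by
      rw [← ContinuousLinearMap.adjoint_inner_left, ← ContinuousLinearMap.star_eq_adjoint, hPs,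
        hPz, inner_zero_left]
    rw [this, sub_zero]
  change (inner ℂ η ((1 - P) η)).re < ε
  rw [e, sub_apply, inner_sub_right, one_apply_eq_self, inner_self_eq_norm_sq_to_K, Complex.sub_re]
  have h1 := (Complex.le_def.1 (op_nonneg_iff.1 h0 (η - toHilbert z))).1
  have h2 : (((‖η - toHilbert z‖ : ℝ) : ℂ) ^ 2).re = ‖η - toHilbert z‖ ^ 2 := by
    rw [← Complex.ofReal_pow, Complex.ofReal_re]
  have h3 : ‖η - toHilbert z‖ ^ 2 < ε := by
    rw [dist_eq_norm] at hz
    calc _ < Real.sqrt ε ^ 2 := pow_lt_pow_left₀ hz (norm_nonneg _) two_ne_zero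
      _ = ε := Real.sq_sqrt hε.le
  have h4 : ((↑‖η - toHilbert z‖ : ℂ) ^ 2).re = ‖η - toHilbert z‖ ^ 2 := h2
  simp only [Complex.zero_re] at h1
  refine lt_of_le_of_lt (sub_le_self _ h1) ?_
  exact lt_of_eq_of_lt h2 h3

/-- Normal positive functionals that agree on elementary tensors are equal. -/
theorem IsNormalPos.ext [SigmaFinite ν] {φ ψ : InstrAlg K ν →ₗ[ℂ] ℂ} (hφ : IsNormalPos φ)
    (hψ : IsNormalPos ψ) (h : ∀ b f, φ (elem b f) = ψ (elem b f)) : φ = ψ := by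
  refine hφ.ext_of_proj hψ finProjSet_nonempty finProjSet_directed ?_ isLUB_finProjSet ?_
  · rintro _ ⟨F, _, rfl⟩
    exact ⟨finProj_star F, finProj_mul F⟩
  · rintro _ ⟨F, _, rfl⟩ _ ⟨F', _, rfl⟩ x
    obtain ⟨b, f, hbf⟩ := exists_finProj_mul_mul x F F'
    simp only [hbf, map_sum, h]

end Uniqueness

/-! ### Compressions of completely positive families of functionals -/

section Compression

variable {A : Type*} [Ring A] [StarRing A] [Algebra ℂ A] [PartialOrder A] {V : Type*}
variable {E : Type*} [NormedAddCommGroup E] [InnerProductSpace ℂ E] [CompleteSpace E]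

/-- Completely positive families of functionals. -/
def IsCPFamily (σ : V → V → A →ₗ[ℂ] ℂ) : Prop :=
  PosKernel fun p q : A × V => σ p.2 q.2 (star p.1 * q.1)

theorem IsCPFamily.posKernel {σ : V → V → A →ₗ[ℂ] ℂ} (hσ : IsCPFamily σ) {κ : Type*}
    (z : κ → A) (w : κ → V) : PosKernel fun i j => σ (w i) (w j) (star (z i) * z j) := fun c => by
  have h := hσ (c.mapDomain fun i => (z i, w i))
  rwa [kerForm_mapDomain] at h

/-- The functional `x ↦ ⟨η, π(x) η'⟩`. -/
def vecFun (π : A →ₗ[ℂ] (E →L[ℂ] E)) (η η' : E) : A →ₗ[ℂ] ℂ where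
  toFun x := inner ℂ η (π x η')
  map_add' x y := by rw [map_add, add_apply, inner_add_right]
  map_smul' c x := by rw [map_smul, smul_apply, inner_smul_right]; rfl

theorem vecFun_apply (π : A →ₗ[ℂ] (E →L[ℂ] E)) (η η' : E) (x : A) :
    vecFun π η η' x = inner ℂ η (π x η') := rfl

variable {ι : Type*}

/-- Cauchy-Schwarz for the positive kernel on A × V is applied to the families z_i and x z_j. The
factor containing z^*x^*xz is then reduced to C² times the one containing z^*z by positivity of r^*r
= C² - x^*x. -/
theorem kerForm_compression_le {σ : V → V → A →ₗ[ℂ] ℂ} (hσ : IsCPFamily σ)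
    (z : ι → A) (w : ι → V) (x : A) {C : ℝ} (hx : ∃ r : A, ((C ^ 2 : ℝ) : ℂ) • 1 - star x * x = star r * r) (c d : ι →₀ ℂ) :
    ‖kerForm (fun i j => σ (w i) (w j) (star (z i) * x * z j)) c d‖ ^ 2
      ≤ C ^ 2 * (kerForm (fun i j => σ (w i) (w j) (star (z i) * z j)) c c).re *
        (kerForm (fun i j => σ (w i) (w j) (star (z i) * z j)) d d).re := by
  have hP := hσ
  have h := hP.cauchy_schwarz (c.mapDomain fun i => (z i, w i)) (d.mapDomain fun i => (x * z i, w i))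
  rw [kerForm_mapDomain, kerForm_mapDomain, kerForm_mapDomain] at h
  simp only [star_mul] at h
  have hd0 := hσ.posKernel z w
  obtain ⟨r, hr⟩ := hx
  have h2 := hσ.posKernel (fun i => r * z i) w d
  have e : ∀ i j, σ (w i) (w j) (star (r * z i) * (r * z j))
      = ((C ^ 2 : ℝ) : ℂ) * σ (w i) (w j) (star (z i) * z j)
        + (-1) * σ (w i) (w j) (star (z i) * star x * (x * z j)) := fun i j => by
    have : star (r * z i) * (r * z j)
        = ((C ^ 2 : ℝ) : ℂ) • (star (z i) * z j) - star (z i) * star x * (x * z j) := by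
      calc star (r * z i) * (r * z j) = star (z i) * (star r * r) * z j := by
            rw [star_mul]; simp only [mul_assoc]
        _ = _ := by
            rw [← hr, mul_sub, sub_mul, mul_smul_comm, smul_mul_assoc, mul_one]
            simp only [mul_assoc]
    rw [this, map_sub, map_smul, smul_eq_mul]
    ring
  simp only [e] at h2
  rw [kerForm_add, kerForm_const_mul, kerForm_const_mul] at h2
  have h3 := (Complex.le_def.1 h2).1
  rw [Complex.add_re, Complex.re_ofReal_mul, neg_one_mul, Complex.neg_re, Complex.zero_re] at h3
  have h4 := (Complex.le_def.1 (hd0 c)).1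
  rw [Complex.zero_re] at h4
  have e2 : ∀ i j, star (z i) * x * z j = star (z i) * (x * z j) := fun i j => mul_assoc _ _ _
  simp only [e2]
  refine h.trans ?_
  rw [mul_comm (C ^ 2), mul_assoc]
  exact mul_le_mul_of_nonneg_left (by linarith) h4

/-- The vectors a i stand for z_i ⊗ w_i in the Stinespring space of σ, which they need not span.
Thus π is the compression of the Stinespring representation and in general not multiplicative. -/
theorem exists_compression_map {σ : V → V → A →ₗ[ℂ] ℂ} (hσ : IsCPFamily σ)
    {N : A → ℝ} (hN0 : ∀ x, 0 ≤ N x)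
    (hNr : ∀ x, ∃ r : A, ((N x ^ 2 : ℝ) : ℂ) • 1 - star x * x = star r * r)
    {a : ι → E} (ha : Total a) (z : ι → A) (w : ι → V)
    (hg : ∀ i j, inner ℂ (a i) (a j) = σ (w i) (w j) (star (z i) * z j)) :
    ∃ π : A →ₗ[ℂ] (E →L[ℂ] E),
      (∀ x i j, inner ℂ (a i) (π x (a j)) = σ (w i) (w j) (star (z i) * x * z j)) ∧
      ∀ x, ‖π x‖ ≤ N x := by
  have hn : ∀ c, (kerForm (fun i j => σ (w i) (w j) (star (z i) * z j)) c c).re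
      = ‖Finsupp.linearCombination ℂ a c‖ ^ 2 := fun c => by
    simp only [← hg]
    rw [kerForm_inner, inner_self_eq_norm_sq_to_K, ← Complex.ofReal_re (‖_‖ ^ 2),
      Complex.ofReal_pow]
    rfl
  choose p hp1 hp2 using fun x => exists_op ha
    (fun i j => σ (w i) (w j) (star (z i) * x * z j)) (hN0 x) fun c d => by
      refine le_of_sq_le_sq ?_ (mul_nonneg (mul_nonneg (hN0 x) (norm_nonneg _)) (norm_nonneg _))
      refine (kerForm_compression_le hσ z w x (hNr x) c d).trans (le_of_eq ?_)
      rw [hn, hn]; ring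
  refine ⟨⟨⟨p, fun x y => ?_⟩, fun c x => ?_⟩, hp2, hp1⟩
  · refine ha.ext_inner ha fun i j => ?_
    rw [hp2, add_apply, inner_add_right, hp2, hp2, mul_add, add_mul, map_add]
  · refine ha.ext_inner ha fun i j => ?_
    rw [RingHom.id_apply, hp2, smul_apply, inner_smul_right, hp2, mul_smul_comm, smul_mul_assoc,
      map_smul, smul_eq_mul]

/-- For finite combinations of the a i this is positivity of σ on the elements x_j z_i; the general
case follows by density. -/
theorem compression_isCP {σ : V → V → A →ₗ[ℂ] ℂ} (hσ : IsCPFamily σ)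
    {a : ι → E} (ha : Total a) (z : ι → A) (w : ι → V)
    {π : A →ₗ[ℂ] (E →L[ℂ] E)}
    (hπ : ∀ x i j, inner ℂ (a i) (π x (a j)) = σ (w i) (w j) (star (z i) * x * z j))
    {n : ℕ} (x : Fin n → A) (η : Fin n → E) :
    0 ≤ ∑ j, ∑ k, inner ℂ (η j) (π (star (x j) * x k) (η k)) := by
  have hd := DenseRange.piMap fun _ : Fin n => ha.denseRange
  refine isClosed_property (p := fun η => 0 ≤ ∑ j, ∑ k, inner ℂ (η j) (π (star (x j) * x k) (η k)))
    hd (isClosed_le (by fun_prop) (by fun_prop)) (fun c => ?_) η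
  have h := hσ.posKernel (fun p : Fin n × ι => x p.1 * z p.2) (fun p => w p.2)
    (∑ j, (c j).mapDomain fun i => (j, i))
  have hl : ∀ (k : Fin n × ι → Fin n × ι → ℂ) (f : Fin n → (Fin n × ι →₀ ℂ)) d,
      kerForm k (∑ j, f j) d = ∑ j, kerForm k (f j) d := fun k f d =>
    map_sum (AddMonoidHom.mk' (fun c => kerForm k c d) fun c c' => kerForm_add_left k c c' d) _ _
  have hr : ∀ (k : Fin n × ι → Fin n × ι → ℂ) (f : Fin n → (Fin n × ι →₀ ℂ)) d,
      kerForm k d (∑ j, f j) = ∑ j, kerForm k d (f j) := fun k f d =>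
    map_sum (AddMonoidHom.mk' (fun c => kerForm k d c) fun c c' => kerForm_add_right k d c c') _ _
  simp only [hl, hr, kerForm_mapDomain] at h
  convert h using 1
  refine Finset.sum_congr rfl fun j _ => Finset.sum_congr rfl fun k _ => ?_
  have e : ∀ i l, σ (w i) (w l) (star (x j * z i) * (x k * z l))
      = inner ℂ (a i) (π (star (x j) * x k) (a l)) := fun i l => by
    rw [hπ, star_mul]; simp only [mul_assoc]
  simp only [e]
  rw [kerForm_inner a fun l => π (star (x j) * x k) (a l)]
  congr 1
  simp [Finsupp.linearCombination_apply, Finsupp.sum, map_sum, Pi.map_apply]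

/-- Normality holds at each a i by assumption. It passes to the linear span by the parallelogram
inequality, and to the closure by a bound on the tail of the net that is uniform in the vector. -/
theorem compression_isNormalPos [SqrtStarAlgebra A] {σ : V → V → A →ₗ[ℂ] ℂ} (hσ : IsCPFamily σ)
    (hN : ∀ v y, IsNormalPos (σ v v ∘ₗ LinearMap.mulRight ℂ y ∘ₗ LinearMap.mulLeft ℂ (star y))) {N : A → ℝ}
    {a : ι → E} (ha : Total a) (z : ι → A) (w : ι → V)
    {π : A →ₗ[ℂ] (E →L[ℂ] E)}
    (hπ : ∀ x i j, inner ℂ (a i) (π x (a j)) = σ (w i) (w j) (star (z i) * x * z j))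
    (hn : ∀ x, ‖π x‖ ≤ N x) (η : E) : IsNormalPos (vecFun π η η) := by
  have hpos : ∀ η x, 0 ≤ vecFun π η η (star x * x) := fun η x => by
    have := compression_isCP hσ ha z w hπ (n := 1) (fun _ => x) (fun _ => η)
    simp only [Fin.sum_univ_one] at this
    exact this
  -- Positivity at ζ - ζ' bounds the cross terms.
  have hadd : ∀ ζ ζ' x, 0 ≤ x → (vecFun π (ζ + ζ') (ζ + ζ') x).re
      ≤ 2 * (vecFun π ζ ζ x).re + 2 * (vecFun π ζ' ζ' x).re := fun ζ ζ' x hx => by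
    have h := (Complex.le_def.1 (functional_nonneg (hpos (ζ - ζ')) hx)).1
    simp only [vecFun_apply, map_add, map_sub, inner_add_left, inner_add_right, inner_sub_left,
      inner_sub_right, Complex.add_re, Complex.sub_re, Complex.zero_re] at h ⊢
    linarith
  have hsub : ∀ (D : Set (A)) (s : A), IsLUB D s → ∀ x ∈ D, 0 ≤ s - x :=
    fun D s hs x hx => (SqrtStarAlgebra.sub_nonneg_iff _ _).2 (hs.1 hx)
  have hmono : ∀ ζ (s x y : A), x ≤ y →
      (vecFun π ζ ζ (s - y)).re ≤ (vecFun π ζ ζ (s - x)).re := fun ζ s x y h => by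
    have := (Complex.le_def.1 (functional_mono (hpos ζ) h)).1
    rw [map_sub, map_sub, Complex.sub_re, Complex.sub_re]
    linarith
  let M : Submodule ℂ E :=
    { carrier := {ζ | ∀ D : Set (A), D.Nonempty → DirectedOn (· ≤ ·) D →
        (∀ x ∈ D, IsSelfAdjoint x) → ∀ s, IsLUB D s → ∀ ε > (0 : ℝ),
          ∃ x ∈ D, (vecFun π ζ ζ (s - x)).re < ε}
      add_mem' := fun {ζ ζ'} h h' D hne hdir hsa s hs ε hε => by
        obtain ⟨x, hx, h1⟩ := h D hne hdir hsa s hs (ε / 4) (by positivity)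
        obtain ⟨y, hy, h2⟩ := h' D hne hdir hsa s hs (ε / 4) (by positivity)
        obtain ⟨t, ht, hxt, hyt⟩ := hdir x hx y hy
        refine ⟨t, ht, ?_⟩
        have h3 := hadd ζ ζ' _ (hsub D s hs t ht)
        have h4 := hmono ζ s x t hxt
        have h5 := hmono ζ' s y t hyt
        linarith
      zero_mem' := fun D hne hdir hsa s hs ε hε => by
        obtain ⟨x, hx⟩ := hne
        exact ⟨x, hx, by simpa [vecFun_apply] using hε⟩
      smul_mem' := fun c ζ h D hne hdir hsa s hs ε hε => by
        obtain ⟨x, hx, h1⟩ := h D hne hdir hsa s hs (ε / (‖c‖ ^ 2 + 1)) (by positivity)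
        refine ⟨x, hx, ?_⟩
        have e : (vecFun π (c • ζ) (c • ζ) (s - x)).re = ‖c‖ ^ 2 * (vecFun π ζ ζ (s - x)).re := by
          rw [vecFun_apply, map_smul, inner_smul_left, inner_smul_right, ← mul_assoc,
            ← Complex.normSq_eq_conj_mul_self, Complex.re_ofReal_mul, Complex.normSq_eq_norm_sq]
          rfl
        have h0 := (Complex.le_def.1 (functional_nonneg (hpos ζ) (hsub D s hs x hx))).1
        rw [Complex.zero_re] at h0
        rw [lt_div_iff₀ (by positivity)] at h1
        rw [e]
        nlinarith }
  have hM : ∀ i, a i ∈ M := fun i D hne hdir hsa s hs ε hε => by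
    obtain ⟨x, hx, h⟩ := (hN (w i) (z i)).normal
      D hne hdir hsa s hs ε hε
    refine ⟨x, hx, ?_⟩
    rw [vecFun_apply, hπ]
    exact h
  have hlc : ∀ c, Finsupp.linearCombination ℂ a c ∈ M := fun c => by
    rw [Finsupp.linearCombination_apply]
    exact M.sum_mem fun i _ => M.smul_mem _ (hM i)
  refine ⟨hpos η, fun D hne hdir hsa s hs ε hε => ?_⟩
  -- Fixing x₀ bounds the states of s - x by those of s - x₀ for all x above x₀. With ‖η - ζ‖² <
  -- ε/(4(C+1)), the approximation error 2C‖η - ζ‖² stays below ε/2, and the error at ζ contributes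
  -- another ε/2.
  obtain ⟨x₀, hx₀⟩ := id hne
  set C := N (s - x₀) with hC
  have hC0 : 0 ≤ C := (norm_nonneg _).trans (hn _)
  obtain ⟨c, hc⟩ := ha.denseRange.exists_dist_lt η
    (Real.sqrt_pos.2 (show 0 < ε / (4 * (C + 1)) by positivity))
  set ζ := Finsupp.linearCombination ℂ a c with hζ
  obtain ⟨x₁, hx₁, h1⟩ := hlc c D hne hdir hsa s hs (ε / 4) (by positivity)
  obtain ⟨x, hx, h0x, h1x⟩ := hdir x₀ hx₀ x₁ hx₁
  refine ⟨x, hx, ?_⟩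
  have h2 := hadd ζ (η - ζ) _ (hsub D s hs x hx)
  rw [add_sub_cancel] at h2
  have h3 := hmono ζ s x₁ x h1x
  have h4 := hmono (η - ζ) s x₀ x h0x
  have h5 : (vecFun π (η - ζ) (η - ζ) (s - x₀)).re ≤ C * ‖η - ζ‖ ^ 2 := by
    refine (Complex.re_le_norm _).trans ((norm_inner_le_norm _ _).trans ?_)
    calc _ ≤ ‖η - ζ‖ * (‖π (s - x₀)‖ * ‖η - ζ‖) := by gcongr; exact (π _).le_opNorm _
      _ ≤ ‖η - ζ‖ * (C * ‖η - ζ‖) := by gcongr; exact hn _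
      _ = _ := by ring
  have h6 : ‖η - ζ‖ ^ 2 < ε / (4 * (C + 1)) := by
    rw [dist_eq_norm] at hc
    calc _ < Real.sqrt (ε / (4 * (C + 1))) ^ 2 := pow_lt_pow_left₀ hc (norm_nonneg _) two_ne_zero
      _ = _ := Real.sq_sqrt (by positivity)
  rw [lt_div_iff₀ (by positivity)] at h6
  nlinarith [sq_nonneg ‖η - ζ‖]

end Compression

/-! ### Compressions of completely positive maps -/

section Compression

variable {H : Type*} [NormedAddCommGroup H] [InnerProductSpace ℂ H] [CompleteSpace H]
variable {V : Type*} [AddCommGroup V] [Module ℂ V] [Module (H →L[ℂ] H)ᵐᵒᵖ V]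
variable {K : Type*} [NormedAddCommGroup K] [InnerProductSpace ℂ K] [CompleteSpace K]
variable {Ω : Type*} [MeasurableSpace Ω] {ν : Measure Ω}

theorem IsCP.finset {S : InstrAlg K ν →ₗ[ℂ] SesqForm H V} (hS : IsCP S) {κ : Type*}
    (s : Finset κ) (x : κ → InstrAlg K ν) (v : κ → V) :
    0 ≤ ∑ j ∈ s, ∑ k ∈ s, (S (star (x j) * x k)).1 (v j) (v k) := by
  have h := hS s.card (fun i => x (s.equivFin.symm i)) (fun i => v (s.equivFin.symm i))
  have e : ∑ j ∈ s, ∑ k ∈ s, (S (star (x j) * x k)).1 (v j) (v k)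
      = ∑ j : s, ∑ k : s, (S (star (x j) * x k)).1 (v j) (v k) := by
    rw [← Finset.sum_coe_sort]
    exact Finset.sum_congr rfl fun j _ => (Finset.sum_coe_sort s _).symm
  rw [e]
  convert h using 1
  rw [← Equiv.sum_comp s.equivFin.symm]
  refine Finset.sum_congr rfl fun j _ => ?_
  rw [← Equiv.sum_comp s.equivFin.symm]

/-- The functional `x ↦ ⟨ξ, S_x(v, w) ξ⟩`. -/
def sFun (S : InstrAlg K ν →ₗ[ℂ] SesqForm H V) (ξ : H) (v w : V) : InstrAlg K ν →ₗ[ℂ] ℂ where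
  toFun x := inner ℂ ξ ((S x).1 v w ξ)
  map_add' x y := by
    rw [map_add]
    change inner ℂ ξ (((S x).1 v w + (S y).1 v w) ξ) = _
    rw [add_apply, inner_add_right]
  map_smul' c x := by
    rw [map_smul]
    change inner ℂ ξ ((c • (S x).1 v w) ξ) = _
    rw [smul_apply, inner_smul_right]
    rfl

theorem sFun_apply (S : InstrAlg K ν →ₗ[ℂ] SesqForm H V) (ξ : H) (v w : V) (x : InstrAlg K ν) :
    sFun S ξ v w x = inner ℂ ξ ((S x).1 v w ξ) := rfl

theorem IsCP.posKernel {S : InstrAlg K ν →ₗ[ℂ] SesqForm H V} (hS : IsCP S) (ξ : H) {κ : Type*}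
    (z : κ → InstrAlg K ν) (w : κ → V) :
    PosKernel fun i j => sFun S ξ (w i) (w j) (star (z i) * z j) := fun c => by
  have h := op_nonneg_iff.1 (hS.finset c.support (fun i => c i • z i) w) ξ
  convert h using 1
  simp only [kerForm, Finsupp.sum, sum_apply, inner_sum]
  refine Finset.sum_congr rfl fun i _ => Finset.sum_congr rfl fun j _ => ?_
  rw [← sFun_apply, star_smul, smul_mul_assoc, mul_smul_comm, map_smul, map_smul, smul_eq_mul,
    smul_eq_mul, mul_assoc]
  rfl

theorem IsCP.sFun_pos {S : InstrAlg K ν →ₗ[ℂ] SesqForm H V} (hS : IsCP S) (ξ : H) (v : V)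
    (x : InstrAlg K ν) : 0 ≤ sFun S ξ v v (star x * x) := by
  have h := hS.posKernel ξ (fun _ : Unit => x) (fun _ => v) (Finsupp.single () 1)
  rwa [kerForm_single] at h

theorem IsCP.form_nonneg {S : InstrAlg K ν →ₗ[ℂ] SesqForm H V} (hS : IsCP S) (v : V)
    {x : InstrAlg K ν} (hx : 0 ≤ x) : 0 ≤ (S x).1 v v :=
  op_nonneg_iff.2 fun η => functional_nonneg (hS.sFun_pos η v) hx

/-- The operators S_x(v,v) form an increasing net whose supremum is a weak limit, so order normality
gives convergence of the vector states. -/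
theorem IsCP.isNormalPos {S : InstrAlg K ν →ₗ[ℂ] SesqForm H V} (hS : IsCP S) (ξ : H) (v : V)
    (hN : IsNormalMap fun x => (S x).1 v v) : IsNormalPos (sFun S ξ v v) := by
  refine ⟨hS.sFun_pos ξ v, fun D hne hdir hsa s hs ε hε => ?_⟩
  have hmono : ∀ x y : InstrAlg K ν, x ≤ y → (S x).1 v v ≤ (S y).1 v v := fun x y h =>
    op_le_iff.2 fun η => by
      have := functional_mono (hS.sFun_pos η v) h
      rw [← sub_nonneg] at this
      rwa [sub_apply, inner_sub_right]
  -- A selfadjoint x is the difference of the positive elements x + ‖x‖ and ‖x‖, and S maps positive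
  -- elements to positive operators.
  have hsa' : ∀ x, IsSelfAdjoint x → IsSelfAdjoint ((S x).1 v v) := fun x hx => by
    have e : x = (x + ((‖x.1‖ : ℝ) : ℂ) • 1) - ((‖x.1‖ : ℝ) : ℂ) • (1 : InstrAlg K ν) := by
      rw [add_sub_cancel_right]
    have h1 : (0 : InstrAlg K ν) ≤ ((‖x.1‖ : ℝ) : ℂ) • (1 : InstrAlg K ν) := by
      rw [instrAlg_le_iff, op_le_iff]
      intro η
      change 0 ≤ inner ℂ η ((((‖x.1‖ : ℝ) : ℂ) •
        (1 : HilbertTensor K (Lp ℂ 2 ν) →L[ℂ] HilbertTensor K (Lp ℂ 2 ν)) - 0) η)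
      rw [sub_zero, smul_apply, inner_smul_right, one_apply_eq_self, inner_self_eq_norm_sq_to_K]
      exact mul_nonneg (Complex.zero_le_real.2 (norm_nonneg _))
        ((Complex.zero_le_real.2 (sq_nonneg ‖η‖)).trans_eq (Complex.ofReal_pow _ _))
    have h2 : (0 : InstrAlg K ν) ≤ x + ((‖x.1‖ : ℝ) : ℂ) • 1 := by
      have hx1 : IsSelfAdjoint x.1 := congrArg Subtype.val hx
      have h3 := hx1.neg_algebraMap_norm_le_self
      rw [neg_le_iff_add_nonneg, Algebra.algebraMap_eq_smul_one] at h3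
      rw [instrAlg_le_iff]
      exact h3
    have := (hS.form_nonneg v h2).isSelfAdjoint.sub (hS.form_nonneg v h1).isSelfAdjoint
    rw [e, map_sub]
    exact this
  obtain ⟨_, ⟨x, hx, rfl⟩, h⟩ := exists_approx_of_isLUB (hne.image _)
    (by
      rintro _ ⟨x, hx, rfl⟩ _ ⟨y, hy, rfl⟩
      obtain ⟨z, hz, h1, h2⟩ := hdir x hx y hy
      exact ⟨_, ⟨z, hz, rfl⟩, hmono _ _ h1, hmono _ _ h2⟩)
    (by rintro _ ⟨x, hx, rfl⟩; exact hsa' x (hsa x hx)) (hN D hne hdir hsa s hs) ξ hε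
  refine ⟨x, hx, ?_⟩
  rw [sFun_apply, map_sub]
  exact h

theorem IsCP.isCPFamily {S : InstrAlg K ν →ₗ[ℂ] SesqForm H V} (hS : IsCP S) (ξ : H) :
    IsCPFamily (sFun S ξ) :=
  hS.posKernel ξ Prod.fst Prod.snd

theorem SesqForm.ext_diag {s t : SesqForm H V} (h : ∀ v, s.1 v v = t.1 v v) : s = t := by
  have key : ∀ r : SesqForm H V, (∀ v, r.1 v v = 0) → r = 0 := fun r hr => by
    obtain ⟨h1, h2, -, -⟩ := r.2
    refine Subtype.ext (funext fun v => funext fun w => ?_)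
    have e1 : ∀ c : ℂ, c • r.1 v w + (starRingEnd ℂ c) • r.1 w v = 0 := fun c => by
      have h := hr (v + c • w)
      rw [h2, h1, h1, hr, hr, smul_zero, add_zero, zero_add] at h
      exact h
    have e2 := e1 1
    have e3 := e1 Complex.I
    rw [map_one, one_smul, one_smul] at e2
    rw [Complex.conj_I, neg_smul, ← sub_eq_add_neg, ← smul_sub, smul_eq_zero,
      or_iff_right Complex.I_ne_zero, sub_eq_zero] at e3
    rw [← e3, ← two_smul ℂ, smul_eq_zero, or_iff_right two_ne_zero] at e2
    exact e2
  rw [← sub_eq_zero]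
  refine key _ fun v => ?_
  change s.1 v v - t.1 v v = 0
  rw [h, sub_self]

/-- Polarisation in V and in H reduces the claim to the scalar functionals ⟨ξ, S_x(v,v)ξ⟩, which are
normal and positive. -/
theorem SesqForm.ext_of_normal [SigmaFinite ν] {S T : InstrAlg K ν →ₗ[ℂ] SesqForm H V}
    (hS : IsCP S) (hT : IsCP T)
    (hSn : ∀ v, IsNormalMap fun x => (S x).1 v v) (hTn : ∀ v, IsNormalMap fun x => (T x).1 v v)
    (h : ∀ b f, S (elem b f) = T (elem b f)) : S = T := by
  refine LinearMap.ext fun x => SesqForm.ext_diag fun v => op_eq_of_inner_self fun ξ => ?_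
  have := IsNormalPos.ext (hS.isNormalPos ξ v (hSn v)) (hT.isNormalPos ξ v (hTn v))
    fun b f => by rw [sFun_apply, sFun_apply, h]
  exact congrArg (fun φ : InstrAlg K ν →ₗ[ℂ] ℂ => φ x) this

variable {E : Type*} [NormedAddCommGroup E] [InnerProductSpace ℂ E] [CompleteSpace E]
variable {ι : Type*}

/-- The compression to the Hilbert space generated by the vectors `a i`. -/
theorem exists_compression {S : InstrAlg K ν →ₗ[ℂ] SesqForm H V} (hS : IsCP S)
    (hN : ∀ v, IsNormalMap fun x => (S x).1 v v) (ξ : H)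
    {a : ι → E} (ha : Total a) (z : ι → InstrAlg K ν) (w : ι → V)
    (hg : ∀ i j, inner ℂ (a i) (a j) = sFun S ξ (w i) (w j) (star (z i) * z j)) :
    ∃ π : InstrAlg K ν →ₗ[ℂ] (E →L[ℂ] E),
      (∀ x i j, inner ℂ (a i) (π x (a j)) = sFun S ξ (w i) (w j) (star (z i) * x * z j)) ∧
      (∀ x, ‖π x‖ ≤ ‖x.1‖) ∧
      (∀ (n : ℕ) (x : Fin n → InstrAlg K ν) (η : Fin n → E),
        0 ≤ ∑ j, ∑ k, inner ℂ (η j) (π (star (x j) * x k) (η k))) ∧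
      ∀ η, IsNormalPos (vecFun π η η) := by
  obtain ⟨π, h1, h2⟩ := exists_compression_map (hS.isCPFamily ξ) (N := fun x => ‖x.1‖)
    (fun x => norm_nonneg _) exists_sub_eq_star_mul_self ha z w hg
  exact ⟨π, h1, h2, fun n x η => compression_isCP (hS.isCPFamily ξ) ha z w h1 x η,
    compression_isNormalPos (hS.isCPFamily ξ)
      (fun v y => (hS.isNormalPos ξ v (hN v)).conj y) ha z w h1 h2⟩

end Compression

/-! ### Cholesky decomposition of positive kernels on `ℕ` -/

section Cholesky

/-- The `r`-th Schur complement. -/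
def schur (a : ℕ → ℕ → ℂ) : ℕ → ℕ → ℕ → ℂ
  | 0 => a
  | r + 1 => fun i j => schur a r i j - schur a r i r * schur a r r j / schur a r r r

theorem PosKernel.diag_nonneg {a : ℕ → ℕ → ℂ} (ha : PosKernel a) (r : ℕ) : 0 ≤ a r r := by
  have := ha (Finsupp.single r 1)
  rwa [kerForm_single] at this

theorem PosKernel.conj_apply {a : ℕ → ℕ → ℂ} (ha : PosKernel a) (i j : ℕ) :
    starRingEnd ℂ (a j i) = a i j := by
  have := ha.conj_symm (Finsupp.single i 1) (Finsupp.single j 1)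
  rwa [kerForm_single, kerForm_single] at this

theorem PosKernel.eq_zero_of_diag {a : ℕ → ℕ → ℂ} (ha : PosKernel a) {r : ℕ} (h : a r r = 0)
    (i : ℕ) : a i r = 0 := by
  have := ha.cauchy_schwarz (Finsupp.single i 1) (Finsupp.single r 1)
  rw [kerForm_single, kerForm_single, kerForm_single, h, Complex.zero_re, mul_zero] at this
  exact norm_eq_zero.1 (pow_eq_zero_iff two_ne_zero |>.1 (le_antisymm this (sq_nonneg _)))

theorem kerForm_single_right (a : ℕ → ℕ → ℂ) (c : ℕ →₀ ℂ) (r : ℕ) :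
    kerForm a c (Finsupp.single r 1) = c.sum fun i z => starRingEnd ℂ z * a i r := by
  simp [kerForm]

/-- One elimination step subtracts |b(c, e_r)|²/b_rr from b(c,c), which Cauchy-Schwarz allows. A
zero pivot causes no trouble: division by zero gives 0, so nothing is subtracted. -/
theorem PosKernel.schur {a : ℕ → ℕ → ℂ} (ha : PosKernel a) (r : ℕ) :
    PosKernel (schur a r) := by
  induction r with
  | zero => exact ha
  | succ r ih =>
    intro c
    set b := CovInstr.schur a r with hb
    change 0 ≤ kerForm (fun i j => b i j - b i r * b r j / b r r) c c
    have e : kerForm (fun i j => b i j - b i r * b r j / b r r) c c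
        = kerForm b c c - kerForm b c (Finsupp.single r 1) *
            starRingEnd ℂ (kerForm b c (Finsupp.single r 1)) / b r r := by
      rw [kerForm_single_right]
      simp only [kerForm, Finsupp.sum, map_sum, map_mul, ih.conj_apply, Finset.sum_mul_sum,
        Finset.sum_div, ← Finset.sum_sub_distrib, Complex.conj_conj]
      refine Finset.sum_congr rfl fun i _ => Finset.sum_congr rfl fun j _ => ?_
      ring
    rw [e, Complex.mul_conj, Complex.normSq_eq_norm_sq]
    have h1 := ih.cauchy_schwarz c (Finsupp.single r 1)
    rw [kerForm_single] at h1
    have h2 := ih c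
    have h3 := ih.diag_nonneg r
    rw [Complex.eq_re_of_ofReal_le h2, Complex.eq_re_of_ofReal_le h3,
      ← Complex.ofReal_div, ← Complex.ofReal_sub, Complex.zero_le_real, sub_nonneg]
    exact div_le_of_le_mul₀ (Complex.le_def.1 h3).1 (Complex.le_def.1 h2).1 h1

/-- Step i clears row and column i, and later steps keep them zero. If the pivot vanishes,
positivity already forces its row and column to vanish. -/
theorem schur_eq_zero {a : ℕ → ℕ → ℂ} (ha : PosKernel a) (r i j : ℕ) (h : i < r ∨ j < r) :
    schur a r i j = 0 := by
  have key : ∀ r i j, i < r → schur a r i j = 0 ∧ schur a r j i = 0 := by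
    intro r
    induction r with
    | zero => intro i j h; omega
    | succ r ih =>
      intro i j h
      change schur a r i j - schur a r i r * schur a r r j / schur a r r r = 0 ∧
        schur a r j i - schur a r j r * schur a r r i / schur a r r r = 0
      rcases Nat.lt_succ_iff_lt_or_eq.1 h with h | rfl
      · simp [ih i j h, ih i r h]
      · by_cases h0 : schur a i i i = 0
        · have h1 := (ha.schur i).eq_zero_of_diag h0 j
          have h2 : schur a i i j = 0 := by
            rw [← (ha.schur i).conj_apply, h1, map_zero]
          simp [h1, h2]
        · field_simp
          simp
  rcases h with h | h
  · exact (key r i j h).1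
  · exact (key r j i h).2

/-- The rows of the Cholesky factor. -/
def chol (a : ℕ → ℕ → ℂ) (r i : ℕ) : ℂ :=
  schur a r r i / ((Real.sqrt (schur a r r r).re : ℝ) : ℂ)

theorem chol_eq_zero {a : ℕ → ℕ → ℂ} (ha : PosKernel a) {r i : ℕ} (h : i < r) :
    chol a r i = 0 := by
  rw [chol, schur_eq_zero ha r r i (Or.inr h), zero_div]

theorem chol_eq_zero_of_diag {a : ℕ → ℕ → ℂ} {r : ℕ} (h : schur a r r r = 0) (i : ℕ) :
    chol a r i = 0 := by
  rw [chol, h, Complex.zero_re, Real.sqrt_zero, Complex.ofReal_zero, div_zero]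

theorem chol_diag_ne_zero {a : ℕ → ℕ → ℂ} (ha : PosKernel a) {r : ℕ} (h : schur a r r r ≠ 0) :
    chol a r r ≠ 0 := by
  have h3 := (ha.schur r).diag_nonneg r
  have e := Complex.eq_re_of_ofReal_le h3
  have h4 : (schur a r r r).re ≠ 0 := fun h0 => h (by rw [e, h0, Complex.ofReal_zero])
  refine div_ne_zero h (Complex.ofReal_ne_zero.2 (Real.sqrt_ne_zero'.2 ?_))
  exact lt_of_le_of_ne (Complex.le_def.1 h3).1 (Ne.symm h4)

/-- The r-th summand is the difference of two successive Schur complements, so the sum telescopes;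
after N > i steps row i has been cleared. -/
theorem sum_chol {a : ℕ → ℕ → ℂ} (ha : PosKernel a) {i j N : ℕ} (h : i < N) :
    ∑ r ∈ Finset.range N, starRingEnd ℂ (chol a r i) * chol a r j = a i j := by
  have key : ∀ R, ∑ r ∈ Finset.range R, starRingEnd ℂ (chol a r i) * chol a r j
      = a i j - schur a R i j := by
    intro R
    induction R with
    | zero => simp [schur]
    | succ R ih =>
      rw [Finset.sum_range_succ, ih]
      change _ = a i j - (schur a R i j - schur a R i R * schur a R R j / schur a R R R)
      have h3 := (ha.schur R).diag_nonneg R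
      have e := Complex.eq_re_of_ofReal_le h3
      rw [chol, chol, map_div₀, (ha.schur R).conj_apply, Complex.conj_ofReal, div_mul_div_comm,
        ← Complex.ofReal_mul, Real.mul_self_sqrt (Complex.le_def.1 h3).1, ← e]
      ring
  rw [key, schur_eq_zero ha N i j (Or.inl h), sub_zero]

open Classical in
/-- The position of the index `r` among the non-zero pivots. -/
def pivotCount (a : ℕ → ℕ → ℂ) (r : ℕ) : ℕ :=
  ∑ s ∈ Finset.range r, if schur a s s s = 0 then 0 else 1

/-- The number of non-zero pivots. -/
def pivotRank (a : ℕ → ℕ → ℂ) : ℕ∞ := ⨆ r, (pivotCount a r : ℕ∞)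

theorem pivotCount_succ (a : ℕ → ℕ → ℂ) {r : ℕ} (h : schur a r r r ≠ 0) :
    pivotCount a (r + 1) = pivotCount a r + 1 := by
  rw [pivotCount, Finset.sum_range_succ, if_neg h]; rfl

theorem pivotCount_succ' (a : ℕ → ℕ → ℂ) {r : ℕ} (h : schur a r r r = 0) :
    pivotCount a (r + 1) = pivotCount a r := by
  rw [pivotCount, Finset.sum_range_succ, if_pos h]; rfl

theorem pivotCount_mono (a : ℕ → ℕ → ℂ) : Monotone (pivotCount a) :=
  monotone_nat_of_le_succ fun r => by
    rw [pivotCount, pivotCount, Finset.sum_range_succ]; exact Nat.le_add_right _ _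

theorem pivotCount_lt (a : ℕ → ℕ → ℂ) {r s : ℕ} (h : schur a r r r ≠ 0) (hrs : r < s) :
    pivotCount a r < pivotCount a s := by
  have := pivotCount_mono a hrs
  rw [Nat.succ_eq_add_one, pivotCount_succ a h] at this
  omega

theorem pivotCount_inj (a : ℕ → ℕ → ℂ) {r s : ℕ} (hr : schur a r r r ≠ 0)
    (hs : schur a s s s ≠ 0) (h : pivotCount a r = pivotCount a s) : r = s := by
  rcases lt_trichotomy r s with h' | h' | h'
  · exact absurd h (pivotCount_lt a hr h').ne
  · exact h'
  · exact absurd h (pivotCount_lt a hs h').ne'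

theorem pivotCount_lt_rank (a : ℕ → ℕ → ℂ) {r : ℕ} (h : schur a r r r ≠ 0) :
    (pivotCount a r : ℕ∞) < pivotRank a := by
  refine lt_of_lt_of_le ?_ (le_iSup (fun r => (pivotCount a r : ℕ∞)) (r + 1))
  rw [pivotCount_succ a h]
  exact_mod_cast Nat.lt_succ_self _

theorem exists_pivot (a : ℕ → ℕ → ℂ) {k : ℕ} (h : (k : ℕ∞) < pivotRank a) :
    ∃ r, schur a r r r ≠ 0 ∧ pivotCount a r = k := by
  obtain ⟨R, hR⟩ := lt_iSup_iff.1 h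
  replace hR : k < pivotCount a R := by exact_mod_cast hR
  clear h
  induction R with
  | zero => simp [pivotCount] at hR
  | succ R ih =>
    by_cases h0 : schur a R R R = 0
    · rw [pivotCount_succ' a h0] at hR
      exact ih hR
    · rw [pivotCount_succ a h0] at hR
      rcases Nat.lt_succ_iff_lt_or_eq.1 hR with h | h
      · exact ih h
      · exact ⟨R, h0, h.symm⟩

/-- Vectors in `ℓ²` with Gram matrix `a`. -/
def cholVec (a : ℕ → ℕ → ℂ) (i : ℕ) : Ell2 :=
  ∑ r ∈ Finset.range (i + 1), lp.single 2 (pivotCount a r) (chol a r i)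

theorem inner_single_single (k l : ℕ) (x y : ℂ) :
    inner ℂ (lp.single 2 k x : Ell2) (lp.single 2 l y) = if k = l then starRingEnd ℂ x * y else 0 := by
  rw [lp.inner_single_left, lp.single_apply]
  split_ifs with h
  · subst h
    simp [mul_comm]
  · rw [Pi.single_eq_of_ne h, inner_zero_right]

/-- Distinct non-zero pivots are placed at distinct coordinates. The coordinate of a zero pivot may
coincide with another one, but its Cholesky row is zero. -/
theorem inner_cholVec {a : ℕ → ℕ → ℂ} (ha : PosKernel a) (i j : ℕ) :
    inner ℂ (cholVec a i) (cholVec a j) = a i j := by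
  have e : ∀ r s, inner ℂ (lp.single 2 (pivotCount a r) (chol a r i) : Ell2)
      (lp.single 2 (pivotCount a s) (chol a s j))
      = if r = s then starRingEnd ℂ (chol a r i) * chol a r j else 0 := fun r s => by
    rw [inner_single_single]
    by_cases hr : schur a r r r = 0
    · simp [chol_eq_zero_of_diag hr]
    by_cases hs : schur a s s s = 0
    · rw [chol_eq_zero_of_diag hs]
      split_ifs with _ h1
      · subst h1; exact absurd hs hr
      · simp
      · exact absurd (by subst_vars; exact hs) hr
      · rfl
    · by_cases h : r = s
      · subst h; simp
      · rw [if_neg h, if_neg fun h' => h (pivotCount_inj a hr hs h')]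
  rw [cholVec, cholVec, sum_inner]
  simp only [inner_sum, e]
  rw [← sum_chol ha (j := j) (Nat.lt_succ_self i)]
  refine Finset.sum_congr rfl fun r _ => ?_
  rw [Finset.sum_ite_eq]
  split_ifs with h
  · rfl
  · rw [chol_eq_zero ha (i := j) (by simpa using h), mul_zero]

theorem cholVec_mem (a : ℕ → ℕ → ℂ) (i : ℕ) : cholVec a i ∈ Fiber (pivotRank a) := by
  refine Submodule.sum_mem _ fun r _ k hk => ?_
  by_cases h : schur a r r r = 0
  · rw [chol_eq_zero_of_diag h, lp.single_apply, Pi.single_zero]; rfl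
  · have h1 := pivotCount_lt_rank a h
    have h2 : k ≠ pivotCount a r := by
      rintro rfl; exact absurd hk h1.not_ge
    rw [lp.single_apply, Pi.single_eq_of_ne h2]

/-- The Cholesky factor is triangular with non-zero diagonal at the pivots, so the coordinates of x
vanish one after the other. Skipping zero pivots makes the coordinates used exactly those below
`pivotRank`, which gives minimality in each fibre. -/
theorem eq_zero_of_inner_cholVec {a : ℕ → ℕ → ℂ} (ha : PosKernel a) {x : Ell2}
    (hx : x ∈ Fiber (pivotRank a)) (h : ∀ i, inner ℂ (cholVec a i) x = 0) : x = 0 := by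
  have key : ∀ r, schur a r r r ≠ 0 → x (pivotCount a r) = 0 := by
    intro r
    induction r using Nat.strong_induction_on with
    | _ r ih =>
      intro hr
      have h1 := h r
      rw [cholVec, sum_inner, Finset.sum_range_succ, Finset.sum_eq_zero, zero_add,
        lp.inner_single_left] at h1
      · rw [RCLike.inner_apply, mul_eq_zero] at h1
        exact h1.resolve_right fun h2 => chol_diag_ne_zero ha hr (by simpa using h2)
      · intro s hs
        rw [lp.inner_single_left]
        by_cases h0 : schur a s s s = 0
        · rw [chol_eq_zero_of_diag h0, inner_zero_left]
        · rw [ih s (by simpa using hs) h0, inner_zero_right]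
  refine lp.ext (funext fun k => ?_)
  by_cases hk : pivotRank a ≤ k
  · exact hx k hk
  · obtain ⟨r, hr, rfl⟩ := exists_pivot a (not_le.1 hk)
    exact key r hr

end Cholesky

section Density

variable {Ω : Type*} [MeasurableSpace Ω] {ν : Measure Ω}

/-! ### Measurability of the Cholesky decomposition -/

theorem measurable_schur {h : ℕ → ℕ → Ω → ℂ} (hh : ∀ i j, Measurable (h i j)) (r i j : ℕ) :
    Measurable fun ω => schur (fun i j => h i j ω) r i j := by
  induction r generalizing i j with
  | zero => exact hh i j
  | succ r ih => exact (ih i j).sub (((ih i r).mul (ih r j)).div (ih r r))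

theorem measurable_chol {h : ℕ → ℕ → Ω → ℂ} (hh : ∀ i j, Measurable (h i j)) (r i : ℕ) :
    Measurable fun ω => chol (fun i j => h i j ω) r i :=
  (measurable_schur hh r r i).div (Complex.measurable_ofReal.comp
    (Complex.measurable_re.comp (measurable_schur hh r r r)).sqrt)

theorem measurable_pivotCount {h : ℕ → ℕ → Ω → ℂ} (hh : ∀ i j, Measurable (h i j)) (r : ℕ) :
    Measurable fun ω => pivotCount (fun i j => h i j ω) r :=
  Finset.measurable_fun_sum _ fun s _ => Measurable.ite
    (measurable_schur hh s s s (measurableSet_singleton 0)) measurable_const measurable_const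

theorem measurable_pivotRank {h : ℕ → ℕ → Ω → ℂ} (hh : ∀ i j, Measurable (h i j)) :
    Measurable fun ω => pivotRank (fun i j => h i j ω) := by
  have hlt : ∀ k : ℕ, MeasurableSet {ω | (k : ℕ∞) < pivotRank (fun i j => h i j ω)} := fun k => by
    simp only [pivotRank, lt_iSup_iff, Nat.cast_lt, Set.ofPred_exists]
    exact MeasurableSet.iUnion fun r => measurableSet_lt measurable_const
      (measurable_pivotCount hh r)
  refine ENat.measurable_iff.2 fun k => ?_
  have : (fun ω => pivotRank (fun i j => h i j ω)) ⁻¹' {(k : ℕ∞)}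
      = {ω | (k : ℕ∞) < pivotRank (fun i j => h i j ω)}ᶜ ∩
        ⋂ l ∈ Set.Iio k, {ω | (l : ℕ∞) < pivotRank (fun i j => h i j ω)} := by
    ext ω
    simp only [Set.mem_preimage, Set.mem_singleton_iff, Set.mem_inter_iff, Set.mem_compl_iff,
      Set.mem_ofPred_eq, not_lt, Set.mem_iInter, Set.mem_Iio]
    refine ⟨fun h => ⟨h.le, fun l hl => by rw [h]; exact_mod_cast hl⟩, fun ⟨h1, h2⟩ => ?_⟩
    refine h1.antisymm (not_lt.1 fun h3 => ?_)
    obtain ⟨l, hl⟩ := ENat.ne_top_iff_exists.1 (h3.trans_le le_top).ne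
    rw [← hl] at h3
    exact absurd (h2 l (by exact_mod_cast h3)) (by rw [← hl]; exact lt_irrefl _)
  rw [this]
  exact (hlt k).compl.inter (MeasurableSet.biInter (Set.to_countable _) fun l _ => hlt l)

theorem stronglyMeasurable_cholVec {h : ℕ → ℕ → Ω → ℂ} (hh : ∀ i j, Measurable (h i j)) (i : ℕ) :
    StronglyMeasurable fun ω => cholVec (fun i j => h i j ω) i := by
  refine Finset.stronglyMeasurable_fun_sum _ fun r _ => ?_
  have hc : Continuous fun p : ℕ × ℂ => (lp.single 2 p.1 p.2 : Ell2) := by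
    refine continuous_prod_of_discrete_left.2 fun k => ?_
    exact (lp.isometry_single (E := fun _ : ℕ => ℂ) (p := 2) k).continuous
  exact hc.comp_stronglyMeasurable
    ((measurable_pivotCount hh r).stronglyMeasurable.prodMk (measurable_chol hh r i).stronglyMeasurable)

/-! ### Densities of normal positive operator measures -/

variable {E : Type*} [NormedAddCommGroup E] [InnerProductSpace ℂ E] [CompleteSpace E]

/-- Simple functions are dense in the L^∞ norm, since an essentially bounded function takes almost
all values in a compact ball. -/
theorem linfty_mem_of_ind {M : Submodule ℂ (Lp ℂ ∞ ν)} (hc : IsClosed (M : Set (Lp ℂ ∞ ν)))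
    (hM : ∀ X (hX : MeasurableSet X), linftyInd ν hX ∈ M) (f : Lp ℂ ∞ ν) : f ∈ M := by
  have hs : ∀ (s : SimpleFunc Ω ℂ) (g : Lp ℂ ∞ ν), g =ᵐ[ν] s → g ∈ M := by
    intro s
    induction s using SimpleFunc.induction with
    | @const c X hX =>
      intro g hg
      have : g = c • linftyInd ν hX := by
        refine Lp.ext ?_
        filter_upwards [hg, Lp.coeFn_smul c (linftyInd ν hX), linftyInd_coeFn (ν := ν) hX]
          with ω h1 h2 h3
        rw [h1, h2, Pi.smul_apply, h3]
        by_cases h : ω ∈ X <;> simp [h]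
      rw [this]
      exact M.smul_mem _ (hM X hX)
    | @add s t _ hs ht =>
      intro g hg
      have hs' := s.memLp_top ν
      have ht' := t.memLp_top ν
      have : g = hs'.toLp s + ht'.toLp t := by
        refine Lp.ext ?_
        filter_upwards [hg, Lp.coeFn_add (hs'.toLp s) (ht'.toLp t), hs'.coeFn_toLp,
          ht'.coeFn_toLp] with ω h1 h2 h3 h4
        rw [h1, h2, Pi.add_apply, h3, h4]; rfl
      rw [this]
      exact M.add_mem (hs _ hs'.coeFn_toLp) (ht _ ht'.coeFn_toLp)
  have hfm : Measurable f := (Lp.stronglyMeasurable f).measurable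
  rw [← SetLike.mem_coe, ← hc.closure_eq, Metric.mem_closure_iff]
  intro ε hε
  -- Finitely many points of the dense sequence come within ε/2 of the whole ball, so rounding to
  -- the nearest of them is uniformly accurate.
  obtain ⟨t, ht⟩ := (isCompact_closedBall (0 : ℂ) ‖f‖).elim_finite_subcover
    (fun k => Metric.ball (TopologicalSpace.denseSeq ℂ k) (ε / 2)) (fun _ => Metric.isOpen_ball) fun z _ => by
      obtain ⟨k, hk⟩ := (TopologicalSpace.denseRange_denseSeq ℂ).exists_dist_lt z (half_pos hε)
      exact Set.mem_iUnion.2 ⟨k, hk⟩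
  let N := t.sup id
  let s : SimpleFunc Ω ℂ := (SimpleFunc.nearestPt (TopologicalSpace.denseSeq ℂ) N).comp f hfm
  have hs' := s.memLp_top ν
  refine ⟨hs'.toLp s, hs s _ hs'.coeFn_toLp, ?_⟩
  rw [dist_eq_norm]
  refine lt_of_le_of_lt (linfty_norm_le (half_pos hε).le ?_) (half_lt_self hε)
  filter_upwards [Lp.coeFn_sub f (hs'.toLp s), hs'.coeFn_toLp, linfty_ae_le_norm f] with ω h1 h2 h3
  rw [h1, Pi.sub_apply, h2, ← dist_eq_norm]
  obtain ⟨k, hk, hk'⟩ := Set.mem_iUnion₂.1 (ht (mem_closedBall_zero_iff.2 h3))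
  have h4 := SimpleFunc.edist_nearestPt_le (TopologicalSpace.denseSeq ℂ) (f ω) (Finset.le_sup (f := id) hk)
  rw [edist_dist, edist_dist, ENNReal.ofReal_le_ofReal_iff dist_nonneg] at h4
  rw [dist_comm]
  refine h4.trans ?_
  rw [dist_comm]
  exact (Metric.mem_ball.1 hk').le

theorem linfty_functional_ext {φ ψ : Lp ℂ ∞ ν →L[ℂ] ℂ}
    (h : ∀ X (hX : MeasurableSet X), φ (linftyInd ν hX) = ψ (linftyInd ν hX)) : φ = ψ :=
  ContinuousLinearMap.ext fun f =>
    linfty_mem_of_ind (M := LinearMap.eqLocus (φ : Lp ℂ ∞ ν →ₗ[ℂ] ℂ) (ψ : Lp ℂ ∞ ν →ₗ[ℂ] ℂ))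
      (isClosed_eq φ.continuous ψ.continuous) h f

theorem integrable_linfty_mul (f : Lp ℂ ∞ ν) {h : Ω → ℂ} (hh : Integrable h ν) :
    Integrable (fun ω => f ω * h ω) ν :=
  hh.bdd_mul (Lp.aestronglyMeasurable f) (linfty_ae_le_norm f)

/-- The functional `f ↦ ∫ f h dν` on `L^∞(ν)`. -/
def densityFunctional {h : Ω → ℂ} (hh : Integrable h ν) : Lp ℂ ∞ ν →L[ℂ] ℂ :=
  LinearMap.mkContinuous
    { toFun f := ∫ ω, f ω * h ω ∂ν
      map_add' f g := by
        rw [← integral_add (integrable_linfty_mul f hh) (integrable_linfty_mul g hh)]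
        refine integral_congr_ae ?_
        filter_upwards [Lp.coeFn_add f g] with ω h1
        rw [h1, Pi.add_apply, add_mul]
      map_smul' c f := by
        rw [RingHom.id_apply, ← integral_smul]
        refine integral_congr_ae ?_
        filter_upwards [Lp.coeFn_smul c f] with ω h1
        rw [h1, Pi.smul_apply, smul_mul_assoc] }
    (∫ ω, ‖h ω‖ ∂ν) fun f => by
      rw [mul_comm, ← integral_const_mul]
      refine (norm_integral_le_integral_norm _).trans (integral_mono_ae
        (integrable_linfty_mul f hh).norm (hh.norm.const_mul _) ?_)
      filter_upwards [linfty_ae_le_norm f] with ω h1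
      simp only [norm_mul]
      gcongr

theorem densityFunctional_apply {h : Ω → ℂ} (hh : Integrable h ν) (f : Lp ℂ ∞ ν) :
    densityFunctional hh f = ∫ ω, f ω * h ω ∂ν := rfl

theorem integral_linftyInd_mul {X : Set Ω} (hX : MeasurableSet X) (h : Ω → ℂ) :
    ∫ ω, linftyInd ν hX ω * h ω ∂ν = ∫ ω in X, h ω ∂ν := by
  rw [← integral_indicator hX]
  refine integral_congr_ae ?_
  filter_upwards [linftyInd_coeFn (ν := ν) hX] with ω h1
  rw [h1]
  by_cases hω : ω ∈ X <;> simp [hω]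

/-- Normal positive contractive `B(E)`-valued maps on `L^∞(ν)`. -/
structure IsNormalPOM (P : Lp ℂ ∞ ν →ₗ[ℂ] (E →L[ℂ] E)) : Prop where
  pos : ∀ f k, 0 ≤ inner ℂ k (P (linftyMul (star f) f) k)
  norm_le : ∀ f, ‖P f‖ ≤ ‖f‖
  normal : ∀ (X : ℕ → Set Ω) (hX : ∀ i, MeasurableSet (X i)), Monotone X → ∀ (k : E), ∀ ε > (0 : ℝ),
    ∃ i, (inner ℂ k (P (linftyInd ν (MeasurableSet.iUnion hX) - linftyInd ν (hX i)) k)).re < ε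

/-- The continuous functional `f ↦ ⟨k, P(f) l⟩`. -/
def IsNormalPOM.functional {P : Lp ℂ ∞ ν →ₗ[ℂ] (E →L[ℂ] E)} (hP : IsNormalPOM P) (k l : E) :
    Lp ℂ ∞ ν →L[ℂ] ℂ :=
  LinearMap.mkContinuous
    { toFun f := inner ℂ k (P f l)
      map_add' f g := by rw [map_add, add_apply, inner_add_right]
      map_smul' c f := by rw [map_smul, smul_apply, inner_smul_right]; rfl }
    (‖k‖ * ‖l‖) fun f => by
      refine (norm_inner_le_norm _ _).trans ?_
      calc ‖k‖ * ‖P f l‖ ≤ ‖k‖ * (‖f‖ * ‖l‖) := by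
            gcongr
            exact ((P f).le_opNorm l).trans (by gcongr; exact hP.norm_le f)
        _ = _ := by ring

theorem linftyMul_star_ind {X : Set Ω} (hX : MeasurableSet X) :
    linftyMul (star (linftyInd ν hX)) (linftyInd ν hX) = linftyInd ν hX := by
  refine Lp.ext ?_
  filter_upwards [linftyMul_coeFn (star (linftyInd ν hX)) (linftyInd ν hX),
    linftyStar_coeFn (linftyInd ν hX), linftyInd_coeFn (ν := ν) hX] with ω h1 h2 h3
  rw [h1, h2, h3]
  by_cases h : ω ∈ X <;> simp [h]

theorem linftyInd_union {X Y : Set Ω} (hX : MeasurableSet X) (hY : MeasurableSet Y)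
    (h : Disjoint X Y) (hXY : MeasurableSet (X ∪ Y)) :
    linftyInd ν hXY = linftyInd ν hX + linftyInd ν hY := by
  refine Lp.ext ?_
  filter_upwards [Lp.coeFn_add (linftyInd ν hX) (linftyInd ν hY), linftyInd_coeFn (ν := ν) hX,
    linftyInd_coeFn (ν := ν) hY, linftyInd_coeFn (ν := ν) hXY] with ω h1 h2 h3 h4
  rw [h1, Pi.add_apply, h2, h3, h4]
  have : ω ∈ X → ω ∉ Y := fun h1 h2 => Set.disjoint_left.1 h h1 h2
  by_cases hx : ω ∈ X <;> by_cases hy : ω ∈ Y <;> simp_all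

theorem linftyInd_of_null {X : Set Ω} (hX : MeasurableSet X) (h : ν X = 0) :
    linftyInd ν hX = 0 := by
  refine Lp.ext ?_
  have h' : ∀ᵐ ω ∂ν, ω ∉ X := measure_eq_zero_iff_ae_notMem.1 h
  filter_upwards [linftyInd_coeFn (ν := ν) hX, Lp.coeFn_zero ℂ ∞ ν, h'] with ω h1 h2 h3
  rw [h1, h2, Set.indicator_of_notMem h3, Pi.zero_apply]

theorem linftyInd_sub {X Y : Set Ω} (hX : MeasurableSet X) (hY : MeasurableSet Y) (h : X ⊆ Y) :
    linftyInd ν hY - linftyInd ν hX = linftyInd ν (hY.diff hX) := by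
  have e : X ∪ Y \ X = Y := Set.union_sdiff_cancel h
  have := linftyInd_union (ν := ν) hX (hY.diff hX) Set.disjoint_sdiff_right (by rwa [e])
  simp only [e] at this
  rw [this, add_sub_cancel_left]

section

variable {P : Lp ℂ ∞ ν →ₗ[ℂ] (E →L[ℂ] E)}

theorem IsNormalPOM.ind_nonneg (hP : IsNormalPOM P) (k : E) {X : Set Ω} (hX : MeasurableSet X) :
    0 ≤ inner ℂ k (P (linftyInd ν hX) k) := by
  have := hP.pos (linftyInd ν hX) k
  rwa [linftyMul_star_ind] at this

/-- Countable additivity is normality along the increasing sequence of partial unions, together with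
monotonicity. -/
theorem IsNormalPOM.hasSum (hP : IsNormalPOM P) (k : E) {X : ℕ → Set Ω}
    (hX : ∀ i, MeasurableSet (X i)) (hd : Pairwise (Function.onFun Disjoint X)) :
    HasSum (fun i => (inner ℂ k (P (linftyInd ν (hX i)) k)).re)
      (inner ℂ k (P (linftyInd ν (MeasurableSet.iUnion hX)) k)).re := by
  have h0 : ∀ {Y : Set Ω} (hY : MeasurableSet Y), 0 ≤ (inner ℂ k (P (linftyInd ν hY) k)).re :=
    fun hY => (Complex.le_def.1 (hP.ind_nonneg k hY)).1
  have hpm : ∀ N, MeasurableSet (Set.accumulate X N) := fun N =>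
    MeasurableSet.biUnion (Set.to_countable _) fun i _ => hX i
  have hs : ∀ N, ∑ i ∈ Finset.range (N + 1), (inner ℂ k (P (linftyInd ν (hX i)) k)).re
      = (inner ℂ k (P (linftyInd ν (hpm N)) k)).re := by
    intro N
    induction N with
    | zero => simp [Set.accumulate_zero_nat]
    | succ N ih =>
      have hdis : Disjoint (Set.accumulate X N) (X (N + 1)) :=
        Set.disjoint_accumulate hd (Nat.lt_succ_self N)
      have e := linftyInd_union (ν := ν) (hpm N) (hX (N + 1)) hdis ((hpm N).union (hX _))
      have e2 : Set.accumulate X (N + 1) = Set.accumulate X N ∪ X (N + 1) :=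
        Set.accumulate_succ X N
      simp only [e2]
      rw [Finset.sum_range_succ, ih, e, map_add, add_apply, inner_add_right, Complex.add_re]
  rw [hasSum_iff_tendsto_nat_of_nonneg fun i => h0 (hX i), Metric.tendsto_atTop]
  intro ε hε
  have hU : ⋃ N, Set.accumulate X N = ⋃ N, X N := Set.iUnion_accumulate
  obtain ⟨N, hN⟩ := hP.normal (Set.accumulate X) hpm Set.monotone_accumulate k ε hε
  simp only [hU] at hN
  refine ⟨N + 1, fun n hn => ?_⟩
  obtain ⟨n, rfl⟩ : ∃ m, n = m + 1 := ⟨n - 1, by omega⟩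
  have hs1 : Set.accumulate X n ⊆ ⋃ N, X N := hU ▸ Set.subset_iUnion (Set.accumulate X) n
  have hs2 : Set.accumulate X N ⊆ Set.accumulate X n := Set.monotone_accumulate (by omega)
  have h1 := h0 ((MeasurableSet.iUnion hX).diff (hpm n))
  have h2 := h0 ((hpm n).diff (hpm N))
  rw [← linftyInd_sub (hpm n) (MeasurableSet.iUnion hX) hs1, map_sub, sub_apply, inner_sub_right, Complex.sub_re] at h1
  rw [← linftyInd_sub (hpm N) (hpm n) hs2, map_sub, sub_apply, inner_sub_right, Complex.sub_re] at h2
  rw [map_sub, sub_apply, inner_sub_right, Complex.sub_re] at hN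
  rw [hs, Real.dist_eq, abs_sub_lt_iff]
  constructor <;> linarith

/-- The measure `X ↦ ⟨k, P(χ_X) k⟩`. -/
def IsNormalPOM.measure (hP : IsNormalPOM P) (k : E) : Measure Ω :=
  Measure.ofMeasurable (fun _ hX => ENNReal.ofReal (inner ℂ k (P (linftyInd ν hX) k)).re)
    (by rw [linftyInd_of_null _ measure_empty]; simp)
    fun X hX hd => by
      have h := hP.hasSum k hX hd
      rw [← ENNReal.ofReal_tsum_of_nonneg
        (fun i => (Complex.le_def.1 (hP.ind_nonneg k (hX i))).1) h.summable, h.tsum_eq]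

theorem IsNormalPOM.measure_apply (hP : IsNormalPOM P) (k : E) {X : Set Ω} (hX : MeasurableSet X) :
    hP.measure k X = ENNReal.ofReal (inner ℂ k (P (linftyInd ν hX) k)).re :=
  Measure.ofMeasurable_apply X hX

/-- P factors through classes modulo ν-null sets, so the measure X ↦ ⟨k, P(χ_X)k⟩ is absolutely
continuous and has a Radon-Nikodym density. Indicators suffice for equality of the functionals. -/
theorem IsNormalPOM.exists_density_diag [SigmaFinite ν] (hP : IsNormalPOM P) (k : E) :
    ∃ (h : Ω → ℂ) (hh : Integrable h ν), Measurable h ∧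
      hP.functional k k = densityFunctional hh := by
  have : IsFiniteMeasure (hP.measure k) := ⟨by
    rw [hP.measure_apply k MeasurableSet.univ]; exact ENNReal.ofReal_lt_top⟩
  have hac : hP.measure k ≪ ν := Measure.AbsolutelyContinuous.mk fun X hX h => by
    rw [hP.measure_apply k hX, linftyInd_of_null hX h]; simp
  refine ⟨fun ω => (((hP.measure k).rnDeriv ν ω).toReal : ℂ),
    (Measure.integrable_toReal_rnDeriv (μ := hP.measure k) (ν := ν)).ofReal,
    Complex.measurable_ofReal.comp (Measure.measurable_rnDeriv _ _).ennreal_toReal,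
    linfty_functional_ext fun X hX => ?_⟩
  rw [densityFunctional_apply, integral_linftyInd_mul, integral_complex_ofReal,
    Measure.setIntegral_toReal_rnDeriv hac, Measure.real, hP.measure_apply k hX,
    ENNReal.toReal_ofReal (Complex.le_def.1 (hP.ind_nonneg k hX)).1]
  exact Complex.eq_re_of_ofReal_le (hP.ind_nonneg k hX)

/-- The off-diagonal densities are obtained from the diagonal ones by polarisation. -/
theorem IsNormalPOM.exists_density [SigmaFinite ν] (hP : IsNormalPOM P) (k l : E) :
    ∃ (h : Ω → ℂ) (hh : Integrable h ν), Measurable h ∧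
      hP.functional k l = densityFunctional hh := by
  choose h hh hm hd using hP.exists_density_diag
  have hi : Integrable (fun ω => (h (k + l) ω - h (k - l) ω - Complex.I * h (k + Complex.I • l) ω
      + Complex.I * h (k - Complex.I • l) ω) / 4) ν :=
    ((((hh _).sub (hh _)).sub ((hh _).const_mul _)).add ((hh _).const_mul _)).div_const 4
  refine ⟨_, hi, by have := hm; fun_prop, ?_⟩
  ext f
  have e : ∀ k, inner ℂ k (P f k) = ∫ ω, f ω * h k ω ∂ν := fun k =>
    congrArg (fun φ : Lp ℂ ∞ ν →L[ℂ] ℂ => φ f) (hd k)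
  have hf := fun k => integrable_linfty_mul f (hh k)
  have e2 : inner ℂ k (P f l) = (inner ℂ (k + l) (P f (k + l)) - inner ℂ (k - l) (P f (k - l))
      - Complex.I * inner ℂ (k + Complex.I • l) (P f (k + Complex.I • l))
      + Complex.I * inner ℂ (k - Complex.I • l) (P f (k - Complex.I • l))) / 4 := by
    simp only [map_add, map_sub, map_smul, inner_add_left, inner_add_right, inner_sub_left,
      inner_sub_right, inner_smul_left, inner_smul_right, Complex.conj_I]
    linear_combination (-1 / 2 * inner ℂ l (P f k) + 1/2 * inner ℂ k (P f l)) * Complex.I_sq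
  change inner ℂ k (P f l) = ∫ ω, f ω * _ ∂ν
  have h1 : Integrable (fun ω => f ω * h (k + l) ω - f ω * h (k - l) ω) ν := (hf _).sub (hf _)
  have h2 : Integrable (fun ω => f ω * h (k + l) ω - f ω * h (k - l) ω
      - Complex.I * (f ω * h (k + Complex.I • l) ω)) ν := h1.sub ((hf _).const_mul _)
  rw [e2, e, e, e, e, ← integral_const_mul, ← integral_const_mul, ← integral_sub (hf _) (hf _),
    ← integral_sub h1 ((hf _).const_mul _), ← integral_add h2 ((hf _).const_mul _),
    ← integral_div]
  refine integral_congr_ae (Eventually.of_forall fun ω => ?_)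
  ring

end

end Density

/-! ### Dilation of normal positive operator measures -/

section Dilation

variable {Ω : Type*} [MeasurableSpace Ω] {ν : Measure Ω}
variable {E : Type*} [NormedAddCommGroup E] [InnerProductSpace ℂ E] [CompleteSpace E]

theorem ae_nonneg_of_setIntegral {g : Ω → ℂ} (hg : Integrable g ν)
    (h : ∀ X, MeasurableSet X → 0 ≤ ∫ ω in X, g ω ∂ν) : ∀ᵐ ω ∂ν, 0 ≤ g ω := by
  have h1 : 0 ≤ᵐ[ν] fun ω => (g ω).re := by
    refine ae_nonneg_of_forall_setIntegral_nonneg hg.re fun X hX _ => ?_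
    have := (Complex.le_def.1 (h X hX)).1
    rwa [← Complex.reCLM_apply (∫ ω in X, g ω ∂ν),
      ← Complex.reCLM.integral_comp_comm hg.integrableOn] at this
  have h2 : (fun ω => (g ω).im) =ᵐ[ν] 0 := by
    refine Integrable.ae_eq_zero_of_forall_setIntegral_eq_zero hg.im fun X hX _ => ?_
    have := (Complex.le_def.1 (h X hX)).2.symm
    rwa [← Complex.imCLM_apply (∫ ω in X, g ω ∂ν),
      ← Complex.imCLM.integral_comp_comm hg.integrableOn] at this
  filter_upwards [h1, h2] with ω h3 h4
  exact Complex.le_def.2 ⟨h3, h4.symm⟩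

/-- The integral over X of the quadratic form at c is ⟨κ, P(χ_X)κ⟩ ≥ 0 with κ = ∑ c_i k_i.
Continuity in c and countability of the finite subsets of ℕ leave a single null set. -/
theorem IsNormalPOM.ae_posKernel {P : Lp ℂ ∞ ν →ₗ[ℂ] (E →L[ℂ] E)} (hP : IsNormalPOM P)
    (k : ℕ → E) {h : ℕ → ℕ → Ω → ℂ} (hh : ∀ i j, Integrable (h i j) ν)
    (hd : ∀ i j f, inner ℂ (k i) (P f (k j)) = ∫ ω, f ω * h i j ω ∂ν) :
    ∀ᵐ ω ∂ν, PosKernel fun i j => h i j ω := by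
  have key : ∀ s : Finset ℕ, ∀ᵐ ω ∂ν, ∀ c : ℕ → ℂ,
      0 ≤ ∑ i ∈ s, ∑ j ∈ s, starRingEnd ℂ (c i) * c j * h i j ω := fun s => by
    refine ae_forall_of_continuous (fun ω => isClosed_le continuous_const ?_) fun c => ?_
    · fun_prop
    · have hi : ∀ i j, Integrable (fun ω => starRingEnd ℂ (c i) * c j * h i j ω) ν := fun i j =>
        (hh i j).const_mul _
      refine ae_nonneg_of_setIntegral
        (integrable_finsetSum _ fun i _ => integrable_finsetSum _ fun j _ => hi i j)
        fun X hX => ?_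
      have h1 := hP.ind_nonneg (∑ i ∈ s, c i • k i) hX
      convert h1 using 1
      rw [integral_finsetSum _ fun i _ => integrable_finsetSum _ fun j _ => (hi i j).integrableOn,
        map_sum, sum_inner]
      refine Finset.sum_congr rfl fun i _ => ?_
      rw [integral_finsetSum _ fun j _ => (hi i j).integrableOn, inner_sum]
      refine Finset.sum_congr rfl fun j _ => ?_
      rw [integral_const_mul, map_smul, inner_smul_left, inner_smul_right, hd,
        integral_linftyInd_mul hX, mul_assoc]
  filter_upwards [ae_all_iff.2 key] with ω hω c
  exact hω c.support c

theorem directIntegral_congr {n n' : Ω → ℕ∞} (h : n =ᵐ[ν] n') :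
    DirectIntegral ν n = DirectIntegral ν n' := by
  ext ψ
  change (∀ᵐ ω ∂ν, ψ ω ∈ Fiber (n ω)) ↔ ∀ᵐ ω ∂ν, ψ ω ∈ Fiber (n' ω)
  refine eventually_congr ?_
  filter_upwards [h] with ω hω
  rw [hω]

/-- `Z` dilates `P` to the diagonal operators on `∫^⊕ H_{n(ω)} dν(ω)`, minimally. -/
structure IsDilation (P : Lp ℂ ∞ ν →ₗ[ℂ] (E →L[ℂ] E)) (n : Ω → ℕ∞) (Z : E →L[ℂ] Lp Ell2 2 ν) :
    Prop where
  mem : ∀ k, Z k ∈ DirectIntegral ν n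
  inner_eq : ∀ k l f, inner ℂ (Z k) (mulOp Ell2 ν f (Z l)) = inner ℂ k (P f l)
  minimal : ∀ ψ ∈ DirectIntegral ν n, (∀ f k, inner ℂ (mulOp Ell2 ν f (Z k)) ψ = 0) → ψ = 0

theorem IsDilation.congr {P : Lp ℂ ∞ ν →ₗ[ℂ] (E →L[ℂ] E)} {n n' : Ω → ℕ∞}
    {Z : E →L[ℂ] Lp Ell2 2 ν} (h : IsDilation P n Z) (hn : n =ᵐ[ν] n') : IsDilation P n' Z :=
  ⟨fun k => directIntegral_congr hn ▸ h.mem k, h.inner_eq,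
    fun ψ hψ => h.minimal ψ ((directIntegral_congr hn).symm ▸ hψ)⟩

/-- A concrete Naimark dilation: Z sends k_i to the function ω ↦ i-th Cholesky vector of the density
matrix at ω. Minimality is the fibrewise totality of these vectors, because orthogonality to all
L^∞-multiples is pointwise orthogonality. -/
theorem IsNormalPOM.exists_isDilation [SigmaFinite ν] [TopologicalSpace.SeparableSpace E]
    {P : Lp ℂ ∞ ν →ₗ[ℂ] (E →L[ℂ] E)} (hP : IsNormalPOM P) (h1 : P (linftyOne ν) = 1) :
    ∃ (n : Ω → ℕ∞) (Z : E →L[ℂ] Lp Ell2 2 ν), Measurable n ∧ IsDilation P n Z := by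
  set k := TopologicalSpace.denseSeq E with hk
  have hkt : Total k := total_of_dense
    ((TopologicalSpace.denseRange_denseSeq E).mono Submodule.subset_span)
  choose h hh hm hd' using fun i j => hP.exists_density (k i) (k j)
  have hd : ∀ i j f, inner ℂ (k i) (P f (k j)) = ∫ ω, f ω * h i j ω ∂ν := fun i j f =>
    congrArg (fun φ : Lp ℂ ∞ ν →L[ℂ] ℂ => φ f) (hd' i j)
  have hpk := hP.ae_posKernel k hh hd
  have hg : ∀ᵐ ω ∂ν, ∀ i j, inner ℂ (cholVec (fun i j => h i j ω) i)
      (cholVec (fun i j => h i j ω) j) = h i j ω := by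
    filter_upwards [hpk] with ω hω i j using inner_cholVec hω i j
  -- The squared norm of the i-th vector is the integrable density h i i.
  have hL : ∀ i, MemLp (fun ω => cholVec (fun i j => h i j ω) i) 2 ν := fun i => by
    have hm' := (stronglyMeasurable_cholVec hm i).aestronglyMeasurable (μ := ν)
    rw [memLp_two_iff_integrable_sq_norm hm']
    refine (hh i i).re.congr ?_
    filter_upwards [hg] with ω hω
    change (h i i ω).re = _
    rw [← hω i i, inner_self_eq_norm_sq_to_K]
    norm_cast
  let d : ℕ → Lp Ell2 2 ν := fun i => (hL i).toLp _
  have hdc : ∀ i, d i =ᵐ[ν] fun ω => cholVec (fun i j => h i j ω) i := fun i => (hL i).coeFn_toLp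
  have hdd : ∀ i j f, inner ℂ (d i) (mulOp Ell2 ν f (d j)) = inner ℂ (k i) (P f (k j)) := by
    intro i j f
    rw [hd, L2.inner_def]
    refine integral_congr_ae ?_
    filter_upwards [hg, hdc i, hdc j, mulOp_coeFn f (d j)] with ω h2 h3 h4 h5
    rw [h5, inner_smul_right, h3, h4, h2]
  -- At f = 1 the dilation identity compares Gram matrices, since P(1) = 1.
  obtain ⟨Z, hZ⟩ := exists_isometry (b := d) hkt fun i j => by
    have := hdd i j (linftyOne ν)
    rwa [h1, mulOp_one, one_apply_eq_self, one_apply_eq_self] at this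
  let n : Ω → ℕ∞ := fun ω => pivotRank fun i j => h i j ω
  have hdm : ∀ i, d i ∈ DirectIntegral ν n := fun i => by
    change ∀ᵐ ω ∂ν, _
    filter_upwards [hdc i] with ω h2
    rw [h2]; exact cholVec_mem _ _
  refine ⟨n, Z.toContinuousLinearMap, measurable_pivotRank hm, ⟨fun x => ?_, fun x y f => ?_, fun ψ hψ h2 => ?_⟩⟩
  · have hc : IsClosed {x | Z x ∈ DirectIntegral ν n} :=
      (isClosed_directIntegral ν n).preimage Z.continuous
    exact (TopologicalSpace.denseRange_denseSeq E).induction_on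
      (p := fun x => Z x ∈ DirectIntegral ν n) x hc fun i => by
        change Z (k i) ∈ _
        rw [hZ]; exact hdm i
  · have : ContinuousLinearMap.adjoint Z.toContinuousLinearMap ∘L mulOp Ell2 ν f ∘L
        Z.toContinuousLinearMap = P f := by
      refine hkt.ext_inner hkt fun i j => ?_
      rw [ContinuousLinearMap.comp_apply, ContinuousLinearMap.adjoint_inner_right, ← hdd, ← hZ,
        ← hZ]
      rfl
    rw [← this, ContinuousLinearMap.comp_apply, ContinuousLinearMap.adjoint_inner_right]
    rfl
  · have h3 : ∀ᵐ ω ∂ν, ∀ i, inner ℂ (d i ω) (ψ ω) = 0 := ae_all_iff.2 fun i =>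
      ae_inner_eq_zero fun f => by
        have := h2 f (k i)
        rwa [LinearIsometry.coe_toContinuousLinearMap, hZ] at this
    have hψ' : ∀ᵐ ω ∂ν, ψ ω ∈ Fiber (n ω) := hψ
    refine Lp.ext ?_
    filter_upwards [h3, hψ', hpk, ae_all_iff.2 hdc, Lp.coeFn_zero Ell2 2 ν] with ω h4 h5 h6 h7 h8
    rw [h8]
    exact eq_zero_of_inner_cholVec h6 h5 fun i => by rw [← h4 i, h7]

end Dilation

/-! ### Norms of tensor products, suprema of indicator functions -/

section Norms

variable {E F : Type*} [NormedAddCommGroup E] [InnerProductSpace ℂ E]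
  [NormedAddCommGroup F] [InnerProductSpace ℂ F]
variable {Ω : Type*} [MeasurableSpace Ω] {ν : Measure Ω}

theorem norm_opTensor_le (a : E →L[ℂ] E) (b : F →L[ℂ] F) : ‖opTensor a b‖ ≤ ‖a‖ * ‖b‖ := by
  refine ContinuousLinearMap.opNorm_le_bound _ (by positivity) fun x => ?_
  refine denseRange_toHilbert.induction_on (p := fun x => ‖opTensor a b x‖ ≤ ‖a‖ * ‖b‖ * ‖x‖) x
    (isClosed_le (by fun_prop) (by fun_prop)) fun z => ?_
  rw [opTensor_toHilbert, LinearIsometry.norm_map, LinearIsometry.norm_map]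
  exact (ContinuousLinearMap.le_opNorm _ z).trans (by gcongr; exact TensorProduct.norm_mapL_le a b)

theorem norm_mulOp_le (f : Lp ℂ ∞ ν) : ‖mulOp E ν f‖ ≤ ‖f‖ := by
  refine ContinuousLinearMap.opNorm_le_bound _ (norm_nonneg _) fun ψ => ?_
  refine (ContinuousLinearMap.norm_holder_apply_apply_le (r := 2)
    (ContinuousLinearMap.lsmul ℂ ℂ : ℂ →L[ℂ] E →L[ℂ] E) f ψ).trans ?_
  gcongr
  exact mul_le_of_le_one_left (norm_nonneg _) ContinuousLinearMap.opNorm_lsmul_le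

theorem norm_elem_one_le {K : Type*} [NormedAddCommGroup K] [InnerProductSpace ℂ K]
    [CompleteSpace K] (f : Lp ℂ ∞ ν) : ‖(elem (1 : K →L[ℂ] K) f : InstrAlg K ν).1‖ ≤ ‖f‖ := by
  refine (norm_opTensor_le _ _).trans ((mul_le_of_le_one_left (norm_nonneg _) ?_).trans
    (norm_mulOp_le f))
  exact ContinuousLinearMap.norm_id_le

theorem op_apply_eq_zero_of_inner [CompleteSpace E] {x : E →L[ℂ] E} (hx : 0 ≤ x) {η : E}
    (h : inner ℂ η (x η) = 0) : x η = 0 := by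
  obtain ⟨r, h1, h2, -⟩ := exists_sqrt_op hx
  have : inner ℂ (r η) (r η) = 0 := by
    rw [← h, ← h2, mul_apply_eq_comp, ← ContinuousLinearMap.adjoint_inner_right r η (r η),
      ← ContinuousLinearMap.star_eq_adjoint, h1]
  rw [← h2, mul_apply_eq_comp, inner_self_eq_zero.1 this, map_zero]

variable {K : Type*} [NormedAddCommGroup K] [InnerProductSpace ℂ K] [CompleteSpace K]

theorem elem_one_ind_mono {X Y : Set Ω} (hX : MeasurableSet X) (hY : MeasurableSet Y) (h : X ⊆ Y) :
    (elem (1 : K →L[ℂ] K) (linftyInd ν hX) : InstrAlg K ν) ≤ elem 1 (linftyInd ν hY) := by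
  have e : (elem (1 : K →L[ℂ] K) (linftyInd ν hY) : InstrAlg K ν)
      = elem 1 (linftyInd ν hX) + star (elem (1 : K →L[ℂ] K) (linftyInd ν (hY.diff hX))) *
        elem 1 (linftyInd ν (hY.diff hX)) := by
    rw [star_elem, elem_mul, linftyMul_star_ind, star_one, mul_one, ← elem_add_right,
      ← linftyInd_sub hX hY h, add_sub_cancel]
  rw [e]
  exact le_add_of_nonneg_right (star_mul_self_nonneg' _)

theorem elem_one_ind_isSelfAdjoint {X : Set Ω} (hX : MeasurableSet X) :
    IsSelfAdjoint (elem (1 : K →L[ℂ] K) (linftyInd ν hX) : InstrAlg K ν) := by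
  rw [← linftyMul_star_ind hX, ← mul_one (1 : K →L[ℂ] K), ← elem_mul]
  nth_rw 1 [← star_one (K →L[ℂ] K), ← star_elem]
  exact IsSelfAdjoint.star_mul_self _

/-- The weak limit T of the increasing sequence lies below s. By convergence of the set integrals, s
- T has zero state at every simple tensor, and a positive operator kills the vectors at which its
state vanishes. -/
theorem isLUB_elem_one_ind {X : ℕ → Set Ω} (hX : ∀ i, MeasurableSet (X i)) (hmono : Monotone X) :
    IsLUB (Set.range fun i => (elem (1 : K →L[ℂ] K) (linftyInd ν (hX i)) : InstrAlg K ν))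
      (elem 1 (linftyInd ν (MeasurableSet.iUnion hX))) := by
  set s : InstrAlg K ν := elem 1 (linftyInd ν (MeasurableSet.iUnion hX)) with hs
  let D : Set (HilbertTensor K (Lp ℂ 2 ν) →L[ℂ] HilbertTensor K (Lp ℂ 2 ν)) :=
    Set.range fun i => (elem (1 : K →L[ℂ] K) (linftyInd ν (hX i)) : InstrAlg K ν).1
  have hDs : ∀ x ∈ D, x ≤ s.1 := by
    rintro _ ⟨i, rfl⟩
    exact instrAlg_le_iff.1 (elem_one_ind_mono (hX i) _ (Set.subset_iUnion X i))
  obtain ⟨T, hT1, hT2, hT3, -⟩ := exists_weak_limit (D := D) (Set.range_nonempty _)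
    (directedOn_range.2 (Monotone.directed_le fun i j hij =>
      instrAlg_le_iff.1 (elem_one_ind_mono (hX i) (hX j) (hmono hij))))
    (by rintro _ ⟨i, rfl⟩
        exact congrArg Subtype.val (elem_one_ind_isSelfAdjoint (K := K) (ν := ν) (hX i))) hDs
  have hTs : T ≤ s.1 := hT2 _ hDs
  have hsT : s.1 = T := by
    refine hilbertTensor_ext_leg fun a f => ?_
    rw [← sub_eq_zero, ← sub_apply]
    refine op_apply_eq_zero_of_inner (sub_nonneg.2 hTs) ?_
    have h0 : 0 ≤ inner ℂ (leg a f) ((s.1 - T) (leg a f)) := op_le_iff.1 hTs _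
    have hval : ∀ {Y : Set Ω} (hY : MeasurableSet Y), (inner ℂ (leg a f)
        ((elem (1 : K →L[ℂ] K) (linftyInd ν hY) : InstrAlg K ν).1 (leg a f))).re
        = ‖a‖ ^ 2 * ∫ ω in Y, ‖f ω‖ ^ 2 ∂ν := fun {Y} hY => by
      change (inner ℂ (leg a f) (opTensor 1 (mulOp ℂ ν (linftyInd ν hY)) (leg a f))).re = _
      rw [opTensor_leg, inner_leg, setIntegral_norm_sq hY]
      nth_rw 1 [← linftyMul_star_ind hY]
      rw [← mulOp_mul, mul_apply_eq_comp, ← inner_mulOp_left, one_apply_eq_self,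
        inner_self_eq_norm_sq_to_K, inner_self_eq_norm_sq_to_K]
      norm_cast
    have hlim : Tendsto (fun i => ‖a‖ ^ 2 * ∫ ω in X i, ‖f ω‖ ^ 2 ∂ν) atTop
        (nhds (‖a‖ ^ 2 * ∫ ω in ⋃ i, X i, ‖f ω‖ ^ 2 ∂ν)) :=
      (tendsto_setIntegral_of_monotone hX hmono (integrable_norm_sq f).integrableOn).const_mul _
    have h1 : (inner ℂ (leg a f) (s.1 (leg a f))).re ≤ (inner ℂ (leg a f) (T (leg a f))).re := by
      rw [hs, hval]
      refine le_of_tendsto' hlim fun i => ?_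
      rw [← hval (hX i)]
      exact op_le_re (hT1 _ ⟨i, rfl⟩) _
    rw [Complex.eq_re_of_ofReal_le h0]
    have h2 := (Complex.le_def.1 h0).1
    rw [sub_apply, inner_sub_right, Complex.sub_re] at h2 ⊢
    rw [Complex.zero_re] at h2
    rw [le_antisymm (sub_nonpos.2 h1) h2, Complex.ofReal_zero]
  refine isLUB_of_approx ?_ fun η ε hε => ?_
  · rintro _ ⟨i, rfl⟩
    exact elem_one_ind_mono (hX i) _ (Set.subset_iUnion X i)
  · obtain ⟨_, ⟨i, rfl⟩, h⟩ := hT3 η ε hε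
    refine ⟨_, ⟨i, rfl⟩, ?_⟩
    rw [← hsT] at h
    exact h

end Norms

/-! ### Sesquilinear forms of dilation type -/

section Forms

variable {H : Type*} [NormedAddCommGroup H] [InnerProductSpace ℂ H] [CompleteSpace H]
variable {V : Type*} [AddCommGroup V] [Module ℂ V] [Module (H →L[ℂ] H)ᵐᵒᵖ V]
variable {H' : Type*} [NormedAddCommGroup H'] [InnerProductSpace ℂ H'] [CompleteSpace H']

/-- The form `(v, w) ↦ (Yv)^* X (Yw)`. -/
def dilForm (Y : V →ₗ[ℂ] (H →L[ℂ] H')) (hY : IsRightLinear Y) (X : H' →L[ℂ] H') :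
    SesqForm H V :=
  ⟨fun v w => ContinuousLinearMap.adjoint (Y v) ∘L X ∘L Y w, by
    refine ⟨fun u v w c => ?_, fun u v w c => ?_, fun u v a => ?_, fun u v a => ?_⟩
    · simp only [map_add, map_smul, ContinuousLinearMap.comp_add, ContinuousLinearMap.comp_smul]
    · simp only [map_add, map_smul, map_smulₛₗ,
        ContinuousLinearMap.add_comp, ContinuousLinearMap.smul_comp]
    · simp only [hY _ a]; rfl
    · simp only [hY _ a, ContinuousLinearMap.adjoint_comp]; rfl⟩

theorem dilForm_apply (Y : V →ₗ[ℂ] (H →L[ℂ] H')) (hY : IsRightLinear Y) (X : H' →L[ℂ] H')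
    (v w : V) : (dilForm Y hY X).1 v w = ContinuousLinearMap.adjoint (Y v) ∘L X ∘L Y w := rfl

theorem inner_dilForm (Y : V →ₗ[ℂ] (H →L[ℂ] H')) (hY : IsRightLinear Y) (X : H' →L[ℂ] H')
    (v w : V) (ξ η : H) : inner ℂ ξ ((dilForm Y hY X).1 v w η) = inner ℂ (Y v ξ) (X (Y w η)) := by
  rw [dilForm_apply, ContinuousLinearMap.comp_apply, ContinuousLinearMap.adjoint_inner_right]
  rfl

/-- Replacing v and w by their multiples under |η⟩⟨ξ| and |ζ⟩⟨ξ| turns the entry at ξ, ξ into the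
entry at η, ζ. This is where the module structure of V enters. -/
theorem SesqForm.ext_unit {s t : SesqForm H V} {ξ : H} (hξ : ‖ξ‖ = 1)
    (h : ∀ v w, inner ℂ ξ (s.1 v w ξ) = inner ℂ ξ (t.1 v w ξ)) : s = t := by
  have key : ∀ (s : SesqForm H V) (v w : V) (η ζ : H), inner ℂ η (s.1 v w ζ)
      = inner ℂ ξ (s.1 (MulOpposite.op (InnerProductSpace.rankOne ℂ η ξ) • v)
        (MulOpposite.op (InnerProductSpace.rankOne ℂ ζ ξ) • w) ξ) := fun s v w η ζ => by
    obtain ⟨-, -, h3, h4⟩ := s.2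
    rw [h3, h4, ContinuousLinearMap.star_eq_adjoint, mul_apply_eq_comp, mul_apply_eq_comp,
      ContinuousLinearMap.adjoint_inner_right]
    simp [InnerProductSpace.rankOne_apply, inner_self_eq_norm_sq_to_K, hξ]
  refine Subtype.ext (funext fun v => funext fun w => ContinuousLinearMap.ext fun ζ =>
    ext_inner_left ℂ fun η => ?_)
  rw [key s, key t, h]

variable {ι : Type*}

theorem IsRightLinear.apply_rankOne {Y : V →ₗ[ℂ] (H →L[ℂ] H')} (hY : IsRightLinear Y) {ξ : H}
    (hξ : ‖ξ‖ = 1) (v : V) (η : H) :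
    Y (MulOpposite.op (InnerProductSpace.rankOne ℂ η ξ) • v) ξ = Y v η := by
  rw [hY]
  simp [InnerProductSpace.rankOne_apply, inner_self_eq_norm_sq_to_K, hξ]

theorem IsRightLinear.total_of_dense {Y : V →ₗ[ℂ] (H →L[ℂ] H')} (hY : IsRightLinear Y)
    (T : ι → H' →L[ℂ] H')
    (h : SigmaStronglyDense (Submodule.span ℂ (Set.range fun p : ι × V => T p.1 ∘L Y p.2)))
    {ξ : H} (hξ : ‖ξ‖ = 1) : Total fun p : ι × V => T p.1 (Y p.2 ξ) := by
  have : Nontrivial H := ⟨ξ, 0, fun h => by simp [h] at hξ⟩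
  intro x hx
  refine h.total x fun p => ?_
  have := hx (p.1.1, MulOpposite.op (InnerProductSpace.rankOne ℂ p.2 ξ) • p.1.2)
  simp only [hY.apply_rankOne hξ] at this
  exact this

theorem IsRightLinear.dense_of_total {Y : V →ₗ[ℂ] (H →L[ℂ] H')} (hY : IsRightLinear Y)
    (T : ι → H' →L[ℂ] H') {ξ : H} (h : Total fun p : ι × V => T p.1 (Y p.2 ξ)) :
    SigmaStronglyDense (Submodule.span ℂ (Set.range fun p : ι × V => T p.1 ∘L Y p.2)) := by
  refine sigmaStronglyDense_of_total (fun p b => ⟨(p.1, MulOpposite.op b • p.2), ?_⟩) fun x hx => ?_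
  · rw [hY, ContinuousLinearMap.comp_assoc]
  · exact h x fun p => hx (p, ξ)

end Forms

/-! ### The minimal dilation of a normal completely positive map -/

section MinimalDilation

variable {H : Type*} [NormedAddCommGroup H] [InnerProductSpace ℂ H] [CompleteSpace H]
variable {V : Type*} [AddCommGroup V] [Module ℂ V] [Module (H →L[ℂ] H)ᵐᵒᵖ V]
variable {K : Type*} [NormedAddCommGroup K] [InnerProductSpace ℂ K] [CompleteSpace K]
variable {Ω : Type*} [MeasurableSpace Ω] {ν : Measure Ω}
variable {E : Type*} [NormedAddCommGroup E] [InnerProductSpace ℂ E] [CompleteSpace E]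

theorem adjoint_leg_comp_leg {e : K} (he : ‖e‖ = 1) :
    ContinuousLinearMap.adjoint (leg e) ∘L leg e = (1 : E →L[ℂ] E) := by
  ext1 f
  rw [ContinuousLinearMap.comp_apply, adjoint_leg, inner_self_eq_norm_sq_to_K, he]
  simp

theorem norm_leg_le {e : K} (he : ‖e‖ = 1) : ‖(leg e : E →L[ℂ] HilbertTensor K E)‖ ≤ 1 := by
  refine ContinuousLinearMap.opNorm_le_bound _ zero_le_one fun f => ?_
  rw [@norm_eq_sqrt_re_inner ℂ, inner_leg, inner_self_eq_norm_sq_to_K, he,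
    @norm_eq_sqrt_re_inner ℂ _ _ _ _ f]
  simp

theorem inner_opTensor_one_left (b : K →L[ℂ] K) (x y : HilbertTensor K E) :
    inner ℂ (opTensor b (1 : E →L[ℂ] E) x) y = inner ℂ x (opTensor (star b) (1 : E →L[ℂ] E) y) := by
  have h := opTensor_star b (1 : E →L[ℂ] E)
  rw [star_one, ContinuousLinearMap.star_eq_adjoint] at h
  rw [← h, ContinuousLinearMap.adjoint_inner_right]

theorem opTensor_one_apply_apply (b c : K →L[ℂ] K) (x : HilbertTensor K E) :
    opTensor b (1 : E →L[ℂ] E) (opTensor c (1 : E →L[ℂ] E) x) = opTensor (b * c) (1 : E →L[ℂ] E) x := by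
  rw [← mul_apply_eq_comp, opTensor_mul, one_mul]

theorem inner_firstMarginal {S : InstrAlg K ν →ₗ[ℂ] SesqForm H V} (ξ : H)
    {J : V →ₗ[ℂ] (H →L[ℂ] HilbertTensor K E)}
    (hJS : ∀ (b : K →L[ℂ] K) (v w : V), (firstMarginal S b).1 v w
      = ContinuousLinearMap.adjoint (J v) ∘L opTensor b (1 : E →L[ℂ] E) ∘L J w)
    (b : K →L[ℂ] K) (v w : V) : sFun S ξ v w (elem b (linftyOne ν))
      = inner ℂ (J v ξ) (opTensor b (1 : E →L[ℂ] E) (J w ξ)) := by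
  rw [sFun_apply]
  change inner ℂ ξ ((firstMarginal S b).1 v w ξ) = _
  rw [hJS, ContinuousLinearMap.comp_apply, ContinuousLinearMap.adjoint_inner_right]
  rfl

/-- The compression to the minimal ancillary dilation of the first marginal. -/
theorem exists_marginal_compression {S : InstrAlg K ν →ₗ[ℂ] SesqForm H V} (hS : IsCP S)
    (hN : ∀ v, IsNormalMap fun x => (S x).1 v v) {ξ : H}
    {J : V →ₗ[ℂ] (H →L[ℂ] HilbertTensor K E)}
    (hJS : ∀ (b : K →L[ℂ] K) (v w : V), (firstMarginal S b).1 v w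
      = ContinuousLinearMap.adjoint (J v) ∘L opTensor b (1 : E →L[ℂ] E) ∘L J w)
    (hJt : Total fun p : (K →L[ℂ] K) × V => opTensor p.1 (1 : E →L[ℂ] E) (J p.2 ξ)) :
    ∃ π : InstrAlg K ν →ₗ[ℂ] (HilbertTensor K E →L[ℂ] HilbertTensor K E),
      (∀ x, ‖π x‖ ≤ ‖x.1‖) ∧ (∀ η, IsNormalPos (vecFun π η η)) ∧ π 1 = 1 ∧
      (∀ f b, π (elem 1 f) * opTensor b 1 = opTensor b 1 * π (elem 1 f)) ∧
      ∀ b f v w, sFun S ξ v w (elem b f)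
        = inner ℂ (J v ξ) (π (elem 1 f) (opTensor b 1 (J w ξ))) := by
  have hS1 := inner_firstMarginal ξ hJS
  obtain ⟨π, hπ, hπn, -, hπN⟩ := exists_compression hS hN ξ hJt
    (fun p => elem p.1 (linftyOne ν)) (fun p => p.2) fun p q => by
      rw [star_elem, elem_mul, linftyStar_one, linftyMul_one, hS1, inner_opTensor_one_left,
        opTensor_one_apply_apply]
  refine ⟨π, hπn, hπN, ?_, fun f b => ?_, fun b f v w => ?_⟩
  · refine hJt.ext_inner hJt fun p q => ?_
    rw [hπ, mul_one, one_apply_eq_self, star_elem, elem_mul, linftyStar_one,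
      linftyMul_one, hS1, inner_opTensor_one_left, opTensor_one_apply_apply]
  -- Although π is only a compression, both sides have the same matrix entries, because 1 ⊗ f
  -- commutes with b ⊗ 1 in the algebra and b ⊗ 1 permutes the generating vectors.
  · refine hJt.ext_inner hJt fun p q => ?_
    have h1 := hπ (elem 1 f) p (b * q.1, q.2)
    have h2 := hπ (elem 1 f) (star b * p.1, p.2) q
    simp only [← opTensor_one_apply_apply] at h1 h2
    rw [mul_apply_eq_comp, mul_apply_eq_comp, h1]
    nth_rw 2 [← star_star b]
    rw [← inner_opTensor_one_left, h2]
    simp only [star_elem, elem_mul, linftyStar_one, linftyMul_one, linftyOne_mul, star_mul,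
      star_star, mul_one, mul_assoc]
  · have h1 := hπ (elem 1 f) (1, v) (b, w)
    simp only [opTensor_one, one_apply_eq_self] at h1
    rw [star_elem, elem_mul, elem_mul,
      star_one, linftyStar_one, linftyOne_mul, linftyMul_one, one_mul, one_mul] at h1
    exact h1.symm

/-- The map `T ↦ (⟨e| ⊗ 1) T (|e⟩ ⊗ 1)`. -/
def slice (e : K) : (HilbertTensor K E →L[ℂ] HilbertTensor K E) →ₗ[ℂ] (E →L[ℂ] E) where
  toFun T := ContinuousLinearMap.adjoint (leg e) ∘L T ∘L leg e
  map_add' S T := by rw [ContinuousLinearMap.add_comp, ContinuousLinearMap.comp_add]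
  map_smul' c T := by rw [ContinuousLinearMap.smul_comp, ContinuousLinearMap.comp_smul]; rfl

theorem slice_apply (e : K) (T : HilbertTensor K E →L[ℂ] HilbertTensor K E) :
    slice e T = ContinuousLinearMap.adjoint (leg e) ∘L T ∘L leg e := rfl

theorem inner_slice (e : K) (T : HilbertTensor K E →L[ℂ] HilbertTensor K E) (k l : E) :
    inner ℂ k (slice e T l) = inner ℂ (leg e k) (T (leg e l)) := by
  rw [slice_apply, ContinuousLinearMap.comp_apply, ContinuousLinearMap.adjoint_inner_right,
    ContinuousLinearMap.comp_apply]

theorem norm_slice_le {e : K} (he : ‖e‖ = 1) (T : HilbertTensor K E →L[ℂ] HilbertTensor K E) :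
    ‖slice e T‖ ≤ ‖T‖ := by
  calc ‖slice e T‖ ≤ ‖ContinuousLinearMap.adjoint (leg e : E →L[ℂ] HilbertTensor K E)‖ *
        (‖T‖ * ‖(leg e : E →L[ℂ] HilbertTensor K E)‖) :=
      (ContinuousLinearMap.opNorm_comp_le _ _).trans
        (mul_le_mul_of_nonneg_left (ContinuousLinearMap.opNorm_comp_le _ _) (norm_nonneg _))
    _ ≤ 1 * (‖T‖ * 1) := by
      rw [LinearIsometryEquiv.norm_map]
      gcongr <;> exact norm_leg_le he
    _ = ‖T‖ := by ring

variable (K ν) in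
/-- The map `f ↦ 1 ⊗ f`. -/
def elemOne : Lp ℂ ∞ ν →ₗ[ℂ] InstrAlg K ν where
  toFun f := elem 1 f
  map_add' := elem_add_right 1
  map_smul' c f := elem_smul_right c 1 f

theorem elemOne_apply (f : Lp ℂ ∞ ν) : elemOne K ν f = elem 1 f := rfl

theorem elemOne_star_mul (f : Lp ℂ ∞ ν) :
    elemOne K ν (linftyMul (star f) f) = star (elemOne K ν f) * elemOne K ν f := by
  rw [elemOne_apply, elemOne_apply, star_elem, elem_mul, star_one, mul_one]

theorem isNormalPOM_slice {π : InstrAlg K ν →ₗ[ℂ] (HilbertTensor K E →L[ℂ] HilbertTensor K E)}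
    (hn : ∀ x, ‖π x‖ ≤ ‖x.1‖) (hN : ∀ η, IsNormalPos (vecFun π η η)) {e : K} (he : ‖e‖ = 1) :
    IsNormalPOM (slice e ∘ₗ π ∘ₗ elemOne K ν) := by
  have hi : ∀ f k, inner ℂ k ((slice e ∘ₗ π ∘ₗ elemOne K ν) f k)
      = vecFun π (leg e k) (leg e k) (elemOne K ν f) := fun f k => inner_slice _ _ _ _
  refine ⟨fun f k => ?_, fun f => ?_, fun X hX hmono k ε hε => ?_⟩
  · rw [hi, elemOne_star_mul]
    exact (hN (leg e k)).pos _
  · exact (norm_slice_le he _).trans ((hn _).trans (norm_elem_one_le f))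
  · obtain ⟨_, ⟨i, rfl⟩, h⟩ := (hN (leg e k)).normal
      (Set.range fun i => (elem (1 : K →L[ℂ] K) (linftyInd ν (hX i)) : InstrAlg K ν))
      (Set.range_nonempty _)
      (directedOn_range.2 (Monotone.directed_le fun i j hij =>
        elem_one_ind_mono (hX i) (hX j) (hmono hij)))
      (by rintro _ ⟨i, rfl⟩; exact elem_one_ind_isSelfAdjoint (hX i)) _
      (isLUB_elem_one_ind hX hmono) ε hε
    refine ⟨i, ?_⟩
    rw [hi, map_sub]
    exact h

/-- The operator measure of the second marginal on the ancillary space. -/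
theorem exists_isNormalPOM {S : InstrAlg K ν →ₗ[ℂ] SesqForm H V} (hS : IsCP S)
    (hN : ∀ v, IsNormalMap fun x => (S x).1 v v) {ξ : H} (hξ : ‖ξ‖ = 1) {e : K} (he : ‖e‖ = 1)
    {J : V →ₗ[ℂ] (H →L[ℂ] HilbertTensor K E)} (hJ : IsRightLinear J)
    (hJS : ∀ (b : K →L[ℂ] K) (v w : V), (firstMarginal S b).1 v w
      = ContinuousLinearMap.adjoint (J v) ∘L opTensor b (1 : E →L[ℂ] E) ∘L J w)
    (hJt : Total fun p : (K →L[ℂ] K) × V => opTensor p.1 (1 : E →L[ℂ] E) (J p.2 ξ)) :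
    ∃ P : Lp ℂ ∞ ν →ₗ[ℂ] (E →L[ℂ] E), IsNormalPOM P ∧ P (linftyOne ν) = 1 ∧
      ∀ b f, S (elem b f) = dilForm J hJ (opTensor b (P f)) := by
  obtain ⟨π, hπn, hπN, hπ1, hcomm, hπ⟩ := exists_marginal_compression hS hN hJS hJt
  refine ⟨slice e ∘ₗ π ∘ₗ elemOne K ν, isNormalPOM_slice hπn hπN he, ?_, fun b f => ?_⟩
  · rw [LinearMap.comp_apply, LinearMap.comp_apply, elemOne_apply, elem_one, hπ1]
    exact adjoint_leg_comp_leg he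
  -- Commuting with L(K) ⊗ 1, the operator lives on the second factor, where it is P(f).
  · have hP : π (elem 1 f) = opTensor 1 (slice e (π (elem 1 f))) :=
      eq_opTensor_one_of_commute (hcomm f) he
    refine SesqForm.ext_unit hξ fun v w => ?_
    rw [inner_dilForm, ← sFun_apply, hπ, hP, ← mul_apply_eq_comp, opTensor_mul, one_mul, mul_one]
    rfl

/-- The map `v ↦ W ∘ J v`. -/
def compLeft {H' H'' : Type*} [NormedAddCommGroup H'] [InnerProductSpace ℂ H']
    [NormedAddCommGroup H''] [InnerProductSpace ℂ H''] (W : H' →L[ℂ] H'')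
    (J : V →ₗ[ℂ] (H →L[ℂ] H')) : V →ₗ[ℂ] (H →L[ℂ] H'') where
  toFun v := W ∘L J v
  map_add' v w := by rw [map_add, ContinuousLinearMap.comp_add]
  map_smul' c v := by rw [map_smul, ContinuousLinearMap.comp_smul]; rfl

theorem IsRightLinear.compLeft {H' H'' : Type*} [NormedAddCommGroup H'] [InnerProductSpace ℂ H']
    [NormedAddCommGroup H''] [InnerProductSpace ℂ H'']
    {J : V →ₗ[ℂ] (H →L[ℂ] H')} (hJ : IsRightLinear J) (W : H' →L[ℂ] H'') :
    IsRightLinear (compLeft W J) := fun v a => by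
  change W ∘L J _ = (W ∘L J v) ∘L a
  rw [hJ]; rfl

theorem dilForm_comp {H' H'' : Type*} [NormedAddCommGroup H'] [InnerProductSpace ℂ H']
    [CompleteSpace H'] [NormedAddCommGroup H''] [InnerProductSpace ℂ H''] [CompleteSpace H'']
    {J : V →ₗ[ℂ] (H →L[ℂ] H')} (hJ : IsRightLinear J) (W : H' →L[ℂ] H'') (X : H'' →L[ℂ] H'') :
    dilForm _ (hJ.compLeft W) X = dilForm J hJ (ContinuousLinearMap.adjoint W ∘L X ∘L W) := by
  refine Subtype.ext (funext fun v => funext fun w => ?_)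
  rw [dilForm_apply, dilForm_apply]
  change ContinuousLinearMap.adjoint (W ∘L J v) ∘L X ∘L W ∘L J w = _
  rw [ContinuousLinearMap.adjoint_comp]
  rfl

/-- `Y` is a minimal dilation of `S` to `K ⊗ ∫^⊕ H_{n(ω)} dν(ω)`. -/
structure IsMinDil (S : InstrAlg K ν →ₗ[ℂ] SesqForm H V) (n : Ω → ℕ∞)
    (Y : V →ₗ[ℂ] (H →L[ℂ] HilbertTensor K (DirectIntegral ν n))) : Prop where
  right : IsRightLinear Y
  eq : ∀ b f, S (elem b f) = dilForm Y right (opTensor b (diagOp f))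
  total : ∀ ξ : H, ‖ξ‖ = 1 → Total fun p : ((K →L[ℂ] K) × Lp ℂ ∞ ν) × V =>
    opTensor p.1.1 (diagOp p.1.2) (Y p.2 ξ)

/-- Y = (1 ⊗ Z)J works because Z^* f̂ Z = P(f). A vector orthogonal to all (b ⊗ f̂)(Yv)ξ is killed
by every (1 ⊗ f̂Z)^*, by totality for J; then each of its slices vanishes by minimality of Z. -/
theorem IsDilation.exists_isMinDil {S : InstrAlg K ν →ₗ[ℂ] SesqForm H V}
    {J : V →ₗ[ℂ] (H →L[ℂ] HilbertTensor K E)} (hJ : IsRightLinear J)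
    (hJt : ∀ ξ : H, ‖ξ‖ = 1 → Total fun p : (K →L[ℂ] K) × V => opTensor p.1 (1 : E →L[ℂ] E) (J p.2 ξ))
    {P : Lp ℂ ∞ ν →ₗ[ℂ] (E →L[ℂ] E)} (hSP : ∀ b f, S (elem b f) = dilForm J hJ (opTensor b (P f)))
    {n : Ω → ℕ∞} {Z : E →L[ℂ] Lp Ell2 2 ν} (h : IsDilation P n Z) :
    ∃ Y, IsMinDil S n Y := by
  let Z' : E →L[ℂ] DirectIntegral ν n := Z.codRestrict _ h.mem
  have hZ : ∀ f, ContinuousLinearMap.adjoint Z' ∘L diagOp f ∘L Z' = P f := fun f => by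
    refine ContinuousLinearMap.ext fun l => ext_inner_left ℂ fun k => ?_
    rw [ContinuousLinearMap.comp_apply, ContinuousLinearMap.adjoint_inner_right, ← h.inner_eq]
    rfl
  refine ⟨_, hJ.compLeft (opTensor 1 Z'), fun b f => ?_, fun ξ hξ ψ hψ => ?_⟩
  · rw [hSP, dilForm_comp, opTensor_adjoint_right, opTensor_comp, opTensor_comp, ← hZ]
    rfl
  · have h1 : ∀ f, ContinuousLinearMap.adjoint (opTensor (1 : K →L[ℂ] K) (diagOp f ∘L Z')) ψ = 0 :=
      fun f => hJt ξ hξ _ fun p => by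
        rw [ContinuousLinearMap.adjoint_inner_right]
        have := hψ ((p.1, f), p.2)
        change inner ℂ (opTensor p.1 (diagOp f) (opTensor 1 Z' (J p.2 ξ))) ψ = 0 at this
        rw [← ContinuousLinearMap.comp_apply, opTensor_comp] at this ⊢
        exact this
    refine total_leg (E := K) (F := DirectIntegral ν n) ψ fun p => ?_
    rw [← ContinuousLinearMap.adjoint_inner_right]
    have h2 : ContinuousLinearMap.adjoint (leg p.1) ψ = 0 := by
      refine Subtype.ext (h.minimal _ (ContinuousLinearMap.adjoint (leg p.1) ψ).2 fun f k => ?_)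
      have h3 : inner ℂ (diagOp f (Z' k)) (ContinuousLinearMap.adjoint (leg p.1) ψ) = 0 := by
        rw [ContinuousLinearMap.adjoint_inner_right]
        have : leg p.1 (diagOp f (Z' k)) = opTensor (1 : K →L[ℂ] K) (diagOp f ∘L Z') (leg p.1 k) := by
          rw [opTensor_leg]; rfl
        rw [this, ← ContinuousLinearMap.adjoint_inner_right, h1, inner_zero_right]
      exact h3
    rw [h2, inner_zero_right]

/-- The quantifier over n' leaves the multiplicity function free on a null set, so that an invariant
version can be chosen before the dilation is fixed. -/
theorem exists_isMinDil [SigmaFinite ν] [Nontrivial H] [Nontrivial K]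
    {S : InstrAlg K ν →ₗ[ℂ] SesqForm H V} (hS : IsCP S)
    (hN : ∀ v, IsNormalMap fun x => (S x).1 v v)
    [TopologicalSpace.SeparableSpace E] (hE : IsMinimalAncillary (firstMarginal S) E) :
    ∃ n : Ω → ℕ∞, Measurable n ∧ ∀ n', n =ᵐ[ν] n' → ∃ Y, IsMinDil S n' Y := by
  obtain ⟨J, hJ, hJS, hJd⟩ := hE
  obtain ⟨ξ, hξ⟩ := exists_norm_eq H (zero_le_one (α := ℝ))
  obtain ⟨e, he⟩ := exists_norm_eq K (zero_le_one (α := ℝ))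
  have hJt : ∀ ξ : H, ‖ξ‖ = 1 → Total fun p : (K →L[ℂ] K) × V =>
      opTensor p.1 (1 : E →L[ℂ] E) (J p.2 ξ) := fun ξ hξ =>
    hJ.total_of_dense (fun b => opTensor b (1 : E →L[ℂ] E)) (by
      convert hJd using 2
      ext x
      simp only [Set.mem_range, Prod.exists, Set.mem_ofPred_eq, eq_comm]) hξ
  obtain ⟨P, hP, hP1, hSP⟩ := exists_isNormalPOM hS hN hξ he hJ hJS (hJt ξ hξ)
  obtain ⟨n, Z, hn, hZ⟩ := hP.exists_isDilation hP1
  exact ⟨n, hn, fun n' h => (hZ.congr h).exists_isMinDil hJ hJt hSP⟩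

theorem IsMinDil.dense [Nontrivial H] {S : InstrAlg K ν →ₗ[ℂ] SesqForm H V} {n : Ω → ℕ∞}
    {Y : V →ₗ[ℂ] (H →L[ℂ] HilbertTensor K (DirectIntegral ν n))} (hY : IsMinDil S n Y) :
    SigmaStronglyDense (Submodule.span ℂ
      {x : H →L[ℂ] HilbertTensor K (DirectIntegral ν n) |
        ∃ (b : K →L[ℂ] K) (f : Lp ℂ ∞ ν) (v : V), x = opTensor b (diagOp f) ∘L Y v}) := by
  obtain ⟨ξ, hξ⟩ := exists_norm_eq H (zero_le_one (α := ℝ))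
  convert hY.right.dense_of_total
    (fun p : (K →L[ℂ] K) × Lp ℂ ∞ ν => opTensor p.1 (diagOp p.2)) (hY.total ξ hξ) using 2
  ext x
  simp only [Set.mem_range, Prod.exists, Set.mem_ofPred_eq, eq_comm]

end MinimalDilation

/-! ### The action on `L^∞(ν)` -/

section Gamma

variable {Ω : Type*} [MeasurableSpace Ω] {G : Type*} [Group G] [MulAction G Ω]
  [MeasurableConstSMul G Ω] {ν : Measure Ω} [QuasiInvariant G ν]

theorem gammaAct_mul (g : G) (f f' : Lp ℂ ∞ ν) :
    gammaAct ν g (linftyMul f f') = linftyMul (gammaAct ν g f) (gammaAct ν g f') := by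
  refine Lp.ext ?_
  filter_upwards [gammaAct_coeFn ν g (linftyMul f f'), gammaAct_coeFn ν g f, gammaAct_coeFn ν g f',
    linftyMul_coeFn (gammaAct ν g f) (gammaAct ν g f'),
    (quasiMeasurePreserving_smul ν g⁻¹).ae (linftyMul_coeFn f f')] with ω h1 h2 h3 h4 h5
  rw [h1, h4, h2, h3, h5]

theorem gammaAct_star (g : G) (f : Lp ℂ ∞ ν) :
    gammaAct ν g (star f) = star (gammaAct ν g f) := by
  refine Lp.ext ?_
  filter_upwards [gammaAct_coeFn ν g (star f), gammaAct_coeFn ν g f,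
    linftyStar_coeFn (gammaAct ν g f),
    (quasiMeasurePreserving_smul ν g⁻¹).ae (linftyStar_coeFn f)] with ω h1 h2 h3 h4
  rw [h1, h3, h2, h4]

theorem gammaAct_one (f : Lp ℂ ∞ ν) : gammaAct ν (1 : G) f = f := by
  refine Lp.ext ?_
  filter_upwards [gammaAct_coeFn ν (1 : G) f] with ω h1
  rw [h1, inv_one, one_smul]

theorem gammaAct_linftyOne (g : G) : gammaAct ν g (linftyOne ν) = linftyOne ν := by
  refine Lp.ext ?_
  filter_upwards [gammaAct_coeFn ν g (linftyOne ν), linftyOne_coeFn (ν := ν),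
    (quasiMeasurePreserving_smul ν g⁻¹).ae (linftyOne_coeFn (ν := ν))] with ω h1 h2 h3
  rw [h1, h2, h3]

theorem gammaAct_gammaAct (g h : G) (f : Lp ℂ ∞ ν) :
    gammaAct ν g (gammaAct ν h f) = gammaAct ν (g * h) f := by
  refine Lp.ext ?_
  filter_upwards [gammaAct_coeFn ν g (gammaAct ν h f), gammaAct_coeFn ν (g * h) f,
    (quasiMeasurePreserving_smul ν g⁻¹).ae (gammaAct_coeFn ν h f)] with ω h1 h2 h3
  rw [h1, h2, h3, smul_smul, mul_inv_rev]

end Gamma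

/-! ### The unitary implementation -/

section Implementation

/-- The isometries permute a total family through a group action on its index set, so they multiply
like the group; the inverse group element supplies the inverse, whence unitarity. -/
theorem exists_unitary_rep {G E : Type*} [Group G] [NormedAddCommGroup E] [InnerProductSpace ℂ E]
    [CompleteSpace E] (W : G → E →ₗᵢ[ℂ] E) {ι : Type*} {a : ι → E} (ha : Total a)
    {σ : G → ι → ι} (hW : ∀ g i, W g (a i) = a (σ g i)) (hσ1 : ∀ i, σ 1 i = i)
    (hσ : ∀ g h i, σ (g * h) i = σ g (σ h i)) :
    ∃ R : G →* unitary (E →L[ℂ] E), ∀ g, (R g : E →L[ℂ] E) = (W g).toContinuousLinearMap := by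
  have hs : ∀ g, star (W g).toContinuousLinearMap * (W g).toContinuousLinearMap = 1 := fun g => by
    refine ContinuousLinearMap.ext fun x => ext_inner_left ℂ fun y => ?_
    rw [mul_apply_eq_comp, ContinuousLinearMap.star_eq_adjoint,
      ContinuousLinearMap.adjoint_inner_right]
    exact (W g).inner_map_map y x
  have hmul : ∀ g h, (W (g * h)).toContinuousLinearMap
      = (W g).toContinuousLinearMap * (W h).toContinuousLinearMap := fun g h =>
    ha.ext fun i => by
      change W (g * h) (a i) = W g (W h (a i))
      rw [hW, hW, hW, hσ]
  have hone : (W 1).toContinuousLinearMap = 1 := ha.ext fun i => by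
    change W 1 (a i) = a i
    rw [hW, hσ1]
  have hu : ∀ g, (W g).toContinuousLinearMap ∈ unitary (E →L[ℂ] E) := fun g => by
    refine Unitary.mem_iff.2 ⟨hs g, ?_⟩
    have h2 : (W g).toContinuousLinearMap * (W g⁻¹).toContinuousLinearMap = 1 := by
      rw [← hmul, mul_inv_cancel, hone]
    rw [left_inv_eq_right_inv (hs g) h2, h2]
  exact ⟨⟨⟨fun g => ⟨_, hu g⟩, Subtype.ext hone⟩, fun g h => Subtype.ext (hmul g h)⟩, fun g => rfl⟩

variable {H : Type*} [NormedAddCommGroup H] [InnerProductSpace ℂ H] [CompleteSpace H]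
variable {V : Type*} [AddCommGroup V] [Module ℂ V] [Module (H →L[ℂ] H)ᵐᵒᵖ V]
variable {K : Type*} [NormedAddCommGroup K] [InnerProductSpace ℂ K] [CompleteSpace K]
variable {Ω : Type*} [MeasurableSpace Ω] {ν : Measure Ω}
variable {n : Ω → ℕ∞}
variable {G : Type*} [Group G] [MulAction G Ω] [MeasurableConstSMul G Ω] [SigmaFinite ν]
  [QuasiInvariant G ν]

theorem opTensor_diag_apply_apply (b c : K →L[ℂ] K) (f h : Lp ℂ ∞ ν)
    (x : HilbertTensor K (DirectIntegral ν n)) :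
    opTensor b (diagOp f) (opTensor c (diagOp h) x) = opTensor (b * c) (diagOp (linftyMul f h)) x := by
  rw [← mul_apply_eq_comp, opTensor_mul, diagOp_mul]

theorem inner_opTensor_diag_left (b : K →L[ℂ] K) (f : Lp ℂ ∞ ν)
    (x y : HilbertTensor K (DirectIntegral ν n)) :
    inner ℂ (opTensor b (diagOp f) x) y = inner ℂ x (opTensor (star b) (diagOp (star f)) y) := by
  have h := opTensor_star b (diagOp f : DirectIntegral ν n →L[ℂ] DirectIntegral ν n)
  rw [diagOp_star, ContinuousLinearMap.star_eq_adjoint] at h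
  rw [← h, ContinuousLinearMap.adjoint_inner_right]

variable {S : InstrAlg K ν →ₗ[ℂ] SesqForm H V}
  {Y : V →ₗ[ℂ] (H →L[ℂ] HilbertTensor K (DirectIntegral ν n))}

theorem IsMinDil.sFun_elem (hY : IsMinDil S n Y) (ξ : H) (b : K →L[ℂ] K) (f : Lp ℂ ∞ ν) (v w : V) :
    sFun S ξ v w (elem b f) = inner ℂ (Y v ξ) (opTensor b (diagOp f) (Y w ξ)) := by
  rw [sFun_apply, hY.eq, inner_dilForm]

theorem IsMinDil.inner_eq (hY : IsMinDil S n Y) (ξ : H) (b c : K →L[ℂ] K) (f h : Lp ℂ ∞ ν)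
    (v w : V) :
    inner ℂ (opTensor b (diagOp f) (Y v ξ)) (opTensor c (diagOp h) (Y w ξ))
      = sFun S ξ v w (elem (star b * c) (linftyMul (star f) h)) := by
  rw [hY.sFun_elem, inner_opTensor_diag_left, opTensor_diag_apply_apply]

theorem sFun_delta {U : G →* (V ≃ₗ[(H →L[ℂ] H)ᵐᵒᵖ] V)} {u : G → unitary (K →L[ℂ] K)}
    (hcov : ∀ (g : G) (x : InstrAlg K ν) (v w : V),
      (S (deltaAct ν u g x)).1 v w = (S x).1 (U g⁻¹ v) (U g⁻¹ w)) (ξ : H) (g : G)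
    (b : K →L[ℂ] K) (f : Lp ℂ ∞ ν) (v w : V) :
    sFun S ξ (U g v) (U g w) (elem ((u g : K →L[ℂ] K) * b * star (u g : K →L[ℂ] K)) (gammaAct ν g f))
      = sFun S ξ v w (elem b f) := by
  have hU : ∀ v, U g⁻¹ (U g v) = v := fun v => by
    rw [map_inv]; exact (U g).symm_apply_apply v
  rw [← deltaAct_elem, sFun_apply, hcov, hU, hU, sFun_apply]

/-- The action `b ↦ u_g b u_g^*`. -/
def betaAct (u : G → unitary (K →L[ℂ] K)) (g : G) (b : K →L[ℂ] K) : K →L[ℂ] K :=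
  (u g : K →L[ℂ] K) * b * star (u g : K →L[ℂ] K)

theorem betaAct_mul (u : G → unitary (K →L[ℂ] K)) (g : G) (b c : K →L[ℂ] K) :
    betaAct u g (b * c) = betaAct u g b * betaAct u g c := by
  have h := Unitary.star_mul_self_of_mem (u g).2
  calc betaAct u g (b * c)
      = (u g : K →L[ℂ] K) * b * (star (u g : K →L[ℂ] K) * (u g : K →L[ℂ] K)) * c *
        star (u g : K →L[ℂ] K) := by
        rw [h, mul_one]; simp only [betaAct, mul_assoc]
    _ = _ := by simp only [betaAct, mul_assoc]

theorem betaAct_star (u : G → unitary (K →L[ℂ] K)) (g : G) (b : K →L[ℂ] K) :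
    betaAct u g (star b) = star (betaAct u g b) := by
  simp only [betaAct, star_mul, star_star, mul_assoc]

theorem betaAct_one_right (u : G → unitary (K →L[ℂ] K)) (g : G) : betaAct u g 1 = 1 := by
  rw [betaAct, mul_one, Unitary.mul_star_self_of_mem (u g).2]

theorem betaAct_one_left {m : G → G → Circle} {u : G → unitary (K →L[ℂ] K)}
    (hu : IsMultiplierRep m u) (b : K →L[ℂ] K) : betaAct u 1 b = b := by
  rw [betaAct, hu.one]; simp

theorem betaAct_betaAct {m : G → G → Circle} {u : G → unitary (K →L[ℂ] K)}
    (hu : IsMultiplierRep m u) (g h : G) (b : K →L[ℂ] K) :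
    betaAct u (g * h) b = betaAct u g (betaAct u h b) := by
  have hc : (m g h : ℂ) * starRingEnd ℂ (m g h : ℂ) = 1 := by
    rw [Complex.mul_conj, Circle.normSq_coe, Complex.ofReal_one]
  simp only [betaAct, hu.mul, star_smul, star_mul, smul_mul_assoc, mul_smul_comm, smul_smul,
    mul_assoc]
  rw [← starRingEnd_apply, mul_comm, hc, one_smul]

/-- The vectors `(b ⊗ f)(Yv)ξ`. -/
def dilVec (Y : V →ₗ[ℂ] (H →L[ℂ] HilbertTensor K (DirectIntegral ν n))) (ξ : H)
    (p : ((K →L[ℂ] K) × Lp ℂ ∞ ν) × V) : HilbertTensor K (DirectIntegral ν n) :=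
  opTensor p.1.1 (diagOp p.1.2) (Y p.2 ξ)

/-- The symmetry on the index set of the vectors `dilVec`. -/
def symAct (U : G →* (V ≃ₗ[(H →L[ℂ] H)ᵐᵒᵖ] V)) (u : G → unitary (K →L[ℂ] K)) (g : G)
    (p : ((K →L[ℂ] K) × Lp ℂ ∞ ν) × V) : ((K →L[ℂ] K) × Lp ℂ ∞ ν) × V :=
  ((betaAct u g p.1.1, gammaAct ν g p.1.2), U g p.2)

theorem symAct_one {U : G →* (V ≃ₗ[(H →L[ℂ] H)ᵐᵒᵖ] V)} {m : G → G → Circle}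
    {u : G → unitary (K →L[ℂ] K)} (hu : IsMultiplierRep m u) (p : ((K →L[ℂ] K) × Lp ℂ ∞ ν) × V) :
    symAct U u 1 p = p := by
  rw [symAct, betaAct_one_left hu, gammaAct_one, map_one]; rfl

theorem symAct_mul {U : G →* (V ≃ₗ[(H →L[ℂ] H)ᵐᵒᵖ] V)} {m : G → G → Circle}
    {u : G → unitary (K →L[ℂ] K)} (hu : IsMultiplierRep m u) (g h : G)
    (p : ((K →L[ℂ] K) × Lp ℂ ∞ ν) × V) : symAct U u (g * h) p = symAct U u g (symAct U u h p) := by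
  simp only [symAct, betaAct_betaAct hu, gammaAct_gammaAct, map_mul, LinearEquiv.mul_apply]

theorem opTensor_diag_dilVec (b : K →L[ℂ] K) (f : Lp ℂ ∞ ν) (ξ : H)
    (p : ((K →L[ℂ] K) × Lp ℂ ∞ ν) × V) :
    opTensor b (diagOp f) (dilVec Y ξ p) = dilVec Y ξ ((b * p.1.1, linftyMul f p.1.2), p.2) :=
  opTensor_diag_apply_apply _ _ _ _ _

theorem symAct_diag (U : G →* (V ≃ₗ[(H →L[ℂ] H)ᵐᵒᵖ] V)) (u : G → unitary (K →L[ℂ] K)) (g : G)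
    (b : K →L[ℂ] K) (f : Lp ℂ ∞ ν) (p : ((K →L[ℂ] K) × Lp ℂ ∞ ν) × V) :
    symAct U u g ((b * p.1.1, linftyMul f p.1.2), p.2)
      = ((betaAct u g b * (symAct U u g p).1.1, linftyMul (gammaAct ν g f) (symAct U u g p).1.2),
          (symAct U u g p).2) := by
  simp only [symAct, betaAct_mul, gammaAct_mul]

theorem dilVec_one (ξ : H) (v : V) : dilVec Y ξ ((1, linftyOne ν), v) = Y v ξ := by
  rw [dilVec, diagOp_one, opTensor_one, one_apply_eq_self]

/-- The isometries `W_g`. -/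
theorem IsMinDil.exists_isometry (hY : IsMinDil S n Y)
    {U : G →* (V ≃ₗ[(H →L[ℂ] H)ᵐᵒᵖ] V)} {u : G → unitary (K →L[ℂ] K)}
    (hcov : ∀ (g : G) (x : InstrAlg K ν) (v w : V),
      (S (deltaAct ν u g x)).1 v w = (S x).1 (U g⁻¹ v) (U g⁻¹ w)) {ξ : H} (hξ : ‖ξ‖ = 1) (g : G) :
    ∃ W : HilbertTensor K (DirectIntegral ν n) →ₗᵢ[ℂ] HilbertTensor K (DirectIntegral ν n),
      ∀ p, W (dilVec Y ξ p) = dilVec Y ξ (symAct U u g p) := by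
  refine CovInstr.exists_isometry (a := dilVec Y ξ) (hY.total ξ hξ) fun p q => ?_
  rw [dilVec, dilVec, dilVec, dilVec, hY.inner_eq, hY.inner_eq]
  simp only [symAct]
  rw [← betaAct_star, ← betaAct_mul, ← gammaAct_star, ← gammaAct_mul]
  exact sFun_delta hcov ξ g _ _ _ _

/-- The unitaries `y_g` implementing the symmetry on the ancilla. -/
structure IsImpl (m : G → G → Circle) (U : G →* (V ≃ₗ[(H →L[ℂ] H)ᵐᵒᵖ] V))
    (u : G → unitary (K →L[ℂ] K)) (Y : V →ₗ[ℂ] (H →L[ℂ] HilbertTensor K (DirectIntegral ν n)))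
    (y : G → unitary (DirectIntegral ν n →L[ℂ] DirectIntegral ν n)) : Prop where
  intertwine : ∀ (g : G) (v : V), Y (U g v) = opTensor (u g : K →L[ℂ] K)
    (y g : DirectIntegral ν n →L[ℂ] DirectIntegral ν n) ∘L Y v
  diag : ∀ (g : G) (f : Lp ℂ ∞ ν), (y g : DirectIntegral ν n →L[ℂ] DirectIntegral ν n) * diagOp f
    = diagOp (gammaAct ν g f) * (y g : DirectIntegral ν n →L[ℂ] DirectIntegral ν n)
  mul : ∀ g h, (y (g * h) : DirectIntegral ν n →L[ℂ] DirectIntegral ν n)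
    = starRingEnd ℂ (m g h : ℂ) • ((y g : DirectIntegral ν n →L[ℂ] DirectIntegral ν n) *
        (y h : DirectIntegral ν n →L[ℂ] DirectIntegral ν n))
  rep : ∃ W : G →* unitary (HilbertTensor K (DirectIntegral ν n) →L[ℂ]
      HilbertTensor K (DirectIntegral ν n)),
    ∀ g : G, (W g : HilbertTensor K (DirectIntegral ν n) →L[ℂ] HilbertTensor K (DirectIntegral ν n))
      = opTensor (u g : K →L[ℂ] K) (y g : DirectIntegral ν n →L[ℂ] DirectIntegral ν n)

/-- A unitary intertwining `b ⊗ 1` and `ubu^* ⊗ 1` is of the form `u ⊗ y`. -/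
theorem exists_unitary_tensor {E : Type*} [NormedAddCommGroup E] [InnerProductSpace ℂ E]
    [CompleteSpace E] [Nontrivial K] (u : unitary (K →L[ℂ] K))
    (W : unitary (HilbertTensor K E →L[ℂ] HilbertTensor K E))
    (h : ∀ b, (W : HilbertTensor K E →L[ℂ] HilbertTensor K E) * opTensor b 1
      = opTensor ((u : K →L[ℂ] K) * b * star (u : K →L[ℂ] K)) 1 *
        (W : HilbertTensor K E →L[ℂ] HilbertTensor K E)) :
    ∃ y : unitary (E →L[ℂ] E), (W : HilbertTensor K E →L[ℂ] HilbertTensor K E)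
      = opTensor (u : K →L[ℂ] K) (y : E →L[ℂ] E) := by
  obtain ⟨e, he⟩ := exists_norm_eq K (zero_le_one (α := ℝ))
  have hu1 := Unitary.star_mul_self_of_mem u.2
  have hu2 := Unitary.mul_star_self_of_mem u.2
  set w := (W : HilbertTensor K E →L[ℂ] HilbertTensor K E)
  -- Removing u from the first factor leaves an operator that commutes with L(K) ⊗ 1.
  have hT : opTensor (star (u : K →L[ℂ] K)) 1 * w
      = opTensor 1 (slice e (opTensor (star (u : K →L[ℂ] K)) 1 * w)) := by
    refine eq_opTensor_one_of_commute (fun b => ?_) he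
    rw [mul_assoc, h, ← mul_assoc, ← mul_assoc, opTensor_mul, opTensor_mul, ← mul_assoc,
      ← mul_assoc, hu1, one_mul]
  set y := slice e (opTensor (star (u : K →L[ℂ] K)) 1 * w)
  have hw : w = opTensor (u : K →L[ℂ] K) y := by
    have : opTensor (u : K →L[ℂ] K) (1 : E →L[ℂ] E) * (opTensor (star (u : K →L[ℂ] K)) 1 * w)
        = opTensor (u : K →L[ℂ] K) 1 * opTensor 1 y := by rw [hT]
    rwa [← mul_assoc, opTensor_mul, hu2, one_mul, opTensor_one, one_mul, opTensor_mul, mul_one,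
      one_mul] at this
  refine ⟨⟨y, Unitary.mem_iff.2 ⟨?_, ?_⟩⟩, hw⟩
  · refine opTensor_one_injective (E := K) ?_
    have := Unitary.star_mul_self_of_mem W.2
    change star w * w = 1 at this
    rw [hw, opTensor_star, opTensor_mul, hu1] at this
    exact this.trans opTensor_one.symm
  · refine opTensor_one_injective (E := K) ?_
    have := Unitary.mul_star_self_of_mem W.2
    change w * star w = 1 at this
    rw [hw, opTensor_star, opTensor_mul, hu2] at this
    exact this.trans opTensor_one.symm

theorem opTensor_unitary_injective {E : Type*} [NormedAddCommGroup E] [InnerProductSpace ℂ E]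
    [Nontrivial K] (u : unitary (K →L[ℂ] K)) {y y' : E →L[ℂ] E}
    (h : opTensor (u : K →L[ℂ] K) y = opTensor (u : K →L[ℂ] K) y') : y = y' := by
  have hu1 := Unitary.star_mul_self_of_mem u.2
  have := congrArg (fun T => opTensor (star (u : K →L[ℂ] K)) (1 : E →L[ℂ] E) * T) h
  simp only [opTensor_mul, hu1, one_mul] at this
  exact opTensor_one_injective this

theorem mul_opTensor_diag_of_dilVec {ξ : H} (ht : Total (dilVec Y ξ))
    {U : G →* (V ≃ₗ[(H →L[ℂ] H)ᵐᵒᵖ] V)} {u : G → unitary (K →L[ℂ] K)} {g : G}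
    {T : HilbertTensor K (DirectIntegral ν n) →L[ℂ] HilbertTensor K (DirectIntegral ν n)}
    (hT : ∀ p, T (dilVec Y ξ p) = dilVec Y ξ (symAct U u g p)) (b : K →L[ℂ] K) (f : Lp ℂ ∞ ν) :
    T * opTensor b (diagOp f) = opTensor (betaAct u g b) (diagOp (gammaAct ν g f)) * T := by
  refine ht.ext fun p => ?_
  change T (opTensor b (diagOp f) (dilVec Y ξ p)) = opTensor _ _ (T (dilVec Y ξ p))
  rw [opTensor_diag_dilVec b f ξ p, hT, hT, symAct_diag]
  exact (opTensor_diag_dilVec _ _ ξ _).symm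

theorem mul_opTensor_one_of_dilVec {ξ : H} (ht : Total (dilVec Y ξ))
    {U : G →* (V ≃ₗ[(H →L[ℂ] H)ᵐᵒᵖ] V)} {u : G → unitary (K →L[ℂ] K)} {g : G}
    {T : HilbertTensor K (DirectIntegral ν n) →L[ℂ] HilbertTensor K (DirectIntegral ν n)}
    (hT : ∀ p, T (dilVec Y ξ p) = dilVec Y ξ (symAct U u g p)) (b : K →L[ℂ] K) :
    T * opTensor b 1 = opTensor ((u g : K →L[ℂ] K) * b * star (u g : K →L[ℂ] K)) 1 * T := by
  have h := mul_opTensor_diag_of_dilVec ht hT b (linftyOne ν)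
  rw [gammaAct_linftyOne, diagOp_one] at h
  exact h

theorem tensor_diag_comm {u : K →L[ℂ] K} {f f' : Lp ℂ ∞ ν}
    {T : HilbertTensor K (DirectIntegral ν n) →L[ℂ] HilbertTensor K (DirectIntegral ν n)}
    (h : T * opTensor 1 (diagOp f) = opTensor 1 (diagOp f') * T)
    {y : DirectIntegral ν n →L[ℂ] DirectIntegral ν n} (hy : T = opTensor u y) :
    opTensor u (y * diagOp f) = opTensor u (diagOp f' * y) := by
  rw [hy, opTensor_mul, opTensor_mul, one_mul, mul_one] at h
  exact h

theorem mul_opTensor_one_diag_of_dilVec {ξ : H} (ht : Total (dilVec Y ξ))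
    {U : G →* (V ≃ₗ[(H →L[ℂ] H)ᵐᵒᵖ] V)} {u : G → unitary (K →L[ℂ] K)} {g : G}
    {T : HilbertTensor K (DirectIntegral ν n) →L[ℂ] HilbertTensor K (DirectIntegral ν n)}
    (hT : ∀ p, T (dilVec Y ξ p) = dilVec Y ξ (symAct U u g p)) (f : Lp ℂ ∞ ν) :
    T * opTensor 1 (diagOp f) = opTensor 1 (diagOp (gammaAct ν g f)) * T := by
  have h := mul_opTensor_diag_of_dilVec ht hT 1 f
  rwa [betaAct_one_right] at h

/-- The action of T is given only on vectors built from ξ. The module element |η⟩⟨ξ| carries it over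
to any η, since U g is L(H)-linear. -/
theorem intertwine_of_dilVec (hY : IsRightLinear Y) {ξ : H} (hξ : ‖ξ‖ = 1)
    {U : G →* (V ≃ₗ[(H →L[ℂ] H)ᵐᵒᵖ] V)} {u : G → unitary (K →L[ℂ] K)} {g : G}
    {T : HilbertTensor K (DirectIntegral ν n) →L[ℂ] HilbertTensor K (DirectIntegral ν n)}
    (hT : ∀ p, T (dilVec Y ξ p) = dilVec Y ξ (symAct U u g p)) (v : V) :
    Y (U g v) = T ∘L Y v := by
  refine ContinuousLinearMap.ext fun η => ?_
  have h := hT ((1, linftyOne ν), MulOpposite.op (InnerProductSpace.rankOne ℂ η ξ) • v)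
  rw [symAct, betaAct_one_right, gammaAct_linftyOne, dilVec_one, dilVec_one,
    hY.apply_rankOne hξ] at h
  change T (Y v η) = Y (U g (MulOpposite.op _ • v)) ξ at h
  rw [(U g).map_smul, hY.apply_rankOne hξ] at h
  exact h.symm

/-- The product is an honest one on the tensor product, so the phase m(g,h) of u is compensated by
its conjugate in the second factor. -/
theorem multiplier_of_tensor {E : Type*} [NormedAddCommGroup E] [InnerProductSpace ℂ E]
    [CompleteSpace E] [Nontrivial K] {m : G → G → Circle} {u : G → unitary (K →L[ℂ] K)}
    (hu : IsMultiplierRep m u) {g h : G} {y y' y'' : E →L[ℂ] E}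
    (H : opTensor (u (g * h) : K →L[ℂ] K) y
      = opTensor (u g : K →L[ℂ] K) y' * opTensor (u h : K →L[ℂ] K) y'') :
    y = starRingEnd ℂ (m g h : ℂ) • (y' * y'') := by
  rw [opTensor_mul, hu.mul, opTensor_smul_left, ← opTensor_smul_right] at H
  have h2 := opTensor_unitary_injective (u g * u h) H
  have hc : starRingEnd ℂ (m g h : ℂ) * (m g h : ℂ) = 1 := by
    rw [mul_comm, Complex.mul_conj, Circle.normSq_coe, Complex.ofReal_one]
  rw [← h2, smul_smul, hc, one_smul]

/-- All properties of y_g are obtained for W_g on the generating vectors and transferred through W_g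
= u_g ⊗ y_g, the unitary u_g being cancelled from the first factor. -/
theorem IsMinDil.exists_isImpl [Nontrivial K] (hY : IsMinDil S n Y)
    {U : G →* (V ≃ₗ[(H →L[ℂ] H)ᵐᵒᵖ] V)} {m : G → G → Circle}
    {u : G → unitary (K →L[ℂ] K)} (hu : IsMultiplierRep m u)
    (hcov : ∀ (g : G) (x : InstrAlg K ν) (v w : V),
      (S (deltaAct ν u g x)).1 v w = (S x).1 (U g⁻¹ v) (U g⁻¹ w)) {ξ : H} (hξ : ‖ξ‖ = 1) :
    ∃ y, IsImpl m U u Y y := by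
  have ht : Total (dilVec Y ξ) := hY.total ξ hξ
  choose W hW using fun g => hY.exists_isometry hcov hξ g
  obtain ⟨R, hR⟩ := exists_unitary_rep W ht hW (symAct_one hu) (symAct_mul hu)
  have hRW : ∀ g p, (R g : HilbertTensor K (DirectIntegral ν n) →L[ℂ]
      HilbertTensor K (DirectIntegral ν n)) (dilVec Y ξ p) = dilVec Y ξ (symAct U u g p) :=
    fun g p => by rw [hR]; exact hW g p
  choose y hy using fun g => exists_unitary_tensor (u g) (R g)
    (mul_opTensor_one_of_dilVec ht (hRW g))
  refine ⟨y, fun g v => ?_, fun g f => ?_, fun g h => ?_, R, hy⟩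
  · exact (intertwine_of_dilVec hY.right hξ (hRW g) v).trans
      (congrArg (fun T => ContinuousLinearMap.comp T (Y v)) (hy g))
  · exact opTensor_unitary_injective (u g)
      (tensor_diag_comm (mul_opTensor_one_diag_of_dilVec ht (hRW g) f) (hy g))
  · exact multiplier_of_tensor hu ((hy (g * h)).symm.trans
      ((congrArg Subtype.val (map_mul R g h)).trans (congrArg₂ (· * ·) (hy g) (hy h))))

end Implementation

/-! ### Fibres -/

section Fibers

/-- The projection of `ℓ²` onto `H_c`. -/
def fiberProj (c : ℕ∞) : Ell2 →L[ℂ] Ell2 := (Fiber c).starProjection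

theorem fiberProj_mem (c : ℕ∞) (x : Ell2) : fiberProj c x ∈ Fiber c :=
  Submodule.starProjection_apply_mem _ _

theorem fiberProj_of_mem {c : ℕ∞} {x : Ell2} (hx : x ∈ Fiber c) : fiberProj c x = x :=
  Submodule.starProjection_eq_self_iff.2 hx

theorem extOp_apply_of_mem {c : ℕ∞} (T : Fiber c →L[ℂ] Fiber c) {x : Ell2} (hx : x ∈ Fiber c) :
    extOp T x = T ⟨x, hx⟩ := by
  have : (Fiber c).orthogonalProjectionOnto x = ⟨x, hx⟩ :=
    Submodule.orthogonalProjectionOnto_mem_subspace_eq_self (K := Fiber c) ⟨x, hx⟩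
  simp only [extOp, ContinuousLinearMap.comp_apply, this, Submodule.subtypeL_apply]

theorem exists_extOp_eq {c : ℕ∞} {F : Ell2 →L[ℂ] Ell2} (h1 : F ∘L fiberProj c = F)
    (h2 : fiberProj c ∘L F = F) : ∃ T : Fiber c →L[ℂ] Fiber c, extOp T = F ∧ ‖T‖ ≤ ‖F‖ := by
  have hm : ∀ x : Fiber c, F x ∈ Fiber c := fun x => by
    rw [← h2]; exact fiberProj_mem _ _
  refine ⟨(F ∘L (Fiber c).subtypeL).codRestrict (Fiber c) hm, ?_, ?_⟩
  · refine ContinuousLinearMap.ext fun x => ?_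
    conv_rhs => rw [← h1]
    rfl
  · exact ContinuousLinearMap.opNorm_le_bound _ (norm_nonneg _) fun x => F.le_opNorm x

/-- A contraction with a contractive inverse is isometric and onto. -/
theorem exists_fiber_unitary {c : ℕ∞} {F F' : Ell2 →L[ℂ] Ell2} (hF : ‖F‖ ≤ 1) (hF' : ‖F'‖ ≤ 1)
    (h1 : F ∘L fiberProj c = F) (h2 : fiberProj c ∘L F = F) (h1' : F' ∘L fiberProj c = F')
    (h2' : fiberProj c ∘L F' = F') (hFF : F ∘L F' = fiberProj c) (hFF' : F' ∘L F = fiberProj c) :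
    ∃ v : unitary (Fiber c →L[ℂ] Fiber c), extOp (v : Fiber c →L[ℂ] Fiber c) = F := by
  obtain ⟨T, hT, hTn⟩ := exists_extOp_eq h1 h2
  obtain ⟨T', hT', hTn'⟩ := exists_extOp_eq h1' h2'
  have hTx : ∀ x : Fiber c, ((T x : Fiber c) : Ell2) = F x := fun x => by
    rw [← hT, extOp_apply_of_mem T x.2]
  have hTx' : ∀ x : Fiber c, ((T' x : Fiber c) : Ell2) = F' x := fun x => by
    rw [← hT', extOp_apply_of_mem T' x.2]
  have e1 : ∀ x, T (T' x) = x := fun x => Subtype.ext (by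
    rw [hTx, hTx', ← ContinuousLinearMap.comp_apply, hFF, fiberProj_of_mem x.2])
  have e2 : ∀ x, T' (T x) = x := fun x => Subtype.ext (by
    rw [hTx', hTx, ← ContinuousLinearMap.comp_apply, hFF', fiberProj_of_mem x.2])
  have hn : ∀ x, ‖T x‖ = ‖x‖ := fun x => by
    refine le_antisymm ((T.le_of_opNorm_le (hTn.trans hF) x).trans_eq (one_mul _)) ?_
    conv_lhs => rw [← e2 x]
    exact (T'.le_of_opNorm_le (hTn'.trans hF') _).trans_eq (one_mul _)
  refine ⟨Unitary.linearIsometryEquiv.symm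
    (LinearIsometryEquiv.ofSurjective ⟨T.toLinearMap, hn⟩ fun x => ⟨T' x, e1 x⟩), ?_⟩
  rw [← hT]
  rfl

/-- If b = k were a finite number below a, then ℂ^{k+1} → H_a → H_k → ℂ^k would be injective. -/
theorem le_of_fiber_injective {a b : ℕ∞} (f : Fiber a →ₗ[ℂ] Fiber b)
    (hf : Function.Injective f) : a ≤ b := by
  by_contra h
  rw [not_le] at h
  obtain ⟨k, rfl⟩ := ENat.ne_top_iff_exists.1 (h.trans_le le_top).ne
  have hi : ∀ i : Fin (k + 1), (i : ℕ∞) < a := fun i =>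
    lt_of_le_of_lt (by exact_mod_cast Nat.lt_succ_iff.1 i.2) h
  let g : (Fin (k + 1) → ℂ) →ₗ[ℂ] Fiber a :=
    { toFun c := ⟨∑ i : Fin (k + 1), lp.single 2 (i : ℕ) (c i), Submodule.sum_mem _ fun i _ l hl => by
        have : l ≠ i := by rintro rfl; exact absurd (hi i) hl.not_gt
        rw [lp.single_apply, Pi.single_eq_of_ne this]⟩
      map_add' c d := Subtype.ext (by
        simp only [Pi.add_apply, lp.single_add, Finset.sum_add_distrib, Submodule.coe_add])
      map_smul' z c := Subtype.ext (by
        simp only [Pi.smul_apply, lp.single_smul, ← Finset.smul_sum, RingHom.id_apply,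
          Submodule.coe_smul]) }
  let p : Fiber (k : ℕ∞) →ₗ[ℂ] (Fin k → ℂ) :=
    { toFun x i := (x : Ell2) i
      map_add' x y := rfl
      map_smul' z x := rfl }
  have hg : Function.Injective g := by
    refine (injective_iff_map_eq_zero g).2 fun c hc => funext fun j => ?_
    have h1 : ((g c : Fiber a) : Ell2) j = 0 := by rw [hc]; rfl
    change ((∑ i : Fin (k + 1), lp.single 2 (i : ℕ) (c i) : Ell2)) j = 0 at h1
    rw [lp.coeFn_sum, Finset.sum_apply, Finset.sum_eq_single j] at h1
    · rwa [lp.single_apply, Pi.single_eq_same] at h1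
    · intro i _ hij
      rw [lp.single_apply, Pi.single_eq_of_ne fun h => hij (Fin.ext h.symm)]
    · simp
  have hp : Function.Injective p := by
    refine (injective_iff_map_eq_zero p).2 fun x hx => Subtype.ext (lp.ext (funext fun l => ?_))
    by_cases hl : l < k
    · exact congrFun hx ⟨l, hl⟩
    · exact x.2 l (by exact_mod_cast not_lt.1 hl)
  have := LinearMap.finrank_le_finrank_of_injective (f := p ∘ₗ f ∘ₗ g) (hp.comp (hf.comp hg))
  simp at this

theorem fiber_eq_of_inverse {a b : ℕ∞} {F F' : Ell2 →L[ℂ] Ell2} (h : F ∘L F' = fiberProj b)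
    (h' : F' ∘L F = fiberProj a) (hF : fiberProj b ∘L F = F) (hF' : fiberProj a ∘L F' = F') :
    a = b := by
  have key : ∀ {a b : ℕ∞} {F F' : Ell2 →L[ℂ] Ell2}, F' ∘L F = fiberProj a →
      fiberProj b ∘L F = F → a ≤ b := fun {a b F F'} h' hF => by
    have hm : ∀ x, F x ∈ Fiber b := fun x => by rw [← hF]; exact fiberProj_mem _ _
    refine le_of_fiber_injective
      ((F.toLinearMap ∘ₗ (Fiber a).subtype).codRestrict (Fiber b) fun x => hm x) fun x y hxy => ?_
    have h1 : F x = F y := congrArg Subtype.val hxy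
    have h2 : ∀ x : Fiber a, F' (F x) = x := fun x => by
      rw [← ContinuousLinearMap.comp_apply, h', fiberProj_of_mem x.2]
    exact Subtype.ext (by rw [← h2, h1, h2])
  exact le_antisymm (key h' hF) (key h hF')

end Fibers

/-! ### The cocycle of Koopman operators -/

section Koopman

variable {Ω : Type*} [MeasurableSpace Ω] {G : Type*} [Group G] [MulAction G Ω]
  [MeasurableConstSMul G Ω] {ν : Measure Ω} [SigmaFinite ν] [QuasiInvariant G ν]
variable {E : Type*} [NormedAddCommGroup E] [InnerProductSpace ℂ E] [CompleteSpace E]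

theorem lintegral_rho' (g : G) {Φ : Ω → ℝ≥0∞} (hΦ : Measurable Φ) :
    ∫⁻ ω, rho ν g⁻¹ ω * Φ ω ∂ν = ∫⁻ ω, Φ (g • ω) ∂ν := by
  rw [← lintegral_rho ν g (F := fun ω => Φ (g • ω)) (hΦ.comp (measurable_const_smul g)).aemeasurable]
  simp only [smul_inv_smul]

/-- The chain rule for Radon-Nikodym derivatives, tested by integrating both sides over measurable
sets. -/
theorem rho_mul (g h : G) :
    rho ν (g * h)⁻¹ =ᵐ[ν] fun ω => rho ν g⁻¹ ω * rho ν h⁻¹ (g⁻¹ • ω) := by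
  have hm : ∀ g : G, Measurable (rho ν g) := fun g => Measure.measurable_rnDeriv _ _
  have hmh : Measurable fun ω => rho ν h⁻¹ (g⁻¹ • ω) := (hm _).comp (measurable_const_smul _)
  refine ae_eq_of_forall_setLIntegral_eq_of_sigmaFinite (hm _) ((hm _).mul hmh) fun X hX _ => ?_
  let Φ : Ω → ℝ≥0∞ := X.indicator 1
  have hΦ : Measurable Φ := measurable_one.indicator hX
  have e : ∀ f : Ω → ℝ≥0∞, ∫⁻ ω in X, f ω ∂ν = ∫⁻ ω, f ω * Φ ω ∂ν := fun f => by
    rw [← lintegral_indicator hX]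
    refine lintegral_congr fun ω => ?_
    by_cases hω : ω ∈ X <;> simp [Φ, hω]
  rw [e, e, lintegral_rho' _ hΦ]
  have h1 := lintegral_rho ν g (F := fun ω => rho ν h⁻¹ ω * Φ (g • ω))
    ((hm _).mul (hΦ.comp (measurable_const_smul g))).aemeasurable
  simp only [smul_inv_smul] at h1
  simp only [mul_assoc]
  have h2 := lintegral_rho' (ν := ν) h (Φ := fun ω => Φ (g • ω))
    (hΦ.comp (measurable_const_smul g))
  rw [h1, h2]
  simp only [mul_smul]

theorem koopman_mul (g h : G) : (koopman E ν (g * h) : Lp E 2 ν →L[ℂ] Lp E 2 ν)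
    = (koopman E ν g : Lp E 2 ν →L[ℂ] Lp E 2 ν) * (koopman E ν h : Lp E 2 ν →L[ℂ] Lp E 2 ν) := by
  refine ContinuousLinearMap.ext fun ψ => Lp.ext ?_
  filter_upwards [koopman_coeFn E ν (g * h) ψ, koopman_coeFn E ν g
    ((koopman E ν h : Lp E 2 ν →L[ℂ] Lp E 2 ν) ψ), rho_mul (ν := ν) g h,
    (quasiMeasurePreserving_smul ν g⁻¹).ae (koopman_coeFn E ν h ψ)] with ω h1 h2 h3 h4
  rw [mul_apply_eq_comp, h1, h2, h3, h4, smul_smul, ENNReal.toReal_mul,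
    Real.sqrt_mul ENNReal.toReal_nonneg, Complex.ofReal_mul, smul_smul, mul_inv_rev]

/-- The density factor is scalar and passes through the linear maps F, so only the translation of
the argument survives. -/
theorem IsField.conj_koopman {T : Lp E 2 ν →L[ℂ] Lp E 2 ν} {F : Ω → E →L[ℂ] E} (h : IsField T F)
    (g : G) : IsField ((koopman E ν g : Lp E 2 ν →L[ℂ] Lp E 2 ν) * T *
      star (koopman E ν g : Lp E 2 ν →L[ℂ] Lp E 2 ν)) fun ω => F (g⁻¹ • ω) := fun ψ => by
  set l := (koopman E ν g : Lp E 2 ν →L[ℂ] Lp E 2 ν)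
  have hl : l (star l ψ) = ψ := by
    rw [← mul_apply_eq_comp, Unitary.mul_star_self_of_mem (koopman E ν g).2, one_apply_eq_self]
  have h1 := koopman_coeFn E ν g (T (star l ψ))
  have h2 := koopman_coeFn E ν g (star l ψ)
  rw [hl] at h2
  filter_upwards [h1, h2, (quasiMeasurePreserving_smul ν g⁻¹).ae (h (star l ψ))] with ω h1 h2 h3
  rw [mul_apply_eq_comp, mul_apply_eq_comp, h1, h2, h3, map_smul]

end Koopman

/-! ### Operators on the direct integral as operators on `L²(ν; ℓ²)` -/

section Star

variable {E : Type*} [NormedAddCommGroup E] [InnerProductSpace ℂ E] [CompleteSpace E]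

theorem op_star_mul (A B : E →L[ℂ] E) : star (A * B) = star B * star A := star_mul A B

theorem op_star_star (A : E →L[ℂ] E) : star (star A) = A := star_star A

theorem op_star_one : star (1 : E →L[ℂ] E) = 1 := star_one _

theorem norm_op_star (A : E →L[ℂ] E) : ‖star A‖ = ‖A‖ :=
  ContinuousLinearMap.adjoint.norm_map A

theorem norm_op_zero_le (A : E →L[ℂ] E) {F : Type*} [NormedAddCommGroup F] [InnerProductSpace ℂ F] :
    ‖(0 : F →L[ℂ] F)‖ ≤ ‖A‖ := by
  rw [norm_zero]; exact norm_nonneg _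

theorem norm_conj_adjoint_le {F : Type*} [NormedAddCommGroup F] [InnerProductSpace ℂ F]
    [CompleteSpace F] {J : F →L[ℂ] E} (hJ : ‖J‖ ≤ 1) (B : F →L[ℂ] F) :
    ‖J ∘L B ∘L ContinuousLinearMap.adjoint J‖ ≤ ‖B‖ := by
  have h2 : ‖ContinuousLinearMap.adjoint J‖ ≤ 1 :=
    (ContinuousLinearMap.adjoint.norm_map J).trans_le hJ
  refine (ContinuousLinearMap.opNorm_comp_le _ _).trans ?_
  refine (mul_le_of_le_one_left (norm_nonneg _) hJ).trans ?_
  exact (ContinuousLinearMap.opNorm_comp_le _ _).trans (mul_le_of_le_one_right (norm_nonneg _) h2)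

theorem star_conj_adjoint {F : Type*} [NormedAddCommGroup F] [InnerProductSpace ℂ F]
    [CompleteSpace F] (J : F →L[ℂ] E) (B : F →L[ℂ] F) :
    star (J ∘L B ∘L ContinuousLinearMap.adjoint J)
      = J ∘L star B ∘L ContinuousLinearMap.adjoint J := by
  rw [ContinuousLinearMap.star_eq_adjoint, ContinuousLinearMap.adjoint_comp,
    ContinuousLinearMap.adjoint_comp, ContinuousLinearMap.adjoint_adjoint,
    ContinuousLinearMap.star_eq_adjoint, ContinuousLinearMap.comp_assoc]

end Star

section Amplification

variable {Ω : Type*} [MeasurableSpace Ω] {ν : Measure Ω} {n : Ω → ℕ∞}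

/-- An operator on `H_⊕` extended by `0` to `L²(ν; ℓ²)`. -/
def extDI (B : DirectIntegral ν n →L[ℂ] DirectIntegral ν n) : Lp Ell2 2 ν →L[ℂ] Lp Ell2 2 ν :=
  (DirectIntegral ν n).subtypeL ∘L B ∘L ContinuousLinearMap.adjoint (DirectIntegral ν n).subtypeL

theorem adjoint_subtypeL_coe (ψ : DirectIntegral ν n) :
    ContinuousLinearMap.adjoint (DirectIntegral ν n).subtypeL (ψ : Lp Ell2 2 ν) = ψ :=
  ext_inner_left ℂ fun _ => ContinuousLinearMap.adjoint_inner_right _ _ _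

theorem extDI_coe (B : DirectIntegral ν n →L[ℂ] DirectIntegral ν n) (ψ : DirectIntegral ν n) :
    extDI B (ψ : Lp Ell2 2 ν) = B ψ := by
  change ((B (ContinuousLinearMap.adjoint (DirectIntegral ν n).subtypeL (ψ : Lp Ell2 2 ν)) :
    DirectIntegral ν n) : Lp Ell2 2 ν) = _
  rw [adjoint_subtypeL_coe]

theorem extDI_injective : Function.Injective
    (extDI : (DirectIntegral ν n →L[ℂ] DirectIntegral ν n) → _) := fun A B h =>
  ContinuousLinearMap.ext fun ψ => Subtype.ext (by rw [← extDI_coe, ← extDI_coe, h])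

theorem extDI_mul (A B : DirectIntegral ν n →L[ℂ] DirectIntegral ν n) :
    extDI (A * B) = extDI A * extDI B :=
  ContinuousLinearMap.ext fun _ => (extDI_coe A _).symm

theorem extDI_smul (c : ℂ) (A : DirectIntegral ν n →L[ℂ] DirectIntegral ν n) :
    extDI (c • A) = c • extDI A :=
  ContinuousLinearMap.ext fun _ => rfl

theorem extDI_star (B : DirectIntegral ν n →L[ℂ] DirectIntegral ν n) :
    star (extDI B) = extDI (star B) :=
  star_conj_adjoint _ B

theorem mulOp_mul_extDI (f : Lp ℂ ∞ ν) (B : DirectIntegral ν n →L[ℂ] DirectIntegral ν n) :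
    mulOp Ell2 ν f * extDI B = extDI (diagOp f * B) :=
  ContinuousLinearMap.ext fun _ => rfl

theorem extDI_mul_mulOp (f : Lp ℂ ∞ ν) (B : DirectIntegral ν n →L[ℂ] DirectIntegral ν n) :
    extDI B * mulOp Ell2 ν f = extDI (B * diagOp f) := by
  have h := congrArg star (mulOp_mul_extDI (star f) (star B))
  rw [star_mul, mulOp_star, star_star, extDI_star, extDI_star] at h
  have e : star ((diagOp (star f) : DirectIntegral ν n →L[ℂ] DirectIntegral ν n) * star B)
      = B * diagOp f := by
    rw [op_star_mul, op_star_star, diagOp_star, star_star]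
  exact (congrArg (fun A => extDI A * _) (op_star_star B).symm).trans (h.trans (congrArg extDI e))

theorem norm_extDI_le (B : DirectIntegral ν n →L[ℂ] DirectIntegral ν n) : ‖extDI B‖ ≤ ‖B‖ :=
  norm_conj_adjoint_le (Submodule.norm_subtypeL_le _) B

instance : TopologicalSpace.SeparableSpace Ell2 := by
  let b : HilbertBasis ℕ ℂ Ell2 := HilbertBasis.ofRepr (LinearIsometryEquiv.refl ℂ Ell2)
  have h1 : TopologicalSpace.IsSeparable (Submodule.span ℂ (Set.range b) : Set Ell2) :=
    (Set.countable_range b).isSeparable.span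
  have h2 := congrArg (fun S : Submodule ℂ Ell2 => (S : Set Ell2)) b.dense_span
  simp only [Submodule.topologicalClosure_coe, Submodule.top_coe] at h2
  exact TopologicalSpace.isSeparable_univ_iff.1 (h2 ▸ h1.closure)

theorem aestronglyMeasurable_fiberProj (hn : Measurable n) (ψ : Lp Ell2 2 ν) :
    AEStronglyMeasurable (fun ω => fiberProj (n ω) (ψ ω)) ν := by
  borelize Ell2
  have : SecondCountableTopology Ell2 := UniformSpace.secondCountable_of_separable Ell2
  have h : Measurable fun p : ℕ∞ × Ell2 => fiberProj p.1 p.2 :=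
    measurable_from_prod_countable_right fun c => (fiberProj c).continuous.measurable
  exact (h.comp_aemeasurable
    (hn.aemeasurable.prodMk (Lp.aestronglyMeasurable ψ).aemeasurable)).aestronglyMeasurable

/-- The projection onto the direct integral acts fibrewise. Measurability of the projected function
uses that n takes countably many values. -/
theorem isField_extDI_one (hn : Measurable n) :
    IsField (extDI (1 : DirectIntegral ν n →L[ℂ] DirectIntegral ν n)) fun ω => fiberProj (n ω) :=
    fun ψ => by
  have hle : ∀ c (x : Ell2), ‖fiberProj c x‖ ≤ ‖x‖ := fun c x =>
    Submodule.norm_starProjection_apply_le _ _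
  have hm : MemLp (fun ω => fiberProj (n ω) (ψ ω)) 2 ν := (Lp.memLp ψ).of_le
    (aestronglyMeasurable_fiberProj hn ψ) (Eventually.of_forall fun ω => hle _ _)
  have hmem : hm.toLp _ ∈ DirectIntegral ν n := by
    filter_upwards [hm.coeFn_toLp] with ω h
    rw [h]; exact fiberProj_mem _ _
  have e : ContinuousLinearMap.adjoint (DirectIntegral ν n).subtypeL ψ = ⟨hm.toLp _, hmem⟩ := by
    refine ext_inner_left ℂ fun φ => ?_
    rw [ContinuousLinearMap.adjoint_inner_right]
    change inner ℂ (φ : Lp Ell2 2 ν) ψ = inner ℂ (φ : Lp Ell2 2 ν) (hm.toLp _)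
    rw [L2.inner_def, L2.inner_def]
    refine integral_congr_ae ?_
    filter_upwards [hm.coeFn_toLp, φ.2] with ω h1 h2
    rw [h1]
    conv_lhs => rw [← fiberProj_of_mem h2]
    exact Submodule.inner_starProjection_left_eq_right _ _ _
  have h : extDI (1 : DirectIntegral ν n →L[ℂ] DirectIntegral ν n) ψ = hm.toLp _ :=
    congrArg Subtype.val e
  rw [h]
  exact hm.coeFn_toLp

theorem IsDecomposedBy.isField (hn : Measurable n)
    {D : DirectIntegral ν n →L[ℂ] DirectIntegral ν n} {Df : ∀ ω, Fiber (n ω) →L[ℂ] Fiber (n ω)}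
    (h : IsDecomposedBy D Df) : IsField (extDI D) fun ω => extOp (Df ω) := fun ψ => by
  have h1 := h.2.2 (ContinuousLinearMap.adjoint (DirectIntegral ν n).subtypeL ψ)
  filter_upwards [h1, isField_extDI_one hn ψ] with ω h1 h2
  refine h1.trans ?_
  refine (congrArg (extOp (Df ω)) h2).trans ?_
  rw [← ContinuousLinearMap.comp_apply]
  congr 1
  refine ContinuousLinearMap.ext fun x => ?_
  change ((Df ω ((Fiber (n ω)).orthogonalProjectionOnto (fiberProj (n ω) x)) : Fiber (n ω)) : Ell2)
    = Df ω ((Fiber (n ω)).orthogonalProjectionOnto x)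
  congr 2
  exact Submodule.orthogonalProjectionOnto_mem_subspace_eq_self (K := Fiber (n ω))
    ((Fiber (n ω)).orthogonalProjectionOnto x)

theorem IsField.isWeaklyMeasurable {T : Lp Ell2 2 ν →L[ℂ] Lp Ell2 2 ν}
    {Tf : ∀ ω, Fiber (n ω) →L[ℂ] Fiber (n ω)} (h : IsField T fun ω => extOp (Tf ω)) :
    IsWeaklyMeasurable ν Tf := fun φ ψ => by
  refine (((Lp.aestronglyMeasurable (φ : Lp Ell2 2 ν)).inner
    (Lp.aestronglyMeasurable (T ψ))).aemeasurable).congr ?_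
  filter_upwards [h ψ] with ω h1
  rw [h1]

theorem extDI_commutes_iff {D : DirectIntegral ν n →L[ℂ] DirectIntegral ν n} :
    CommutesLinfty (extDI D) ↔ ∀ f : Lp ℂ ∞ ν, D * diagOp f = diagOp f * D := by
  refine forall_congr' fun f => ?_
  rw [mulOp_mul_extDI, extDI_mul_mulOp, extDI_injective.eq_iff]

theorem IsField.commutes {E : Type*} [NormedAddCommGroup E] [InnerProductSpace ℂ E]
    {T : Lp E 2 ν →L[ℂ] Lp E 2 ν} {F : Ω → E →L[ℂ] E} (h : IsField T F) : CommutesLinfty T :=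
  fun f => ContinuousLinearMap.ext fun ψ => Lp.ext (by
    filter_upwards [h (mulOp E ν f ψ), h ψ, mulOp_coeFn f ψ, mulOp_coeFn f (T ψ)]
      with ω h1 h2 h3 h4
    rw [mul_apply_eq_comp, mul_apply_eq_comp, h1, h3, map_smul, h4, h2])

/-- Extended by 0 to L²(ν; ℓ²), D is decomposable. Its field is almost everywhere unchanged by the
fibre projections on either side, so it restricts to the fibres; 0 is used on the exceptional set.
-/
theorem exists_isDecomposedBy [SigmaFinite ν] (hn : Measurable n)
    {D : DirectIntegral ν n →L[ℂ] DirectIntegral ν n}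
    (hD : ∀ f : Lp ℂ ∞ ν, D * diagOp f = diagOp f * D) :
    ∃ Df : ∀ ω, Fiber (n ω) →L[ℂ] Fiber (n ω), IsDecomposedBy D Df := by
  classical
  obtain ⟨F, hFn, hF⟩ := (extDI_commutes_iff.2 hD).exists_field
  have hP := isField_extDI_one (ν := ν) hn
  have e1 : extDI D * extDI (1 : DirectIntegral ν n →L[ℂ] DirectIntegral ν n) = extDI D := by rw [← extDI_mul, mul_one]
  have e2 : extDI (1 : DirectIntegral ν n →L[ℂ] DirectIntegral ν n) * extDI D = extDI D := by rw [← extDI_mul, one_mul]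
  have h1 := (e1 ▸ hF.mul hP).ae_eq hF
  have h2 := (e2 ▸ hP.mul hF).ae_eq hF
  have h3 : ∀ ω, ∃ T : Fiber (n ω) →L[ℂ] Fiber (n ω), ‖T‖ ≤ ‖extDI D‖ ∧
      (F ω ∘L fiberProj (n ω) = F ω → fiberProj (n ω) ∘L F ω = F ω → extOp T = F ω) := fun ω => by
    by_cases h : F ω ∘L fiberProj (n ω) = F ω ∧ fiberProj (n ω) ∘L F ω = F ω
    · obtain ⟨T, hT, hTn⟩ := exists_extOp_eq h.1 h.2
      exact ⟨T, hTn.trans (hFn ω), fun _ _ => hT⟩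
    · exact ⟨0, norm_op_zero_le _, fun a b => absurd ⟨a, b⟩ h⟩
  choose Df hn' hDf using h3
  have hf : IsField (extDI D) fun ω => extOp (Df ω) := fun ψ => by
    filter_upwards [hF ψ, h1, h2] with ω h h1 h2
    rw [h, hDf ω h1 h2]
  refine ⟨Df, hf.isWeaklyMeasurable, ⟨_, Eventually.of_forall hn'⟩, fun ψ => ?_⟩
  have := hf ψ
  rwa [extDI_coe] at this

end Amplification

/-! ### The fields of covariant unitaries -/

section Cocycle

variable {Ω : Type*} [MeasurableSpace Ω] {G : Type*} [Group G] [MulAction G Ω]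
  [MeasurableConstSMul G Ω] {ν : Measure Ω} [SigmaFinite ν] [QuasiInvariant G ν]
variable {n : Ω → ℕ∞}

/-- The quotient of an operator on `H_⊕` by the Koopman unitary. -/
def overKoopman (g : G) (z : DirectIntegral ν n →L[ℂ] DirectIntegral ν n) :
    Lp Ell2 2 ν →L[ℂ] Lp Ell2 2 ν :=
  extDI z * star (koopman Ell2 ν g : Lp Ell2 2 ν →L[ℂ] Lp Ell2 2 ν)

theorem overKoopman_koopman (g : G) (z : DirectIntegral ν n →L[ℂ] DirectIntegral ν n) :
    overKoopman g z * (koopman Ell2 ν g : Lp Ell2 2 ν →L[ℂ] Lp Ell2 2 ν) = extDI z := by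
  rw [overKoopman, mul_assoc, Unitary.star_mul_self_of_mem (koopman Ell2 ν g).2, mul_one]

theorem star_koopman_mul_mulOp {E : Type*} [NormedAddCommGroup E] [InnerProductSpace ℂ E]
    [CompleteSpace E] (g : G) (f : Lp ℂ ∞ ν) :
    star (koopman E ν g : Lp E 2 ν →L[ℂ] Lp E 2 ν) * mulOp E ν (gammaAct ν g f)
      = mulOp E ν f * star (koopman E ν g : Lp E 2 ν →L[ℂ] Lp E 2 ν) := by
  have h1 := Unitary.star_mul_self_of_mem (koopman E ν g).2
  have h2 := Unitary.mul_star_self_of_mem (koopman E ν g).2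
  have h := koopman_mul_mulOp (E := E) ν g f
  set l := (koopman E ν g : Lp E 2 ν →L[ℂ] Lp E 2 ν)
  calc star l * mulOp E ν (gammaAct ν g f)
      = star l * (mulOp E ν (gammaAct ν g f) * l) * star l := by
        rw [mul_assoc, mul_assoc, h2, mul_one]
    _ = (star l * l) * mulOp E ν f * star l := by rw [← h]; simp only [mul_assoc]
    _ = _ := by rw [h1, one_mul]

/-- Both z and the Koopman unitary implement the translation γ_g, which cancels in the quotient. -/
theorem overKoopman_commutes {g : G} {z : DirectIntegral ν n →L[ℂ] DirectIntegral ν n}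
    (hz : ∀ f : Lp ℂ ∞ ν, z * diagOp f = diagOp (gammaAct ν g f) * z) :
    CommutesLinfty (overKoopman g z) := fun f => by
  obtain ⟨f', rfl⟩ : ∃ f', f = gammaAct ν g f' := ⟨gammaAct ν g⁻¹ f, by
    rw [gammaAct_gammaAct, mul_inv_cancel, gammaAct_one]⟩
  rw [overKoopman, mul_assoc, star_koopman_mul_mulOp, ← mul_assoc, extDI_mul_mulOp, hz,
    ← mulOp_mul_extDI, mul_assoc]

theorem CommutesLinfty.star {E : Type*} [NormedAddCommGroup E] [InnerProductSpace ℂ E]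
    [CompleteSpace E] {T : Lp E 2 ν →L[ℂ] Lp E 2 ν} (h : CommutesLinfty T) :
    CommutesLinfty (star T) := fun f => by
  have := congrArg Star.star (h (Star.star f))
  rw [star_mul, star_mul, mulOp_star, star_star] at this
  exact this.symm

theorem norm_unitary_le_one {E : Type*} [NormedAddCommGroup E] [InnerProductSpace ℂ E]
    [CompleteSpace E] (z : unitary (E →L[ℂ] E)) : ‖(z : E →L[ℂ] E)‖ ≤ 1 :=
  ContinuousLinearMap.opNorm_le_bound _ zero_le_one fun x => by
    rw [one_mul]; exact (Unitary.norm_map z x).le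

/-- For T = z λ_g^*, the projection TT^* has fibres H_{n(ω)} and T^*T has fibres H_{n(g⁻¹ω)}. Hence
the field of T is almost everywhere unitary between these spaces and their dimensions agree. Since
H_c is one fixed subspace of ℓ² for each c, source and target then coincide. -/
theorem exists_field_of_covariant (hn : Measurable n) (g : G)
    (z : unitary (DirectIntegral ν n →L[ℂ] DirectIntegral ν n))
    (hz : ∀ f : Lp ℂ ∞ ν, (z : DirectIntegral ν n →L[ℂ] DirectIntegral ν n) * diagOp f
      = diagOp (gammaAct ν g f) * (z : DirectIntegral ν n →L[ℂ] DirectIntegral ν n)) :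
    (∀ᵐ ω ∂ν, n (g⁻¹ • ω) = n ω) ∧
    ∃ v : ∀ ω, unitary (Fiber (n ω) →L[ℂ] Fiber (n ω)),
      IsField (overKoopman g (z : DirectIntegral ν n →L[ℂ] DirectIntegral ν n))
        fun ω => extOp (v ω : Fiber (n ω) →L[ℂ] Fiber (n ω)) := by
  classical
  have hl1 := Unitary.star_mul_self_of_mem (koopman Ell2 ν g).2
  have hz1 := Unitary.star_mul_self_of_mem z.2
  have hz2 := Unitary.mul_star_self_of_mem z.2
  have hzn := norm_unitary_le_one z
  have hln := norm_unitary_le_one (star (koopman Ell2 ν g))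
  have hP := isField_extDI_one (ν := ν) hn
  have hQ := hP.conj_koopman g
  set w := (z : DirectIntegral ν n →L[ℂ] DirectIntegral ν n)
  have hTc := overKoopman_commutes hz
  have hTd : overKoopman g w
    = extDI w * star (koopman Ell2 ν g : Lp Ell2 2 ν →L[ℂ] Lp Ell2 2 ν) := rfl
  set T := overKoopman g w
  rw [Unitary.coe_star] at hln
  set l := (koopman Ell2 ν g : Lp Ell2 2 ν →L[ℂ] Lp Ell2 2 ν)
  have hTn : ‖T‖ ≤ 1 := by
    rw [hTd]
    exact (norm_mul_le _ _).trans (mul_le_one₀ ((norm_extDI_le w).trans hzn) (norm_nonneg _) hln)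
  have hTs : star T = l * extDI (star w) := by rw [hTd, star_mul, star_star, extDI_star]
  obtain ⟨F, hFn, hF⟩ := hTc.exists_field
  obtain ⟨F', hFn', hF'⟩ := hTc.star.exists_field
  have e1 : T * star T = extDI (1 : DirectIntegral ν n →L[ℂ] DirectIntegral ν n) := by
    rw [hTs, hTd, mul_assoc, ← mul_assoc (star l), hl1, one_mul, ← extDI_mul, hz2]
  have e2 : star T * T = l * extDI (1 : DirectIntegral ν n →L[ℂ] DirectIntegral ν n) * star l := by
    rw [hTs, hTd, mul_assoc, ← mul_assoc (extDI _), ← extDI_mul, hz1, ← mul_assoc]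
  have e3 : extDI (1 : DirectIntegral ν n →L[ℂ] DirectIntegral ν n) * T = T := by rw [hTd, ← mul_assoc, ← extDI_mul, one_mul]
  have e4 : T * (l * extDI (1 : DirectIntegral ν n →L[ℂ] DirectIntegral ν n) * star l) = T := by
    rw [hTd, mul_assoc, ← mul_assoc (star l), ← mul_assoc (star l), hl1, one_mul, ← mul_assoc,
      ← extDI_mul, mul_one]
  have e5 : star T * extDI (1 : DirectIntegral ν n →L[ℂ] DirectIntegral ν n) = star T := by rw [hTs, mul_assoc, ← extDI_mul, mul_one]
  have e6 : (l * extDI (1 : DirectIntegral ν n →L[ℂ] DirectIntegral ν n) * star l) * star T = star T := by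
    have := congrArg star e4
    rw [star_mul, star_mul, star_mul, star_star, extDI_star, op_star_one, ← mul_assoc l] at this
    exact this
  have a1 := (hF.mul hF').ae_eq (e1 ▸ hP)
  have a2 := (hF'.mul hF).ae_eq (e2 ▸ hQ)
  have a3 := (e3 ▸ hP.mul hF).ae_eq hF
  have a4 := (e4 ▸ hF.mul hQ).ae_eq hF
  have a5 := (e5 ▸ hF'.mul hP).ae_eq hF'
  have a6 := (e6 ▸ hQ.mul hF').ae_eq hF'
  have hinv : ∀ᵐ ω ∂ν, n (g⁻¹ • ω) = n ω := by
    filter_upwards [a1, a2, a3, a6] with ω a1 a2 a3 a6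
    exact fiber_eq_of_inverse a1 a2 a3 a6
  refine ⟨hinv, ?_⟩
  -- The field is required to be unitary at every ω; the identity is taken where the operator
  -- obtained is not.
  have h3 : ∀ ω, ∃ v : unitary (Fiber (n ω) →L[ℂ] Fiber (n ω)),
      (∃ v' : unitary (Fiber (n ω) →L[ℂ] Fiber (n ω)),
        extOp (v' : Fiber (n ω) →L[ℂ] Fiber (n ω)) = F ω) →
      extOp (v : Fiber (n ω) →L[ℂ] Fiber (n ω)) = F ω := fun ω => by
    by_cases h : ∃ v' : unitary (Fiber (n ω) →L[ℂ] Fiber (n ω)),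
        extOp (v' : Fiber (n ω) →L[ℂ] Fiber (n ω)) = F ω
    · exact ⟨h.choose, fun _ => h.choose_spec⟩
    · exact ⟨1, fun h' => absurd h' h⟩
  choose v hv using h3
  refine ⟨v, fun ψ => ?_⟩
  have hsn : ‖star T‖ ≤ 1 := by rwa [norm_op_star]
  filter_upwards [hF ψ, hinv, a1, a2, a3, a4, a5, a6] with ω h hi a1 a2 a3 a4 a5 a6
  rw [hi] at a2 a4 a6
  rw [h, hv ω (exists_fiber_unitary ((hFn ω).trans hTn) ((hFn' ω).trans hsn) a4 a3 a5 a6 a1 a2)]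

/-- Conjugation by the Koopman unitary of g translates the second field by g⁻¹, which is the shift
in the cocycle identity. -/
theorem overKoopman_mul (g h : G) (z w : DirectIntegral ν n →L[ℂ] DirectIntegral ν n) :
    overKoopman (g * h) (z * w) = overKoopman g z *
      ((koopman Ell2 ν g : Lp Ell2 2 ν →L[ℂ] Lp Ell2 2 ν) * overKoopman h w *
        star (koopman Ell2 ν g : Lp Ell2 2 ν →L[ℂ] Lp Ell2 2 ν)) := by
  have hl1 := Unitary.star_mul_self_of_mem (koopman Ell2 ν g).2
  rw [overKoopman, overKoopman, overKoopman, koopman_mul, star_mul, extDI_mul]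
  set l := (koopman Ell2 ν g : Lp Ell2 2 ν →L[ℂ] Lp Ell2 2 ν)
  set k := (koopman Ell2 ν h : Lp Ell2 2 ν →L[ℂ] Lp Ell2 2 ν)
  calc _ = extDI z * (1 * (extDI w * (star k * star l))) := by rw [one_mul, mul_assoc]
    _ = _ := by rw [← hl1]; simp only [mul_assoc]

theorem overKoopman_apply {g : G} {z : DirectIntegral ν n →L[ℂ] DirectIntegral ν n}
    {F : Ω → Ell2 →L[ℂ] Ell2} (h : IsField (overKoopman g z) F) (ψ : DirectIntegral ν n) :
    ∀ᵐ ω ∂ν, (z ψ : Lp Ell2 2 ν) ω = (Real.sqrt (rho ν g⁻¹ ω).toReal : ℂ) •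
      F ω ((ψ : Lp Ell2 2 ν) (g⁻¹ • ω)) := by
  have e := congrArg (fun T : Lp Ell2 2 ν →L[ℂ] Lp Ell2 2 ν => T ψ) (overKoopman_koopman g z)
  simp only [mul_apply_eq_comp, extDI_coe] at e
  filter_upwards [h ((koopman Ell2 ν g : Lp Ell2 2 ν →L[ℂ] Lp Ell2 2 ν) ψ),
    koopman_coeFn Ell2 ν g (ψ : Lp Ell2 2 ν)] with ω h1 h2
  rw [← e, h1, h2, map_smul]

/-- An operator commutes with a covariant one iff the fields intertwine. -/
theorem commute_iff_field {g : G} {z D : DirectIntegral ν n →L[ℂ] DirectIntegral ν n}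
    {F D' : Ω → Ell2 →L[ℂ] Ell2} (hF : IsField (overKoopman g z) F) (hD : IsField (extDI D) D') :
    D * z = z * D ↔ ∀ᵐ ω ∂ν, D' ω ∘L F ω = F ω ∘L D' (g⁻¹ • ω) := by
  have hl1 := Unitary.star_mul_self_of_mem (koopman Ell2 ν g).2
  have h1 := hD.mul hF
  have h2 := hF.mul (hD.conj_koopman g)
  have h3 := overKoopman_koopman g z
  have e1 : extDI D * overKoopman g z = overKoopman g (D * z) := by
    rw [overKoopman, overKoopman, extDI_mul, mul_assoc]
  have e2 : overKoopman g z * ((koopman Ell2 ν g : Lp Ell2 2 ν →L[ℂ] Lp Ell2 2 ν) * extDI D *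
        star (koopman Ell2 ν g : Lp Ell2 2 ν →L[ℂ] Lp Ell2 2 ν)) = overKoopman g (z * D) := by
    rw [← mul_assoc, ← mul_assoc, h3, ← extDI_mul, overKoopman]
  rw [e1] at h1
  rw [e2] at h2
  constructor
  · intro h
    rw [h] at h1
    exact h1.ae_eq h2
  · intro h
    have e : overKoopman g (D * z) = overKoopman g (z * D) :=
      ContinuousLinearMap.ext fun ψ => Lp.ext (by
        filter_upwards [h1 ψ, h2 ψ, h] with ω a b c
        rw [a, b, c])
    refine extDI_injective ?_
    rw [← overKoopman_koopman g (D * z), e, overKoopman_koopman]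

end Cocycle

/-! ### Extremality for covariant dilations -/

section Extremal

variable {H : Type*} [NormedAddCommGroup H] [InnerProductSpace ℂ H] [CompleteSpace H]
variable {V : Type*} [AddCommGroup V] [Module ℂ V] [Module (H →L[ℂ] H)ᵐᵒᵖ V]
variable {K : Type*} [NormedAddCommGroup K] [InnerProductSpace ℂ K] [CompleteSpace K]
variable {M : Type*} [NormedAddCommGroup M] [InnerProductSpace ℂ M] [CompleteSpace M]
variable {Ω : Type*} [MeasurableSpace Ω] {ν : Measure Ω}
variable {G : Type*} [Group G] [MulAction G Ω] [MeasurableConstSMul G Ω] [SigmaFinite ν]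
  [QuasiInvariant G ν]

/-- The form `(v, w) ↦ (Yv)^* X (Yw)` depends linearly on `X`. -/
def dilFormLin (Y : V →ₗ[ℂ] (H →L[ℂ] M)) (hY : IsRightLinear Y) : (M →L[ℂ] M) →ₗ[ℂ] SesqForm H V where
  toFun X := dilForm Y hY X
  map_add' X X' := Subtype.ext (funext fun v => funext fun w => ContinuousLinearMap.ext fun ζ =>
    map_add (ContinuousLinearMap.adjoint (Y v)) (X (Y w ζ)) (X' (Y w ζ)))
  map_smul' c X := Subtype.ext (funext fun v => funext fun w => ContinuousLinearMap.ext fun ζ =>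
    map_smul (ContinuousLinearMap.adjoint (Y v)) c (X (Y w ζ)))

theorem dilFormLin_apply (Y : V →ₗ[ℂ] (H →L[ℂ] M)) (hY : IsRightLinear Y) (X : M →L[ℂ] M) :
    dilFormLin Y hY X = dilForm Y hY X := rfl

theorem exists_of_mem_openSegment {S S' S'' : InstrAlg K ν →ₗ[ℂ] SesqForm H V}
    (h : S ∈ openSegment ℝ S' S'') :
    ∃ a b : ℝ, 0 < a ∧ 0 < b ∧ S = (a : ℂ) • S' + (b : ℂ) • S'' := by
  obtain ⟨a, b, ha, hb, -, rfl⟩ := h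
  exact ⟨a, b, ha, hb, rfl⟩

theorem mem_openSegment_of_add_eq {S S' S'' : InstrAlg K ν →ₗ[ℂ] SesqForm H V}
    (h : S' + S'' = S + S) : S ∈ openSegment ℝ S' S'' := by
  refine ⟨1 / 2, 1 / 2, by norm_num, by norm_num, by norm_num, ?_⟩
  change ((1 / 2 : ℝ) : ℂ) • S' + ((1 / 2 : ℝ) : ℂ) • S'' = S
  have e : ((1 / 2 : ℝ) : ℂ) * 2 = 1 := by norm_num
  rw [← smul_add, h, ← two_smul ℂ S, smul_smul, e, one_smul]

theorem inner_unitary (w : unitary (M →L[ℂ] M)) (x y : M) :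
    inner ℂ ((w : M →L[ℂ] M) x) ((w : M →L[ℂ] M) y) = inner ℂ x y := by
  rw [← ContinuousLinearMap.adjoint_inner_right, ← ContinuousLinearMap.star_eq_adjoint,
    ← mul_apply_eq_comp, Unitary.star_mul_self_of_mem w.2, one_apply_eq_self]

theorem deltaAct_mul (u : G → unitary (K →L[ℂ] K)) (g : G) (x y : InstrAlg K ν) :
    deltaAct ν u g (x * y) = deltaAct ν u g x * deltaAct ν u g y := by
  refine Subtype.ext ?_
  have h := implUnitary_star_mul (ν := ν) u g
  change implUnitary ν u g * (x.1 * y.1) * star (implUnitary ν u g)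
    = implUnitary ν u g * x.1 * star (implUnitary ν u g) *
      (implUnitary ν u g * y.1 * star (implUnitary ν u g))
  generalize implUnitary ν u g = w at *
  calc w * (x.1 * y.1) * star w = w * x.1 * 1 * y.1 * star w := by simp only [mul_assoc, one_mul]
    _ = _ := by rw [← h]; simp only [mul_assoc]

theorem deltaAct_star (u : G → unitary (K →L[ℂ] K)) (g : G) (x : InstrAlg K ν) :
    deltaAct ν u g (star x) = star (deltaAct ν u g x) := by
  refine Subtype.ext ?_
  change implUnitary ν u g * star x.1 * star (implUnitary ν u g)
    = star (implUnitary ν u g * x.1 * star (implUnitary ν u g))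
  rw [star_mul, star_mul, star_star, mul_assoc]

theorem star_elem_mul (b c : K →L[ℂ] K) (f h : Lp ℂ ∞ ν) :
    (star (elem b f) * elem c h : InstrAlg K ν) = elem (star b * c) (linftyMul (star f) h) := by
  rw [star_elem, elem_mul]

theorem sFun_deltaAct {S : InstrAlg K ν →ₗ[ℂ] SesqForm H V}
    {U : G →* (V ≃ₗ[(H →L[ℂ] H)ᵐᵒᵖ] V)} {u : G → unitary (K →L[ℂ] K)}
    (hcov : ∀ (g : G) (x : InstrAlg K ν) (v w : V),
      (S (deltaAct ν u g x)).1 v w = (S x).1 (U g⁻¹ v) (U g⁻¹ w)) (ξ : H) (g : G)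
    (x : InstrAlg K ν) (v w : V) :
    sFun S ξ (U g v) (U g w) (deltaAct ν u g x) = sFun S ξ v w x := by
  have hU : ∀ v, U g⁻¹ (U g v) = v := fun v => by
    rw [map_inv]; exact (U g).symm_apply_apply v
  rw [sFun_apply, hcov, hU, hU, sFun_apply]

theorem sFun_add (S T : InstrAlg K ν →ₗ[ℂ] SesqForm H V) (ξ : H) (v w : V) :
    sFun (S + T) ξ v w = sFun S ξ v w + sFun T ξ v w :=
  LinearMap.ext fun _ => inner_add_right _ _ _

theorem sFun_smul (c : ℂ) (S : InstrAlg K ν →ₗ[ℂ] SesqForm H V) (ξ : H) (v w : V) :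
    sFun (c • S) ξ v w = c • sFun S ξ v w :=
  LinearMap.ext fun _ => inner_smul_right _ _ _

/-- For an upper bound B of the image, B - S_s = (B - S_x) - (S_s - S_x), and the subtracted term
can be made small in any given state. This is the converse of `IsCP.isNormalPos`. -/
theorem isNormalMap_of_isNormalPos {S : InstrAlg K ν →ₗ[ℂ] SesqForm H V} {v : V}
    (h : ∀ ξ, IsNormalPos (sFun S ξ v v)) : IsNormalMap fun x => (S x).1 v v := by
  intro D hne hdir hsa s hs
  have hmono : ∀ x y : InstrAlg K ν, x ≤ y → (S x).1 v v ≤ (S y).1 v v := fun x y hxy =>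
    op_le_iff.2 fun η => by
      have := functional_mono (h η).pos hxy
      rw [← sub_nonneg] at this
      rwa [sub_apply, inner_sub_right]
  refine ⟨?_, fun B hB => op_le_iff.2 fun η => ?_⟩
  · rintro _ ⟨x, hx, rfl⟩
    exact hmono _ _ (hs.1 hx)
  have hxB : ∀ x ∈ D, 0 ≤ inner ℂ η ((B - (S x).1 v v) η) := fun x hx =>
    op_le_iff.1 (hB ⟨x, hx, rfl⟩) η
  have hxs : ∀ x ∈ D, 0 ≤ inner ℂ η (((S s).1 v v - (S x).1 v v) η) := fun x hx =>
    op_le_iff.1 (hmono _ _ (hs.1 hx)) η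
  have e : ∀ x, inner ℂ η ((B - (S s).1 v v) η)
      = inner ℂ η ((B - (S x).1 v v) η) - inner ℂ η (((S s).1 v v - (S x).1 v v) η) := fun x => by
    rw [← inner_sub_right, ← sub_apply, sub_sub_sub_cancel_right]
  rw [Complex.le_def]
  constructor
  · refine le_of_forall_pos_lt_add fun ε hε => ?_
    obtain ⟨x, hx, hlt⟩ := (h η).normal D hne hdir hsa s hs ε hε
    have h1 := (Complex.le_def.1 (hxB x hx)).1
    have h2 : (inner ℂ η (((S s).1 v v - (S x).1 v v) η)).re < ε := by
      rw [map_sub, Complex.sub_re, sFun_apply, sFun_apply] at hlt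
      rwa [sub_apply, inner_sub_right, Complex.sub_re]
    rw [e x, Complex.sub_re]
    simp only [Complex.zero_re] at h1 ⊢
    linarith
  · obtain ⟨x, hx⟩ := hne
    rw [e x, Complex.sub_im, ← (Complex.le_def.1 (hxB x hx)).2, ← (Complex.le_def.1 (hxs x hx)).2,
      Complex.zero_im, sub_zero]

theorem IsCP.add {S T : InstrAlg K ν →ₗ[ℂ] SesqForm H V} (hS : IsCP S) (hT : IsCP T) :
    IsCP (S + T) := fun n x v => by
  have h := add_nonneg (hS n x v) (hT n x v)
  rw [← Finset.sum_add_distrib] at h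
  simp only [← Finset.sum_add_distrib] at h
  exact h

theorem isNormalMap_add {S T : InstrAlg K ν →ₗ[ℂ] SesqForm H V} (hS : IsCP S) (hT : IsCP T) {v : V}
    (hSn : IsNormalMap fun x => (S x).1 v v) (hTn : IsNormalMap fun x => (T x).1 v v) :
    IsNormalMap fun x => ((S + T) x).1 v v :=
  isNormalMap_of_isNormalPos fun ξ => by
    rw [sFun_add]
    exact (hS.isNormalPos ξ v hSn).add (hT.isNormalPos ξ v hTn)

/-- A covariant dilation on a Hilbert space `M`, minimal for the unit vector `ξ`. -/
structure IsCovDil (S : InstrAlg K ν →ₗ[ℂ] SesqForm H V) (U : G →* (V ≃ₗ[(H →L[ℂ] H)ᵐᵒᵖ] V))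
    (u : G → unitary (K →L[ℂ] K)) (ξ : H) (Y : V →ₗ[ℂ] (H →L[ℂ] M))
    (ρ : (K →L[ℂ] K) → Lp ℂ ∞ ν → (M →L[ℂ] M)) (W : G →* unitary (M →L[ℂ] M)) : Prop where
  norm_eq : ‖ξ‖ = 1
  right : IsRightLinear Y
  eq : ∀ b f, S (elem b f) = dilForm Y right (ρ b f)
  total : Total fun p : ((K →L[ℂ] K) × Lp ℂ ∞ ν) × V => ρ p.1.1 p.1.2 (Y p.2 ξ)
  mul : ∀ b b' f f', ρ b f * ρ b' f' = ρ (b * b') (linftyMul f f')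
  adjoint : ∀ b f, star (ρ b f) = ρ (star b) (star f)
  one : ρ 1 (linftyOne ν) = 1
  intertwine : ∀ g v, Y (U g v) = (W g : M →L[ℂ] M) ∘L Y v
  cov : ∀ g b f, (W g : M →L[ℂ] M) * ρ b f
    = ρ (betaAct u g b) (gammaAct ν g f) * (W g : M →L[ℂ] M)

namespace IsCovDil

variable {S : InstrAlg K ν →ₗ[ℂ] SesqForm H V} {U : G →* (V ≃ₗ[(H →L[ℂ] H)ᵐᵒᵖ] V)}
  {u : G → unitary (K →L[ℂ] K)} {ξ : H} {Y : V →ₗ[ℂ] (H →L[ℂ] M)}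
  {ρ : (K →L[ℂ] K) → Lp ℂ ∞ ν → (M →L[ℂ] M)} {W : G →* unitary (M →L[ℂ] M)} {s₁ : SesqForm H V}

/-- The generating vectors of a dilation. -/
def vec (ρ : (K →L[ℂ] K) → Lp ℂ ∞ ν → (M →L[ℂ] M)) (Y : V →ₗ[ℂ] (H →L[ℂ] M)) (ξ : H)
    (p : ((K →L[ℂ] K) × Lp ℂ ∞ ν) × V) : M := ρ p.1.1 p.1.2 (Y p.2 ξ)

theorem rho_vec (hY : IsCovDil S U u ξ Y ρ W) (b : K →L[ℂ] K) (f : Lp ℂ ∞ ν) (p : ((K →L[ℂ] K) × Lp ℂ ∞ ν) × V) :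
    ρ b f (vec ρ Y ξ p) = vec ρ Y ξ ((b * p.1.1, linftyMul f p.1.2), p.2) :=
  congrArg (fun T : M →L[ℂ] M => T (Y p.2 ξ)) (hY.mul _ _ _ _)

theorem inner_rho (hY : IsCovDil S U u ξ Y ρ W) (b : K →L[ℂ] K) (f : Lp ℂ ∞ ν) (x y : M) :
    inner ℂ x (ρ b f y) = inner ℂ (ρ (star b) (star f) x) y := by
  rw [← hY.adjoint, ContinuousLinearMap.star_eq_adjoint, ContinuousLinearMap.adjoint_inner_left]

theorem unitary_vec (hY : IsCovDil S U u ξ Y ρ W) (g : G) (p : ((K →L[ℂ] K) × Lp ℂ ∞ ν) × V) :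
    (W g : M →L[ℂ] M) (vec ρ Y ξ p) = vec ρ Y ξ (symAct U u g p) := by
  have h := congrArg (fun T : M →L[ℂ] M => T (Y p.2 ξ)) (hY.cov g p.1.1 p.1.2)
  simp only [mul_apply_eq_comp] at h
  refine h.trans ?_
  change _ = ρ _ _ (Y (U g p.2) ξ)
  rw [hY.intertwine]
  rfl

theorem inner_vec (hY : IsCovDil S U u ξ Y ρ W) (p q : ((K →L[ℂ] K) × Lp ℂ ∞ ν) × V) :
    inner ℂ (vec ρ Y ξ p) (vec ρ Y ξ q)
      = sFun S ξ p.2 q.2 (star (elem p.1.1 p.1.2) * elem q.1.1 q.1.2) := by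
  rw [star_elem_mul, sFun_apply, hY.eq, inner_dilForm, ← hY.mul, mul_apply_eq_comp, hY.inner_rho,
    star_star, star_star]
  rfl

theorem ext_vec (hY : IsCovDil S U u ξ Y ρ W) {X X' : M →L[ℂ] M}
    (h : ∀ p q, inner ℂ (vec ρ Y ξ p) (X (vec ρ Y ξ q)) = inner ℂ (vec ρ Y ξ p) (X' (vec ρ Y ξ q))) :
    X = X' := Total.ext_inner (a := vec ρ Y ξ) (b := vec ρ Y ξ) hY.total hY.total h

theorem vec_one (hY : IsCovDil S U u ξ Y ρ W) (v : V) : vec ρ Y ξ ((1, linftyOne ν), v) = Y v ξ := by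
  rw [vec, hY.one, one_apply_eq_self]

/-- Arveson's Radon-Nikodym operator: the kernel of aS' is dominated by that of S, whose Gram
vectors span M, so the kernel of S' is bounded by a⁻¹ and is represented by an operator on M. -/
theorem exists_radonNikodym (hY : IsCovDil S U u ξ Y ρ W) {S' S'' : InstrAlg K ν →ₗ[ℂ] SesqForm H V} (h' : IsCP S')
    (h'' : IsCP S'') {a b : ℝ} (ha : 0 < a) (hb : 0 < b) (hS : S = (a : ℂ) • S' + (b : ℂ) • S'') :
    ∃ X : M →L[ℂ] M, ∀ p q, inner ℂ (vec ρ Y ξ p) (X (vec ρ Y ξ q))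
      = sFun S' ξ p.2 q.2 (star (elem p.1.1 p.1.2) * elem q.1.1 q.1.2) := by
  have k1 := h'.posKernel ξ (fun p : ((K →L[ℂ] K) × Lp ℂ ∞ ν) × V => elem p.1.1 p.1.2) Prod.snd
  have k2 := h''.posKernel ξ (fun p : ((K →L[ℂ] K) × Lp ℂ ∞ ν) × V => elem p.1.1 p.1.2) Prod.snd
  set κ := fun p q : ((K →L[ℂ] K) × Lp ℂ ∞ ν) × V =>
    sFun S' ξ p.2 q.2 (star (elem p.1.1 p.1.2) * elem q.1.1 q.1.2)
  have hle : ∀ c, (kerForm κ c c).re ≤ a⁻¹ * ‖Finsupp.linearCombination ℂ (vec ρ Y ξ) c‖ ^ 2 := by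
    intro c
    have h1 := kerForm_inner (vec ρ Y ξ) (vec ρ Y ξ) c c
    simp only [hY.inner_vec] at h1
    rw [hS] at h1
    simp only [sFun_add, sFun_smul, LinearMap.add_apply, LinearMap.smul_apply, smul_eq_mul] at h1
    rw [kerForm_add, kerForm_const_mul, kerForm_const_mul, inner_self_eq_norm_sq_to_K] at h1
    have h2 := congrArg Complex.re h1
    have e : ((‖Finsupp.linearCombination ℂ (vec ρ Y ξ) c‖ : ℂ) ^ 2).re
        = ‖Finsupp.linearCombination ℂ (vec ρ Y ξ) c‖ ^ 2 := by
      rw [← Complex.ofReal_pow, Complex.ofReal_re]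
    have h3 := h2.trans e
    rw [Complex.add_re, Complex.re_ofReal_mul, Complex.re_ofReal_mul] at h3
    have h4 := (Complex.le_def.1 (k2 c)).1
    rw [inv_mul_eq_div, le_div_iff₀ ha, ← h3]
    have := mul_nonneg hb.le h4
    linarith
  obtain ⟨X, -, hX⟩ := exists_op hY.total κ (inv_nonneg.2 ha.le) fun c d => by
    have h0 := inv_nonneg.2 ha.le
    refine le_of_sq_le_sq ?_ (mul_nonneg (mul_nonneg h0 (norm_nonneg _)) (norm_nonneg _))
    refine (k1.cauchy_schwarz c d).trans ?_
    have h1 := mul_le_mul (hle c) (hle d) (Complex.le_def.1 (k1 d)).1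
      (mul_nonneg h0 (sq_nonneg _))
    refine h1.trans (le_of_eq ?_)
    change a⁻¹ * ‖Finsupp.linearCombination ℂ (vec ρ Y ξ) c‖ ^ 2 *
      (a⁻¹ * ‖Finsupp.linearCombination ℂ (vec ρ Y ξ) d‖ ^ 2)
      = (a⁻¹ * ‖Finsupp.linearCombination ℂ (vec ρ Y ξ) c‖ *
        ‖Finsupp.linearCombination ℂ (vec ρ Y ξ) d‖) ^ 2
    ring
  exact ⟨X, hX⟩

/-- The matrix entries of both products are values of S' at the same element, bracketed differently.
-/
theorem commute_rho (hY : IsCovDil S U u ξ Y ρ W) {S' : InstrAlg K ν →ₗ[ℂ] SesqForm H V} {X : M →L[ℂ] M}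
    (hX : ∀ p q, inner ℂ (vec ρ Y ξ p) (X (vec ρ Y ξ q))
      = sFun S' ξ p.2 q.2 (star (elem p.1.1 p.1.2) * elem q.1.1 q.1.2)) (b : K →L[ℂ] K)
    (f : Lp ℂ ∞ ν) : X * ρ b f = ρ b f * X := by
  refine hY.ext_vec fun p q => ?_
  rw [mul_apply_eq_comp, mul_apply_eq_comp, hY.inner_rho, hY.rho_vec, hY.rho_vec, hX, hX]
  congr 1
  rw [← elem_mul, ← elem_mul, star_mul, ← star_elem, star_star, mul_assoc]

theorem commute_unitary (hY : IsCovDil S U u ξ Y ρ W) {S' : InstrAlg K ν →ₗ[ℂ] SesqForm H V}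
    (hcov : ∀ (g : G) (x : InstrAlg K ν) (v w : V),
      (S' (deltaAct ν u g x)).1 v w = (S' x).1 (U g⁻¹ v) (U g⁻¹ w)) {X : M →L[ℂ] M}
    (hX : ∀ p q, inner ℂ (vec ρ Y ξ p) (X (vec ρ Y ξ q))
      = sFun S' ξ p.2 q.2 (star (elem p.1.1 p.1.2) * elem q.1.1 q.1.2)) (g : G) :
    X * (W g : M →L[ℂ] M) = (W g : M →L[ℂ] M) * X := by
  have h : star (W g : M →L[ℂ] M) * (X * (W g : M →L[ℂ] M)) = X := by
    refine hY.ext_vec fun p q => ?_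
    rw [mul_apply_eq_comp, mul_apply_eq_comp, ContinuousLinearMap.star_eq_adjoint,
      ContinuousLinearMap.adjoint_inner_right, hY.unitary_vec, hY.unitary_vec, hX, hX]
    have h1 := sFun_deltaAct hcov ξ g (star (elem p.1.1 p.1.2) * elem q.1.1 q.1.2) p.2 q.2
    rw [deltaAct_mul, deltaAct_star, deltaAct_elem, deltaAct_elem] at h1
    exact h1
  have h2 := Unitary.mul_star_self_of_mem (W g).2
  conv_rhs => rw [← h, ← mul_assoc, h2, one_mul]

theorem form_radonNikodym (hY : IsCovDil S U u ξ Y ρ W)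
    {S' : InstrAlg K ν →ₗ[ℂ] SesqForm H V} {X : M →L[ℂ] M}
    (hX : ∀ p q, inner ℂ (vec ρ Y ξ p) (X (vec ρ Y ξ q))
      = sFun S' ξ p.2 q.2 (star (elem p.1.1 p.1.2) * elem q.1.1 q.1.2)) (b : K →L[ℂ] K)
    (f : Lp ℂ ∞ ν) : S' (elem b f) = dilForm Y hY.right (X * ρ b f) := by
  refine SesqForm.ext_unit hY.norm_eq fun v w => ?_
  have h := hX ((1, linftyOne ν), v) ((b, f), w)
  rw [hY.vec_one, star_elem_mul, star_one, one_mul, linftyStar_one, linftyOne_mul] at h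
  rw [inner_dilForm]
  exact h.symm

/-- A component S' of a decomposition of S has a Radon-Nikodym operator X. As S'_1 = S_1, the
criterion applies to X - 1; thus X = 1, and S' agrees with S on elementary tensors, hence everywhere
by normality. -/
theorem mem_extremePoints (hY : IsCovDil S U u ξ Y ρ W) (hS : S ∈ NCP ν U u s₁)
    (h : ∀ X : M →L[ℂ] M, (∀ b f, X * ρ b f = ρ b f * X) →
      (∀ g, X * (W g : M →L[ℂ] M) = (W g : M →L[ℂ] M) * X) → dilForm Y hY.right X = 0 → X = 0) :
    S ∈ Set.extremePoints ℝ (NCP ν U u s₁) := by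
  refine ⟨hS, fun S' hS' S'' hS'' hab => ?_⟩
  obtain ⟨a, b, ha, hb, hab⟩ := exists_of_mem_openSegment hab
  obtain ⟨X, hX⟩ := hY.exists_radonNikodym hS'.1 hS''.1 ha hb hab
  have hf := hY.form_radonNikodym hX
  have e1 := hf 1 (linftyOne ν)
  have e2 := hY.eq 1 (linftyOne ν)
  rw [elem_one, hY.one, mul_one, hS'.2.2.2] at e1
  rw [elem_one, hY.one, hS.2.2.2] at e2
  have h0 : X - 1 = 0 := by
    refine h _ (fun b f => ?_) (fun g => ?_) ?_
    · rw [sub_mul, mul_sub, hY.commute_rho hX, one_mul, mul_one]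
    · rw [sub_mul, mul_sub, hY.commute_unitary hS'.2.2.1 hX, one_mul, mul_one]
    · rw [← dilFormLin_apply, map_sub, dilFormLin_apply, dilFormLin_apply, ← e1, ← e2, sub_self]
  rw [sub_eq_zero] at h0
  refine SesqForm.ext_of_normal hS'.1 hS.1 hS'.2.1 hS.2.1 fun b f => ?_
  rw [hf, h0, one_mul, hY.eq]

/-- The new map is x ↦ (rYv)^* π(x) (rYw), where π is the normal extension of ρ to the whole
algebra. Using the root r on both sides shows complete positivity; commutation with W gives
covariance. -/
theorem exists_deformation (hY : IsCovDil S U u ξ Y ρ W) (hS : S ∈ NCP ν U u s₁) {r : M →L[ℂ] M}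
    (hr : star r = r) (hrρ : ∀ b f, r * ρ b f = ρ b f * r)
    (hrW : ∀ g, r * (W g : M →L[ℂ] M) = (W g : M →L[ℂ] M) * r)
    (h1 : dilForm Y hY.right (r * r) = s₁) :
    ∃ T ∈ NCP ν U u s₁, ∀ b f, T (elem b f) = dilForm Y hY.right (r * r * ρ b f) := by
  obtain ⟨π, hπ, -, hπp, hπn⟩ := exists_compression hS.1 hS.2.1 ξ (a := vec ρ Y ξ) hY.total
    (fun p : ((K →L[ℂ] K) × Lp ℂ ∞ ν) × V => elem p.1.1 p.1.2) Prod.snd hY.inner_vec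
  have hπρ : ∀ b f, π (elem b f) = ρ b f := fun b f => hY.ext_vec fun p q => by
    rw [hπ, hY.rho_vec, hY.inner_vec, mul_assoc, elem_mul]
  -- Covariance must hold for all x, not only for elementary tensors, so it is read off from the
  -- matrix entries of π and the covariance of S.
  have hπδ : ∀ g x, (W g : M →L[ℂ] M) * π x = π (deltaAct ν u g x) * (W g : M →L[ℂ] M) := by
    intro g x
    have h : star (W g : M →L[ℂ] M) * (π (deltaAct ν u g x) * (W g : M →L[ℂ] M)) = π x := by
      refine hY.ext_vec fun p q => ?_
      rw [mul_apply_eq_comp, mul_apply_eq_comp, ContinuousLinearMap.star_eq_adjoint,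
        ContinuousLinearMap.adjoint_inner_right, hY.unitary_vec, hY.unitary_vec, hπ, hπ]
      have h1 := sFun_deltaAct hS.2.2.1 ξ g (star (elem p.1.1 p.1.2) * x * elem q.1.1 q.1.2) p.2 q.2
      rw [deltaAct_mul, deltaAct_mul, deltaAct_star, deltaAct_elem, deltaAct_elem] at h1
      exact h1
    rw [← h, ← mul_assoc, Unitary.mul_star_self_of_mem (W g).2, one_mul]
  let T : InstrAlg K ν →ₗ[ℂ] SesqForm H V := dilFormLin _ (hY.right.compLeft r) ∘ₗ π
  have hT : ∀ x v w ζ ζ', inner ℂ ζ ((T x).1 v w ζ') = inner ℂ (r (Y v ζ)) (π x (r (Y w ζ'))) :=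
    fun x v w ζ ζ' => inner_dilForm _ (hY.right.compLeft r) _ _ _ _ _
  have hTe : ∀ b f, T (elem b f) = dilForm Y hY.right (r * r * ρ b f) := fun b f =>
    SesqForm.ext_unit hY.norm_eq fun v w => by
      rw [hT, hπρ, inner_dilForm, mul_assoc, hrρ, mul_apply_eq_comp, mul_apply_eq_comp]
      nth_rw 1 [← hr]
      rw [ContinuousLinearMap.star_eq_adjoint, ContinuousLinearMap.adjoint_inner_left]
  refine ⟨T, ⟨fun n x v => op_nonneg_iff.2 fun ζ => ?_, fun v => ?_, fun g x v w => ?_, ?_⟩, hTe⟩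
  · have h := hπp n x fun j => r (Y (v j) ζ)
    simp only [sum_apply, inner_sum, hT]
    exact h
  · refine isNormalMap_of_isNormalPos fun ζ => ?_
    have e : sFun T ζ v v = vecFun π (r (Y v ζ)) (r (Y v ζ)) := LinearMap.ext fun x => hT x v v ζ ζ
    rw [e]
    exact hπn _
  · have hW : ∀ v ζ, (W g : M →L[ℂ] M) (r (Y (U g⁻¹ v) ζ)) = r (Y v ζ) := fun v ζ => by
      have h1 := congrArg (fun X : M →L[ℂ] M => X (Y (U g⁻¹ v) ζ)) (hrW g)
      refine h1.symm.trans (congrArg r ?_)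
      have h2 := congrArg (fun A : H →L[ℂ] M => A ζ) (hY.intertwine g (U g⁻¹ v))
      have hU : U g (U g⁻¹ v) = v := by rw [map_inv]; exact (U g).apply_symm_apply v
      rw [hU] at h2
      exact h2.symm
    refine ContinuousLinearMap.ext fun ζ' => ext_inner_left ℂ fun ζ => ?_
    rw [hT, hT, ← hW v, ← hW w]
    have h1 := congrArg (fun X : M →L[ℂ] M => X (r (Y (U g⁻¹ w) ζ'))) (hπδ g x)
    simp only [mul_apply_eq_comp] at h1
    rw [← h1]
    exact inner_unitary (W g) _ _
  · rw [← elem_one, hTe, hY.one, mul_one, h1]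

/-- The deformations of S by 1 + tX and 1 - tX have midpoint S, so extremality makes them equal to
S, and S determines the deforming operator. -/
theorem eq_zero_of_selfAdjoint (hY : IsCovDil S U u ξ Y ρ W)
    (hS : S ∈ Set.extremePoints ℝ (NCP ν U u s₁)) {X : M →L[ℂ] M} (hX : star X = X)
    (hXρ : ∀ b f, X * ρ b f = ρ b f * X)
    (hXW : ∀ g, X * (W g : M →L[ℂ] M) = (W g : M →L[ℂ] M) * X)
    (h0 : dilForm Y hY.right X = 0) : X = 0 := by
  have key : ∀ Z : M →L[ℂ] M, star Z = Z → ‖Z‖ ≤ 1 → (∀ b f, Z * ρ b f = ρ b f * Z) →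
      (∀ g, Z * (W g : M →L[ℂ] M) = (W g : M →L[ℂ] M) * Z) → dilForm Y hY.right Z = 0 →
      ∃ T ∈ NCP ν U u s₁, ∀ b f, T (elem b f) = dilForm Y hY.right ((1 + Z) * ρ b f) := by
    intro Z hZ hZn hZρ hZW hZ0
    have hpos : (0 : M →L[ℂ] M) ≤ 1 + Z := op_nonneg_iff.2 fun η => by
      have hi : (inner ℂ η (Z η)).im = 0 := by
        rw [← Complex.conj_eq_iff_im, inner_conj_symm]
        nth_rw 1 [← hZ]
        rw [ContinuousLinearMap.star_eq_adjoint, ContinuousLinearMap.adjoint_inner_left]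
      have hn : ‖inner ℂ η (Z η)‖ ≤ ‖η‖ ^ 2 := by
        refine (norm_inner_le_norm _ _).trans ?_
        rw [pow_two]
        exact mul_le_mul_of_nonneg_left ((Z.le_of_opNorm_le hZn η).trans_eq (one_mul _))
          (norm_nonneg _)
      have hr := (abs_le.1 ((Complex.abs_re_le_norm _).trans hn)).1
      rw [add_apply, inner_add_right, one_apply_eq_self, inner_self_eq_norm_sq_to_K]
      have e : ((‖η‖ : ℂ) ^ 2) = ((‖η‖ ^ 2 : ℝ) : ℂ) := (Complex.ofReal_pow _ _).symm
      refine Complex.le_def.2 ⟨?_, ?_⟩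
      · rw [Complex.add_re]
        change 0 ≤ ((‖η‖ : ℂ) ^ 2).re + _
        rw [e, Complex.ofReal_re]; linarith
      · rw [Complex.add_im]
        change 0 = ((‖η‖ : ℂ) ^ 2).im + _
        rw [e, Complex.ofReal_im, hi, add_zero]
    obtain ⟨r, hr1, hr2, hr3⟩ := exists_sqrt_op hpos
    have hc : ∀ c : M →L[ℂ] M, Z * c = c * Z → r * c = c * r := fun c h =>
      (hr3 c (by rw [mul_add, add_mul, mul_one, one_mul, h])).symm
    obtain ⟨T, hT, hTe⟩ := hY.exists_deformation hS.1 hr1 (fun b f => hc _ (hZρ b f))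
      (fun g => hc _ (hZW g)) (by
        rw [hr2]
        have e2 := hY.eq 1 (linftyOne ν)
        rw [elem_one, hY.one, hS.1.2.2.2] at e2
        rw [← dilFormLin_apply, map_add, dilFormLin_apply, dilFormLin_apply, hZ0, ← e2, add_zero])
    exact ⟨T, hT, fun b f => by rw [hTe, hr2]⟩
  -- This scaling gives ‖tX‖ ≤ 1, hence 1 ± tX ≥ 0; the summand 1 avoids dividing by zero.
  set t : ℂ := ((1 + ‖X‖ : ℝ) : ℂ)⁻¹ with ht
  have hp : (0 : ℝ) < 1 + ‖X‖ := by positivity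
  have ht0 : t ≠ 0 := inv_ne_zero (Complex.ofReal_ne_zero.2 hp.ne')
  have htn : ‖t • X‖ ≤ 1 := by
    rw [norm_smul, ht, norm_inv, Complex.norm_real, Real.norm_of_nonneg hp.le, inv_mul_le_iff₀ hp]
    linarith
  have hts : star (t • X) = t • X := by
    rw [star_smul, hX, ht, ← Complex.ofReal_inv]
    congr 1
    exact Complex.conj_ofReal _
  have htρ : ∀ b f, (t • X) * ρ b f = ρ b f * (t • X) := fun b f => by
    rw [smul_mul_assoc, hXρ, mul_smul_comm]
  have htW : ∀ g, (t • X) * (W g : M →L[ℂ] M) = (W g : M →L[ℂ] M) * (t • X) := fun g => by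
    rw [smul_mul_assoc, hXW, mul_smul_comm]
  have hz : ∀ c : ℂ, dilForm Y hY.right (c • X) = 0 := fun c => by
    rw [← dilFormLin_apply, map_smul, dilFormLin_apply, h0, smul_zero]
  obtain ⟨T, hT, hTe⟩ := key (t • X) hts htn htρ htW (hz t)
  obtain ⟨T', hT', hTe'⟩ := key (-(t • X)) (by rw [star_neg, hts]) (by rwa [norm_neg])
    (fun b f => by rw [neg_mul, mul_neg, htρ]) (fun g => by rw [neg_mul, mul_neg, htW])
    (by rw [← neg_smul]; exact hz _)
  have hsum : T + T' = S + S := by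
    refine SesqForm.ext_of_normal (hT.1.add hT'.1) (hS.1.1.add hS.1.1)
      (fun v => isNormalMap_add hT.1 hT'.1 (hT.2.1 v) (hT'.2.1 v))
      (fun v => isNormalMap_add hS.1.1 hS.1.1 (hS.1.2.1 v) (hS.1.2.1 v)) fun b f => ?_
    rw [LinearMap.add_apply, LinearMap.add_apply, hTe, hTe', hY.eq]
    rw [← dilFormLin_apply, ← dilFormLin_apply, ← dilFormLin_apply, ← map_add, ← map_add, ← add_mul,
      add_add_add_comm, add_neg_cancel, add_zero, add_mul, one_mul]
  have hTS : T = S :=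
    hS.2 hT hT' (mem_openSegment_of_add_eq hsum)
  -- Equality of the maps at the elements b^*b' ⊗ f̄f' gives all matrix entries between generating
  -- vectors, as 1 + tX commutes with ρ.
  have h1 : (1 + t • X : M →L[ℂ] M) = 1 := by
    refine hY.ext_vec fun p q => ?_
    have e := hTe (star p.1.1 * q.1.1) (linftyMul (star p.1.2) q.1.2)
    rw [hTS, hY.eq] at e
    have e' := congrArg (fun s : SesqForm H V => inner ℂ ξ (s.1 p.2 q.2 ξ)) e
    simp only [inner_dilForm] at e'
    have c1 : (1 + t • X) * ρ (star p.1.1) (star p.1.2) = ρ (star p.1.1) (star p.1.2) * (1 + t • X) := by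
      rw [add_mul, mul_add, htρ, one_mul, mul_one]
    rw [← hY.mul, ← mul_assoc, c1, mul_assoc, mul_apply_eq_comp, mul_apply_eq_comp,
      hY.inner_rho (star p.1.1), hY.inner_rho (star p.1.1), star_star, star_star] at e'
    exact e'.symm
  have h2 : t • X = 0 := by rwa [add_eq_left] at h1
  exact (smul_eq_zero.1 h2).resolve_left ht0

/-- The admissible X form a *-closed space, so the selfadjoint case applies to X + X^* and i(X -
X^*). -/
theorem mem_extremePoints_iff (hY : IsCovDil S U u ξ Y ρ W) (hS : S ∈ NCP ν U u s₁) :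
    S ∈ Set.extremePoints ℝ (NCP ν U u s₁) ↔
    ∀ X : M →L[ℂ] M, (∀ b f, X * ρ b f = ρ b f * X) →
      (∀ g, X * (W g : M →L[ℂ] M) = (W g : M →L[ℂ] M) * X) → dilForm Y hY.right X = 0 → X = 0 := by
  refine ⟨fun h X hXρ hXW h0 => ?_, hY.mem_extremePoints hS⟩
  have sρ : ∀ b f, star X * ρ b f = ρ b f * star X := fun b f => by
    have := congrArg star (hXρ (star b) (star f))
    rw [star_mul, star_mul, hY.adjoint, star_star, star_star] at this
    exact this.symm
  have sW : ∀ g, star X * (W g : M →L[ℂ] M) = (W g : M →L[ℂ] M) * star X := fun g => by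
    have := congrArg star (hXW g⁻¹)
    rw [star_mul, star_mul, map_inv, ← Unitary.star_eq_inv, Unitary.coe_star, star_star] at this
    exact this.symm
  have s0 : dilForm Y hY.right (star X) = 0 := SesqForm.ext_diag fun v =>
    op_eq_of_inner_self fun η => by
      have := congrArg (fun s : SesqForm H V => inner ℂ η (s.1 v v η)) h0
      simp only [inner_dilForm] at this
      rw [inner_dilForm, ContinuousLinearMap.star_eq_adjoint,
        ContinuousLinearMap.adjoint_inner_right, ← inner_conj_symm, this]
      change starRingEnd ℂ (inner ℂ η (0 : H)) = inner ℂ η (0 : H)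
      rw [inner_zero_right, map_zero]
  have hlin : ∀ c d : ℂ, dilForm Y hY.right (c • X + d • star X) = 0 := fun c d => by
    rw [← dilFormLin_apply, map_add, map_smul, map_smul, dilFormLin_apply, dilFormLin_apply, h0, s0,
      smul_zero, smul_zero, add_zero]
  have hcomm : ∀ (c d : ℂ) (A : M →L[ℂ] M), X * A = A * X → star X * A = A * star X →
      (c • X + d • star X) * A = A * (c • X + d • star X) := fun c d A h1 h2 => by
    rw [add_mul, mul_add, smul_mul_assoc, smul_mul_assoc, mul_smul_comm, mul_smul_comm, h1, h2]
  have z1 := hY.eq_zero_of_selfAdjoint h (X := (1 : ℂ) • X + (1 : ℂ) • star X)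
    (by rw [one_smul, one_smul, star_add, star_star, add_comm])
    (fun b f => hcomm _ _ _ (hXρ b f) (sρ b f)) (fun g => hcomm _ _ _ (hXW g) (sW g)) (hlin _ _)
  have z2 := hY.eq_zero_of_selfAdjoint h (X := Complex.I • X + (-Complex.I) • star X)
    (by
      rw [star_add, star_smul, star_smul, star_star, star_neg, add_comm]
      have : star Complex.I = -Complex.I := Complex.conj_I
      rw [this, neg_neg])
    (fun b f => hcomm _ _ _ (hXρ b f) (sρ b f)) (fun g => hcomm _ _ _ (hXW g) (sW g)) (hlin _ _)
  rw [one_smul, one_smul] at z1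
  rw [eq_neg_of_add_eq_zero_right z1, smul_neg, neg_smul, neg_neg, ← add_smul, smul_eq_zero] at z2
  refine z2.resolve_left ?_
  rw [← two_mul]
  exact mul_ne_zero two_ne_zero Complex.I_ne_zero

end IsCovDil

end Extremal

/-! ### Invariant versions of almost invariant functions -/

section Invariance

variable {Ω : Type*} [MeasurableSpace Ω] {G : Type*} [Group G] [MeasurableSpace G]
  [MeasurableMul₂ G] [MulAction G Ω] [MeasurableSMul₂ G Ω] {ν : Measure Ω} [SigmaFinite ν]

theorem borelSpace_enat : BorelSpace ℕ∞ :=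
  ⟨by rw [borel_eq_top_of_countable]; exact eq_top_iff.2 fun _ _ => .of_discrete⟩

/-- A measurable function that is almost invariant under every group element agrees almost
everywhere with an invariant one. -/
theorem exists_invariant_ae_eq {n₀ : Ω → ℕ∞} (hn₀ : Measurable n₀)
    (hinv : ∀ g : G, ∀ᵐ ω ∂ν, n₀ (g • ω) = n₀ ω) :
    ∃ n : Ω → ℕ∞, Measurable n ∧ n₀ =ᵐ[ν] n ∧
      ((∃ μ : Measure G, SigmaFinite μ ∧ μ ≠ 0 ∧
          ∀ (h : G) (A : Set G), MeasurableSet A → μ A = 0 → μ ((fun g => g * h) ⁻¹' A) = 0) →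
        ∀ (g : G) (ω : Ω), n (g • ω) = n ω) := by
  classical
  by_cases hμ : ∃ μ : Measure G, SigmaFinite μ ∧ μ ≠ 0 ∧
      ∀ (h : G) (A : Set G), MeasurableSet A → μ A = 0 → μ ((fun g => g * h) ⁻¹' A) = 0
  swap
  · exact ⟨n₀, hn₀, ae_eq_refl _, fun h => absurd h hμ⟩
  obtain ⟨μ, _, hμ0, hμr⟩ := hμ
  have hmeas : ∀ c, MeasurableSet {p : Ω × G | n₀ (p.2 • p.1) = c} := fun c =>
    (hn₀.comp (measurable_snd.smul measurable_fst)) (measurableSet_singleton c)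
  have hA : ∀ c, MeasurableSet {ω : Ω | ∀ᵐ g ∂μ, n₀ (g • ω) = c} := fun c =>
    (measurable_measure_prodMk_left (ν := μ) (hmeas c).compl) (measurableSet_singleton 0)
  -- Moving ω to hω translates the exceptional subset of G on the right, and μ-null sets are stable
  -- under that.
  have hshift : ∀ c (h : G) (ω : Ω), (∀ᵐ g ∂μ, n₀ (g • ω) = c) → ∀ᵐ g ∂μ, n₀ (g • h • ω) = c := by
    intro c h ω hω
    have hm : MeasurableSet {g : G | n₀ (g • ω) = c} :=
      (hn₀.comp (measurable_id.smul measurable_const)) (measurableSet_singleton c)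
    have h1 := hμr h _ hm.compl hω
    simp only [smul_smul]
    exact h1
  have hshift' : ∀ c (h : G) (ω : Ω), (∀ᵐ g ∂μ, n₀ (g • h • ω) = c) ↔ ∀ᵐ g ∂μ, n₀ (g • ω) = c :=
    fun c h ω => ⟨fun hω => by
      have := hshift c h⁻¹ (h • ω) hω
      rwa [inv_smul_smul] at this, hshift c h ω⟩
  have hb := borelSpace_enat
  -- The supremum picks the value that n₀ takes at μ-almost all points of the orbit, unique because
  -- μ ≠ 0, and returns 0 if there is none.
  refine ⟨fun ω => ⨆ c : ℕ∞, if ∀ᵐ g ∂μ, n₀ (g • ω) = c then c else 0, ?_, ?_, fun _ g ω => ?_⟩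
  · exact Measurable.iSup fun c => Measurable.ite (hA c) measurable_const measurable_const
  · have hm : MeasurableSet {p : Ω × G | n₀ (p.2 • p.1) = n₀ p.1} :=
      measurableSet_eq_fun (hn₀.comp (measurable_snd.smul measurable_fst))
        (hn₀.comp measurable_fst)
    -- Fubini exchanges the two almost-everywhere quantifiers.
    have h1 : ∀ᵐ ω ∂ν, ∀ᵐ g ∂μ, n₀ (g • ω) = n₀ ω :=
      (Measure.ae_ae_comm hm).2 (Eventually.of_forall hinv)
    filter_upwards [h1] with ω hω
    have : NeZero μ := ⟨hμ0⟩
    refine le_antisymm ?_ (iSup_le fun c => ?_)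
    · refine le_iSup_of_le (n₀ ω) ?_
      rw [if_pos hω]
    · split_ifs with hc
      · obtain ⟨g, h1, h2⟩ := (hω.and hc).exists
        exact (h2.symm.trans h1).le
      · exact zero_le
  · simp only [hshift']

end Invariance

/-! ### The structure theorem for a minimal dilation -/

section Structure

variable {H : Type*} [NormedAddCommGroup H] [InnerProductSpace ℂ H] [CompleteSpace H]
variable {V : Type*} [AddCommGroup V] [Module ℂ V] [Module (H →L[ℂ] H)ᵐᵒᵖ V]
variable {K : Type*} [NormedAddCommGroup K] [InnerProductSpace ℂ K] [CompleteSpace K]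
variable {Ω : Type*} [MeasurableSpace Ω] {ν : Measure Ω} {n : Ω → ℕ∞}
variable {G : Type*} [Group G] [MulAction G Ω] [MeasurableConstSMul G Ω] [SigmaFinite ν]
  [QuasiInvariant G ν]
variable {S : InstrAlg K ν →ₗ[ℂ] SesqForm H V} {U : G →* (V ≃ₗ[(H →L[ℂ] H)ᵐᵒᵖ] V)}
  {m : G → G → Circle} {u : G → unitary (K →L[ℂ] K)} {s₁ : SesqForm H V}
  {Y : V →ₗ[ℂ] (H →L[ℂ] HilbertTensor K (DirectIntegral ν n))}
  {y : G → unitary (DirectIntegral ν n →L[ℂ] DirectIntegral ν n)}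

theorem opTensor_unitary_mul {E : Type*} [NormedAddCommGroup E] [InnerProductSpace ℂ E]
    (u : unitary (K →L[ℂ] K)) (b : K →L[ℂ] K) {z f f' : E →L[ℂ] E} (h : z * f = f' * z) :
    opTensor (u : K →L[ℂ] K) z * opTensor b f
      = opTensor ((u : K →L[ℂ] K) * b * star (u : K →L[ℂ] K)) f' * opTensor (u : K →L[ℂ] K) z := by
  rw [opTensor_mul, opTensor_mul, h, mul_assoc, Unitary.star_mul_self_of_mem u.2, mul_one]

theorem opTensor_zero_right {E : Type*} [NormedAddCommGroup E] [InnerProductSpace ℂ E]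
    (b : K →L[ℂ] K) : opTensor b (0 : E →L[ℂ] E) = 0 := by
  have h := opTensor_smul_right (0 : ℂ) b (0 : E →L[ℂ] E)
  rwa [zero_smul, zero_smul] at h

/-! ### Dilations of the form b ⊗ d(f) with symmetry u_g ⊗ z_g -/

section Tensor

variable {E : Type*} [NormedAddCommGroup E] [InnerProductSpace ℂ E] [CompleteSpace E]
  {d : Lp ℂ ∞ ν → (E →L[ℂ] E)} {z : G → unitary (E →L[ℂ] E)} {ξ : H}
  {Y : V →ₗ[ℂ] (H →L[ℂ] HilbertTensor K E)}
  {W : G →* unitary (HilbertTensor K E →L[ℂ] HilbertTensor K E)}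

theorem isCovDil_opTensor (hd : ∀ f f', d f * d f' = d (linftyMul f f'))
    (hd' : ∀ f, star (d f) = d (star f)) (hd1 : d (linftyOne ν) = 1)
    (hz : ∀ g f, (z g : E →L[ℂ] E) * d f = d (gammaAct ν g f) * (z g : E →L[ℂ] E))
    (hW : ∀ g, (W g : HilbertTensor K E →L[ℂ] HilbertTensor K E)
      = opTensor (u g : K →L[ℂ] K) (z g : E →L[ℂ] E))
    (hξ : ‖ξ‖ = 1) (hY : IsRightLinear Y)
    (heq : ∀ b f, S (elem b f) = dilForm Y hY (opTensor b (d f)))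
    (ht : Total fun p : ((K →L[ℂ] K) × Lp ℂ ∞ ν) × V => opTensor p.1.1 (d p.1.2) (Y p.2 ξ))
    (hi : ∀ g v, Y (U g v) = opTensor (u g : K →L[ℂ] K) (z g : E →L[ℂ] E) ∘L Y v) :
    IsCovDil S U u ξ Y (fun b f => opTensor b (d f)) W where
  norm_eq := hξ
  right := hY
  eq := heq
  total := ht
  mul b b' f f' := by rw [opTensor_mul, hd]
  adjoint b f := by rw [opTensor_star, hd']
  one := by rw [hd1, opTensor_one]
  intertwine g v := by rw [hi, hW]
  cov g b f := by rw [hW]; exact opTensor_unitary_mul (u g) b (hz g f)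

/-- Commuting with every b ⊗ 1 forces X = 1 ⊗ D, and the remaining commutation relations descend to
D because tensoring with a unitary of the non-zero space K is injective. -/
theorem IsCovDil.tensor_mem_extremePoints_iff [Nontrivial K]
    (hC : IsCovDil S U u ξ Y (fun b f => opTensor b (d f)) W) (hd1 : d (linftyOne ν) = 1)
    (hW : ∀ g, (W g : HilbertTensor K E →L[ℂ] HilbertTensor K E)
      = opTensor (u g : K →L[ℂ] K) (z g : E →L[ℂ] E)) (hS : S ∈ NCP ν U u s₁) :
    S ∈ Set.extremePoints ℝ (NCP ν U u s₁) ↔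
      ∀ D : E →L[ℂ] E, (∀ f, D * d f = d f * D) →
        (∀ g, D * (z g : E →L[ℂ] E) = (z g : E →L[ℂ] E) * D) →
        dilForm Y hC.right (opTensor 1 D) = 0 → D = 0 := by
  obtain ⟨e, he⟩ := exists_norm_eq K (zero_le_one (α := ℝ))
  have hc : ∀ (D : E →L[ℂ] E) (g : G),
      opTensor (1 : K →L[ℂ] K) D * (W g : HilbertTensor K E →L[ℂ] HilbertTensor K E)
        = (W g : HilbertTensor K E →L[ℂ] HilbertTensor K E) * opTensor (1 : K →L[ℂ] K) D ↔
      D * (z g : E →L[ℂ] E) = (z g : E →L[ℂ] E) * D := fun D g => by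
    rw [hW, opTensor_mul, opTensor_mul, one_mul, mul_one]
    exact ⟨opTensor_unitary_injective (u g), fun h => by rw [h]⟩
  refine (hC.mem_extremePoints_iff hS).trans ⟨fun h D hf hg h0 => ?_, fun h X hρ hW' h0 => ?_⟩
  · refine opTensor_one_injective (E := K) ?_
    refine (h (opTensor 1 D) (fun b f => ?_) (fun g => (hc D g).2 (hg g)) h0).trans
      (opTensor_zero_right 1).symm
    rw [opTensor_mul, opTensor_mul, hf, one_mul, mul_one]
  · have hX := eq_opTensor_one_of_commute (T := X) (fun b => by
      have := hρ b (linftyOne ν)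
      rwa [hd1] at this) he
    generalize ContinuousLinearMap.adjoint (leg e) ∘L X ∘L leg e = D at hX
    subst hX
    have hD : D = 0 := h D (fun f => opTensor_one_injective (E := K) (by
        have := hρ 1 f
        rwa [opTensor_mul, opTensor_mul, one_mul] at this))
      (fun g => (hc D g).1 (hW' g)) h0
    rw [hD, opTensor_zero_right]

end Tensor

theorem IsMinDil.mem_extremePoints_iff [Nontrivial K] (hY : IsMinDil S n Y) (hy : IsImpl m U u Y y)
    {ξ : H} (hξ : ‖ξ‖ = 1) (hS : S ∈ NCP ν U u s₁) :
    S ∈ Set.extremePoints ℝ (NCP ν U u s₁) ↔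
      ∀ D : DirectIntegral ν n →L[ℂ] DirectIntegral ν n,
        (∀ f : Lp ℂ ∞ ν, D * diagOp f = diagOp f * D) →
        (∀ g, D * (y g : DirectIntegral ν n →L[ℂ] DirectIntegral ν n)
          = (y g : DirectIntegral ν n →L[ℂ] DirectIntegral ν n) * D) →
        dilForm Y hY.right (opTensor 1 D) = 0 → D = 0 := by
  obtain ⟨W, hW⟩ := hy.rep
  exact (isCovDil_opTensor diagOp_mul diagOp_star diagOp_one hy.diag hW hξ hY.right hY.eq
    (hY.total ξ hξ) hy.intertwine).tensor_mem_extremePoints_iff diagOp_one hW hS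

theorem dilForm_eq_zero_iff {M : Type*} [NormedAddCommGroup M] [InnerProductSpace ℂ M]
    [CompleteSpace M] (Y : V →ₗ[ℂ] (H →L[ℂ] M)) (hY : IsRightLinear Y) (X : M →L[ℂ] M) :
    dilForm Y hY X = 0 ↔ ∀ v, ContinuousLinearMap.adjoint (Y v) ∘L X ∘L Y v = 0 :=
  ⟨fun h v => congrArg (fun s : SesqForm H V => s.1 v v) h, fun h => SesqForm.ext_diag h⟩

/-- Each operator relation for y_g becomes a pointwise relation after division by the Koopman
unitary, since an operator determines its field almost everywhere. -/
theorem IsMinDil.exists_fields [Nontrivial H] [Nontrivial K] (hn : Measurable n)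
    (hY : IsMinDil S n Y) (hu : IsMultiplierRep m u) (hS : S ∈ NCP ν U u s₁) :
    (∀ g : G, ∀ᵐ ω ∂ν, n (g • ω) = n ω) ∧
    ∃ (y : ∀ (_ : G) (ω : Ω), unitary (Fiber (n ω) →L[ℂ] Fiber (n ω)))
      (yOp : G → unitary (DirectIntegral ν n →L[ℂ] DirectIntegral ν n)),
      IsImpl m U u Y yOp ∧
      (∀ g, IsField (overKoopman g (yOp g : DirectIntegral ν n →L[ℂ] DirectIntegral ν n))
        fun ω => extOp (y g ω : Fiber (n ω) →L[ℂ] Fiber (n ω))) ∧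
      (∀ g h : G, ∀ᵐ ω ∂ν,
        extOp (y (g * h) ω : Fiber (n ω) →L[ℂ] Fiber (n ω))
          = (starRingEnd ℂ (m g h : ℂ)) •
              (extOp (y g ω : Fiber (n ω) →L[ℂ] Fiber (n ω)) ∘L
                extOp (y h (g⁻¹ • ω) : Fiber (n (g⁻¹ • ω)) →L[ℂ] Fiber (n (g⁻¹ • ω))))) ∧
      (S ∈ Set.extremePoints ℝ (NCP ν U u s₁) ↔
        ∀ (D : DirectIntegral ν n →L[ℂ] DirectIntegral ν n)
          (Df : ∀ ω, Fiber (n ω) →L[ℂ] Fiber (n ω)),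
          IsDecomposedBy D Df →
          (∀ v : V, ContinuousLinearMap.adjoint (Y v) ∘L
            opTensor (1 : K →L[ℂ] K) D ∘L Y v = 0) →
          (∀ g : G, ∀ᵐ ω ∂ν,
            extOp (Df ω) ∘L extOp (y g ω : Fiber (n ω) →L[ℂ] Fiber (n ω))
              = extOp (y g ω : Fiber (n ω) →L[ℂ] Fiber (n ω)) ∘L extOp (Df (g⁻¹ • ω))) →
          D = 0) := by
  obtain ⟨ξ, hξ⟩ := exists_norm_eq H (zero_le_one (α := ℝ))
  have hcov := hS.2.2.1
  have hex := hY.exists_isImpl hu hcov hξ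
  obtain ⟨yOp, hy⟩ := hex
  have hf := fun g => exists_field_of_covariant hn g (yOp g) (hy.diag g)
  choose y hyf using fun g => (hf g).2
  refine ⟨fun g => by simpa only [inv_inv] using (hf g⁻¹).1, y, yOp, hy, hyf, fun g h => ?_, ?_⟩
  · have h1 := ((hyf g).mul ((hyf h).conj_koopman g)).smul (starRingEnd ℂ (m g h : ℂ))
    refine (hyf (g * h)).ae_eq ?_
    have e : overKoopman (g * h) (yOp (g * h) : DirectIntegral ν n →L[ℂ] DirectIntegral ν n)
        = (starRingEnd ℂ (m g h : ℂ)) •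
          overKoopman (g * h) ((yOp g : DirectIntegral ν n →L[ℂ] DirectIntegral ν n) *
            (yOp h : DirectIntegral ν n →L[ℂ] DirectIntegral ν n)) := by
      rw [overKoopman, hy.mul, extDI_smul, smul_mul_assoc]
      rfl
    rw [e, overKoopman_mul]
    exact h1
  · refine (hY.mem_extremePoints_iff hy hξ hS).trans ⟨fun h D Df hD h0 hg => ?_,
      fun h D hf' hg h0 => ?_⟩
    · have hDf := hD.isField hn
      exact h D (extDI_commutes_iff.1 hDf.commutes)
        (fun g => (commute_iff_field (hyf g) hDf).2 (hg g)) ((dilForm_eq_zero_iff _ _ _).2 h0)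
    · obtain ⟨Df, hD⟩ := exists_isDecomposedBy hn hf'
      exact h D Df hD ((dilForm_eq_zero_iff _ _ _).1 h0)
        fun g => (commute_iff_field (hyf g) (hD.isField hn)).1 (hg g)

end Structure

/-! ### The degenerate case -/

section Degenerate

variable {Ω : Type*} [MeasurableSpace Ω] {ν : Measure Ω}

instance : Subsingleton (Fiber 0) :=
  ⟨fun x y => Subtype.ext (lp.ext (funext fun k => by
    rw [x.2 k (zero_le), y.2 k (zero_le)]))⟩

theorem eq_zero_of_mem_fiber_zero {x : Ell2} (hx : x ∈ Fiber 0) : x = 0 :=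
  congrArg Subtype.val (Subsingleton.elim (⟨x, hx⟩ : Fiber 0) 0)

theorem extOp_fiber_zero (T : Fiber 0 →L[ℂ] Fiber 0) : extOp T = 0 :=
  ContinuousLinearMap.ext fun _ => eq_zero_of_mem_fiber_zero (Subtype.mem _)

instance : Subsingleton (DirectIntegral ν fun _ => 0) :=
  ⟨fun ψ φ => Subtype.ext (Lp.ext (by
    filter_upwards [ψ.2, φ.2] with ω h1 h2
    rw [eq_zero_of_mem_fiber_zero h1, eq_zero_of_mem_fiber_zero h2]))⟩

section Tensor

variable {E F : Type*} [NormedAddCommGroup E] [InnerProductSpace ℂ E] [CompleteSpace E]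
  [NormedAddCommGroup F] [InnerProductSpace ℂ F] [CompleteSpace F]

instance subsingleton_hilbertTensor_left [Subsingleton E] : Subsingleton (HilbertTensor E F) :=
  subsingleton_of_forall_eq 0 fun x => total_leg x fun p => by
    beta_reduce
    rw [leg_apply, Subsingleton.elim p.1 0, TensorProduct.zero_tmul, map_zero, inner_zero_left]

instance subsingleton_hilbertTensor_right [Subsingleton F] : Subsingleton (HilbertTensor E F) :=
  subsingleton_of_forall_eq 0 fun x => total_leg x fun p => by
    beta_reduce
    rw [leg_apply, Subsingleton.elim p.2 0, TensorProduct.tmul_zero, map_zero, inner_zero_left]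

end Tensor

end Degenerate

end CovInstr

end

/-! ### The main theorem -/

open CovInstr in
theorem mainTheorem7
    {H K V G Ω K' : Type*}
    [NormedAddCommGroup H] [InnerProductSpace ℂ H] [CompleteSpace H]
    [NormedAddCommGroup K] [InnerProductSpace ℂ K] [CompleteSpace K]
    [AddCommGroup V] [Module ℂ V] [Module (H →L[ℂ] H)ᵐᵒᵖ V] [IsScalarTower ℂ (H →L[ℂ] H)ᵐᵒᵖ V]
    [Group G] [MeasurableSpace G] [MeasurableMul₂ G] [MeasurableInv G]
    [MeasurableSpace Ω] [MulAction G Ω] [MeasurableSMul₂ G Ω]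
    (ν : Measure Ω) [SigmaFinite ν] [QuasiInvariant G ν]
    (U : G →* (V ≃ₗ[(H →L[ℂ] H)ᵐᵒᵖ] V))
    (m : G → G → Circle) (hm : IsTwoCocycle m)
    (u : G → unitary (K →L[ℂ] K)) (hu : IsMultiplierRep m u)
    (s₁ : SesqForm H V)
    (S : InstrAlg K ν →ₗ[ℂ] SesqForm H V) (hS : S ∈ NCP ν U u s₁)
    [NormedAddCommGroup K'] [InnerProductSpace ℂ K'] [CompleteSpace K']
    [TopologicalSpace.SeparableSpace K'] (hK' : IsMinimalAncillary (firstMarginal S) K') :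
    ∃ n : Ω → ℕ∞, Measurable n ∧
      -- the multiplicity function is invariant
      (∀ g : G, ∀ᵐ ω ∂ν, n (g • ω) = n ω) ∧
      ((∃ μ : Measure G, SigmaFinite μ ∧ μ ≠ 0 ∧
          ∀ (h : G) (A : Set G), MeasurableSet A → μ A = 0 → μ ((fun g => g * h) ⁻¹' A) = 0) →
        ∀ (g : G) (ω : Ω), n (g • ω) = n ω) ∧
      ∃ Y : V →ₗ[ℂ] (H →L[ℂ] HilbertTensor K (DirectIntegral ν n)),
        -- the dilation and its minimality
        IsRightLinear Y ∧
        (∀ (b : K →L[ℂ] K) (f : Lp ℂ ∞ ν) (v w : V),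
          (S (elem b f)).1 v w
            = ContinuousLinearMap.adjoint (Y v) ∘L opTensor b (diagOp f) ∘L Y w) ∧
        SigmaStronglyDense (Submodule.span ℂ
          {x : H →L[ℂ] HilbertTensor K (DirectIntegral ν n) |
            ∃ (b : K →L[ℂ] K) (f : Lp ℂ ∞ ν) (v : V), x = opTensor b (diagOp f) ∘L Y v}) ∧
        -- the unitaries `y_g` and their fields `y(g, ω)`
        ∃ (y : ∀ (_ : G) (ω : Ω), unitary (Fiber (n ω) →L[ℂ] Fiber (n ω)))
          (yOp : G → unitary (DirectIntegral ν n →L[ℂ] DirectIntegral ν n)),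
          (∀ g : G, IsWeaklyMeasurable ν fun ω => (y g ω : Fiber (n ω) →L[ℂ] Fiber (n ω))) ∧
          (∀ (g : G) (ψ : DirectIntegral ν n), ∀ᵐ ω ∂ν,
            ((yOp g : DirectIntegral ν n →L[ℂ] DirectIntegral ν n) ψ : Lp Ell2 2 ν) ω
              = (Real.sqrt (rho ν g⁻¹ ω).toReal : ℂ) •
                  extOp (y g ω : Fiber (n ω) →L[ℂ] Fiber (n ω))
                    ((ψ : Lp Ell2 2 ν) (g⁻¹ • ω))) ∧
          (∀ (g : G) (v : V),
            Y (U g v) = opTensor (u g : K →L[ℂ] K)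
              (yOp g : DirectIntegral ν n →L[ℂ] DirectIntegral ν n) ∘L Y v) ∧
          -- the cocycle identity
          (∀ g h : G, ∀ᵐ ω ∂ν,
            extOp (y (g * h) ω : Fiber (n ω) →L[ℂ] Fiber (n ω))
              = (starRingEnd ℂ (m g h : ℂ)) •
                  (extOp (y g ω : Fiber (n ω) →L[ℂ] Fiber (n ω)) ∘L
                    extOp (y h (g⁻¹ • ω) :
                      Fiber (n (g⁻¹ • ω)) →L[ℂ] Fiber (n (g⁻¹ • ω))))) ∧
          -- `g ↦ u_g ⊗ y_g` is a unitary representation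
          (∃ W : G →* unitary (HilbertTensor K (DirectIntegral ν n) →L[ℂ]
                HilbertTensor K (DirectIntegral ν n)),
            ∀ g : G, (W g : HilbertTensor K (DirectIntegral ν n) →L[ℂ]
                HilbertTensor K (DirectIntegral ν n))
              = opTensor (u g : K →L[ℂ] K)
                  (yOp g : DirectIntegral ν n →L[ℂ] DirectIntegral ν n)) ∧
          -- the extremality criterion
          (S ∈ Set.extremePoints ℝ (NCP ν U u s₁) ↔
            ∀ (D : DirectIntegral ν n →L[ℂ] DirectIntegral ν n)
              (Df : ∀ ω, Fiber (n ω) →L[ℂ] Fiber (n ω)),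
              IsDecomposedBy D Df →
              (∀ v : V, ContinuousLinearMap.adjoint (Y v) ∘L
                opTensor (1 : K →L[ℂ] K) D ∘L Y v = 0) →
              (∀ g : G, ∀ᵐ ω ∂ν,
                extOp (Df ω) ∘L extOp (y g ω : Fiber (n ω) →L[ℂ] Fiber (n ω))
                  = extOp (y g ω : Fiber (n ω) →L[ℂ] Fiber (n ω)) ∘L extOp (Df (g⁻¹ • ω))) →
              D = 0) := by
  classical
  by_cases hHK : Nontrivial H ∧ Nontrivial K
  · obtain ⟨_, _⟩ := hHK
    have hCP := hS.1
    have hN := hS.2.1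
    have hn₀ := exists_isMinDil hCP hN hK'
    obtain ⟨n₀, hn₀, h₀⟩ := hn₀
    have hY₀ := h₀ n₀ (ae_eq_refl _)
    obtain ⟨Y₀, hY₀⟩ := hY₀
    have hinv := (hY₀.exists_fields hn₀ hu hS).1
    -- The first dilation serves only to show that n₀ is almost invariant. The dilation and the
    -- fields are then built anew over the invariant n, because y(g,ω) must act on H_{n(ω)} for
    -- every ω.
    have hn := exists_invariant_ae_eq hn₀ hinv
    obtain ⟨n, hn, hae, hstrict⟩ := hn
    have hY := h₀ n hae
    obtain ⟨Y, hY⟩ := hY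
    have hF := hY.exists_fields hn hu hS
    obtain ⟨h1, y, yOp, hy, hyf, hcoc, hext⟩ := hF
    exact ⟨n, hn, h1, hstrict, Y, hY.right,
      fun b f v w => congrArg (fun s : SesqForm H V => s.1 v w) (hY.eq b f), hY.dense, y, yOp,
      fun g => (hyf g).isWeaklyMeasurable, fun g ψ => overKoopman_apply (hyf g) ψ, hy.intertwine,
      hcoc, hy.rep, hext⟩
  -- If H or K is zero there is no unit vector to work with, but S = 0 is the only map; zero
  -- multiplicity satisfies every clause, and S is trivially extreme.
  · have hsub : Subsingleton (InstrAlg K ν →ₗ[ℂ] SesqForm H V) := by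
      rw [not_and_or, not_nontrivial_iff_subsingleton, not_nontrivial_iff_subsingleton] at hHK
      rcases hHK with _ | _
      · have : Subsingleton (SesqForm H V) := ⟨fun s t => Subtype.ext (funext fun v =>
          funext fun w => ContinuousLinearMap.ext fun ξ => Subsingleton.elim _ _)⟩
        exact ⟨fun A B => LinearMap.ext fun x => Subsingleton.elim _ _⟩
      · have : Subsingleton (InstrAlg K ν) := ⟨fun x y => Subtype.ext
          (ContinuousLinearMap.ext fun ζ => Subsingleton.elim _ _)⟩
        exact ⟨fun A B => LinearMap.ext fun x => by
          rw [Subsingleton.elim x 0, map_zero, map_zero]⟩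
    refine ⟨fun _ => 0, measurable_const, fun g => Eventually.of_forall fun _ => rfl,
      fun _ _ _ => rfl, 0, fun v a => (ContinuousLinearMap.zero_comp a).symm, fun b f v w => ?_, ?_,
      fun _ _ => 1, fun _ => 1, ?_, ?_, ?_, ?_, ⟨1, ?_⟩, ?_⟩
    · rw [Subsingleton.elim S 0]
      refine ContinuousLinearMap.ext fun ξ => Eq.symm ?_
      exact (congrArg (ContinuousLinearMap.adjoint
        (0 : H →L[ℂ] HilbertTensor K (DirectIntegral ν fun _ => 0)))
        (Subsingleton.elim _ 0)).trans (map_zero _)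
    · intro A ξ _ ε hε
      refine ⟨0, Submodule.zero_mem _, ?_⟩
      have e : ∀ j, ‖(A - 0) (ξ j)‖ ^ 2 = 0 := fun j => by
        rw [Subsingleton.elim ((A - 0) (ξ j)) 0, norm_zero, zero_pow two_ne_zero]
      simpa only [e, tsum_zero] using hε
    · intro g φ ψ
      simp only [extOp_fiber_zero, zero_apply, inner_zero_right]
      exact aemeasurable_const
    · intro g ψ
      filter_upwards [((1 : DirectIntegral ν (fun _ => 0) →L[ℂ] DirectIntegral ν fun _ => 0) ψ).2]
        with ω h1
      simp only [extOp_fiber_zero, zero_apply, smul_zero]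
      exact eq_zero_of_mem_fiber_zero h1
    · intro g v
      exact ContinuousLinearMap.ext fun ξ => Subsingleton.elim _ _
    · intro g h
      refine Eventually.of_forall fun ω => ?_
      simp only [extOp_fiber_zero, ContinuousLinearMap.comp_zero, smul_zero]
    · intro g
      exact ContinuousLinearMap.ext fun ξ => Subsingleton.elim _ _
    · refine iff_of_true ⟨hS, fun A _ B _ _ => Subsingleton.elim _ _⟩ fun D Df _ _ _ => ?_
      exact ContinuousLinearMap.ext fun ξ => Subsingleton.elim _ _
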